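/- Let $k$ be a field of characteristic $0$ and let $\mathfrak F$ be one of the Feynman categories (without units) for operads, cyclic operads, modular operads, properads, wheeled properads, or wheeled props (for the last one the basic graph morphisms are edge contractions, loop contractions and mergers of directed corollas). Let $\mathcal P$ be an odd dg $\mathfrak F$-operad and $\mathcal O$ a dg $\mathfrak F$-operad over $k$, with differentials of degree $+1$, where in the odd case each contraction acts with degree $1$ and two contractions anticommute. Assume: - each $\mathcal P(v)$ has finite total dimension and, in the case of properads, for each $v$ only finitely many two-vertex contractions with target $v$ act non-trivially on $\mathcal P$; - $\mathcal P$ is concentrated in non-negative degrees or, more generally, its Feynman transform $\mathsf{FT}(\mathcal P)$ is cofibrant. Here $\mathsf{FT}(\mathcal P)$ is the free $\mathfrak F$-operad on the linear dual of $\mathcal P$, with the differential given on generators by the transposes (with the standard signs) of the differential, of the loop contractions and of the two-vertex contractions of $\mathcal P$, and "cofibrant" refers to the model structure on dg $\mathfrak F$-operads with levelwise quasi-isomorphisms as weak equivalences and levelwise surjections as fibrations. Two maps $\gamma_0,\gamma_1:\mathsf{FT}(\mathcal P)\to\mathcal O$ are homotopic if $(\gamma_0,\gamma_1)$ lifts to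 some path object of $\mathcal O$, that is, to some factorization $\mathcal O\to P(\mathcal O)\to\mathcal O\oplus\mathcal O$ of the diagonal into a weak equivalence followed by a fibration. Write $[\mathsf{FT}(\mathcal P),\mathcal O]$ for the set of homotopy classes. Let $\Omega_n=k[t_0,\dots,t_n,dt_0,\dots,dt_n]/(\sum t_i-1,\sum dt_i)$ be the commutative dg algebra of polynomial differential forms on the $n$-simplex, with its simplicial structure. Let $ME_n$ be the set of solutions $\alpha$ of degree $0$ of the master equation $$ d\alpha+\sum_{\text{loop contractions}}\gamma(\alpha)+\tfrac12\sum_{\text{two-vertex contractions}}\gamma(\alpha,\alpha)=0 $$ in $$ \lim(\mathcal P\otimes\mathcal O\otimes\Omega_n)=\prod_{v}\bigl(\mathcal P(v)\otimes\mathcal O(v)\otimes\Omega_n\bigr)^{\mathrm{Aut}(v)}, $$ where $v$ runs over the isomorphism classes of corollas of $\mathfrak F$. The sums at $v$ run over the isomorphism classes of contractions with target $v$, each weighted by the inverse of the order of its automorphism group; in the two-vertex sum the two source vertices are ordered and automorphisms preserve this order. The sets $ME_n$ form a simplicial set $ME_\bullet$. For $s_0,s_1\in ME_0$ write $s_0\sim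 s_1$ if there is $s\in ME_1$ with $\delta_0(s)=s_0$ and $\delta_1(s)=s_1$. Then homotopy of maps and $\sim$ are equivalence relations. There is a bijection $\mathrm{Hom}(\mathsf{FT}(\mathcal P),\mathcal O)\to ME_0$ that identifies a map with the family of its restrictions to the generators $\mathcal P(v)^\ast$, viewed in $\mathcal P(v)\otimes\mathcal O(v)$. Under it two maps are homotopic if and only if the corresponding solutions are related by $\sim$. Consequently it induces a bijection $$[\mathsf{FT}(\mathcal P),\mathcal O]\;\cong\;\pi_0(ME_\bullet).$$ -/

import Mathlib

open CategoryTheory TensorProduct Opposite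

universe u

namespace FeynmanME

/-! ### The six Feynman categories: corollas and basic morphisms -/

/-- The six kinds of operad-like structures under consideration.  Wheeled props are the non-unital
ones, i.e. those whose basic graph morphisms are edge contractions, loop contractions and mergers
of arbitrary directed corollas. -/
inductive Kind : Type
  | operad | cyclic | modular | properad | wheeledProperad | wheeledProp

/-- Kinds whose flags carry a direction (in / out). -/
def Kind.directed : Kind → Prop
  | .cyclic | .modular => False
  | _ => True

/-- Kinds in which a loop (an edge joining two flags of one vertex) may be contracted. -/
def Kind.hasLoops : Kind → Prop
  | .modular | .wheeledProperad | .wheeledProp => True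
  | _ => False

/-- The increase of the genus label under contraction of a loop. -/
def Kind.loopGenus : Kind → ℕ
  | .modular => 1
  | _ => 0

/-- A corolla (vertex) of kind `T`: finitely many labelled flags, with a direction when `T` is
directed (`out = true` for outputs) and a genus label when `T` is modular.  Unused labels are
`false` and `0`.  An operadic corolla has exactly one output (its root).  These are the objects of
a skeleton of the groupoid of vertices of the Feynman category, once labelled flags are used. -/
structure Corolla (T : Kind) : Type where
  n : ℕ
  out : Fin n → Bool
  genus : ℕ
  root : T = .operad → ∃! i, out i = true
  undirected : ¬ T.directed → ∀ i, out i = false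
  genus_zero : T ≠ .modular → genus = 0

/-- The combinatorial data of a graph morphism from flags `X` to flags `Y` (contravariant on flags):
`j` says which source flag survives as a given target flag, and `E x x'` says that `x` and `x'` form
an edge which is contracted (the ghost edges). -/
@[ext] structure Gph (X Y : Type) : Type where
  j : Y → X
  E : X → X → Prop

namespace Gph

variable {X Y Z : Type}

/-- Identity morphism. -/
def one (X : Type) : Gph X X := ⟨fun x => x, fun _ _ => False⟩

/-- First apply `g`, then `h`. -/
def comp (g : Gph X Y) (h : Gph Y Z) : Gph X Z :=
  ⟨fun z => g.j (h.j z), fun p q => g.E p q ∨ ∃ y z, h.E y z ∧ g.j y = p ∧ g.j z = q⟩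

/-- Disjoint union with the identity of `Z` on the right. -/
def addRight (g : Gph X Y) (Z : Type) : Gph (X ⊕ Z) (Y ⊕ Z) :=
  ⟨Sum.map g.j (fun z => z), fun p q => ∃ x y, g.E x y ∧ p = Sum.inl x ∧ q = Sum.inl y⟩

/-- Transport along a bijection of the source flags. -/
def reindex (g : Gph X Y) (e : X ≃ Z) : Gph Z Y :=
  ⟨fun y => e (g.j y), fun p q => g.E (e.symm p) (e.symm q)⟩

/-- No edge is contracted. -/
def NoEdge (g : Gph X Y) : Prop := ∀ p q, ¬ g.E p q

/-- Exactly one edge is contracted. -/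
def OneEdge (g : Gph X Y) : Prop :=
  ∃ x x', g.E x x' ∧ ∀ y y', g.E y y' → (y = x ∧ y' = x') ∨ (y = x' ∧ y' = x)

open Classical in
/-- The degree of a basic morphism: `0` for isomorphisms and mergers, `1` for contractions. -/
noncomputable def deg (g : Gph X Y) : ℤ := if g.NoEdge then 0 else 1

/-- The degree by which the corresponding operation shifts: the degree of the morphism in the odd
case, zero otherwise. -/
noncomputable def sh (odd : Bool) (g : Gph X Y) : ℤ := if odd then g.deg else 0

/-- `g` is a legitimate graph morphism: the target flags inject into the source flags compatibly
with directions, and the remaining source flags are paired into edges by a fixed point free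
involution; in the directed case an edge consists of an output and an input. -/
structure IsGraph (T : Kind) (g : Gph X Y) (oX : X → Bool) (oY : Y → Bool) : Prop where
  inj : Function.Injective g.j
  out_j : ∀ y, oY y = oX (g.j y)
  symm : ∀ x x', g.E x x' → g.E x' x
  irrefl : ∀ x, ¬ g.E x x
  leg : ∀ y x, ¬ g.E (g.j y) x
  paired : ∀ x, x ∉ Set.range g.j → ∃! x', g.E x x'
  opposite : T.directed → ∀ x x', g.E x x' → oX x ≠ oX x'

end Gph

/-- Basic morphisms from one corolla `a` to a corolla `v`: isomorphisms, and contractions of one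
loop if the kind has loops. -/
structure UGen {T : Kind} (a v : Corolla T) : Type where
  g : Gph (Fin a.n) (Fin v.n)
  isGraph : g.IsGraph T a.out v.out
  shape : (g.NoEdge ∧ v.genus = a.genus) ∨
    (T.hasLoops ∧ g.OneEdge ∧ v.genus = a.genus + T.loopGenus)

/-- Basic morphisms from two corollas `a, b` to a corolla `v`: mergers (for wheeled props);
contraction of one edge joining `a` and `b` (except for properads); for properads, contraction of
at least one edge joining `a` and `b`, all of them being directed from the same one of `a`, `b` to
the other one. -/
structure BGen {T : Kind} (a b v : Corolla T) : Type where
  g : Gph (Fin a.n ⊕ Fin b.n) (Fin v.n)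
  isGraph : g.IsGraph T (Sum.elim a.out b.out) v.out
  genus : v.genus = a.genus + b.genus
  shape : (T = .wheeledProp ∧ g.NoEdge) ∨
    (T ≠ .properad ∧ g.OneEdge ∧ ∃ p q, g.E (.inl p) (.inr q)) ∨
    (T = .properad ∧ (∃ p q, g.E (.inl p) (.inr q)) ∧ (∀ x x', g.E x x' → x.isLeft ≠ x'.isLeft) ∧
      ∃ c, ∀ p q, g.E (.inl p) (.inr q) → a.out p = c)

/-- Cyclic rotation of three blocks of flags. -/
def rot (X Y Z : Type) : (X ⊕ Y) ⊕ Z ≃ (Y ⊕ Z) ⊕ X :=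
  (Equiv.sumAssoc X Y Z).trans (Equiv.sumComm X (Y ⊕ Z))

/-! ### dg `𝔉`-operads and odd dg `𝔉`-operads -/

/-- The raw data of a (`odd = false`) dg `𝔉`-operad, or of an odd (`odd = true`) one, with values in
cochain complexes of `k`-vector spaces: graded vector spaces, differentials of degree `1`, and one
operation for each basic morphism.  In the odd case contractions act by operations of degree `1`. -/
structure RawOp (k : Type u) [Field k] (T : Kind) (odd : Bool) where
  X : Corolla T → ℤ → ModuleCat.{u} k
  d : ∀ {v : Corolla T} {i n : ℤ}, i + 1 = n → (X v i →ₗ[k] X v n)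
  un : ∀ {a v : Corolla T} (γ : UGen a v) {i n : ℤ}, i + γ.g.sh odd = n → (X a i →ₗ[k] X v n)
  bin : ∀ {a b v : Corolla T} (γ : BGen a b v) {i j n : ℤ}, i + j + γ.g.sh odd = n →
    (X a i →ₗ[k] X b j →ₗ[k] X v n)

/-- The defining identities: `R.Law x` says that `x` is the difference of the two sides of an
instance of an identity that has to hold in a dg `𝔉`-operad (odd dg `𝔉`-operad).  The operations are
applied on the left, so that `bin γ x y` is the operation of degree `sh` evaluated on `x ⊗ y`.
* `d_d`, `d_un`, `d_bin`: the differential squares to zero and is a derivation;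
* `un_one`, `un_un`, `un_bin`, `bin_un`: functoriality for identities and for those composites of
  basic morphisms which are again basic morphisms;
* `bin_swap`: symmetry, with the Koszul sign;
* `un_un_comm`, `un_bin_comm`, `un_bin_assoc`, `bin_bin_assoc`: the quadratic relations, for two
  factorizations of a graph morphism into basic ones that differ by the order of the two steps.
  In the odd case two contractions anticommute. -/
inductive RawOp.Law {k : Type u} [Field k] {T : Kind} {odd : Bool} (R : RawOp k T odd) :
    ∀ {v : Corolla T} {n : ℤ}, R.X v n → Prop
  | d_d {v : Corolla T} {i m n : ℤ} (h₁ : i + 1 = m) (h₂ : m + 1 = n) (x : R.X v i) :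
      Law R (R.d h₂ (R.d h₁ x))
  | d_un {a v : Corolla T} (γ : UGen a v) {i m i' n : ℤ} (h₁ : i + γ.g.sh odd = m)
      (h₂ : m + 1 = n) (h₁' : i + 1 = i') (h₂' : i' + γ.g.sh odd = n) (x : R.X a i) :
      Law R (R.d h₂ (R.un γ h₁ x) - (γ.g.sh odd).negOnePow • R.un γ h₂' (R.d h₁' x))
  | d_bin {a b v : Corolla T} (γ : BGen a b v) {i j m i' j' n : ℤ}
      (h₁ : i + j + γ.g.sh odd = m) (h₂ : m + 1 = n) (hi : i + 1 = i') (hj : j + 1 = j')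
      (h₃ : i' + j + γ.g.sh odd = n) (h₄ : i + j' + γ.g.sh odd = n) (x : R.X a i) (y : R.X b j) :
      Law R (R.d h₂ (R.bin γ h₁ x y) - (γ.g.sh odd).negOnePow •
        (R.bin γ h₃ (R.d hi x) y + i.negOnePow • R.bin γ h₄ x (R.d hj y)))
  | un_one {v : Corolla T} (γ : UGen v v) (hγ : γ.g = Gph.one _) {i : ℤ}
      (h : i + γ.g.sh odd = i) (x : R.X v i) :
      Law R (R.un γ h x - x)
  | un_un {a b v : Corolla T} (γ₁ : UGen a b) (γ₂ : UGen b v) (γ : UGen a v)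
      (hγ : γ.g = γ₁.g.comp γ₂.g) {i m n : ℤ} (h₁ : i + γ₁.g.sh odd = m)
      (h₂ : m + γ₂.g.sh odd = n) (h : i + γ.g.sh odd = n) (x : R.X a i) :
      Law R (R.un γ₂ h₂ (R.un γ₁ h₁ x) - R.un γ h x)
  | un_bin {a b c v : Corolla T} (γ₁ : BGen a b c) (γ₂ : UGen c v) (γ : BGen a b v)
      (hγ : γ.g = γ₁.g.comp γ₂.g) {i j m n : ℤ} (h₁ : i + j + γ₁.g.sh odd = m)
      (h₂ : m + γ₂.g.sh odd = n) (h : i + j + γ.g.sh odd = n) (x : R.X a i) (y : R.X b j) :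
      Law R (R.un γ₂ h₂ (R.bin γ₁ h₁ x y) - R.bin γ h x y)
  | bin_un {a a' b v : Corolla T} (γ₁ : UGen a a') (γ₂ : BGen a' b v) (γ : BGen a b v)
      (hγ : γ.g = (γ₁.g.addRight _).comp γ₂.g) {i j m n : ℤ} (h₁ : i + γ₁.g.sh odd = m)
      (h₂ : m + j + γ₂.g.sh odd = n) (h : i + j + γ.g.sh odd = n) (x : R.X a i) (y : R.X b j) :
      Law R (R.bin γ₂ h₂ (R.un γ₁ h₁ x) y - R.bin γ h x y)
  | bin_swap {a b v : Corolla T} (γ : BGen a b v) (γ' : BGen b a v)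
      (hγ : γ'.g = γ.g.reindex (Equiv.sumComm _ _)) {i j n : ℤ} (h : i + j + γ.g.sh odd = n)
      (h' : j + i + γ'.g.sh odd = n) (x : R.X a i) (y : R.X b j) :
      Law R (R.bin γ h x y - (i * j).negOnePow • R.bin γ' h' y x)
  | un_un_comm {a b b' v : Corolla T} (γ₁ : UGen a b) (γ₂ : UGen b v) (γ₁' : UGen a b')
      (γ₂' : UGen b' v) (hγ : γ₁.g.comp γ₂.g = γ₁'.g.comp γ₂'.g) (hne : γ₁.g.E ≠ γ₁'.g.E)
      {i m m' n : ℤ} (h₁ : i + γ₁.g.sh odd = m) (h₂ : m + γ₂.g.sh odd = n)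
      (h₁' : i + γ₁'.g.sh odd = m') (h₂' : m' + γ₂'.g.sh odd = n) (x : R.X a i) :
      Law R (R.un γ₂ h₂ (R.un γ₁ h₁ x) -
        (γ₁.g.sh odd * γ₂.g.sh odd).negOnePow • R.un γ₂' h₂' (R.un γ₁' h₁' x))
  | un_bin_comm {a b c c' v : Corolla T} (γ₁ : BGen a b c) (γ₂ : UGen c v) (γ₁' : BGen a b c')
      (γ₂' : UGen c' v) (hγ : γ₁.g.comp γ₂.g = γ₁'.g.comp γ₂'.g) (hne : γ₁.g.E ≠ γ₁'.g.E)
      {i j m m' n : ℤ} (h₁ : i + j + γ₁.g.sh odd = m) (h₂ : m + γ₂.g.sh odd = n)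
      (h₁' : i + j + γ₁'.g.sh odd = m') (h₂' : m' + γ₂'.g.sh odd = n)
      (x : R.X a i) (y : R.X b j) :
      Law R (R.un γ₂ h₂ (R.bin γ₁ h₁ x y) -
        (γ₁.g.sh odd * γ₂.g.sh odd).negOnePow • R.un γ₂' h₂' (R.bin γ₁' h₁' x y))
  | un_bin_assoc {a a' b c v : Corolla T} (γ₁ : BGen a b c) (γ₂ : UGen c v) (γ₁' : UGen a a')
      (γ₂' : BGen a' b v) (hγ : γ₁.g.comp γ₂.g = (γ₁'.g.addRight _).comp γ₂'.g)
      {i j m m' n : ℤ} (h₁ : i + j + γ₁.g.sh odd = m) (h₂ : m + γ₂.g.sh odd = n)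
      (h₁' : i + γ₁'.g.sh odd = m') (h₂' : m' + j + γ₂'.g.sh odd = n)
      (x : R.X a i) (y : R.X b j) :
      Law R (R.un γ₂ h₂ (R.bin γ₁ h₁ x y) -
        (γ₁.g.sh odd * γ₂.g.sh odd).negOnePow • R.bin γ₂' h₂' (R.un γ₁' h₁' x) y)
  | bin_bin_assoc {a b c e e' v : Corolla T} (γ₁ : BGen a b e) (γ₂ : BGen e c v)
      (γ₁' : BGen b c e') (γ₂' : BGen e' a v)
      (hγ : ((γ₁.g.addRight _).comp γ₂.g).reindex (rot _ _ _) = (γ₁'.g.addRight _).comp γ₂'.g)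
      {i j l m m' n : ℤ} (h₁ : i + j + γ₁.g.sh odd = m) (h₂ : m + l + γ₂.g.sh odd = n)
      (h₁' : j + l + γ₁'.g.sh odd = m') (h₂' : m' + i + γ₂'.g.sh odd = n)
      (x : R.X a i) (y : R.X b j) (z : R.X c l) :
      Law R (R.bin γ₂ h₂ (R.bin γ₁ h₁ x y) z -
        (γ₁.g.sh odd * γ₂.g.sh odd).negOnePow •
          (i * (j + l)).negOnePow • R.bin γ₂' h₂' (R.bin γ₁' h₁' y z) x)

/-- A dg `𝔉`-operad (`odd = false`) or an odd dg `𝔉`-operad (`odd = true`) over `k`, where `𝔉` is the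
Feynman category of kind `T`. -/
structure Op (k : Type u) [Field k] (T : Kind) (odd : Bool) extends RawOp k T odd where
  law : ∀ {v : Corolla T} {n : ℤ} {x : X v n}, toRawOp.Law x → x = 0

namespace Op

variable {k : Type u} [Field k] {T : Kind} {odd : Bool}

/-- The underlying cochain complex at the corolla `v`. -/
noncomputable def complex (O : Op k T odd) (v : Corolla T) : CochainComplex (ModuleCat.{u} k) ℤ :=
  CochainComplex.of (fun n => O.X v n) (fun _ => ModuleCat.ofHom (O.d rfl)) (fun _ => by
    ext x
    exact O.law (RawOp.Law.d_d rfl rfl x))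

/-- Morphisms of (odd) dg `𝔉`-operads. -/
@[ext] structure Hom (M N : Op k T odd) : Type u where
  app : ∀ (v : Corolla T) (n : ℤ), M.X v n →ₗ[k] N.X v n
  app_d : ∀ {v : Corolla T} {i n : ℤ} (h : i + 1 = n) (x : M.X v i),
    app v n (M.d h x) = N.d h (app v i x)
  app_un : ∀ {a v : Corolla T} (γ : UGen a v) {i n : ℤ} (h : i + γ.g.sh odd = n) (x : M.X a i),
    app v n (M.un γ h x) = N.un γ h (app a i x)
  app_bin : ∀ {a b v : Corolla T} (γ : BGen a b v) {i j n : ℤ} (h : i + j + γ.g.sh odd = n)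
    (x : M.X a i) (y : M.X b j),
    app v n (M.bin γ h x y) = N.bin γ h (app a i x) (app b j y)

/-- The chain map at the corolla `v`. -/
noncomputable def Hom.chain {M N : Op k T odd} (f : Hom M N) (v : Corolla T) :
    M.complex v ⟶ N.complex v :=
  CochainComplex.ofHom (fun n => ModuleCat.ofHom (f.app v n)) (fun i => by
    dsimp only [complex]
    rw [CochainComplex.of_d, CochainComplex.of_d]
    ext x
    exact (f.app_d rfl x).symm)

/-- Weak equivalences: levelwise quasi-isomorphisms. -/
def Hom.IsWeakEq {M N : Op k T odd} (f : Hom M N) : Prop := ∀ v, QuasiIso (f.chain v)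

/-- Fibrations: levelwise (degreewise) surjections. -/
def Hom.IsFib {M N : Op k T odd} (f : Hom M N) : Prop :=
  ∀ v n, Function.Surjective (f.app v n)

/-- Cofibrant objects: those with the left lifting property against all acyclic fibrations. -/
def IsCofibrant (M : Op k T odd) : Prop :=
  ∀ (A B : Op k T odd) (p : Hom A B), p.IsWeakEq → p.IsFib → ∀ f : Hom M B,
    ∃ g : Hom M A, ∀ v n x, p.app v n (g.app v n x) = f.app v n x

/-- A path object of `O`: a factorization `O → P → O ⊕ O` of the diagonal into a weak equivalence
and a fibration.  The fibration is given by its two components `q₀`, `q₁`. -/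
structure PathObject (O : Op k T odd) where
  P : Op k T odd
  s : Hom O P
  q₀ : Hom P O
  q₁ : Hom P O
  weakEq : s.IsWeakEq
  q₀_s : ∀ v n x, q₀.app v n (s.app v n x) = x
  q₁_s : ∀ v n x, q₁.app v n (s.app v n x) = x
  fib : ∀ v n (x₀ x₁ : O.X v n), ∃ y : P.X v n, q₀.app v n y = x₀ ∧ q₁.app v n y = x₁

/-- Homotopic maps: `(γ₀, γ₁) : M → O ⊕ O` lifts to some path object of `O`. -/
def Homotopic {M O : Op k T odd} (γ₀ γ₁ : Hom M O) : Prop :=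
  ∃ (Q : PathObject O) (h : Hom M Q.P),
    (∀ v n x, Q.q₀.app v n (h.app v n x) = γ₀.app v n x) ∧
    (∀ v n x, Q.q₁.app v n (h.app v n x) = γ₁.app v n x)

/-- Concentrated in non-negative degrees. -/
def NonNeg (P : Op k T odd) : Prop := ∀ v n, n < 0 → Subsingleton (P.X v n)

/-- Each `P(v)` has finite total dimension. -/
def LevelwiseFinite (P : Op k T odd) : Prop :=
  ∀ v, Module.Finite k (DirectSum ℤ (fun n => P.X v n))

/-- Each `P(v)` is the target of only finitely many non-zero two-vertex contractions. -/
def LocallyFinite (P : Op k T odd) : Prop :=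
  ∀ v, {γ : Σ a b, BGen a b v | γ.2.2.g.deg = 1 ∧
    ∃ (i j n : ℤ) (h : i + j + γ.2.2.g.sh odd = n), P.bin γ.2.2 h ≠ 0}.Finite

end Op

/-! ### The Feynman transform -/

section FeynmanTransform

variable {k : Type u} [Field k] {T : Kind}

/-- Formal monomials in the elements of the dual of `P` (a functional on `P(v)` of degree `i` has
degree `-i`), the operations of a dg `𝔉`-operad, and the differential. -/
inductive Mono (P : Op k T true) : Corolla T → ℤ → Type u
  | gen {v : Corolla T} {i n : ℤ} (h : i + n = 0) (f : Module.Dual k (P.X v i)) : Mono P v n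
  | d {v : Corolla T} {i n : ℤ} (h : i + 1 = n) (x : Mono P v i) : Mono P v n
  | un {a v : Corolla T} (γ : UGen a v) {i n : ℤ} (h : i + γ.g.sh false = n) (x : Mono P a i) :
      Mono P v n
  | bin {a b v : Corolla T} (γ : BGen a b v) {i j n : ℤ} (h : i + j + γ.g.sh false = n)
      (x : Mono P a i) (y : Mono P b j) : Mono P v n

/-- Linear combinations of formal monomials. -/
noncomputable abbrev freeRaw (P : Op k T true) : RawOp k T false where
  X v n := ModuleCat.of k (Mono P v n →₀ k)
  d h := Finsupp.lmapDomain k k (Mono.d h)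
  un γ _ _ h := Finsupp.lmapDomain k k (Mono.un γ h)
  bin γ _ _ _ h :=
    Finsupp.linearCombination k (fun p => Finsupp.lmapDomain k k (fun q => Mono.bin γ h p q))

/-- The generator attached to a functional on `P(v)` of degree `i`, in degree `n = -i`. -/
noncomputable def genFree (P : Op k T true) {v : Corolla T} {i n : ℤ} (h : i + n = 0)
    (f : Module.Dual k (P.X v i)) : (freeRaw P).X v n :=
  Finsupp.single (Mono.gen h f) (1 : k)

/-- The chosen basis of a homogeneous component. -/
noncomputable abbrev hBasis (P : Op k T true) (v : Corolla T) (i : ℤ) :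
    Module.Basis (Module.Basis.ofVectorSpaceIndex k (P.X v i)) k (P.X v i) :=
  Module.Basis.ofVectorSpace k (P.X v i)

/-- The contraction of one loop, summed over all ways to obtain `v` as the result: the transpose of
the loop contractions of `P`.  The factor `1 / n!` accounts for the labellings of the flags of the
source, so that each isomorphism class is weighted by the inverse of its number of automorphisms. -/
noncomputable def loopTerm (P : Op k T true) {v : Corolla T} {i n : ℤ} (h : i + n = 0)
    (f : Module.Dual k (P.X v i)) : (freeRaw P).X v (n + 1) :=
  ∑ᶠ γ : Σ a : Corolla T, {γ : UGen a v // γ.g.deg = 1},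
    ((γ.1.n.factorial : k)⁻¹) •
      (freeRaw P).un γ.2.1 (by simp [Gph.sh])
        (genFree P (i := i - 1) (n := n + 1) (by lia)
          (f ∘ₗ P.un γ.2.1 (by simp [Gph.sh, γ.2.2])))

/-- The contraction of two vertices, summed over all ways to obtain `v` as the result: the
transpose of the two-vertex contractions of `P`, written in terms of bases of the homogeneous
components of `P` and the dual bases. -/
noncomputable def edgeTerm (P : Op k T true) {v : Corolla T} {i n : ℤ} (h : i + n = 0)
    (f : Module.Dual k (P.X v i)) : (freeRaw P).X v (n + 1) :=
  (2 : k)⁻¹ • ∑ᶠ γ : Σ a b : Corolla T, {γ : BGen a b v // γ.g.deg = 1},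
    ((γ.1.n.factorial * γ.2.1.n.factorial : k)⁻¹) •
      ∑ᶠ j : ℤ, (j * (i - 1 - j)).negOnePow •
        ∑ᶠ (p : Module.Basis.ofVectorSpaceIndex k (P.X γ.1 j))
          (q : Module.Basis.ofVectorSpaceIndex k (P.X γ.2.1 (i - 1 - j))),
          f (P.bin γ.2.2.1 (by simp [Gph.sh, γ.2.2.2]) (hBasis P γ.1 j p)
            (hBasis P γ.2.1 (i - 1 - j) q)) •
            (freeRaw P).bin γ.2.2.1 (by simp only [Gph.sh]; simp; lia)
              (genFree P (i := j) (n := -j) (by lia) ((hBasis P γ.1 j).coord p))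
              (genFree P (i := i - 1 - j) (n := -(i - 1 - j)) (by lia)
                ((hBasis P γ.2.1 (i - 1 - j)).coord q))

/-- The relations of the Feynman transform: the identities of a dg `𝔉`-operad, linearity and
equivariance of the generators, and the prescribed value of the differential on generators. -/
inductive FTRel (P : Op k T true) : ∀ {v : Corolla T} {n : ℤ}, (freeRaw P).X v n → Prop
  | law {v : Corolla T} {n : ℤ} {x : (freeRaw P).X v n} : (freeRaw P).Law x → FTRel P x
  | gen_add {v : Corolla T} {i n : ℤ} (h : i + n = 0) (f f' : Module.Dual k (P.X v i)) :
      FTRel P (genFree P h (f + f') - (genFree P h f + genFree P h f'))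
  | gen_smul {v : Corolla T} {i n : ℤ} (h : i + n = 0) (c : k) (f : Module.Dual k (P.X v i)) :
      FTRel P (genFree P h (c • f) - c • genFree P h f)
  | gen_iso {a v : Corolla T} (σ : UGen a v) (hσ : σ.g.deg = 0) {i n : ℤ} (h : i + n = 0)
      (hi : i + σ.g.sh true = i) (hn : n + σ.g.sh false = n) (f : Module.Dual k (P.X v i)) :
      FTRel P ((freeRaw P).un σ hn (genFree P h (f ∘ₗ P.un σ hi)) - genFree P h f)
  | gen_d {v : Corolla T} {i n : ℤ} (h : i + n = 0) (f : Module.Dual k (P.X v i)) :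
      FTRel P ((freeRaw P).d rfl (genFree P h f) - (n + 1).negOnePow •
        (genFree P (i := i - 1) (n := n + 1) (by lia) (f ∘ₗ P.d (by lia)) +
          loopTerm P h f + edgeTerm P h f))
  | d {v : Corolla T} {i n : ℤ} (h : i + 1 = n) {x : (freeRaw P).X v i} :
      FTRel P x → FTRel P ((freeRaw P).d h x)
  | un {a v : Corolla T} (γ : UGen a v) {i n : ℤ} (h : i + γ.g.sh false = n)
      {x : (freeRaw P).X a i} : FTRel P x → FTRel P ((freeRaw P).un γ h x)
  | bin_left {a b v : Corolla T} (γ : BGen a b v) {i j n : ℤ} (h : i + j + γ.g.sh false = n)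
      {x : (freeRaw P).X a i} (y : (freeRaw P).X b j) :
      FTRel P x → FTRel P ((freeRaw P).bin γ h x y)
  | bin_right {a b v : Corolla T} (γ : BGen a b v) {i j n : ℤ} (h : i + j + γ.g.sh false = n)
      (x : (freeRaw P).X a i) {y : (freeRaw P).X b j} :
      FTRel P y → FTRel P ((freeRaw P).bin γ h x y)

/-- The span of the relations. -/
noncomputable def ftSub (P : Op k T true) (v : Corolla T) (n : ℤ) : Submodule k ((freeRaw P).X v n) :=
  Submodule.span k {x | FTRel P x}

theorem ftSub_map (P : Op k T true) {a v : Corolla T} {i n : ℤ}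
    (φ : (freeRaw P).X a i →ₗ[k] (freeRaw P).X v n) (hφ : ∀ x, FTRel P x → FTRel P (φ x)) :
    ftSub P a i ≤ (ftSub P v n).comap φ :=
  Submodule.span_le.2 fun x hx => Submodule.subset_span (hφ x hx)

/-- The quotient by the relations. -/
noncomputable abbrev ftRaw (P : Op k T true) : RawOp k T false where
  X v n := ModuleCat.of k ((freeRaw P).X v n ⧸ ftSub P v n)
  d h := Submodule.mapQ _ _ ((freeRaw P).d h) (ftSub_map P _ fun _ => FTRel.d h)
  un γ _ _ h := Submodule.mapQ _ _ ((freeRaw P).un γ h) (ftSub_map P _ fun _ => FTRel.un γ h)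
  bin {a b v} γ i j n h := Submodule.liftQ (ftSub P a i)
    (LinearMap.flip (Submodule.liftQ (ftSub P b j)
      (LinearMap.flip (((freeRaw P).bin γ h).compr₂ (ftSub P v n).mkQ))
      (Submodule.span_le.2 fun y hy => by
        refine LinearMap.mem_ker.2 (LinearMap.ext fun x => ?_)
        exact (Submodule.Quotient.mk_eq_zero _).2
          (Submodule.subset_span (FTRel.bin_right γ h x hy)))))
    (Submodule.span_le.2 fun x hx => by
      refine LinearMap.mem_ker.2 (LinearMap.ext fun y => ?_)
      obtain ⟨y, rfl⟩ := Submodule.Quotient.mk_surjective _ y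
      exact (Submodule.Quotient.mk_eq_zero _).2
        (Submodule.subset_span (FTRel.bin_left γ h y hx)))

theorem ftRaw_law (P : Op k T true) {v : Corolla T} {n : ℤ} {x : (ftRaw P).X v n}
    (hx : (ftRaw P).Law x) :
    ∃ y : (freeRaw P).X v n, (freeRaw P).Law y ∧ (ftSub P v n).mkQ y = x := by
  cases hx with
  | d_d h₁ h₂ x =>
    obtain ⟨x, rfl⟩ := Submodule.Quotient.mk_surjective _ x
    exact ⟨_, .d_d h₁ h₂ x, rfl⟩
  | d_un γ h₁ h₂ h₁' h₂' x =>
    obtain ⟨x, rfl⟩ := Submodule.Quotient.mk_surjective _ x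
    exact ⟨_, .d_un γ h₁ h₂ h₁' h₂' x, rfl⟩
  | d_bin γ h₁ h₂ hi hj h₃ h₄ x y =>
    obtain ⟨x, rfl⟩ := Submodule.Quotient.mk_surjective _ x
    obtain ⟨y, rfl⟩ := Submodule.Quotient.mk_surjective _ y
    exact ⟨_, .d_bin γ h₁ h₂ hi hj h₃ h₄ x y, rfl⟩
  | un_one γ hγ h x =>
    obtain ⟨x, rfl⟩ := Submodule.Quotient.mk_surjective _ x
    exact ⟨_, .un_one γ hγ h x, rfl⟩
  | un_un γ₁ γ₂ γ hγ h₁ h₂ h x =>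
    obtain ⟨x, rfl⟩ := Submodule.Quotient.mk_surjective _ x
    exact ⟨_, .un_un γ₁ γ₂ γ hγ h₁ h₂ h x, rfl⟩
  | un_bin γ₁ γ₂ γ hγ h₁ h₂ h x y =>
    obtain ⟨x, rfl⟩ := Submodule.Quotient.mk_surjective _ x
    obtain ⟨y, rfl⟩ := Submodule.Quotient.mk_surjective _ y
    exact ⟨_, .un_bin γ₁ γ₂ γ hγ h₁ h₂ h x y, rfl⟩
  | bin_un γ₁ γ₂ γ hγ h₁ h₂ h x y =>
    obtain ⟨x, rfl⟩ := Submodule.Quotient.mk_surjective _ x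
    obtain ⟨y, rfl⟩ := Submodule.Quotient.mk_surjective _ y
    exact ⟨_, .bin_un γ₁ γ₂ γ hγ h₁ h₂ h x y, rfl⟩
  | bin_swap γ γ' hγ h h' x y =>
    obtain ⟨x, rfl⟩ := Submodule.Quotient.mk_surjective _ x
    obtain ⟨y, rfl⟩ := Submodule.Quotient.mk_surjective _ y
    exact ⟨_, .bin_swap γ γ' hγ h h' x y, rfl⟩
  | un_un_comm γ₁ γ₂ γ₁' γ₂' hγ hne h₁ h₂ h₁' h₂' x =>
    obtain ⟨x, rfl⟩ := Submodule.Quotient.mk_surjective _ x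
    exact ⟨_, .un_un_comm γ₁ γ₂ γ₁' γ₂' hγ hne h₁ h₂ h₁' h₂' x, rfl⟩
  | un_bin_comm γ₁ γ₂ γ₁' γ₂' hγ hne h₁ h₂ h₁' h₂' x y =>
    obtain ⟨x, rfl⟩ := Submodule.Quotient.mk_surjective _ x
    obtain ⟨y, rfl⟩ := Submodule.Quotient.mk_surjective _ y
    exact ⟨_, .un_bin_comm γ₁ γ₂ γ₁' γ₂' hγ hne h₁ h₂ h₁' h₂' x y, rfl⟩
  | un_bin_assoc γ₁ γ₂ γ₁' γ₂' hγ h₁ h₂ h₁' h₂' x y =>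
    obtain ⟨x, rfl⟩ := Submodule.Quotient.mk_surjective _ x
    obtain ⟨y, rfl⟩ := Submodule.Quotient.mk_surjective _ y
    exact ⟨_, .un_bin_assoc γ₁ γ₂ γ₁' γ₂' hγ h₁ h₂ h₁' h₂' x y, rfl⟩
  | bin_bin_assoc γ₁ γ₂ γ₁' γ₂' hγ h₁ h₂ h₁' h₂' x y z =>
    obtain ⟨x, rfl⟩ := Submodule.Quotient.mk_surjective _ x
    obtain ⟨y, rfl⟩ := Submodule.Quotient.mk_surjective _ y
    obtain ⟨z, rfl⟩ := Submodule.Quotient.mk_surjective _ z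
    exact ⟨_, .bin_bin_assoc γ₁ γ₂ γ₁' γ₂' hγ h₁ h₂ h₁' h₂' x y z, rfl⟩

/-- The Feynman transform of an odd dg `𝔉`-operad `P`: the dg `𝔉`-operad generated by the dual of
`P`, whose differential is given on generators by the transposes of the differential of `P`, of the
loop contractions and of the two-vertex contractions of `P`.  Since the derivation of the free
graded `𝔉`-operad on the dual of `P` prescribed by `FTRel.gen_d` squares to zero, the underlying
graded `𝔉`-operad is this free one. -/
noncomputable def FT (P : Op k T true) : Op k T false where
  toRawOp := ftRaw P
  law := by
    intro v n x hx
    obtain ⟨y, hy, rfl⟩ := ftRaw_law P hx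
    exact (Submodule.Quotient.mk_eq_zero _).2 (Submodule.subset_span (FTRel.law hy))

/-- The generator of the Feynman transform attached to a functional on `P(v)` of degree `i`. -/
noncomputable def FT.gen (P : Op k T true) {v : Corolla T} {i n : ℤ} (h : i + n = 0)
    (f : Module.Dual k (P.X v i)) : (FT P).X v n :=
  (ftSub P v n).mkQ (genFree P h f)

end FeynmanTransform

/-! ### Polynomial differential forms on simplices -/

section Forms

variable (k : Type u) [Field k]

/-- The relations between the generators `t i` (`Sum.inl i`) and `dt i` (`Sum.inr i`). -/
inductive OmegaRel (n : ℕ) : FreeAlgebra k (Fin (n + 1) ⊕ Fin (n + 1)) →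
    FreeAlgebra k (Fin (n + 1) ⊕ Fin (n + 1)) → Prop
  | t_t (i j : Fin (n + 1)) : OmegaRel n
      (FreeAlgebra.ι k (.inl i) * FreeAlgebra.ι k (.inl j))
      (FreeAlgebra.ι k (.inl j) * FreeAlgebra.ι k (.inl i))
  | t_dt (i j : Fin (n + 1)) : OmegaRel n
      (FreeAlgebra.ι k (.inl i) * FreeAlgebra.ι k (.inr j))
      (FreeAlgebra.ι k (.inr j) * FreeAlgebra.ι k (.inl i))
  | dt_dt (i j : Fin (n + 1)) : OmegaRel n
      (FreeAlgebra.ι k (.inr i) * FreeAlgebra.ι k (.inr j))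
      (-(FreeAlgebra.ι k (.inr j) * FreeAlgebra.ι k (.inr i)))
  | sum_t : OmegaRel n (∑ i, FreeAlgebra.ι k (.inl i)) 1
  | sum_dt : OmegaRel n (∑ i, FreeAlgebra.ι k (.inr i)) 0

/-- The algebra `Ω_n` of polynomial differential forms on the `n`-simplex. -/
def Omega (n : ℕ) : Type u := RingQuot (OmegaRel k n)

namespace Omega

noncomputable instance (n : ℕ) : Ring (Omega k n) := inferInstanceAs (Ring (RingQuot (OmegaRel k n)))

noncomputable instance (n : ℕ) : Algebra k (Omega k n) :=
  inferInstanceAs (Algebra k (RingQuot (OmegaRel k n)))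

/-- The quotient map. -/
noncomputable def mk (n : ℕ) : FreeAlgebra k (Fin (n + 1) ⊕ Fin (n + 1)) →ₐ[k] Omega k n :=
  RingQuot.mkAlgHom k (OmegaRel k n)

/-- The barycentric coordinates. -/
noncomputable def t {n : ℕ} (i : Fin (n + 1)) : Omega k n :=
  mk k n (FreeAlgebra.ι k (.inl i))

/-- Their differentials. -/
noncomputable def dt {n : ℕ} (i : Fin (n + 1)) : Omega k n :=
  mk k n (FreeAlgebra.ι k (.inr i))

variable {k}

theorem mk_rel {n : ℕ} {x y : FreeAlgebra k (Fin (n + 1) ⊕ Fin (n + 1))} (h : OmegaRel k n x y) :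
    mk k n x = mk k n y :=
  RingQuot.mkAlgHom_rel k h

theorem t_t {n : ℕ} (i j : Fin (n + 1)) : t k i * t k j = t k j * t k i := by
  simpa only [map_mul, t, dt] using mk_rel (OmegaRel.t_t (k := k) i j)

theorem t_dt {n : ℕ} (i j : Fin (n + 1)) : t k i * dt k j = dt k j * t k i := by
  simpa only [map_mul, t, dt] using mk_rel (OmegaRel.t_dt (k := k) i j)

theorem dt_dt {n : ℕ} (i j : Fin (n + 1)) : dt k i * dt k j = -(dt k j * dt k i) := by
  simpa only [map_mul, map_neg, t, dt] using mk_rel (OmegaRel.dt_dt (k := k) i j)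

theorem sum_t (n : ℕ) : ∑ i : Fin (n + 1), t k i = 1 := by
  simpa only [map_sum, map_one, t] using mk_rel (OmegaRel.sum_t (k := k) (n := n))

theorem sum_dt (n : ℕ) : ∑ i : Fin (n + 1), dt k i = 0 := by
  simpa only [map_sum, map_zero, dt] using mk_rel (OmegaRel.sum_dt (k := k) (n := n))

/-- Algebra maps out of `Ω_n`. -/
noncomputable def lift {n : ℕ} {A : Type u} [Ring A] [Algebra k A] (a b : Fin (n + 1) → A)
    (haa : ∀ i j, a i * a j = a j * a i) (hab : ∀ i j, a i * b j = b j * a i)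
    (hbb : ∀ i j, b i * b j = -(b j * b i)) (ha : ∑ i, a i = 1) (hb : ∑ i, b i = 0) :
    Omega k n →ₐ[k] A :=
  RingQuot.liftAlgHom k ⟨FreeAlgebra.lift k (Sum.elim a b), fun _ _ h => by
    cases h with
    | t_t i j => simpa using haa i j
    | t_dt i j => simpa using hab i j
    | dt_dt i j => simpa using hbb i j
    | sum_t => simpa using ha
    | sum_dt => simpa using hb⟩

theorem lift_t {n : ℕ} {A : Type u} [Ring A] [Algebra k A] (a b : Fin (n + 1) → A)
    (haa hab hbb ha hb) (i : Fin (n + 1)) : lift (k := k) a b haa hab hbb ha hb (t k i) = a i := by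
  exact (RingQuot.liftAlgHom_mkAlgHom_apply _ _ _ _).trans (by simp)

theorem lift_dt {n : ℕ} {A : Type u} [Ring A] [Algebra k A] (a b : Fin (n + 1) → A)
    (haa hab hbb ha hb) (i : Fin (n + 1)) :
    lift (k := k) a b haa hab hbb ha hb (dt k i) = b i := by
  exact (RingQuot.liftAlgHom_mkAlgHom_apply _ _ _ _).trans (by simp)

theorem hom_ext {n : ℕ} {A : Type u} [Ring A] [Algebra k A] {f g : Omega k n →ₐ[k] A}
    (ht : ∀ i, f (t k i) = g (t k i)) (hdt : ∀ i, f (dt k i) = g (dt k i)) : f = g := by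
  apply RingQuot.ringQuot_ext'
  apply FreeAlgebra.hom_ext
  funext x
  rcases x with i | i
  · exact ht i
  · exact hdt i

/-- The algebra map `x ↦ !![ε x, dx; 0, x]`, where `ε x = (-1) ^ |x| x` and `dx` is the exterior
derivative; its multiplicativity encodes the graded Leibniz rule. -/
noncomputable def jet (n : ℕ) : Omega k n →ₐ[k] Matrix (Fin 2) (Fin 2) (Omega k n) :=
  lift (fun i => !![t k i, dt k i; 0, t k i]) (fun i => !![-dt k i, 0; 0, dt k i])
    (fun i j => by
      simp only [Matrix.mul_fin_two]
      rw [t_t i j, t_dt i j, ← t_dt j i]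
      simp [add_comm])
    (fun i j => by
      simp only [Matrix.mul_fin_two]
      rw [t_dt i j, mul_neg, neg_mul, t_dt i j, dt_dt i j]
      simp)
    (fun i j => by
      simp only [Matrix.mul_fin_two, neg_mul_neg]
      rw [dt_dt i j]
      simp)
    (by
      ext p q
      fin_cases p <;> fin_cases q <;> simp [Matrix.sum_apply, sum_t, sum_dt])
    (by
      ext p q
      fin_cases p <;> fin_cases q <;> simp [Matrix.sum_apply, sum_dt])

/-- The sign operator `x ↦ (-1) ^ |x| x`. -/
noncomputable def eps (n : ℕ) : Omega k n →ₗ[k] Omega k n where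
  toFun x := jet n x 0 0
  map_add' x y := by simp
  map_smul' c x := by simp

/-- The exterior derivative. -/
noncomputable def d (n : ℕ) : Omega k n →ₗ[k] Omega k n where
  toFun x := jet n x 0 1
  map_add' x y := by simp
  map_smul' c x := by simp

/-- Forms of degree `r`: (polynomials in the `t i`) times (products of `r` factors `dt i`). -/
noncomputable def gr (k : Type u) [Field k] (n r : ℕ) : Submodule k (Omega k n) :=
  Subalgebra.toSubmodule (Algebra.adjoin k (Set.range (t k))) *
    (Submodule.span k (Set.range (dt k))) ^ r

/-- Pull-back along a map of vertices: `t i ↦ ∑ t j` over all `j` which are sent to `i`. -/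
noncomputable def pull {m n : ℕ} (θ : Fin (m + 1) → Fin (n + 1)) : Omega k n →ₐ[k] Omega k m :=
  lift (fun i => ∑ j with θ j = i, t k j) (fun i => ∑ j with θ j = i, dt k j)
    (fun i j => by
      rw [Finset.sum_mul_sum, Finset.sum_mul_sum, Finset.sum_comm]
      exact Finset.sum_congr rfl fun _ _ => Finset.sum_congr rfl fun _ _ => t_t _ _)
    (fun i j => by
      rw [Finset.sum_mul_sum, Finset.sum_mul_sum, Finset.sum_comm]
      exact Finset.sum_congr rfl fun _ _ => Finset.sum_congr rfl fun _ _ => t_dt _ _)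
    (fun i j => by
      rw [Finset.sum_mul_sum, Finset.sum_mul_sum, Finset.sum_comm, ← Finset.sum_neg_distrib]
      refine Finset.sum_congr rfl fun _ _ => ?_
      rw [← Finset.sum_neg_distrib]
      exact Finset.sum_congr rfl fun _ _ => dt_dt _ _)
    (by rw [Finset.sum_fiberwise]; exact sum_t m)
    (by rw [Finset.sum_fiberwise]; exact sum_dt m)

theorem pull_t {m n : ℕ} (θ : Fin (m + 1) → Fin (n + 1)) (i : Fin (n + 1)) :
    pull (k := k) θ (t k i) = ∑ j with θ j = i, t k j := lift_t _ _ _ _ _ _ _ _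

theorem pull_dt {m n : ℕ} (θ : Fin (m + 1) → Fin (n + 1)) (i : Fin (n + 1)) :
    pull (k := k) θ (dt k i) = ∑ j with θ j = i, dt k j := lift_dt _ _ _ _ _ _ _ _

theorem pull_id (n : ℕ) : pull (k := k) (fun i : Fin (n + 1) => i) = AlgHom.id k _ :=
  hom_ext (fun i => by simp [pull_t, Finset.filter_eq']) (fun i => by
    simp [pull_dt, Finset.filter_eq'])

theorem pull_comp {l m n : ℕ} (θ : Fin (m + 1) → Fin (n + 1)) (η : Fin (l + 1) → Fin (m + 1)) :
    pull (k := k) (fun i => θ (η i)) = (pull η).comp (pull θ) := by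
  classical
  refine hom_ext (fun i => ?_) (fun i => ?_)
  · simp only [AlgHom.comp_apply, pull_t, map_sum]
    rw [← Finset.sum_fiberwise_of_maps_to (g := η) (t := Finset.univ.filter fun j => θ j = i)]
    · refine Finset.sum_congr rfl fun j hj => Finset.sum_congr ?_ fun _ _ => rfl
      ext x
      simp only [Finset.mem_filter, Finset.mem_univ, true_and] at hj ⊢
      exact ⟨fun h => h.2, fun h => ⟨h ▸ hj, h⟩⟩
    · intro x hx
      simpa using hx
  · simp only [AlgHom.comp_apply, pull_dt, map_sum]
    rw [← Finset.sum_fiberwise_of_maps_to (g := η) (t := Finset.univ.filter fun j => θ j = i)]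
    · refine Finset.sum_congr rfl fun j hj => Finset.sum_congr ?_ fun _ _ => rfl
      ext x
      simp only [Finset.mem_filter, Finset.mem_univ, true_and] at hj ⊢
      exact ⟨fun h => h.2, fun h => ⟨h ▸ hj, h⟩⟩
    · intro x hx
      simpa using hx

theorem jet_pull {m n : ℕ} (θ : Fin (m + 1) → Fin (n + 1)) (x : Omega k n) :
    jet m (pull θ x) = (jet n x).map (pull θ) := by
  have : (jet m).comp (pull (k := k) θ) = (AlgHom.mapMatrix (pull θ)).comp (jet n) := by
    refine hom_ext (fun i => ?_) (fun i => ?_)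
    · simp only [AlgHom.comp_apply, pull_t, map_sum, jet, lift_t]
      ext p q
      fin_cases p <;> fin_cases q <;> simp [Matrix.sum_apply, pull_t, pull_dt]
    · simp only [AlgHom.comp_apply, pull_dt, map_sum, jet, lift_dt]
      ext p q
      fin_cases p <;> fin_cases q <;> simp [Matrix.sum_apply, pull_dt]
  exact DFunLike.congr_fun this x

theorem eps_pull {m n : ℕ} (θ : Fin (m + 1) → Fin (n + 1)) (x : Omega k n) :
    eps m (pull θ x) = pull θ (eps n x) := by
  change jet m (pull θ x) 0 0 = _
  rw [jet_pull]
  rfl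

theorem d_pull {m n : ℕ} (θ : Fin (m + 1) → Fin (n + 1)) (x : Omega k n) :
    d m (pull θ x) = pull θ (d n x) := by
  change jet m (pull θ x) 0 1 = _
  rw [jet_pull]
  rfl

theorem pull_gr {m n : ℕ} (θ : Fin (m + 1) → Fin (n + 1)) {r : ℕ} {x : Omega k n}
    (hx : x ∈ gr k n r) : pull θ x ∈ gr k m r := by
  have h₁ : (Subalgebra.toSubmodule (Algebra.adjoin k (Set.range (t k (n := n))))).map
      (pull (k := k) θ).toLinearMap ≤
      Subalgebra.toSubmodule (Algebra.adjoin k (Set.range (t k (n := m)))) := by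
    rintro _ ⟨y, hy, rfl⟩
    have : (Algebra.adjoin k (Set.range (t k (n := n)))) ≤
        (Algebra.adjoin k (Set.range (t k (n := m)))).comap (pull θ) := by
      refine Algebra.adjoin_le ?_
      rintro _ ⟨i, rfl⟩
      change pull θ (t k i) ∈ Algebra.adjoin k (Set.range (t k (n := m)))
      rw [pull_t]
      exact Subalgebra.sum_mem _ fun j _ => Algebra.subset_adjoin ⟨j, rfl⟩
    exact this hy
  have h₂ : (Submodule.span k (Set.range (dt k (n := n)))).map (pull (k := k) θ).toLinearMap ≤
      Submodule.span k (Set.range (dt k (n := m))) := by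
    rw [Submodule.map_span_le]
    rintro _ ⟨i, rfl⟩
    change pull θ (dt k i) ∈ Submodule.span k (Set.range (dt k (n := m)))
    rw [pull_dt]
    exact Submodule.sum_mem _ fun j _ => Submodule.subset_span ⟨j, rfl⟩
  have := Submodule.mem_map_of_mem (f := (pull (k := k) θ).toLinearMap) hx
  rw [gr, Submodule.map_mul, Submodule.map_pow] at this
  exact mul_le_mul' h₁ (pow_le_pow_left' h₂ r) this

end Omega

end Forms

/-! ### Master equations -/

section Master

variable {k : Type u} [Field k] {T : Kind} {odd : Bool}

/-- The total space of a graded vector space. -/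
abbrev Op.Tot (P : Op k T odd) (v : Corolla T) : Type u := DirectSum ℤ (fun n => P.X v n)

namespace Op

/-- A homogeneous element, as an element of the total space. -/
noncomputable abbrev inc (P : Op k T odd) (v : Corolla T) (n : ℤ) : P.X v n →ₗ[k] P.Tot v :=
  DirectSum.lof k ℤ (fun n => P.X v n) n

/-- The differential on the total space. -/
noncomputable def totD (P : Op k T odd) (v : Corolla T) : P.Tot v →ₗ[k] P.Tot v :=
  DirectSum.toModule k ℤ _ (fun i => P.inc v (i + 1) ∘ₗ P.d rfl)

/-- The sign operator `x ↦ (-1) ^ |x| x` on the total space. -/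
noncomputable def totEps (P : Op k T odd) (v : Corolla T) : P.Tot v →ₗ[k] P.Tot v :=
  DirectSum.toModule k ℤ _ (fun i => i.negOnePow • P.inc v i)

/-- One-vertex operations on total spaces. -/
noncomputable def totUn (P : Op k T odd) {a v : Corolla T} (γ : UGen a v) :
    P.Tot a →ₗ[k] P.Tot v :=
  DirectSum.toModule k ℤ _ (fun i => P.inc v (i + γ.g.sh odd) ∘ₗ P.un γ rfl)

/-- Two-vertex operations on total spaces. -/
noncomputable def totBin (P : Op k T odd) {a b v : Corolla T} (γ : BGen a b v) :
    P.Tot a →ₗ[k] P.Tot b →ₗ[k] P.Tot v :=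
  DirectSum.toModule k ℤ _ (fun i => LinearMap.flip (DirectSum.toModule k ℤ _ (fun j =>
    LinearMap.flip ((P.bin γ rfl).compr₂ (P.inc v (i + j + γ.g.sh odd))))))

end Op

/-- The tensor product of two bilinear maps with the Koszul sign
`(a ⊗ a') , (b ⊗ b') ↦ (-1) ^ (|a'| |b|) f (a, b) ⊗ f' (a', b')`, where `e'` and `e` are the sign
operators of `A'` and `B`: the sign `(-1) ^ (p q)` is `(1 + (-1) ^ p + (-1) ^ q - (-1) ^ (p + q)) / 2`. -/
noncomputable def koszul {A A' B B' C C' : Type u} [AddCommGroup A] [AddCommGroup A']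
    [AddCommGroup B] [AddCommGroup B'] [AddCommGroup C] [AddCommGroup C'] [Module k A] [Module k A']
    [Module k B] [Module k B'] [Module k C] [Module k C'] (f : A →ₗ[k] B →ₗ[k] C)
    (f' : A' →ₗ[k] B' →ₗ[k] C') (e' : A' →ₗ[k] A') (e : B →ₗ[k] B) :
    A ⊗[k] A' →ₗ[k] B ⊗[k] B' →ₗ[k] C ⊗[k] C' :=
  (2 : k)⁻¹ • (map₂ f f' +
    (map₂ f f').compl₁₂ (TensorProduct.map LinearMap.id e') LinearMap.id +
    (map₂ f f').compl₁₂ LinearMap.id (TensorProduct.map e LinearMap.id) -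
    (map₂ f f').compl₁₂ (TensorProduct.map LinearMap.id e') (TensorProduct.map e LinearMap.id))

theorem koszul_natural {A A' A'' B B' B'' C C' C'' : Type u} [AddCommGroup A] [AddCommGroup A']
    [AddCommGroup B] [AddCommGroup B'] [AddCommGroup C] [AddCommGroup C'] [Module k A] [Module k A']
    [Module k B] [Module k B'] [Module k C] [Module k C'] [AddCommGroup A''] [AddCommGroup B'']
    [AddCommGroup C''] [Module k A''] [Module k B''] [Module k C''] (f : A →ₗ[k] B →ₗ[k] C)
    (f' : A' →ₗ[k] B' →ₗ[k] C') (f'' : A'' →ₗ[k] B'' →ₗ[k] C'') (e' : A' →ₗ[k] A')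
    (e'' : A'' →ₗ[k] A'') (e : B →ₗ[k] B) (φ : A' →ₗ[k] A'') (χ : B' →ₗ[k] B'')
    (ψ : C' →ₗ[k] C'') (h : ∀ x y, f'' (φ x) (χ y) = ψ (f' x y)) (he : ∀ x, e'' (φ x) = φ (e' x))
    (x : A ⊗[k] A') (y : B ⊗[k] B') :
    koszul f f'' e'' e (TensorProduct.map LinearMap.id φ x) (TensorProduct.map LinearMap.id χ y) =
      TensorProduct.map LinearMap.id ψ (koszul f f' e' e x y) := by
  induction x using TensorProduct.induction_on with
  | zero => simp
  | add x x' hx hx' => simp only [map_add, LinearMap.add_apply, hx, hx']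
  | tmul a a' =>
    induction y using TensorProduct.induction_on with
    | zero => simp
    | add y y' hy hy' => simp only [map_add, hy, hy']
    | tmul b b' => simp [koszul, h, he]

variable (P : Op k T true) (O : Op k T false)

/-- The space `P(v) ⊗ O(v) ⊗ Ω_n`. -/
abbrev Coeff (v : Corolla T) (n : ℕ) : Type u := P.Tot v ⊗[k] (O.Tot v ⊗[k] Omega k n)

namespace Coeff

/-- The differential of `P(v) ⊗ O(v) ⊗ Ω_n`. -/
noncomputable def d (v : Corolla T) (n : ℕ) : Coeff P O v n →ₗ[k] Coeff P O v n :=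
  TensorProduct.map (P.totD v) LinearMap.id +
    TensorProduct.map (P.totEps v) (TensorProduct.map (O.totD v) LinearMap.id +
      TensorProduct.map (O.totEps v) (Omega.d n))

/-- One-vertex operations. -/
noncomputable def un {a v : Corolla T} (γ : UGen a v) (n : ℕ) :
    Coeff P O a n →ₗ[k] Coeff P O v n :=
  TensorProduct.map (P.totUn γ) (TensorProduct.map (O.totUn γ) LinearMap.id)

/-- Two-vertex operations. -/
noncomputable def bin {a b v : Corolla T} (γ : BGen a b v) (n : ℕ) :
    Coeff P O a n →ₗ[k] Coeff P O b n →ₗ[k] Coeff P O v n :=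
  koszul (P.totBin γ)
    (koszul (O.totBin γ) (LinearMap.mul k (Omega k n)) (Omega.eps n) (O.totEps b))
    (TensorProduct.map (O.totEps a) (Omega.eps n)) (P.totEps b)

/-- Elements of total degree `0`. -/
noncomputable def deg0 (v : Corolla T) (n : ℕ) : Submodule k (Coeff P O v n) :=
  Submodule.span k {x | ∃ (i j : ℤ) (r : ℕ) (p : P.X v i) (o : O.X v j) (w : Omega k n),
    w ∈ Omega.gr k n r ∧ i + j + r = 0 ∧ x = P.inc v i p ⊗ₜ (O.inc v j o ⊗ₜ w)}

/-- Pull-back of forms. -/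
noncomputable def pull {m n : ℕ} (θ : Fin (m + 1) → Fin (n + 1)) (v : Corolla T) :
    Coeff P O v n →ₗ[k] Coeff P O v m :=
  TensorProduct.map LinearMap.id
    (TensorProduct.map LinearMap.id (Omega.pull (k := k) θ).toLinearMap)

end Coeff

/-- `α` is a degree `0` solution of the master equation in `lim (P ⊗ O ⊗ Ω_n)`, the product over all
corollas `v` of the spaces of `Aut(v)`-invariants of `P(v) ⊗ O(v) ⊗ Ω_n`, realized as the families
which are compatible with all isomorphisms of corollas.  The master equation at `v` is
`d α + (sum over all loop contractions to v) + (sum over all two-vertex contractions to v) = 0`.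
In the sums, which have to be finite, every isomorphism class of contractions to `v` is weighted by
the inverse of the order of its automorphism group. -/
structure IsME (n : ℕ) (α : ∀ v : Corolla T, Coeff P O v n) : Prop where
  deg0 : ∀ v, α v ∈ Coeff.deg0 P O v n
  invariant : ∀ {a v : Corolla T} (σ : UGen a v), σ.g.deg = 0 → Coeff.un P O σ n (α a) = α v
  finite_loops : ∀ v, (Function.support fun γ : Σ a : Corolla T, {γ : UGen a v // γ.g.deg = 1} =>
    Coeff.un P O γ.2.1 n (α γ.1)).Finite
  finite_edges : ∀ v, (Function.support
    fun γ : Σ a b : Corolla T, {γ : BGen a b v // γ.g.deg = 1} =>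
      Coeff.bin P O γ.2.2.1 n (α γ.1) (α γ.2.1)).Finite
  master : ∀ v, Coeff.d P O v n (α v) +
    (∑ᶠ γ : Σ a : Corolla T, {γ : UGen a v // γ.g.deg = 1},
      ((γ.1.n.factorial : k)⁻¹) • Coeff.un P O γ.2.1 n (α γ.1)) +
    (2 : k)⁻¹ • (∑ᶠ γ : Σ a b : Corolla T, {γ : BGen a b v // γ.g.deg = 1},
      ((γ.1.n.factorial * γ.2.1.n.factorial : k)⁻¹) •
        Coeff.bin P O γ.2.2.1 n (α γ.1) (α γ.2.1)) = 0

namespace Coeff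

variable {m n : ℕ} (θ : Fin (m + 1) → Fin (n + 1))

theorem pull_un {a v : Corolla T} (γ : UGen a v) (x : Coeff P O a n) :
    pull P O θ v (un P O γ n x) = un P O γ m (pull P O θ a x) := by
  simp only [pull, un, ← LinearMap.comp_apply, ← TensorProduct.map_comp, LinearMap.comp_id,
    LinearMap.id_comp]

theorem pull_bin {a b v : Corolla T} (γ : BGen a b v) (x : Coeff P O a n) (y : Coeff P O b n) :
    pull P O θ v (bin P O γ n x y) = bin P O γ m (pull P O θ a x) (pull P O θ b y) := by
  refine (koszul_natural _ _ _ _ _ _ _ _ _ (fun x y => ?_) (fun x => ?_) x y).symm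
  · exact koszul_natural _ _ _ _ _ _ _ _ _ (fun x y => (map_mul (Omega.pull θ) x y).symm)
      (fun x => Omega.eps_pull θ x) x y
  · have : TensorProduct.map (O.totEps a) (Omega.eps (k := k) m) ∘ₗ
        TensorProduct.map LinearMap.id (Omega.pull θ).toLinearMap =
        TensorProduct.map LinearMap.id (Omega.pull θ).toLinearMap ∘ₗ
          TensorProduct.map (O.totEps a) (Omega.eps n) :=
      TensorProduct.ext' fun o w => by simp [Omega.eps_pull]
    exact LinearMap.congr_fun this x

theorem pull_d (v : Corolla T) (x : Coeff P O v n) :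
    pull P O θ v (d P O v n x) = d P O v m (pull P O θ v x) := by
  induction x using TensorProduct.induction_on with
  | zero => simp
  | add x y hx hy => simp only [map_add, hx, hy]
  | tmul p y =>
    induction y using TensorProduct.induction_on with
    | zero => simp
    | add x y hx hy => simp only [map_add, TensorProduct.tmul_add, hx, hy]
    | tmul o w => simp [pull, d, Omega.d_pull, TensorProduct.tmul_add]

theorem pull_id (n : ℕ) (v : Corolla T) :
    pull P O (fun i : Fin (n + 1) => i) v = LinearMap.id := by
  rw [pull, Omega.pull_id, AlgHom.toLinearMap_id, TensorProduct.map_id, TensorProduct.map_id]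

theorem pull_comp {l m n : ℕ} (θ : Fin (m + 1) → Fin (n + 1)) (η : Fin (l + 1) → Fin (m + 1))
    (v : Corolla T) :
    pull P O (fun i => θ (η i)) v = pull P O η v ∘ₗ pull P O θ v := by
  rw [pull, Omega.pull_comp, pull, pull, ← TensorProduct.map_comp, ← TensorProduct.map_comp]
  rfl

theorem pull_deg0 (v : Corolla T) {x : Coeff P O v n} (hx : x ∈ deg0 P O v n) :
    pull P O θ v x ∈ deg0 P O v m := by
  have : deg0 P O v n ≤ (deg0 P O v m).comap (pull P O θ v) := by
    refine Submodule.span_le.2 ?_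
    rintro _ ⟨i, j, r, p, o, w, hw, h, rfl⟩
    exact Submodule.subset_span ⟨i, j, r, p, o, _, Omega.pull_gr θ hw, h, by simp [pull]⟩
  exact this hx

end Coeff

theorem IsME.pull {m n : ℕ} (θ : Fin (m + 1) → Fin (n + 1)) {α : ∀ v : Corolla T, Coeff P O v n}
    (h : IsME P O n α) : IsME P O m (fun v => Coeff.pull P O θ v (α v)) where
  deg0 v := Coeff.pull_deg0 P O θ v (h.deg0 v)
  invariant σ hσ := by rw [← Coeff.pull_un, h.invariant σ hσ]
  finite_loops v := (h.finite_loops v).subset fun γ hγ h0 => hγ (by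
    simp only [← Coeff.pull_un]
    exact (congrArg _ h0).trans (map_zero _))
  finite_edges v := (h.finite_edges v).subset fun γ hγ h0 => hγ (by
    simp only [← Coeff.pull_bin]
    exact (congrArg _ h0).trans (map_zero _))
  master v := by
    have := congrArg (Coeff.pull P O θ v) (h.master v)
    rw [map_add, map_add, map_smul, map_zero, Coeff.pull_d,
      map_finsum (Coeff.pull P O θ v), map_finsum (Coeff.pull P O θ v)] at this
    · simpa only [map_smul, Coeff.pull_un, Coeff.pull_bin] using this
    · refine (h.finite_edges v).subset fun γ hγ h0 => hγ ?_
      exact (congrArg _ h0).trans (smul_zero _)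
    · refine (h.finite_loops v).subset fun γ hγ h0 => hγ ?_
      exact (congrArg _ h0).trans (smul_zero _)

/-- The simplicial set `ME_•` of solutions of the master equation with values in polynomial forms on
simplices. -/
noncomputable def MESet : SSet.{u} where
  obj Δ := {α : ∀ v : Corolla T, Coeff P O v Δ.unop.len // IsME P O Δ.unop.len α}
  map θ := ↾fun α => ⟨fun v => Coeff.pull P O θ.unop.toOrderHom v (α.1 v),
    IsME.pull P O θ.unop.toOrderHom α.2⟩
  map_id Δ := by
    ext α v
    exact LinearMap.congr_fun (Coeff.pull_id P O Δ.unop.len v) (α.1 v)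
  map_comp θ η := by
    ext α v
    exact LinearMap.congr_fun
      (Coeff.pull_comp P O θ.unop.toOrderHom η.unop.toOrderHom v) (α.1 v)

/-- The set `ME_n` of `n`-simplices of `ME_•`. -/
abbrev MESimplex (n : ℕ) : Type u := (MESet P O).obj (op (SimplexCategory.mk n))

/-- The family underlying a vertex of `ME_•`, i.e. a solution of the master equation in
`lim (P ⊗ O)`; recall that `Ω_0 = k`. -/
def MESimplex.family (s : MESimplex P O 0) (v : Corolla T) : Coeff P O v 0 := s.1 v

/-- The relation on solutions of the master equation that defines `π₀`: `s₀ ∼ s₁` if and only if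
there is `s ∈ ME_1` with `δ₀ s = s₀` and `δ₁ s = s₁`. -/
def MERel (s₀ s₁ : MESimplex P O 0) : Prop :=
  ∃ s : MESimplex P O 1, (MESet P O).δ 0 s = s₀ ∧ (MESet P O).δ 1 s = s₁

variable {P} in
/-- Evaluation of a functional on `P(v)` of degree `i` on the first factor:
`p ⊗ o ⊗ w ↦ f(p) (o ⊗ w)`. -/
noncomputable def Coeff.eval {v : Corolla T} {i : ℤ} (f : Module.Dual k (P.X v i)) (n : ℕ) :
    Coeff P O v n →ₗ[k] O.Tot v ⊗[k] Omega k n :=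
  (TensorProduct.lid k _).toLinearMap ∘ₗ
    TensorProduct.map (f ∘ₗ DirectSum.component k ℤ (fun n => P.X v n) i) LinearMap.id

end Master

end FeynmanME

namespace FeynmanME

/-! ### Signs -/

/-! For a dg operad `A`, each `P(v) ⊗ A(v)` carries the tensor differential, and every contraction
acts on these spaces with degree one because it does so on `P`. Write Δ for the weighted sum of loop
contractions (`loops`), [ , ] for that of two-vertex contractions (`bracket`), and F(α) = dα + Δα +
½[α, α] (`curvature`). The theorem rests on three facts.

First, maps `FT P → A` are the invariant degree zero families α in `P ⊗ A` with F(α) = 0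
(`FT.homEquiv`). `FT P` is presented by generators and relations, with d² = 0 among the relations,
so a map is a choice of values on generators that respects them. Since `P(v)` is finite-dimensional,
values that are linear in the functional form an element of `P(v) ⊗ A(v)`. Equivariance of the
generators becomes invariance of α, and the prescribed differential becomes F(α) = 0
(`RestrictsTo.ev_curvature`). Taking `A = O` gives the vertices of `ME_•`; taking `A = O ⊗ Ω_1`
gives its edges, and the faces become evaluation at the ends of the interval (`vertexEquiv`,
`edgeEquiv`, `δ_edgeEquiv`). Hence ∼ is homotopy through the particular object `O ⊗ Ω_1`.

Second, `O ⊗ Ω_1` is a path object, since integration of forms contracts the kernel of evaluation at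
an end (`PathOp.ev_kerAcyclic`). When the source is cofibrant, a homotopy through an arbitrary path
object yields a third map joined to both given ones by homotopies through `O ⊗ Ω_1`
(`Op.IsCofibrant.exists_pathHomotopic`). Filling an open box in `O ⊗ Ω_1 ⊗ Ω_1` then joins the two
maps directly (`PathHomotopic.euclidean`). The same box filling gives symmetry and transitivity, so
homotopy and ∼ are the same equivalence relation, and its quotient is π₀.

Third, `FT P` is cofibrant when `P` is non-negatively graded (`Op.NonNeg.isCofibrant`). By the first
fact this means that solutions lift along acyclic fibrations. Filter `P ⊗ A` by the degree in `P`.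
Contractions and the differential of `P` raise this degree, so to leading order the equation is
linear, with operator ± d_A. Lift degree by degree: the obstruction is the leading term of F(α),
which lies in the acyclic kernel and is closed by the Bianchi identity dF + ΔF + [F, α] = 0
(`bianchi`). The correction is made invariant by averaging over isomorphisms, and at each corolla
the process stops because `P(v)` is finite-dimensional.

The Bianchi identity is combinatorial. The ways to factor a given graph morphism with given first
edges form a torsor under relabellings of the intermediate corolla, hence have total weight one
(`TwoStep.finsum_weight`). Interchanging two contractions reverses the sign. So Δ² = 0, Δ[α, α] =
-2[Δα, α] and [[α, α], α] = 0. The delicate point is to determine which pairs of contractions can be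
interchanged (`TwoStep.edge_loop_trichotomy`, `TwoStep.exchange_dichotomy`). -/

theorem negOnePow_smul_eq_ite {V : Type*} [AddCommGroup V] (n : ℤ) (x : V) :
    n.negOnePow • x = if Even n then x else -x := by
  split_ifs with h
  · rw [Int.negOnePow_even n h, one_smul]
  · rw [Int.negOnePow_odd n (Int.not_even_iff_odd.1 h), Units.neg_smul, one_smul]

theorem Gph.sh_false {X Y : Type} (g : Gph X Y) : g.sh false = 0 := by simp [Gph.sh]

theorem Gph.sh_true_of_deg {X Y : Type} (g : Gph X Y) {r : ℤ} (h : g.deg = r) : g.sh true = r := by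
  simp [Gph.sh, h]

theorem Gph.deg_eq_zero_iff {X Y : Type} (g : Gph X Y) : g.deg = 0 ↔ g.NoEdge := by
  unfold Gph.deg; split_ifs with h <;> simp [h]

theorem Gph.deg_eq_one_iff {X Y : Type} (g : Gph X Y) : g.deg = 1 ↔ ¬ g.NoEdge := by
  unfold Gph.deg; split_ifs with h <;> simp [h]

/-! ### Operations on total spaces, computed on homogeneous elements -/

section Total

variable {k : Type u} [Field k] {T : Kind} {odd : Bool}

namespace Op

variable (P : Op k T odd)

theorem totD_inc {v : Corolla T} {i n : ℤ} (h : i + 1 = n) (x : P.X v i) :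
    P.totD v (P.inc v i x) = P.inc v n (P.d h x) := by
  subst h; simp [totD]

theorem totEps_inc {v : Corolla T} {i : ℤ} (x : P.X v i) :
    P.totEps v (P.inc v i x) = i.negOnePow • P.inc v i x := by
  simp [totEps]

theorem totUn_inc {a v : Corolla T} (γ : UGen a v) {i n : ℤ} (h : i + γ.g.sh odd = n)
    (x : P.X a i) : P.totUn γ (P.inc a i x) = P.inc v n (P.un γ h x) := by
  subst h; simp [totUn]

theorem totBin_inc {a b v : Corolla T} (γ : BGen a b v) {i j n : ℤ} (h : i + j + γ.g.sh odd = n)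
    (x : P.X a i) (y : P.X b j) :
    P.totBin γ (P.inc a i x) (P.inc b j y) = P.inc v n (P.bin γ h x y) := by
  subst h; simp [totBin]

theorem tot_induction {v : Corolla T} {p : P.Tot v → Prop} (h0 : p 0)
    (hadd : ∀ x y, p x → p y → p (x + y)) (h : ∀ i x, p (P.inc v i x)) (x : P.Tot v) : p x :=
  DirectSum.induction_on x h0 (fun i x => h i x) hadd

theorem tot_hom_ext {v : Corolla T} {V : Type*} [AddCommGroup V] [Module k V]
    {f g : P.Tot v →ₗ[k] V} (h : ∀ i x, f (P.inc v i x) = g (P.inc v i x)) : f = g :=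
  DirectSum.linearMap_ext k fun i => LinearMap.ext (h i)

theorem inc_injective (v : Corolla T) (i : ℤ) : Function.Injective (P.inc v i) :=
  DirectSum.of_injective i

/-- The homogeneous component of degree `i`. -/
noncomputable abbrev proj (v : Corolla T) (i : ℤ) : P.Tot v →ₗ[k] P.X v i :=
  DirectSum.component k ℤ (fun n => P.X v n) i

@[simp] theorem proj_inc_same (v : Corolla T) (i : ℤ) (x : P.X v i) :
    P.proj v i (P.inc v i x) = x := by
  simp [proj]

theorem proj_inc_ne (v : Corolla T) {i j : ℤ} (h : i ≠ j) (x : P.X v i) :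
    P.proj v j (P.inc v i x) = 0 := by
  exact DFinsupp.single_eq_of_ne h.symm

end Op

end Total

/-! ### The convolution complexes `P(v) ⊗ A(v)` -/

section Convolution

variable {k : Type u} [Field k] {T : Kind} (P : Op k T true) (A : Op k T false)

/-- The space `P(v) ⊗ A(v)`. -/
abbrev Conv (v : Corolla T) : Type u := P.Tot v ⊗[k] A.Tot v

namespace Conv

/-- The differential of `P(v) ⊗ A(v)`. -/
noncomputable def d (v : Corolla T) : Conv P A v →ₗ[k] Conv P A v :=
  TensorProduct.map (P.totD v) LinearMap.id + TensorProduct.map (P.totEps v) (A.totD v)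

/-- One-vertex operations. -/
noncomputable def un {a v : Corolla T} (γ : UGen a v) : Conv P A a →ₗ[k] Conv P A v :=
  TensorProduct.map (P.totUn γ) (A.totUn γ)

/-- Two-vertex operations. -/
noncomputable def bin {a b v : Corolla T} (γ : BGen a b v) :
    Conv P A a →ₗ[k] Conv P A b →ₗ[k] Conv P A v :=
  koszul (P.totBin γ) (A.totBin γ) (A.totEps a) (P.totEps b)

/-- A homogeneous pure tensor. -/
noncomputable abbrev pure {v : Corolla T} {i j : ℤ} (p : P.X v i) (o : A.X v j) : Conv P A v :=
  P.inc v i p ⊗ₜ[k] A.inc v j o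

/-- Elements of total degree `m`. -/
noncomputable def deg (v : Corolla T) (m : ℤ) : Submodule k (Conv P A v) :=
  Submodule.span k {x | ∃ (i j : ℤ) (p : P.X v i) (o : A.X v j), i + j = m ∧ x = pure P A p o}

variable {P A}

theorem pure_mem_deg {v : Corolla T} {i j m : ℤ} (h : i + j = m) (p : P.X v i) (o : A.X v j) :
    pure P A p o ∈ deg P A v m := Submodule.subset_span ⟨i, j, p, o, h, rfl⟩

theorem hom_ext {v : Corolla T} {V : Type*} [AddCommGroup V] [Module k V]
    {f g : Conv P A v →ₗ[k] V}
    (h : ∀ (i j : ℤ) (p : P.X v i) (o : A.X v j), f (pure P A p o) = g (pure P A p o)) : f = g :=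
  TensorProduct.ext (P.tot_hom_ext fun i p => A.tot_hom_ext fun j o => h i j p o)

theorem eq_of_pure {v : Corolla T} {V : Type*} [AddCommGroup V] [Module k V]
    (f g : Conv P A v →ₗ[k] V)
    (h : ∀ (i j : ℤ) (p : P.X v i) (o : A.X v j), f (pure P A p o) = g (pure P A p o)) (x) :
    f x = g x := by rw [hom_ext h]

theorem eq_of_pure_deg {v : Corolla T} {V : Type*} [AddCommGroup V] [Module k V] {m : ℤ}
    (f g : Conv P A v →ₗ[k] V)
    (h : ∀ (i j : ℤ) (p : P.X v i) (o : A.X v j), i + j = m → f (pure P A p o) = g (pure P A p o))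
    {x} (hx : x ∈ deg P A v m) : f x = g x := by
  refine LinearMap.eqOn_span (f := f) (g := g) ?_ hx
  rintro _ ⟨i, j, p, o, hm, rfl⟩
  exact h i j p o hm

theorem map_mem_of_pure_deg {v : Corolla T} {V : Type*} [AddCommGroup V] [Module k V] {m : ℤ}
    (f : Conv P A v →ₗ[k] V) (S : Submodule k V)
    (h : ∀ (i j : ℤ) (p : P.X v i) (o : A.X v j), i + j = m → f (pure P A p o) ∈ S)
    {x} (hx : x ∈ deg P A v m) : f x ∈ S := by
  have : deg P A v m ≤ S.comap f := by
    refine Submodule.span_le.2 ?_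
    rintro _ ⟨i, j, p, o, hm, rfl⟩
    exact h i j p o hm
  exact this hx

theorem d_pure {v : Corolla T} {i i' j j' : ℤ} (hi : i + 1 = i') (hj : j + 1 = j')
    (p : P.X v i) (o : A.X v j) :
    d P A v (pure P A p o) = pure P A (P.d hi p) o + i.negOnePow • pure P A p (A.d hj o) := by
  simp [d, Op.totD_inc _ hi, Op.totD_inc _ hj, Op.totEps_inc]
  rfl

theorem un_pure {a v : Corolla T} (γ : UGen a v) {i n j m : ℤ} (hi : i + γ.g.sh true = n)
    (hj : j + γ.g.sh false = m) (p : P.X a i) (o : A.X a j) :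
    un P A γ (pure P A p o) = pure P A (P.un γ hi p) (A.un γ hj o) := by
  simp [un, Op.totUn_inc _ γ hi, Op.totUn_inc _ γ hj]

end Conv

/-- Only the eigenvalues of the two sign operators enter, so one computation serves `P ⊗ A`, `A ⊗
Ω_1` and the constant model alike. The four terms collapse to twice a sign, and 2 is invertible. -/
theorem koszul_tmul {A A' B B' C C' : Type u} [CharZero k] [AddCommGroup A] [AddCommGroup A']
    [AddCommGroup B] [AddCommGroup B'] [AddCommGroup C] [AddCommGroup C'] [Module k A] [Module k A']
    [Module k B] [Module k B'] [Module k C] [Module k C'] (f : A →ₗ[k] B →ₗ[k] C)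
    (f' : A' →ₗ[k] B' →ₗ[k] C') (e' : A' →ₗ[k] A') (e : B →ₗ[k] B) (a : A) (a' : A') (b : B)
    (b' : B') {p q : ℤ} (ha : e' a' = p.negOnePow • a') (hb : e b = q.negOnePow • b) :
    koszul f f' e' e (a ⊗ₜ a') (b ⊗ₜ b') = (p * q).negOnePow • (f a b ⊗ₜ[k] f' a' b') := by
  simp only [negOnePow_smul_eq_ite, Int.even_mul] at ha hb ⊢
  have h2 : (2 : k) ≠ 0 := two_ne_zero
  have key : ∀ x : C ⊗[k] C', (2 : k)⁻¹ • (x + x) = x := fun x => by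
    rw [← two_smul k x, smul_smul, inv_mul_cancel₀ h2, one_smul]
  by_cases hp : Even p <;> by_cases hq : Even q <;>
    simp [koszul, ha, hb, hp, hq, key, TensorProduct.tmul_neg, TensorProduct.neg_tmul]
  rw [sub_eq_add_neg, key]

namespace Conv

variable {P A} [CharZero k]

theorem bin_pure {a b v : Corolla T} (γ : BGen a b v) {i i' j j' n m : ℤ}
    (h : i + i' + γ.g.sh true = n) (h' : j + j' + γ.g.sh false = m)
    (p : P.X a i) (o : A.X a j) (q : P.X b i') (r : A.X b j') :
    bin P A γ (pure P A p o) (pure P A q r) =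
      (j * i').negOnePow • pure P A (P.bin γ h p q) (A.bin γ h' o r) := by
  rw [bin, koszul_tmul _ _ _ _ _ _ _ _ (A.totEps_inc o) (P.totEps_inc q), P.totBin_inc γ h,
    A.totBin_inc γ h']

end Conv

end Convolution

end FeynmanME

namespace FeynmanME

/-! ### `P ⊗ A` satisfies the identities of an odd operad -/

section ConvolutionLaws

variable {k : Type u} [Field k] {T : Kind} {P : Op k T true} {A : Op k T false}

namespace Conv

theorem neg_pure {v : Corolla T} {i j : ℤ} (p : P.X v i) (o : A.X v j) :
    pure P A (-p) o = -pure P A p o := by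
  rw [pure, map_neg, TensorProduct.neg_tmul]

theorem pure_neg {v : Corolla T} {i j : ℤ} (p : P.X v i) (o : A.X v j) :
    pure P A p (-o) = -pure P A p o := by
  rw [pure, map_neg, TensorProduct.tmul_neg]

theorem add_pure {v : Corolla T} {i j : ℤ} (p p' : P.X v i) (o : A.X v j) :
    pure P A (p + p') o = pure P A p o + pure P A p' o := by
  rw [pure, map_add, TensorProduct.add_tmul]

theorem pure_add {v : Corolla T} {i j : ℤ} (p : P.X v i) (o o' : A.X v j) :
    pure P A p (o + o') = pure P A p o + pure P A p o' := by
  rw [pure, map_add, TensorProduct.tmul_add]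

theorem pure_zero {v : Corolla T} {i j : ℤ} (p : P.X v i) :
    pure P A p (0 : A.X v j) = 0 := by
  rw [pure, map_zero, TensorProduct.tmul_zero]

theorem zero_pure {v : Corolla T} {i j : ℤ} (o : A.X v j) :
    pure P A (0 : P.X v i) o = 0 := by
  rw [pure, map_zero, TensorProduct.zero_tmul]

theorem d_mem_deg {v : Corolla T} {m n : ℤ} (h : m + 1 = n) {x} (hx : x ∈ deg P A v m) :
    d P A v x ∈ deg P A v n := by
  refine map_mem_of_pure_deg _ _ (fun i j p o hij => ?_) hx
  rw [d_pure rfl rfl, negOnePow_smul_eq_ite]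
  refine add_mem (pure_mem_deg (by lia) _ _) ?_
  split_ifs
  · exact pure_mem_deg (by lia) _ _
  · exact neg_mem (pure_mem_deg (by lia) _ _)

theorem un_mem_deg {a v : Corolla T} (γ : UGen a v) {m n : ℤ} (h : m + γ.g.sh true = n) {x}
    (hx : x ∈ deg P A a m) : un P A γ x ∈ deg P A v n := by
  refine map_mem_of_pure_deg _ _ (fun i j p o hij => ?_) hx
  rw [un_pure γ rfl rfl]
  exact pure_mem_deg (by simp [Gph.sh_false]; lia) _ _

theorem bin_mem_deg [CharZero k] {a b v : Corolla T} (γ : BGen a b v) {l m n : ℤ}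
    (h : l + m + γ.g.sh true = n) {x y} (hx : x ∈ deg P A a l) (hy : y ∈ deg P A b m) :
    bin P A γ x y ∈ deg P A v n := by
  refine map_mem_of_pure_deg ((bin P A γ).flip y) _ (fun i j p o hij => ?_) hx
  refine map_mem_of_pure_deg (bin P A γ _) _ (fun i' j' p' o' hij' => ?_) hy
  rw [bin_pure γ rfl rfl, negOnePow_smul_eq_ite]
  have := pure_mem_deg (m := n) (i := i + i' + γ.g.sh true) (j := j + j' + γ.g.sh false)
    (by simp [Gph.sh_false]; lia) (P.bin γ rfl p p') (A.bin γ rfl o o')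
  split_ifs
  · exact this
  · exact neg_mem this

theorem d_d (v : Corolla T) (x : Conv P A v) : d P A v (d P A v x) = 0 := by
  refine eq_of_pure (d P A v ∘ₗ d P A v) 0 (fun i j p o => ?_) x
  simp only [LinearMap.comp_apply, LinearMap.zero_apply]
  rw [d_pure rfl rfl, negOnePow_smul_eq_ite]
  have h₁ := P.law (.d_d rfl rfl p)
  have h₂ := A.law (.d_d rfl rfl o)
  split_ifs with h <;> simp only [map_add, map_neg] <;>
    rw [d_pure rfl rfl, d_pure rfl rfl, h₁, h₂, zero_pure, pure_zero, negOnePow_smul_eq_ite,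
      negOnePow_smul_eq_ite] <;>
    simp only [Int.even_add_one, h, not_true, not_false_iff, if_true, if_false, neg_zero] <;> abel

theorem d_un {a v : Corolla T} (γ : UGen a v) (x : Conv P A a) :
    d P A v (un P A γ x) = (γ.g.sh true).negOnePow • un P A γ (d P A a x) := by
  have := eq_of_pure (d P A v ∘ₗ un P A γ) ((γ.g.sh true).negOnePow • un P A γ ∘ₗ d P A a)
    (fun i j p o => ?_) x
  · simpa using this
  have h0 : γ.g.sh false = 0 := γ.g.sh_false
  have h₁ := sub_eq_zero.1 <| P.law (.d_un γ (n := i + γ.g.sh true + 1) rfl rfl rfl (by lia) p)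
  have h₂ := sub_eq_zero.1 <| A.law (.d_un γ (n := j + γ.g.sh false + 1) rfl rfl rfl (by lia) o)
  have e₁ := fun x => un_pure (P := P) (A := A) γ (n := i + γ.g.sh true + 1) (i := i + 1)
    (by lia) (m := j + γ.g.sh false) rfl x o
  have e₂ := fun y => un_pure (P := P) (A := A) γ (n := i + γ.g.sh true) rfl (j := j + 1)
    (m := j + γ.g.sh false + 1) (by lia) p y
  simp only [LinearMap.comp_apply, LinearMap.smul_apply]
  rw [un_pure γ rfl rfl, d_pure rfl rfl, d_pure rfl rfl, h₁, h₂]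
  simp only [negOnePow_smul_eq_ite, h0, Int.even_add, Even.zero, if_true]
  by_cases hi : Even i <;> by_cases hs : Even (γ.g.sh true) <;>
    simp only [hi, hs, if_true, if_false, map_add, map_neg, e₁, e₂, neg_pure, neg_neg, neg_add,
      iff_true, iff_false, not_true, not_false_iff]

theorem d_un_of_deg_one {a v : Corolla T} (γ : UGen a v) (hγ : γ.g.deg = 1) (x : Conv P A a) :
    d P A v (un P A γ x) = -un P A γ (d P A a x) := by
  rw [d_un, γ.g.sh_true_of_deg hγ, Int.negOnePow_one, Units.neg_smul, one_smul]

theorem d_un_of_deg_zero {a v : Corolla T} (γ : UGen a v) (hγ : γ.g.deg = 0) (x : Conv P A a) :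
    d P A v (un P A γ x) = un P A γ (d P A a x) := by
  rw [d_un, γ.g.sh_true_of_deg hγ, Int.negOnePow_zero, one_smul]

theorem un_un {a b v : Corolla T} (γ₁ : UGen a b) (γ₂ : UGen b v) (γ : UGen a v)
    (hγ : γ.g = γ₁.g.comp γ₂.g) (h : γ₁.g.sh true + γ₂.g.sh true = γ.g.sh true)
    (x : Conv P A a) : un P A γ₂ (un P A γ₁ x) = un P A γ x := by
  refine eq_of_pure (un P A γ₂ ∘ₗ un P A γ₁) (un P A γ) (fun i j p o => ?_) x
  rw [LinearMap.comp_apply, un_pure γ₁ rfl rfl, un_pure γ₂ rfl rfl,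
    un_pure γ (n := i + γ₁.g.sh true + γ₂.g.sh true) (by lia)
      (m := j + γ₁.g.sh false + γ₂.g.sh false) (by simp [Gph.sh_false]),
    sub_eq_zero.1 (P.law (.un_un γ₁ γ₂ γ hγ rfl rfl _ p)),
    sub_eq_zero.1 (A.law (.un_un γ₁ γ₂ γ hγ rfl rfl _ o))]

/-- The sign comes from `P` alone: contractions of `A` have degree zero and commute, while those of
`P` have degree one and anticommute. The same holds for the other quadratic relations below. -/
theorem un_un_comm {a b b' v : Corolla T} (γ₁ : UGen a b) (γ₂ : UGen b v) (γ₁' : UGen a b')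
    (γ₂' : UGen b' v) (hγ : γ₁.g.comp γ₂.g = γ₁'.g.comp γ₂'.g) (hne : γ₁.g.E ≠ γ₁'.g.E)
    (h₁ : γ₁.g.deg = 1) (h₂ : γ₂.g.deg = 1) (h₁' : γ₁'.g.deg = 1) (h₂' : γ₂'.g.deg = 1)
    (x : Conv P A a) :
    un P A γ₂ (un P A γ₁ x) = -un P A γ₂' (un P A γ₁' x) := by
  refine eq_of_pure (un P A γ₂ ∘ₗ un P A γ₁) (-(un P A γ₂' ∘ₗ un P A γ₁')) (fun i j p o => ?_) x
  have s₁ := γ₁.g.sh_true_of_deg h₁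
  have s₂ := γ₂.g.sh_true_of_deg h₂
  have s₁' := γ₁'.g.sh_true_of_deg h₁'
  have s₂' := γ₂'.g.sh_true_of_deg h₂'
  have e₁ := sub_eq_zero.1 <| P.law (.un_un_comm γ₁ γ₂ γ₁' γ₂' hγ hne (i := i) rfl rfl rfl
    (by lia) p)
  have e₂ := sub_eq_zero.1 <| A.law (.un_un_comm γ₁ γ₂ γ₁' γ₂' hγ hne (i := j) rfl rfl rfl
    (by simp [Gph.sh_false]) o)
  simp only [LinearMap.comp_apply, LinearMap.neg_apply]
  rw [un_pure γ₁ rfl rfl, un_pure γ₂ rfl rfl, un_pure γ₁' rfl rfl,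
    un_pure γ₂' (n := i + γ₁.g.sh true + γ₂.g.sh true) (by lia)
      (m := j + γ₁.g.sh false + γ₂.g.sh false) (by simp [Gph.sh_false]), e₁, e₂]
  simp [negOnePow_smul_eq_ite, s₁, s₂, Gph.sh_false, neg_pure]

variable [CharZero k]

theorem un_bin {a b c v : Corolla T} (γ₁ : BGen a b c) (γ₂ : UGen c v) (γ : BGen a b v)
    (hγ : γ.g = γ₁.g.comp γ₂.g) (h : γ₁.g.sh true + γ₂.g.sh true = γ.g.sh true)
    (x : Conv P A a) (y : Conv P A b) :
    un P A γ₂ (bin P A γ₁ x y) = bin P A γ x y := by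
  refine eq_of_pure (un P A γ₂ ∘ₗ (bin P A γ₁).flip y) ((bin P A γ).flip y)
    (fun i j p o => ?_) x
  refine eq_of_pure (un P A γ₂ ∘ₗ (bin P A γ₁ _)) (bin P A γ _) (fun i' j' p' o' => ?_) y
  rw [LinearMap.comp_apply, bin_pure γ₁ rfl rfl,
    bin_pure γ (n := i + i' + γ₁.g.sh true + γ₂.g.sh true) (by lia)
      (m := j + j' + γ₁.g.sh false + γ₂.g.sh false) (by simp [Gph.sh_false]),
    ← sub_eq_zero.1 (P.law (.un_bin γ₁ γ₂ γ hγ rfl rfl _ p p')),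
    ← sub_eq_zero.1 (A.law (.un_bin γ₁ γ₂ γ hγ rfl rfl _ o o'))]
  simp only [negOnePow_smul_eq_ite]
  split_ifs <;> simp only [map_neg, un_pure γ₂ rfl rfl]

/-- The Koszul signs from `P`, from `A` and from passing one through the other combine into
(-1)^(mn) for the total degrees, which the parity hypothesis removes. -/
theorem bin_swap {a b v : Corolla T} (γ : BGen a b v) (γ' : BGen b a v)
    (hγ : γ'.g = γ.g.reindex (Equiv.sumComm _ _)) (h : γ'.g.sh true = γ.g.sh true) {m n : ℤ}
    {x : Conv P A a} {y : Conv P A b} (hx : x ∈ deg P A a m) (hy : y ∈ deg P A b n)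
    (hmn : Even (m * n)) : bin P A γ x y = bin P A γ' y x := by
  refine eq_of_pure_deg ((bin P A γ).flip y) (bin P A γ' y) (fun i j p o hij => ?_) hx
  refine eq_of_pure_deg (bin P A γ _) ((bin P A γ').flip _) (fun i' j' p' o' hij' => ?_) hy
  rw [LinearMap.flip_apply, bin_pure γ rfl rfl,
    bin_pure γ' (n := i + i' + γ.g.sh true) (by lia)
      (m := j + j' + γ.g.sh false) (by simp [Gph.sh_false]; lia),
    sub_eq_zero.1 (P.law (.bin_swap γ γ' hγ rfl (by lia) p p')),
    sub_eq_zero.1 (A.law (.bin_swap γ γ' hγ rfl (by simp [Gph.sh_false]; lia) o o'))]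
  subst hij hij'
  simp only [negOnePow_smul_eq_ite]
  simp only [Int.even_mul, Int.even_add] at hmn ⊢
  by_cases Even i <;> by_cases Even j <;> by_cases Even i' <;> by_cases Even j' <;>
    simp_all only [neg_pure, pure_neg, if_true, if_false, or_true, or_false, iff_true, iff_false,
      true_or, false_or, true_and, and_true, not_true, not_false_iff, neg_neg, or_self]

/-- The operation has degree one, which gives the overall sign; the remaining Koszul sign (-1)^m in
front of the second term disappears for even `m`. -/
theorem d_bin {a b v : Corolla T} (γ : BGen a b v) (hγ : γ.g.deg = 1) {m : ℤ} (hm : Even m)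
    {x : Conv P A a} (hx : x ∈ deg P A a m) (y : Conv P A b) :
    d P A v (bin P A γ x y) =
      -(bin P A γ (d P A a x) y + bin P A γ x (d P A b y)) := by
  refine eq_of_pure_deg (d P A v ∘ₗ (bin P A γ).flip y)
    (-((bin P A γ).flip y ∘ₗ d P A a + (bin P A γ).flip (d P A b y)))
    (fun i j p o hij => ?_) hx
  refine eq_of_pure (d P A v ∘ₗ bin P A γ _)
    (-(bin P A γ _ + bin P A γ _ ∘ₗ d P A b)) (fun i' j' p' o' => ?_) y
  have h1 : γ.g.sh true = 1 := γ.g.sh_true_of_deg hγ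
  have h0 : γ.g.sh false = 0 := γ.g.sh_false
  have h₁ := sub_eq_zero.1 <| P.law (.d_bin γ (n := i + i' + γ.g.sh true + 1) rfl rfl rfl rfl
    (by lia) (by lia) p p')
  have h₂ := sub_eq_zero.1 <| A.law (.d_bin γ (n := j + j' + γ.g.sh false + 1) rfl rfl rfl rfl
    (by lia) (by lia) o o')
  simp only [LinearMap.comp_apply, LinearMap.neg_apply, LinearMap.add_apply]
  rw [bin_pure γ rfl rfl, d_pure (p := p) rfl rfl, d_pure (p := p') rfl rfl]
  have e₁ := fun x y => bin_pure γ (n := i + i' + γ.g.sh true + 1) (i := i + 1) (i' := i')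
    (j := j) (j' := j') (by lia) rfl x (P := P) (A := A) o y o'
  have e₂ := bin_pure γ (n := i + i' + γ.g.sh true) rfl (m := j + j' + γ.g.sh false + 1)
    (by lia) p (A.d rfl o) p' o'
  have e₃ := bin_pure γ (n := i + i' + γ.g.sh true + 1) (by lia) (m := j + j' + γ.g.sh false)
    rfl p o (P.d rfl p') o'
  have e₄ := bin_pure γ (n := i + i' + γ.g.sh true) rfl (m := j + j' + γ.g.sh false + 1)
    (by lia) p o p' (A.d rfl o')
  have hp : Even i ↔ Even j := by
    subst hij; simpa [Int.even_add] using hm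
  have hd := fun (x : P.X v (i + i' + γ.g.sh true)) (y : A.X v (j + j' + γ.g.sh false)) =>
    d_pure (P := P) (A := A) rfl rfl x y
  simp only [map_add, LinearMap.add_apply]
  simp only [negOnePow_smul_eq_ite, h0, h1, Int.even_add, Int.even_mul, Even.zero, if_true, hp,
    Int.not_even_one] at *
  by_cases hj : Even j <;> by_cases hj' : Even j' <;> by_cases hi' : Even i' <;>
    simp only [hj, hj', hi', if_true, if_false, or_true, or_false, true_or, false_or, iff_true,
      iff_false, not_true, not_false_iff, map_neg, LinearMap.neg_apply] at * <;>
    simp only [hd, h₁, h₂, e₁, e₂, e₃, e₄, neg_pure, pure_neg, add_pure, pure_add, neg_add_rev,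
      neg_neg] <;> abel

theorem un_bin_comm {a b c c' v : Corolla T} (γ₁ : BGen a b c) (γ₂ : UGen c v) (γ₁' : BGen a b c')
    (γ₂' : UGen c' v) (hγ : γ₁.g.comp γ₂.g = γ₁'.g.comp γ₂'.g) (hne : γ₁.g.E ≠ γ₁'.g.E)
    (h₁ : γ₁.g.deg = 1) (h₂ : γ₂.g.deg = 1) (h₁' : γ₁'.g.deg = 1) (h₂' : γ₂'.g.deg = 1)
    (x : Conv P A a) (y : Conv P A b) :
    un P A γ₂ (bin P A γ₁ x y) = -un P A γ₂' (bin P A γ₁' x y) := by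
  refine eq_of_pure (un P A γ₂ ∘ₗ (bin P A γ₁).flip y) (-(un P A γ₂' ∘ₗ (bin P A γ₁').flip y))
    (fun i j p o => ?_) x
  refine eq_of_pure (un P A γ₂ ∘ₗ bin P A γ₁ _) (-(un P A γ₂' ∘ₗ bin P A γ₁' _))
    (fun i' j' p' o' => ?_) y
  have s₁ := γ₁.g.sh_true_of_deg h₁
  have s₂ := γ₂.g.sh_true_of_deg h₂
  have s₁' := γ₁'.g.sh_true_of_deg h₁'
  have s₂' := γ₂'.g.sh_true_of_deg h₂'
  have e₁ := sub_eq_zero.1 <| P.law (.un_bin_comm γ₁ γ₂ γ₁' γ₂' hγ hne (i := i) (j := i') rfl rfl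
    rfl (by lia) p p')
  have e₂ := sub_eq_zero.1 <| A.law (.un_bin_comm γ₁ γ₂ γ₁' γ₂' hγ hne (i := j) (j := j') rfl rfl
    rfl (by simp [Gph.sh_false]) o o')
  simp only [LinearMap.comp_apply, LinearMap.neg_apply]
  have f := fun x y => un_pure (P := P) (A := A) γ₂ rfl rfl (i := i + i' + γ₁.g.sh true)
    (j := j + j' + γ₁.g.sh false) x y
  have f' := fun x y => un_pure (P := P) (A := A) γ₂' (n := i + i' + γ₁.g.sh true + γ₂.g.sh true)
    (by lia) (m := j + j' + γ₁.g.sh false + γ₂.g.sh false) (by simp [Gph.sh_false])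
    (i := i + i' + γ₁'.g.sh true) (j := j + j' + γ₁'.g.sh false) x y
  rw [bin_pure γ₁ rfl rfl, bin_pure γ₁' rfl rfl]
  simp only [negOnePow_smul_eq_ite, s₁, s₂, Gph.sh_false] at e₁ e₂ ⊢
  split_ifs <;> simp only [map_neg, f, f', e₁, e₂] <;> simp [neg_pure]

theorem un_bin_assoc {a a' b c v : Corolla T} (γ₁ : BGen a b c) (γ₂ : UGen c v) (γ₁' : UGen a a')
    (γ₂' : BGen a' b v) (hγ : γ₁.g.comp γ₂.g = (γ₁'.g.addRight _).comp γ₂'.g)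
    (h₁ : γ₁.g.deg = 1) (h₂ : γ₂.g.deg = 1) (h₁' : γ₁'.g.deg = 1) (h₂' : γ₂'.g.deg = 1)
    (x : Conv P A a) (y : Conv P A b) :
    un P A γ₂ (bin P A γ₁ x y) = -bin P A γ₂' (un P A γ₁' x) y := by
  refine eq_of_pure (un P A γ₂ ∘ₗ (bin P A γ₁).flip y) (-((bin P A γ₂').flip y ∘ₗ un P A γ₁'))
    (fun i j p o => ?_) x
  refine eq_of_pure (un P A γ₂ ∘ₗ bin P A γ₁ _) (-(bin P A γ₂' _))
    (fun i' j' p' o' => ?_) y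
  have s₁ := γ₁.g.sh_true_of_deg h₁
  have s₂ := γ₂.g.sh_true_of_deg h₂
  have s₁' := γ₁'.g.sh_true_of_deg h₁'
  have s₂' := γ₂'.g.sh_true_of_deg h₂'
  have e₁ := sub_eq_zero.1 <| P.law (.un_bin_assoc γ₁ γ₂ γ₁' γ₂' hγ (i := i) (j := i') rfl rfl
    rfl (by lia) p p')
  have e₂ := sub_eq_zero.1 <| A.law (.un_bin_assoc γ₁ γ₂ γ₁' γ₂' hγ (i := j) (j := j') rfl rfl
    rfl (by simp [Gph.sh_false]) o o')
  simp only [LinearMap.comp_apply, LinearMap.neg_apply]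
  have f := fun x y => un_pure (P := P) (A := A) γ₂ rfl rfl (i := i + i' + γ₁.g.sh true)
    (j := j + j' + γ₁.g.sh false) x y
  rw [bin_pure γ₁ rfl rfl, un_pure γ₁' rfl rfl,
    bin_pure γ₂' (n := i + i' + γ₁.g.sh true + γ₂.g.sh true) (by lia)
      (m := j + j' + γ₁.g.sh false + γ₂.g.sh false) (by simp [Gph.sh_false])]
  simp only [negOnePow_smul_eq_ite, s₁, s₂, Gph.sh_false, add_zero] at e₁ e₂ ⊢
  split_ifs <;> simp only [map_neg, f, e₁, e₂] <;> simp [neg_pure]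

theorem bin_bin_assoc {a b c e e' v : Corolla T} (γ₁ : BGen a b e) (γ₂ : BGen e c v)
    (γ₁' : BGen b c e') (γ₂' : BGen e' a v)
    (hγ : ((γ₁.g.addRight _).comp γ₂.g).reindex (rot _ _ _) = (γ₁'.g.addRight _).comp γ₂'.g)
    (h₁ : γ₁.g.deg = 1) (h₂ : γ₂.g.deg = 1) (h₁' : γ₁'.g.deg = 1) (h₂' : γ₂'.g.deg = 1)
    {x : Conv P A a} {y : Conv P A b} {z : Conv P A c}
    (hx : x ∈ deg P A a 0) (hy : y ∈ deg P A b 0) (hz : z ∈ deg P A c 0) :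
    bin P A γ₂ (bin P A γ₁ x y) z = -bin P A γ₂' (bin P A γ₁' y z) x := by
  refine eq_of_pure_deg ((bin P A γ₂).flip z ∘ₗ (bin P A γ₁).flip y)
    (-(bin P A γ₂' (bin P A γ₁' y z))) (fun i j p o hij => ?_) hx
  refine eq_of_pure_deg ((bin P A γ₂).flip z ∘ₗ bin P A γ₁ _)
    (-((bin P A γ₂').flip _ ∘ₗ (bin P A γ₁').flip z)) (fun i' j' p' o' hij' => ?_) hy
  refine eq_of_pure_deg (bin P A γ₂ _)
    (-((bin P A γ₂').flip _ ∘ₗ bin P A γ₁' _)) (fun i'' j'' p'' o'' hij'' => ?_) hz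
  have s₁ := γ₁.g.sh_true_of_deg h₁
  have s₂ := γ₂.g.sh_true_of_deg h₂
  have s₁' := γ₁'.g.sh_true_of_deg h₁'
  have s₂' := γ₂'.g.sh_true_of_deg h₂'
  have e₁ := sub_eq_zero.1 <| P.law (.bin_bin_assoc γ₁ γ₂ γ₁' γ₂' hγ (i := i) (j := i') (l := i'')
    rfl rfl rfl (by lia) p p' p'')
  have e₂ := sub_eq_zero.1 <| A.law (.bin_bin_assoc γ₁ γ₂ γ₁' γ₂' hγ (i := j) (j := j') (l := j'')
    rfl rfl rfl (by simp [Gph.sh_false]; lia) o o' o'')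
  simp only [LinearMap.comp_apply, LinearMap.neg_apply, LinearMap.flip_apply]
  have f := fun x y => bin_pure (P := P) (A := A) γ₂ rfl rfl (i := i + i' + γ₁.g.sh true)
    (j := j + j' + γ₁.g.sh false) x y p'' o''
  have f' := fun x y => bin_pure (P := P) (A := A) γ₂'
    (n := i + i' + γ₁.g.sh true + i'' + γ₂.g.sh true) (by lia)
    (m := j + j' + γ₁.g.sh false + j'' + γ₂.g.sh false) (by simp [Gph.sh_false]; lia)
    (i := i' + i'' + γ₁'.g.sh true) (j := j' + j'' + γ₁'.g.sh false) x y p o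
  rw [bin_pure γ₁ rfl rfl, bin_pure γ₁' rfl rfl]
  -- In total degree zero the `P`-degree and the `A`-degree of each factor have the same parity, so
  -- every sign depends on three parities only.
  have par : ∀ {r s : ℤ}, r + s = 0 → (Even s ↔ Even r) := fun {r s} h =>
    (Int.even_add.1 (h ▸ Even.zero)).symm
  have p₁ := par hij
  have p₂ := par hij'
  have p₃ := par hij''
  simp only [negOnePow_smul_eq_ite, s₁, s₂, Gph.sh_false, Int.even_add, Int.even_mul, p₁, p₂, p₃,
    Even.zero, Int.not_even_one, or_self, if_true, if_false, iff_true] at e₁ e₂ f f' ⊢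
  by_cases hi : Even i <;> by_cases hi' : Even i' <;> by_cases hi'' : Even i'' <;>
    simp only [hi, hi', hi'', if_true, if_false, or_true, or_false, true_or, false_or, iff_true,
      iff_false, not_true, not_false_iff, map_neg, LinearMap.neg_apply] at * <;>
    simp only [f, f', e₁, e₂, neg_pure, pure_neg, neg_neg]

end Conv

end ConvolutionLaws

end FeynmanME

namespace FeynmanME

/-! ### Graph morphisms -/

namespace Gph

variable {X Y Z W : Type}

theorem comp_assoc (f : Gph X Y) (g : Gph Y Z) (h : Gph Z W) :
    (f.comp g).comp h = f.comp (g.comp h) := by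
  refine Gph.ext rfl (funext fun p => funext fun q => propext ?_)
  simp only [comp]
  constructor
  · rintro ((h | ⟨y, z, h, rfl, rfl⟩) | ⟨y, z, h, rfl, rfl⟩)
    · exact .inl h
    · exact .inr ⟨y, z, .inl h, rfl, rfl⟩
    · exact .inr ⟨_, _, .inr ⟨y, z, h, rfl, rfl⟩, rfl, rfl⟩
  · rintro (h | ⟨y, z, h | ⟨y, z, h, rfl, rfl⟩, rfl, rfl⟩)
    · exact .inl (.inl h)
    · exact .inl (.inr ⟨y, z, h, rfl, rfl⟩)
    · exact .inr ⟨y, z, h, rfl, rfl⟩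

theorem one_comp (f : Gph X Y) : (one X).comp f = f := by
  refine Gph.ext rfl (funext fun p => funext fun q => propext ?_)
  simp [comp, one]

theorem comp_one (f : Gph X Y) : f.comp (one Y) = f := by
  refine Gph.ext rfl (funext fun p => funext fun q => propext ?_)
  simp [comp, one]

theorem addRight_comp (f : Gph X Y) (g : Gph Y Z) (W : Type) :
    (f.comp g).addRight W = (f.addRight W).comp (g.addRight W) := by
  refine Gph.ext ?_ (funext fun p => funext fun q => propext ?_)
  · funext x; cases x <;> rfl
  · simp only [comp, addRight]
    constructor
    · rintro ⟨_, _, h | ⟨y, z, h, rfl, rfl⟩, rfl, rfl⟩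
      · exact .inl ⟨_, _, h, rfl, rfl⟩
      · exact .inr ⟨_, _, ⟨y, z, h, rfl, rfl⟩, rfl, rfl⟩
    · rintro (⟨x, y, h, rfl, rfl⟩ | ⟨_, _, ⟨y, z, h, rfl, rfl⟩, rfl, rfl⟩)
      · exact ⟨x, y, .inl h, rfl, rfl⟩
      · exact ⟨_, _, .inr ⟨y, z, h, rfl, rfl⟩, rfl, rfl⟩

theorem addRight_one (X W : Type) : (one X).addRight W = one (X ⊕ W) := by
  refine Gph.ext ?_ (funext fun p => funext fun q => propext ?_)
  · funext x; cases x <;> rfl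
  · simp [one, addRight]

theorem reindex_comp (f : Gph X Y) (g : Gph Y Z) (e : X ≃ W) :
    (f.comp g).reindex e = (f.reindex e).comp g := by
  refine Gph.ext rfl (funext fun p => funext fun q => propext ?_)
  simp [comp, reindex, ← Equiv.eq_symm_apply]

theorem reindex_reindex (f : Gph X Y) (e : X ≃ Z) (e' : Z ≃ W) :
    (f.reindex e).reindex e' = f.reindex (e.trans e') := rfl

theorem reindex_refl (f : Gph X Y) : f.reindex (Equiv.refl X) = f := rfl

@[simp] theorem addRight_E_inl (g : Gph X Y) (p q : X) :
    (g.addRight Z).E (.inl p) (.inl q) ↔ g.E p q := by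
  simp [addRight]

@[simp] theorem addRight_E_inr_left (g : Gph X Y) (p : Z) (q : X ⊕ Z) :
    ¬ (g.addRight Z).E (.inr p) q := by
  simp [addRight]

@[simp] theorem addRight_E_inr_right (g : Gph X Y) (p : X ⊕ Z) (q : Z) :
    ¬ (g.addRight Z).E p (.inr q) := by
  simp [addRight]

/-- The symmetric relation consisting of the single edge `{x, x'}`. -/
def pair (x x' : X) (p q : X) : Prop := (p = x ∧ q = x') ∨ (p = x' ∧ q = x)

theorem pair_comm (x x' : X) : pair x x' = pair x' x := by
  funext p q; exact propext (by unfold pair; tauto)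

theorem pair_self (x x' : X) : pair x x' x x' := .inl ⟨rfl, rfl⟩

namespace IsGraph

variable {T : Kind} {oX : X → Bool} {oY : Y → Bool} {oZ : Z → Bool} {g : Gph X Y}

theorem ne_left (h : g.IsGraph T oX oY) {x x' : X} (hx : g.E x x') (y : Y) : g.j y ≠ x := by
  rintro rfl; exact h.leg _ _ hx

theorem unique (h : g.IsGraph T oX oY) {x x' x'' : X} (h' : g.E x x') (h'' : g.E x x'') :
    x' = x'' :=
  (h.paired x (by rintro ⟨y, hy⟩; exact h.ne_left h' y hy)).unique h' h''

theorem mem_range_iff (h : g.IsGraph T oX oY) {x : X} : x ∈ Set.range g.j ↔ ∀ x', ¬ g.E x x' := by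
  refine ⟨?_, fun hx => ?_⟩
  · rintro ⟨y, rfl⟩ x'; exact h.leg _ _
  · by_contra h'
    exact hx _ (h.paired x h').choose_spec.1

theorem comp_E_j (h : g.IsGraph T oX oY) {g' : Gph Y Z} {y z : Y} :
    (g.comp g').E (g.j y) (g.j z) ↔ g'.E y z := by
  constructor
  · rintro (h' | ⟨y', z', h', h₁, h₂⟩)
    · exact (h.leg _ _ h').elim
    · rwa [← h.inj h₁, ← h.inj h₂]
  · exact fun h' => .inr ⟨y, z, h', rfl, rfl⟩

theorem comp (h : g.IsGraph T oX oY) {g' : Gph Y Z} (h' : g'.IsGraph T oY oZ) :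
    (g.comp g').IsGraph T oX oZ where
  inj := h.inj.comp h'.inj
  out_j y := by rw [h'.out_j, h.out_j]; rfl
  symm := by
    rintro x x' (hx | ⟨y, z, hx, rfl, rfl⟩)
    · exact .inl (h.symm _ _ hx)
    · exact .inr ⟨_, _, h'.symm _ _ hx, rfl, rfl⟩
  irrefl := by
    rintro x (hx | ⟨y, z, hx, rfl, hz⟩)
    · exact h.irrefl _ hx
    · rw [h.inj hz] at hx; exact h'.irrefl _ hx
  leg := by
    rintro y x (hx | ⟨y', z, hx, hy, rfl⟩)
    · exact h.leg _ _ hx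
    · rw [h.inj hy] at hx; exact h'.leg _ _ hx
  paired := by
    intro x hx
    by_cases hr : x ∈ Set.range g.j
    · obtain ⟨y, rfl⟩ := hr
      obtain ⟨z, hz, hz'⟩ := h'.paired y (by rintro ⟨w, rfl⟩; exact hx ⟨w, rfl⟩)
      refine ⟨g.j z, .inr ⟨y, z, hz, rfl, rfl⟩, ?_⟩
      rintro w (hw | ⟨y', z', hw, hy, rfl⟩)
      · exact (h.leg _ _ hw).elim
      · rw [h.inj hy] at hw; rw [hz' _ hw]
    · obtain ⟨z, hz, hz'⟩ := h.paired x hr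
      refine ⟨z, .inl hz, ?_⟩
      rintro w (hw | ⟨y', z', hw, hy, rfl⟩)
      · exact hz' _ hw
      · exact (hr ⟨_, hy⟩).elim
  opposite := by
    rintro hT x x' (hx | ⟨y, z, hx, rfl, rfl⟩)
    · exact h.opposite hT _ _ hx
    · rw [← h.out_j, ← h.out_j]; exact h'.opposite hT _ _ hx

theorem addRight (h : g.IsGraph T oX oY) (oZ : Z → Bool) :
    (g.addRight Z).IsGraph T (Sum.elim oX oZ) (Sum.elim oY oZ) where
  inj := by
    rintro (x | x) (y | y) hxy <;> simp [Gph.addRight] at hxy ⊢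
    · exact h.inj hxy
    · exact hxy
  out_j := by rintro (y | y) <;> simp [Gph.addRight, h.out_j]
  symm := by
    rintro _ _ ⟨x, y, hx, rfl, rfl⟩; exact ⟨y, x, h.symm _ _ hx, rfl, rfl⟩
  irrefl := by
    rintro _ ⟨x, y, hx, rfl, hy⟩
    rw [Sum.inl_injective hy] at hx; exact h.irrefl _ hx
  leg := by
    rintro (y | y) _ ⟨x, x', hx, hy, rfl⟩
    · rw [← Sum.inl_injective hy] at hx; exact h.leg _ _ hx
    · cases hy
  paired := by
    rintro (x | x) hx
    · obtain ⟨z, hz, hz'⟩ := h.paired x (by rintro ⟨y, rfl⟩; exact hx ⟨.inl y, rfl⟩)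
      refine ⟨.inl z, ⟨x, z, hz, rfl, rfl⟩, ?_⟩
      rintro _ ⟨x', y', h', hx', rfl⟩
      rw [← Sum.inl_injective hx'] at h'; rw [hz' _ h']
    · exact (hx ⟨.inr x, rfl⟩).elim
  opposite := by
    rintro hT _ _ ⟨x, y, hx, rfl, rfl⟩; exact h.opposite hT _ _ hx

theorem reindex (h : g.IsGraph T oX oY) (e : X ≃ Z) {oZ : Z → Bool} (ho : ∀ x, oZ (e x) = oX x) :
    (g.reindex e).IsGraph T oZ oY where
  inj := e.injective.comp h.inj
  out_j y := by rw [h.out_j]; exact (ho _).symm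
  symm _ _ hx := h.symm _ _ hx
  irrefl _ hx := h.irrefl _ hx
  leg y x hx := by simp only [Gph.reindex, Equiv.symm_apply_apply] at hx; exact h.leg _ _ hx
  paired x hx := by
    obtain ⟨z, hz, hz'⟩ := h.paired (e.symm x) (by
      rintro ⟨y, hy⟩; exact hx ⟨y, by simp [Gph.reindex, hy]⟩)
    refine ⟨e z, by simpa [Gph.reindex] using hz, fun w hw => ?_⟩
    rw [← hz' _ hw, Equiv.apply_symm_apply]
  opposite hT x x' hx := by
    have := h.opposite hT _ _ hx
    rwa [← ho, ← ho, Equiv.apply_symm_apply, Equiv.apply_symm_apply] at this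

/-- The flags of the middle set embed into the source and avoid the edges of the first morphism, so
the second morphism can be read off from the composite on them. -/
theorem comp_cancel (h : g.IsGraph T oX oY) {g₁ g₂ : Gph Y Z} (he : g.comp g₁ = g.comp g₂) :
    g₁ = g₂ := by
  refine Gph.ext (funext fun z => h.inj (congrFun (congrArg Gph.j he) z))
    (funext fun p => funext fun q => propext ?_)
  rw [← h.comp_E_j, he, h.comp_E_j]

/-- A contraction of part of the edges of `G` is always a first step of `G`. Since every flag has
only one partner, both ends of an edge that is not yet contracted survive the first step, and the
residual edges pair the surviving flags correctly. -/
theorem exists_comp (h : g.IsGraph T oX oY) {G : Gph X Z} (hG : G.IsGraph T oX oZ)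
    (hE : ∀ p q, g.E p q → G.E p q) :
    ∃ g' : Gph Y Z, g'.IsGraph T oY oZ ∧ g.comp g' = G := by
  have hj : ∀ z, ∃ y, g.j y = G.j z := fun z =>
    h.mem_range_iff.2 fun x' hx' => hG.leg _ _ (hE _ _ hx')
  choose j hj using hj
  refine ⟨⟨j, fun y y' => G.E (g.j y) (g.j y')⟩, ⟨?_, ?_, ?_, ?_, ?_, ?_, ?_⟩, ?_⟩
  · intro z z' hz; exact hG.inj (by rw [← hj, ← hj]; exact congrArg g.j hz)
  · intro z; rw [h.out_j, hG.out_j, hj]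
  · exact fun _ _ => hG.symm _ _
  · exact fun _ => hG.irrefl _
  · intro z y hz; dsimp only at hz; rw [hj] at hz; exact hG.leg _ _ hz
  · intro y hy
    obtain ⟨x, hx, hx'⟩ := hG.paired (g.j y) (by
      rintro ⟨z, hz⟩; exact hy ⟨z, h.inj (by rw [hj, hz])⟩)
    obtain ⟨y', rfl⟩ : x ∈ Set.range g.j := h.mem_range_iff.2 fun x' hxx' => by
      have := hG.unique (hE _ _ hxx') (hG.symm _ _ hx)
      subst this
      exact h.leg _ _ (h.symm _ _ hxx')
    exact ⟨y', hx, fun y'' h'' => h.inj (hx' _ h'')⟩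
  · intro hT y y' hy; rw [h.out_j, h.out_j]; exact hG.opposite hT _ _ hy
  · refine Gph.ext (funext hj) (funext fun p => funext fun q => propext ⟨?_, fun hpq => ?_⟩)
    · rintro (hx | ⟨y, z, hx, rfl, rfl⟩)
      · exact hE _ _ hx
      · exact hx
    · by_cases hp : p ∈ Set.range g.j
      · by_cases hq : q ∈ Set.range g.j
        · obtain ⟨y, rfl⟩ := hp
          obtain ⟨z, rfl⟩ := hq
          exact .inr ⟨y, z, hpq, rfl, rfl⟩
        · obtain ⟨p', hp', -⟩ := h.paired q hq
          have := hG.unique (hE _ _ hp') (hG.symm _ _ hpq)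
          subst this
          exact .inl (h.symm _ _ hp')
      · obtain ⟨q', hq', -⟩ := h.paired p hp
        have := hG.unique (hE _ _ hq') hpq
        subst this
        exact .inl hq'

/-- The surviving flags are exactly those lying on no edge. Hence the contracted edges determine a
graph morphism up to a bijection of its target flags. -/
theorem exists_equiv (h : g.IsGraph T oX oY) {g' : Gph X Z} (h' : g'.IsGraph T oX oZ)
    (hE : g.E = g'.E) : ∃ e : Z ≃ Y, ∀ z, g'.j z = g.j (e z) := by
  have hr : Set.range g'.j = Set.range g.j := by
    ext x; rw [h'.mem_range_iff, h.mem_range_iff, hE]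
  refine ⟨(Equiv.ofInjective _ h'.inj).trans ((Equiv.setCongr hr).trans
    (Equiv.ofInjective _ h.inj).symm), fun z => ?_⟩
  simp [Equiv.apply_ofInjective_symm]

/-- Contraction of a part of the edges of a graph. -/
theorem exists_contract [Finite Z] (h : g.IsGraph T oX oY) {i : Z → X}
    (hi : Function.Injective i) {E : Z → Z → Prop} (hE : ∀ p q, E p q → g.E (i p) (i q))
    (hs : ∀ p q, E p q → E q p) :
    ∃ (n : ℕ) (g' : Gph Z (Fin n)),
      g'.IsGraph T (fun z => oX (i z)) (fun y => oX (i (g'.j y))) ∧ g'.E = E := by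
  obtain ⟨n, ⟨φ⟩⟩ := Finite.exists_equiv_fin {x : Z // ∀ x', ¬ E x x'}
  refine ⟨n, ⟨fun y => (φ.symm y).1, E⟩, ⟨?_, fun _ => rfl, hs, ?_, ?_, ?_, ?_⟩, rfl⟩
  · exact Subtype.val_injective.comp φ.symm.injective
  · exact fun x hx => h.irrefl _ (hE _ _ hx)
  · exact fun y => (φ.symm y).2
  · intro x hx
    have : ∃ x', E x x' := by
      by_contra hn
      push Not at hn
      exact hx ⟨φ ⟨x, hn⟩, by simp⟩
    obtain ⟨x', hx'⟩ := this
    exact ⟨x', hx', fun y hy => hi (h.unique (hE _ _ hy) (hE _ _ hx'))⟩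
  · exact fun hT x x' hx => h.opposite hT _ _ (hE _ _ hx)

theorem oneEdge (h : g.IsGraph T oX oY) (h₁ : g.OneEdge) : ∃ x x', g.E = pair x x' := by
  obtain ⟨x, x', hx, hu⟩ := h₁
  refine ⟨x, x', funext fun p => funext fun q => propext ⟨hu p q, ?_⟩⟩
  rintro (⟨rfl, rfl⟩ | ⟨rfl, rfl⟩)
  · exact hx
  · exact h.symm _ _ hx

/-- One edge uses up two flags. This bounds the sources of the basic morphisms onto a given corolla
and is the reason that the sums over them are finite outside the properadic case. -/
theorem card_le [Fintype X] [Fintype Y] [DecidableEq X] (h : g.IsGraph T oX oY)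
    (hs : g.NoEdge ∨ g.OneEdge) : Fintype.card X ≤ Fintype.card Y + 2 := by
  have h2 : ∃ s : Finset X, s.card ≤ 2 ∧ ∀ x, x ∉ Set.range g.j → x ∈ s := by
    rcases hs with hs | ⟨x, x', -, hu⟩
    · exact ⟨∅, by simp, fun x hx => (hx (h.mem_range_iff.2 fun x' => hs x x')).elim⟩
    · refine ⟨{x, x'}, Finset.card_le_two, fun y hy => ?_⟩
      obtain ⟨z, hz, -⟩ := h.paired y hy
      rcases hu _ _ hz with ⟨rfl, -⟩ | ⟨rfl, -⟩ <;> simp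
  obtain ⟨s, hs, hx⟩ := h2
  calc Fintype.card X = (Finset.univ : Finset X).card := rfl
    _ ≤ (Finset.univ.image g.j ∪ s).card := Finset.card_le_card fun x _ => by
      by_cases hr : x ∈ Set.range g.j
      · obtain ⟨y, rfl⟩ := hr; simp
      · exact Finset.mem_union_right _ (hx x hr)
    _ ≤ _ := (Finset.card_union_le _ _).trans (Nat.add_le_add Finset.card_image_le hs)

end IsGraph

theorem oneEdge_of_eq_pair {g : Gph X Y} {x x' : X} (h : g.E = pair x x') : g.OneEdge :=
  ⟨x, x', h ▸ pair_self x x', fun y y' hy => by rwa [h] at hy⟩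

theorem OneEdge.not_noEdge {g : Gph X Y} (h : g.OneEdge) : ¬ g.NoEdge := by
  obtain ⟨x, x', h, -⟩ := h
  exact fun hn => hn _ _ h

theorem noEdge_comp_iff (g : Gph X Y) (g' : Gph Y Z) :
    (g.comp g').NoEdge ↔ g.NoEdge ∧ g'.NoEdge := by
  constructor
  · exact fun h => ⟨fun p q hpq => h p q (.inl hpq), fun p q hpq => h _ _ (.inr ⟨p, q, hpq, rfl, rfl⟩)⟩
  · rintro ⟨h₁, h₂⟩ p q (h | ⟨y, z, h, -⟩)
    · exact h₁ _ _ h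
    · exact h₂ _ _ h

theorem comp_E_of_noEdge_right (g : Gph X Y) {g' : Gph Y Z} (h : g'.NoEdge) :
    (g.comp g').E = g.E := by
  funext p q
  refine propext ⟨?_, .inl⟩
  rintro (h' | ⟨y, z, h', -⟩)
  · exact h'
  · exact (h _ _ h').elim

theorem comp_E_of_noEdge_left {g : Gph X Y} (hg : g.NoEdge) (g' : Gph Y Z) (p q : X) :
    (g.comp g').E p q ↔ ∃ y z, g'.E y z ∧ g.j y = p ∧ g.j z = q := by
  simp [comp, hg p q]

theorem noEdge_addRight {g : Gph X Y} (h : g.NoEdge) : (g.addRight Z).NoEdge := by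
  rintro _ _ ⟨x, y, h', -⟩; exact h _ _ h'

theorem OneEdge.comp_right {g : Gph X Y} (h : g.OneEdge) {g' : Gph Y Z} (h' : g'.NoEdge) :
    (g.comp g').OneEdge := by
  unfold OneEdge; rw [comp_E_of_noEdge_right g h']; exact h

theorem OneEdge.comp_left {g : Gph X Y} (hg : g.NoEdge) {g' : Gph Y Z} (h : g'.OneEdge) :
    (g.comp g').OneEdge := by
  obtain ⟨y, y', hy, hu⟩ := h
  refine ⟨g.j y, g.j y', .inr ⟨y, y', hy, rfl, rfl⟩, fun p q hpq => ?_⟩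
  obtain ⟨z, z', hz, rfl, rfl⟩ := (comp_E_of_noEdge_left hg g' p q).1 hpq
  rcases hu _ _ hz with ⟨rfl, rfl⟩ | ⟨rfl, rfl⟩ <;> simp

theorem OneEdge.reindex {g : Gph X Y} (h : g.OneEdge) (e : X ≃ Z) : (g.reindex e).OneEdge := by
  obtain ⟨y, y', hy, hu⟩ := h
  refine ⟨e y, e y', by simpa [Gph.reindex] using hy, fun p q hpq => ?_⟩
  simpa [Equiv.symm_apply_eq] using hu _ _ hpq

theorem reindex_deg (g : Gph X Y) (e : X ≃ Z) : (g.reindex e).deg = g.deg := by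
  have : (g.reindex e).NoEdge ↔ g.NoEdge :=
    ⟨fun h p q hpq => h (e p) (e q) (by simpa [reindex] using hpq), fun h p q => h _ _⟩
  classical exact if_congr this rfl rfl

theorem comp_deg_right (g : Gph X Y) {g' : Gph Y Z} (h : g'.deg = 0) :
    (g.comp g').deg = g.deg := by
  rw [deg_eq_zero_iff] at h
  classical exact if_congr (by simp [noEdge_comp_iff, h]) rfl rfl

theorem comp_deg_left {g : Gph X Y} (h : g.deg = 0) (g' : Gph Y Z) :
    (g.comp g').deg = g'.deg := by
  rw [deg_eq_zero_iff] at h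
  classical exact if_congr (by simp [noEdge_comp_iff, h]) rfl rfl

end Gph

end FeynmanME

namespace FeynmanME

variable {T : Kind}

/-! ### Isomorphisms of corollas and their action on basic morphisms -/

theorem UGen.ext_g {a v : Corolla T} {γ γ' : UGen a v} (h : γ.g = γ'.g) : γ = γ' := by
  cases γ; cases γ'; congr

theorem BGen.ext_g {a b v : Corolla T} {γ γ' : BGen a b v} (h : γ.g = γ'.g) : γ = γ' := by
  cases γ; cases γ'; congr

/-- Isomorphisms of corollas. -/
abbrev Iso (a v : Corolla T) : Type := {σ : UGen a v // σ.g.deg = 0}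

/-- Loop contractions. -/
abbrev Loop (a v : Corolla T) : Type := {γ : UGen a v // γ.g.deg = 1}

/-- Two-vertex contractions. -/
abbrev Edge (a b v : Corolla T) : Type := {γ : BGen a b v // γ.g.deg = 1}

namespace Iso

variable {a b v : Corolla T}

theorem noEdge (σ : Iso a v) : σ.1.g.NoEdge := (Gph.deg_eq_zero_iff _).1 σ.2

theorem genus_eq (σ : Iso a v) : v.genus = a.genus := by
  rcases σ.1.shape with h | h
  · exact h.2
  · exact (h.2.1.not_noEdge σ.noEdge).elim

theorem bijective (σ : Iso a v) : Function.Bijective σ.1.g.j :=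
  ⟨σ.1.isGraph.inj, fun x => σ.1.isGraph.mem_range_iff.2 fun x' => σ.noEdge x x'⟩

/-- The isomorphism given by a bijection of flags. -/
def ofEquiv (e : Fin v.n ≃ Fin a.n) (ho : ∀ y, v.out y = a.out (e y)) (hg : v.genus = a.genus) :
    Iso a v :=
  ⟨⟨⟨e, fun _ _ => False⟩, ⟨e.injective, ho, fun _ _ h => h, fun _ h => h, fun _ _ h => h,
    fun x hx => (hx (e.surjective x)).elim, fun _ _ _ h => h.elim⟩, .inl ⟨fun _ _ h => h, hg⟩⟩,
    (Gph.deg_eq_zero_iff _).2 fun _ _ h => h⟩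

/-- The bijection of flags underlying an isomorphism. -/
noncomputable def equiv (σ : Iso a v) : Fin v.n ≃ Fin a.n := Equiv.ofBijective _ σ.bijective

/-- The identity. -/
def refl (a : Corolla T) : Iso a a := ofEquiv (Equiv.refl _) (fun _ => rfl) rfl

/-- The inverse. -/
noncomputable def symm (σ : Iso a v) : Iso v a :=
  ofEquiv σ.equiv.symm (fun y => by
    rw [σ.1.isGraph.out_j]; exact congrArg a.out (σ.equiv.apply_symm_apply y).symm) σ.genus_eq.symm

theorem comp_symm_g (σ : Iso a v) : σ.1.g.comp σ.symm.1.g = Gph.one _ := by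
  refine Gph.ext (funext fun y => ?_) (funext fun p => funext fun q => propext ?_)
  · exact σ.equiv.apply_symm_apply y
  · simp [Gph.comp, Gph.one, σ.noEdge p q, σ.symm.noEdge _ _]

theorem symm_comp_g (σ : Iso a v) : σ.symm.1.g.comp σ.1.g = Gph.one _ := by
  refine Gph.ext (funext fun y => ?_) (funext fun p => funext fun q => propext ?_)
  · exact σ.equiv.symm_apply_apply y
  · simp [Gph.comp, Gph.one, σ.noEdge _ _, σ.symm.noEdge p q]

end Iso

namespace UGen

variable {a a' v v' : Corolla T}

/-- Composition with an isomorphism of the target. -/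
def post (γ : UGen a v) (σ : Iso v v') : UGen a v' :=
  ⟨γ.g.comp σ.1.g, γ.isGraph.comp σ.1.isGraph, by
    rw [Gph.noEdge_comp_iff, σ.genus_eq]
    exact γ.shape.imp (fun h => ⟨⟨h.1, σ.noEdge⟩, h.2⟩)
      fun h => ⟨h.1, h.2.1.comp_right σ.noEdge, h.2.2⟩⟩

/-- Composition with an isomorphism of the source. -/
def pre (σ : Iso a a') (γ : UGen a' v) : UGen a v :=
  ⟨σ.1.g.comp γ.g, σ.1.isGraph.comp γ.isGraph, by
    rw [Gph.noEdge_comp_iff, ← σ.genus_eq]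
    exact γ.shape.imp (fun h => ⟨⟨σ.noEdge, h.1⟩, h.2⟩)
      fun h => ⟨h.1, h.2.1.comp_left σ.noEdge, h.2.2⟩⟩

theorem post_deg (γ : UGen a v) (σ : Iso v v') : (γ.post σ).g.deg = γ.g.deg :=
  Gph.comp_deg_right _ σ.2

theorem pre_deg (σ : Iso a a') (γ : UGen a' v) : (pre σ γ).g.deg = γ.g.deg :=
  Gph.comp_deg_left σ.2 _

theorem oneEdge_of_deg (γ : UGen a v) (h : γ.g.deg = 1) : γ.g.OneEdge := by
  rcases γ.shape with h' | h'
  · exact ((Gph.deg_eq_one_iff _).1 h h'.1).elim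
  · exact h'.2.1

theorem hasLoops_of_deg (γ : UGen a v) (h : γ.g.deg = 1) : T.hasLoops := by
  rcases γ.shape with h' | h'
  · exact ((Gph.deg_eq_one_iff _).1 h h'.1).elim
  · exact h'.1

theorem genus_of_deg (γ : UGen a v) (h : γ.g.deg = 1) : v.genus = a.genus + T.loopGenus := by
  rcases γ.shape with h' | h'
  · exact ((Gph.deg_eq_one_iff _).1 h h'.1).elim
  · exact h'.2.2

theorem noEdge_or_oneEdge (γ : UGen a v) : γ.g.NoEdge ∨ γ.g.OneEdge :=
  γ.shape.imp And.left fun h => h.2.1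

end UGen

namespace BGen

variable {a a' b v v' : Corolla T}

/-- Composition with an isomorphism of the target. -/
def post (γ : BGen a b v) (σ : Iso v v') : BGen a b v' :=
  ⟨γ.g.comp σ.1.g, γ.isGraph.comp σ.1.isGraph, by rw [σ.genus_eq, γ.genus], by
    rw [Gph.noEdge_comp_iff, Gph.comp_E_of_noEdge_right _ σ.noEdge]
    rcases γ.shape with h | h | h
    · exact .inl ⟨h.1, h.2, σ.noEdge⟩
    · exact .inr (.inl ⟨h.1, h.2.1.comp_right σ.noEdge, h.2.2⟩)
    · exact .inr (.inr h)⟩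

/-- Composition with an isomorphism of the first source. -/
def pre (σ : Iso a a') (γ : BGen a' b v) : BGen a b v :=
  ⟨(σ.1.g.addRight _).comp γ.g, (σ.1.isGraph.addRight _).comp γ.isGraph, by
    rw [← σ.genus_eq, γ.genus], by
    have hn : (σ.1.g.addRight (Fin b.n)).NoEdge := Gph.noEdge_addRight σ.noEdge
    have hex : (∃ p q, γ.g.E (.inl p) (.inr q)) →
        ∃ p q, ((σ.1.g.addRight _).comp γ.g).E (.inl p) (.inr q) := fun ⟨p, q, h⟩ =>
      ⟨σ.1.g.j p, q, .inr ⟨_, _, h, rfl, rfl⟩⟩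
    rw [Gph.noEdge_comp_iff]
    rcases γ.shape with h | h | ⟨h₁, h₂, h₃, c, hc⟩
    · exact .inl ⟨h.1, hn, h.2⟩
    · exact .inr (.inl ⟨h.1, h.2.1.comp_left hn, hex h.2.2⟩)
    · refine .inr (.inr ⟨h₁, hex h₂, fun x x' hx => ?_, c, fun p q hx => ?_⟩)
      · obtain ⟨y, z, hy, rfl, rfl⟩ := (Gph.comp_E_of_noEdge_left hn _ _ _).1 hx
        have := h₃ _ _ hy
        cases y <;> cases z <;> simp_all [Gph.addRight]
      · obtain ⟨y, z, hy, h₁, h₂⟩ := (Gph.comp_E_of_noEdge_left hn _ _ _).1 hx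
        rcases y with y | y <;> rcases z with z | z <;> simp [Gph.addRight] at h₁ h₂
        subst h₁ h₂
        rw [← hc _ _ hy, σ.1.isGraph.out_j]⟩

/-- Interchange of the two sources. -/
def swap (γ : BGen a b v) : BGen b a v :=
  ⟨γ.g.reindex (Equiv.sumComm _ _), γ.isGraph.reindex _ (by rintro (x | x) <;> rfl), by
    rw [γ.genus, add_comm], by
    have hex : (∃ p q, γ.g.E (.inl p) (.inr q)) →
        ∃ p q, (γ.g.reindex (Equiv.sumComm _ _)).E (.inl p) (.inr q) := fun ⟨p, q, h⟩ =>
      ⟨q, p, γ.isGraph.symm _ _ h⟩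
    rcases γ.shape with h | h | ⟨h₁, h₂, h₃, c, hc⟩
    · exact .inl ⟨h.1, fun p q => h.2 _ _⟩
    · exact .inr (.inl ⟨h.1, h.2.1.reindex _, hex h.2.2⟩)
    · refine .inr (.inr ⟨h₁, hex h₂, fun x x' hx => ?_, !c, fun p q hx => ?_⟩)
      · have := h₃ _ _ hx
        cases x <;> cases x' <;> simp_all
      · have h' := γ.isGraph.symm _ _ hx
        have := γ.isGraph.opposite (by rw [h₁]; trivial) _ _ h'
        have hc' := hc _ _ h'
        change a.out q ≠ b.out p at this
        rw [hc'] at this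
        cases c <;> cases h : b.out p <;> simp_all⟩

theorem swap_swap (γ : BGen a b v) : γ.swap.swap = γ := BGen.ext_g (by
  simp only [swap, Gph.reindex_reindex]
  rw [show (Equiv.sumComm (Fin a.n) (Fin b.n)).trans (Equiv.sumComm _ _) = Equiv.refl _ from
    Equiv.ext fun x => by cases x <;> rfl]; rfl)

theorem swap_deg (γ : BGen a b v) : γ.swap.g.deg = γ.g.deg := Gph.reindex_deg _ _

theorem post_deg (γ : BGen a b v) (σ : Iso v v') : (γ.post σ).g.deg = γ.g.deg :=
  Gph.comp_deg_right _ σ.2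

theorem pre_deg (σ : Iso a a') (γ : BGen a' b v) : (pre σ γ).g.deg = γ.g.deg :=
  Gph.comp_deg_left ((Gph.deg_eq_zero_iff _).2 (Gph.noEdge_addRight σ.noEdge)) _

theorem edge_of_deg (γ : BGen a b v) (h : γ.g.deg = 1) : ∃ p q, γ.g.E (.inl p) (.inr q) := by
  rcases γ.shape with h' | h' | h'
  · exact ((Gph.deg_eq_one_iff _).1 h h'.2).elim
  · exact h'.2.2
  · exact h'.2.1

theorem isLeft_ne (γ : BGen a b v) (h : γ.g.deg = 1) {x x' : Fin a.n ⊕ Fin b.n}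
    (hx : γ.g.E x x') : x.isLeft ≠ x'.isLeft := by
  rcases γ.shape with h' | h' | h'
  · exact ((Gph.deg_eq_one_iff _).1 h h'.2).elim
  · obtain ⟨y, y', he⟩ := γ.isGraph.oneEdge h'.2.1
    obtain ⟨p, q, hpq⟩ := h'.2.2
    rw [he] at hx hpq
    rcases hx with ⟨rfl, rfl⟩ | ⟨rfl, rfl⟩ <;> rcases hpq with ⟨rfl, rfl⟩ | ⟨rfl, rfl⟩ <;> simp
  · exact h'.2.2.1 _ _ hx

theorem out_const (γ : BGen a b v) (h : γ.g.deg = 1) {p p' : Fin a.n} {q q' : Fin b.n}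
    (hx : γ.g.E (.inl p) (.inr q)) (hx' : γ.g.E (.inl p') (.inr q')) : a.out p = a.out p' := by
  rcases γ.shape with h' | h' | h'
  · exact ((Gph.deg_eq_one_iff _).1 h h'.2).elim
  · obtain ⟨y, y', he⟩ := γ.isGraph.oneEdge h'.2.1
    rw [he] at hx hx'
    rcases hx with ⟨rfl, rfl⟩ | ⟨rfl, rfl⟩ <;> rcases hx' with ⟨h, h'⟩ | ⟨h, h'⟩ <;> simp_all
  · obtain ⟨c, hc⟩ := h'.2.2.2
    rw [hc _ _ hx, hc _ _ hx']

theorem oneEdge_of_deg (γ : BGen a b v) (h : γ.g.deg = 1) (hT : T ≠ .properad) : γ.g.OneEdge := by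
  rcases γ.shape with h' | h' | h'
  · exact ((Gph.deg_eq_one_iff _).1 h h'.2).elim
  · exact h'.2.1
  · exact (hT h'.1).elim

theorem exists_pair (γ : BGen a b v) (h : γ.g.deg = 1) (hT : T ≠ .properad) :
    ∃ p q, γ.g.E = Gph.pair (.inl p) (.inr q) := by
  obtain ⟨x, x', he⟩ := γ.isGraph.oneEdge (γ.oneEdge_of_deg h hT)
  obtain ⟨p, q, hpq⟩ := γ.edge_of_deg h
  rw [he] at hpq
  rcases hpq with ⟨rfl, rfl⟩ | ⟨rfl, rfl⟩
  · exact ⟨p, q, he⟩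
  · exact ⟨p, q, he.trans (Gph.pair_comm _ _)⟩

end BGen

/-! ### Composition with isomorphisms is bijective -/

/-- Composition with an isomorphism of the target, as a bijection. -/
noncomputable def UGen.postEquiv (r : ℤ) {v v' : Corolla T} (σ : Iso v v') :
    (Σ a : Corolla T, {γ : UGen a v // γ.g.deg = r}) ≃
      (Σ a : Corolla T, {γ : UGen a v' // γ.g.deg = r}) :=
  Equiv.sigmaCongrRight fun a =>
    { toFun γ := ⟨γ.1.post σ, (γ.1.post_deg σ).trans γ.2⟩
      invFun γ := ⟨γ.1.post σ.symm, (γ.1.post_deg σ.symm).trans γ.2⟩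
      left_inv γ := Subtype.ext (UGen.ext_g (by
        simp only [UGen.post]; rw [Gph.comp_assoc, σ.comp_symm_g, Gph.comp_one]))
      right_inv γ := Subtype.ext (UGen.ext_g (by
        simp only [UGen.post]; rw [Gph.comp_assoc, σ.symm_comp_g, Gph.comp_one])) }

/-- Composition with an isomorphism of the target, as a bijection. -/
noncomputable def BGen.postEquiv {v v' : Corolla T} (σ : Iso v v') :
    (Σ a b : Corolla T, Edge a b v) ≃ (Σ a b : Corolla T, Edge a b v') :=
  Equiv.sigmaCongrRight fun a => Equiv.sigmaCongrRight fun b =>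
    { toFun γ := ⟨γ.1.post σ, (γ.1.post_deg σ).trans γ.2⟩
      invFun γ := ⟨γ.1.post σ.symm, (γ.1.post_deg σ.symm).trans γ.2⟩
      left_inv γ := Subtype.ext (BGen.ext_g (by
        simp only [BGen.post]; rw [Gph.comp_assoc, σ.comp_symm_g, Gph.comp_one]))
      right_inv γ := Subtype.ext (BGen.ext_g (by
        simp only [BGen.post]; rw [Gph.comp_assoc, σ.symm_comp_g, Gph.comp_one])) }

/-! ### Finiteness -/

theorem Corolla.finite_le (N M : ℕ) : {a : Corolla T | a.n ≤ N ∧ a.genus ≤ M}.Finite := by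
  let f : {a : Corolla T // a.n ≤ N ∧ a.genus ≤ M} →
      (Σ n : Fin (N + 1), (Fin n → Bool) × Fin (M + 1)) := fun a =>
    ⟨⟨a.1.n, Nat.lt_succ_of_le a.2.1⟩, a.1.out, ⟨a.1.genus, Nat.lt_succ_of_le a.2.2⟩⟩
  refine Set.finite_coe_iff.1 (Finite.of_injective f ?_)
  rintro ⟨⟨n, o, g, _, _, _⟩, h⟩ ⟨⟨n', o', g', _, _, _⟩, h'⟩ hf
  simp only [f, Sigma.mk.injEq, Fin.mk.injEq] at hf
  obtain ⟨rfl, hf⟩ := hf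
  obtain ⟨rfl, hf⟩ := Prod.mk.injEq .. ▸ eq_of_heq hf
  obtain rfl := Fin.mk.inj hf
  rfl

theorem Gph.finite (X Y : Type) [Finite X] [Finite Y] : Finite (Gph X Y) :=
  Finite.of_injective (fun g => (g.j, g.E)) fun _ _ h =>
    Gph.ext (congrArg Prod.fst h) (congrArg Prod.snd h)

instance UGen.finite (a v : Corolla T) : Finite (UGen a v) :=
  have := Gph.finite (Fin a.n) (Fin v.n)
  Finite.of_injective UGen.g fun _ _ => UGen.ext_g

instance BGen.finite (a b v : Corolla T) : Finite (BGen a b v) :=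
  have := Gph.finite (Fin a.n ⊕ Fin b.n) (Fin v.n)
  Finite.of_injective BGen.g fun _ _ => BGen.ext_g

instance UGen.finite_sigma (p : ∀ a v : Corolla T, UGen a v → Prop) (v : Corolla T) :
    Finite (Σ a : Corolla T, {γ : UGen a v // p a v γ}) := by
  have := (Corolla.finite_le (T := T) (v.n + 2) v.genus).to_subtype
  refine Finite.of_injective (β := Σ a : {a : Corolla T | a.n ≤ v.n + 2 ∧ a.genus ≤ v.genus},
    {γ : UGen a.1 v // p a.1 v γ}) (fun γ => ⟨⟨γ.1, ?_, ?_⟩, γ.2⟩) ?_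
  · simpa using γ.2.1.isGraph.card_le γ.2.1.noEdge_or_oneEdge
  · rcases γ.2.1.shape with h | h <;> lia
  · rintro ⟨a, γ⟩ ⟨a', γ'⟩ h
    simp only [Sigma.mk.injEq, Subtype.mk.injEq] at h
    obtain ⟨rfl, h⟩ := h
    exact congrArg _ (eq_of_heq h)

/-- For properads the statement fails, since arbitrarily many parallel edges may be contracted at
once; this is why local finiteness is assumed there. -/
theorem BGen.finite_sigma (hT : T ≠ .properad) (v : Corolla T) :
    Finite (Σ a b : Corolla T, Edge a b v) := by
  have := (Corolla.finite_le (T := T) (v.n + 2) v.genus).to_subtype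
  have h1 : ∀ γ : (Σ a b : Corolla T, Edge a b v), γ.1.n + γ.2.1.n ≤ v.n + 2 := fun γ => by
    simpa using γ.2.2.1.isGraph.card_le (.inr (γ.2.2.1.oneEdge_of_deg γ.2.2.2 hT))
  refine Finite.of_injective (β := Σ a b : {a : Corolla T | a.n ≤ v.n + 2 ∧ a.genus ≤ v.genus},
    Edge a.1 b.1 v) (fun γ => ⟨⟨γ.1, ?_, ?_⟩, ⟨γ.2.1, ?_, ?_⟩, γ.2.2⟩) ?_
  · have := h1 γ; lia
  · have := γ.2.2.1.genus; lia
  · have := h1 γ; lia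
  · have := γ.2.2.1.genus; lia
  · rintro ⟨a, b, γ⟩ ⟨a', b', γ'⟩ h
    simp only [Sigma.mk.injEq, Subtype.mk.injEq] at h
    obtain ⟨rfl, h⟩ := h
    obtain ⟨h, h'⟩ := Sigma.mk.inj (eq_of_heq h)
    obtain rfl := Subtype.mk.inj h
    rw [eq_of_heq h']

theorem Op.totBin_support_finite {k : Type u} [Field k] (P : Op k T true)
    (hloc : T = .properad → P.LocallyFinite) (v : Corolla T) :
    {γ : Σ a b : Corolla T, Edge a b v | P.totBin γ.2.2.1 ≠ 0}.Finite := by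
  by_cases hT : T = .properad
  · refine Set.Finite.of_finite_image (f := fun γ => (⟨γ.1, γ.2.1, γ.2.2.1⟩ :
      Σ a b : Corolla T, BGen a b v)) ((hloc hT v).subset ?_) ?_
    · rintro _ ⟨⟨a, b, γ, hγ⟩, h, rfl⟩
      refine ⟨hγ, ?_⟩
      by_contra hn
      push Not at hn
      refine h (P.tot_hom_ext fun i x => P.tot_hom_ext fun j y => ?_)
      rw [P.totBin_inc γ rfl, hn i j _ rfl]
      simp
    · rintro ⟨a, b, γ, hγ⟩ - ⟨a', b', γ', hγ'⟩ - h
      simp only [Sigma.mk.injEq] at h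
      obtain ⟨rfl, h⟩ := h
      obtain ⟨rfl, h⟩ := Sigma.mk.inj (eq_of_heq h)
      obtain rfl := eq_of_heq h
      rfl
  · have := BGen.finite_sigma hT v
    exact Set.toFinite _

/-! ### Counting isomorphisms -/

/-- The corolla `e` with its flags relabelled. -/
def Corolla.relabel (e : Corolla T) (π : Equiv.Perm (Fin e.n)) : Corolla T where
  n := e.n
  out i := e.out (π i)
  genus := e.genus
  root hT := by
    obtain ⟨i, hi, hi'⟩ := e.root hT
    exact ⟨π.symm i, by simpa using hi, fun j hj => by rw [← hi' _ hj, Equiv.symm_apply_apply]⟩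
  undirected h i := e.undirected h _
  genus_zero := e.genus_zero

/-- The isomorphism onto the relabelled corolla. -/
def Corolla.relabelIso (e : Corolla T) (π : Equiv.Perm (Fin e.n)) : Iso e (e.relabel π) :=
  Iso.ofEquiv π (fun _ => rfl) rfl

/-- An isomorphism out of a corolla is a permutation of its flags, which also determines the target
because flags are numbered. There are therefore exactly n! of them, which is where the weights 1/n!
come from. -/
theorem Corolla.relabel_bijective (e : Corolla T) : Function.Bijective
    (fun π : Equiv.Perm (Fin e.n) => (⟨e.relabel π, e.relabelIso π⟩ : Σ e' : Corolla T, Iso e e')) := by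
  constructor
  · intro π π' h
    -- The targets of the two isomorphisms are not yet known to agree; passing to the list of values
    -- of the flag map removes the dependence on the target.
    have := congrArg (fun x : Σ e' : Corolla T, Iso e e' => List.ofFn x.2.1.g.j) h
    exact Equiv.ext (congrFun (List.ofFn_injective this))
  · have key : ∀ (o : Fin e.n → Bool) (r u z) (j : Fin e.n → Fin e.n)
        (E : Fin e.n → Fin e.n → Prop) (hG : (Gph.mk j E).IsGraph T e.out o) (hs) (hd),
        Function.Bijective j → (∀ p q, ¬ E p q) → ∃ π : Equiv.Perm (Fin e.n),
        (⟨e.relabel π, e.relabelIso π⟩ : Σ e' : Corolla T, Iso e e') =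
          ⟨⟨e.n, o, e.genus, r, u, z⟩, ⟨⟨⟨j, E⟩, hG, hs⟩, hd⟩⟩ := by
      intro o r u z j E hG hs hd hb hE
      obtain rfl : o = fun x => e.out (j x) := funext hG.out_j
      refine ⟨Equiv.ofBijective j hb, ?_⟩
      congr 1
      refine Subtype.ext (UGen.ext_g (Gph.ext rfl ?_))
      funext p q
      exact propext ⟨False.elim, fun h => hE _ _ h⟩
    rintro ⟨⟨n, o, g, r, u, z⟩, σ⟩
    have hn : n = e.n := by simpa using Fintype.card_congr σ.equiv
    subst hn
    have hg := σ.genus_eq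
    dsimp only at hg
    subst hg
    exact key o r u z σ.1.g.j σ.1.g.E σ.1.isGraph σ.1.shape σ.2 σ.bijective σ.noEdge

/-- A set of isomorphic factorizations has total weight `1`, each of them being weighted by the
inverse of the number of labellings of the flags of the intermediate corolla. -/
theorem finsum_torsor {k : Type u} [Field k] [CharZero k] {ι : Type*} (S : Set ι) (c : ι → k)
    (e : Corolla T) (Φ : (Σ e' : Corolla T, Iso e e') → ι) (hΦ : Function.Injective Φ)
    (hS : Set.range Φ = S) (hc : ∀ x, c (Φ x) = (e.n.factorial : k)⁻¹) :
    S.Finite ∧ ∑ᶠ y ∈ S, c y = 1 := by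
  have hinj := hΦ.comp e.relabel_bijective.1
  have hr : S = Set.range (Φ ∘ fun π : Equiv.Perm (Fin e.n) => ⟨e.relabel π, e.relabelIso π⟩) := by
    rw [e.relabel_bijective.2.range_comp, hS]
  refine ⟨hr ▸ Set.finite_range _, ?_⟩
  rw [hr, finsum_mem_range hinj, finsum_eq_sum_of_fintype]
  simp only [Function.comp_apply, hc, Finset.sum_const, Finset.card_univ, Fintype.card_perm,
    Fintype.card_fin, nsmul_eq_mul]
  exact mul_inv_cancel₀ (Nat.cast_ne_zero.2 (Nat.factorial_ne_zero _))

end FeynmanME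

namespace FeynmanME

/-! ### Sums over related factorizations -/

/-- If `R` relates the elements of `ι` and `ι'` in such a way that the weights of the elements
related to a given one add up to `1`, and if related elements have opposite values, then the weighted
sums over the elements which are related to something are opposite. -/
theorem finsum_eq_neg_of_rel {k V ι ι' : Type*} [Field k] [AddCommGroup V] [Module k V]
    (R : ι → ι' → Prop) (c : ι → k) (c' : ι' → k) (G : ι → V) (G' : ι' → V)
    (hG : ∀ x y, R x y → G x = -G' y)
    (hc : ∀ x, (∃ y, R x y) → {y | R x y}.Finite ∧ ∑ᶠ y ∈ {y | R x y}, c' y = 1)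
    (hc' : ∀ y, (∃ x, R x y) → {x | R x y}.Finite ∧ ∑ᶠ x ∈ {x | R x y}, c x = 1)
    (hf : G.support.Finite) (hf' : G'.support.Finite) :
    ∑ᶠ x ∈ {x | ∃ y, R x y}, c x • G x = -∑ᶠ y ∈ {y | ∃ x, R x y}, c' y • G' y := by
  classical
  -- If `G x` is non-zero then every `y` related to `x` lies in the support of `G'`, so restricting
  -- to the finite support loses none of the weight.
  have h₁ : ∀ x, (∃ y, R x y) → G x ≠ 0 →
      ∑ y ∈ hf'.toFinset, (if R x y then c' y else 0) = 1 := by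
    intro x hx h0
    rw [← Finset.sum_filter, ← (hc x hx).2]
    refine (finsum_mem_eq_sum_of_inter_support_eq _ ?_).symm
    ext y
    simp only [Set.mem_inter_iff, Finset.coe_filter, Set.Finite.mem_toFinset, Function.mem_support,
      Set.mem_setOf_eq]
    refine ⟨fun h => ⟨⟨fun h' => h0 (by rw [hG x y h.1, h', neg_zero]), h.1⟩, h.2⟩,
      fun h => ⟨h.1.2, h.2⟩⟩
  have h₂ : ∀ y, (∃ x, R x y) → G' y ≠ 0 →
      ∑ x ∈ hf.toFinset, (if R x y then c x else 0) = 1 := by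
    intro y hy h0
    rw [← Finset.sum_filter, ← (hc' y hy).2]
    refine (finsum_mem_eq_sum_of_inter_support_eq _ ?_).symm
    ext x
    simp only [Set.mem_inter_iff, Finset.coe_filter, Set.Finite.mem_toFinset, Function.mem_support,
      Set.mem_setOf_eq]
    refine ⟨fun h => ⟨⟨fun h' => h0 ?_, h.1⟩, h.2⟩, fun h => ⟨h.1.2, h.2⟩⟩
    rw [← neg_eq_zero, ← hG x y h.1, h']
  -- The value at `x` is spread over the related `y`, whose weights add up to one. Treating the
  -- other side in the same way yields the same double sum up to sign.
  have e₁ : ∑ᶠ x ∈ {x | ∃ y, R x y}, c x • G x =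
      ∑ x ∈ hf.toFinset, ∑ y ∈ hf'.toFinset, if R x y then (c x * c' y) • G x else 0 := by
    rw [finsum_mem_eq_sum_of_inter_support_eq (t := hf.toFinset.filter fun x => ∃ y, R x y),
      Finset.sum_filter]
    · refine Finset.sum_congr rfl fun x hx => ?_
      rw [Set.Finite.mem_toFinset] at hx
      split_ifs with h
      · conv_lhs => rw [← mul_one (c x), ← h₁ x h hx, Finset.mul_sum, Finset.sum_smul]
        refine Finset.sum_congr rfl fun y _ => ?_
        split_ifs <;> simp
      · exact (Finset.sum_eq_zero fun y _ => if_neg fun h' => h ⟨y, h'⟩).symm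
    · ext x
      simp only [Set.mem_inter_iff, Finset.coe_filter, Set.Finite.mem_toFinset,
        Function.mem_support, Set.mem_setOf_eq]
      exact ⟨fun h => ⟨⟨fun h' => h.2 (by rw [h', smul_zero]), h.1⟩, h.2⟩, fun h => ⟨h.1.2, h.2⟩⟩
  have e₂ : ∑ᶠ y ∈ {y | ∃ x, R x y}, c' y • G' y =
      ∑ y ∈ hf'.toFinset, ∑ x ∈ hf.toFinset, if R x y then (c x * c' y) • G' y else 0 := by
    rw [finsum_mem_eq_sum_of_inter_support_eq (t := hf'.toFinset.filter fun y => ∃ x, R x y),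
      Finset.sum_filter]
    · refine Finset.sum_congr rfl fun y hy => ?_
      rw [Set.Finite.mem_toFinset] at hy
      split_ifs with h
      · conv_lhs => rw [← one_mul (c' y), ← h₂ y h hy, Finset.sum_mul, Finset.sum_smul]
        refine Finset.sum_congr rfl fun x _ => ?_
        split_ifs <;> simp
      · exact (Finset.sum_eq_zero fun x _ => if_neg fun h' => h ⟨x, h'⟩).symm
    · ext y
      simp only [Set.mem_inter_iff, Finset.coe_filter, Set.Finite.mem_toFinset,
        Function.mem_support, Set.mem_setOf_eq]
      exact ⟨fun h => ⟨⟨fun h' => h.2 (by rw [h', smul_zero]), h.1⟩, h.2⟩, fun h => ⟨h.1.2, h.2⟩⟩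
  rw [e₁, e₂, Finset.sum_comm, ← Finset.sum_neg_distrib]
  refine Finset.sum_congr rfl fun y _ => ?_
  rw [← Finset.sum_neg_distrib]
  refine Finset.sum_congr rfl fun x _ => ?_
  split_ifs with h
  · rw [hG x y h, smul_neg]
  · rw [neg_zero]

theorem finsum_sigma_of_finite {V ι : Type*} {β : ι → Type*} [AddCommMonoid V]
    (f : (Σ i, β i) → V) (hf : f.support.Finite) :
    ∑ᶠ x, f x = ∑ᶠ i, ∑ᶠ j, f ⟨i, j⟩ := by
  classical
  have hfib : ∀ i, (Function.support fun j => f ⟨i, j⟩).Finite := fun i =>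
    (hf.preimage (sigma_mk_injective (i := i)).injOn).subset fun j hj => hj
  have hs : (Function.support fun i => ∑ᶠ j, f ⟨i, j⟩) ⊆ (hf.toFinset.image Sigma.fst : Finset ι) := by
    intro i hi
    obtain ⟨j, hj⟩ : ∃ j, f ⟨i, j⟩ ≠ 0 := by
      by_contra h
      push Not at h
      exact hi (finsum_eq_zero_of_forall_eq_zero h)
    exact Finset.mem_coe.2 (Finset.mem_image.2 ⟨⟨i, j⟩, by simpa using hj, rfl⟩)
  rw [finsum_eq_sum_of_support_subset _ hs]
  have : (hf.toFinset : Finset (Σ i, β i)) ⊆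
      (hf.toFinset.image Sigma.fst).sigma fun i => (hfib i).toFinset := by
    rintro ⟨i, j⟩ hx
    simp only [Finset.mem_sigma, Finset.mem_image, Set.Finite.mem_toFinset] at hx ⊢
    exact ⟨⟨_, hx, rfl⟩, hx⟩
  rw [finsum_eq_sum_of_support_subset f (s := (hf.toFinset.image Sigma.fst).sigma
    fun i => (hfib i).toFinset) (fun x hx => this (by simpa using hx)), Finset.sum_sigma]
  exact Finset.sum_congr rfl fun i _ => (finsum_eq_sum _ (hfib i)).symm

/-! ### Two-step factorizations -/

/-- A family of basic morphisms from fixed sources to a variable corolla. -/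
structure FirstStep (T : Kind) where
  X : Type
  oX : X → Bool
  F : Corolla T → Type
  g : ∀ {e : Corolla T}, F e → Gph X (Fin e.n)
  g_inj : ∀ {e : Corolla T} {f f' : F e}, g f = g f' → f = f'
  isGraph : ∀ {e : Corolla T} (f : F e), (g f).IsGraph T oX e.out
  genus : ∀ {e e' : Corolla T}, F e → F e' → e.genus = e'.genus
  post : ∀ {e e' : Corolla T}, F e → Iso e e' → F e'
  g_post : ∀ {e e' : Corolla T} (f : F e) (σ : Iso e e'), g (post f σ) = (g f).comp σ.1.g

/-- A family of basic morphisms from a variable corolla to a fixed corolla. -/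
structure SecondStep (T : Kind) (v : Corolla T) where
  ext : Type → Type
  S : Corolla T → Type
  tot : ∀ {X : Type} {e : Corolla T}, Gph X (Fin e.n) → S e → Gph (ext X) (Fin v.n)
  pre : ∀ {e e' : Corolla T}, Iso e e' → S e' → S e
  pre_symm_pre : ∀ {e e' : Corolla T} (σ : Iso e e') (s : S e'), pre σ.symm (pre σ s) = s
  tot_comp : ∀ {X : Type} {e e' : Corolla T} (g : Gph X (Fin e.n)) (σ : Iso e e') (s : S e'),
    tot (g.comp σ.1.g) s = tot g (pre σ s)
  cancel : ∀ {X : Type} {oX : X → Bool} {e : Corolla T} {g : Gph X (Fin e.n)},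
    g.IsGraph T oX e.out → ∀ {s s' : S e}, tot g s = tot g s' → s = s'

/-- A composable pair of basic morphisms. -/
abbrev TwoStep {T : Kind} {v : Corolla T} (F : FirstStep T) (S : SecondStep T v) : Type :=
  Σ e : Corolla T, F.F e × S.S e

namespace TwoStep

variable {T : Kind} {v : Corolla T} {F : FirstStep T} {S : SecondStep T v}

/-- The composite. -/
def tot (y : TwoStep F S) : Gph (S.ext F.X) (Fin v.n) := S.tot (F.g y.2.1) y.2.2

/-- The edges which are contracted in the first step. -/
def E (y : TwoStep F S) : F.X → F.X → Prop := (F.g y.2.1).E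

/-- The factorizations of a graph morphism with prescribed first edges have total weight `1`. -/
theorem finsum_weight {k : Type u} [Field k] [CharZero k] (y₀ : TwoStep F S) :
    {y : TwoStep F S | y.tot = y₀.tot ∧ y.E = y₀.E}.Finite ∧
      ∑ᶠ y ∈ {y : TwoStep F S | y.tot = y₀.tot ∧ y.E = y₀.E}, (y.1.n.factorial : k)⁻¹ = 1 := by
  obtain ⟨e₀, f₀, s₀⟩ := y₀
  -- All the factorizations in question arise from one of them by inserting an isomorphism of the
  -- intermediate corolla together with its inverse.
  refine finsum_torsor _ _ e₀ (fun x => ⟨x.1, F.post f₀ x.2, S.pre x.2.symm s₀⟩) ?_ ?_ ?_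
  · rintro ⟨e, σ⟩ ⟨e', σ'⟩ h
    simp only [Sigma.mk.injEq] at h
    obtain ⟨rfl, h⟩ := h
    have h := congrArg (F.g ∘ Prod.fst) (eq_of_heq h)
    simp only [Function.comp_apply, F.g_post] at h
    rw [Subtype.ext (UGen.ext_g ((F.isGraph f₀).comp_cancel h))]
  · ext ⟨e, f, s⟩
    constructor
    · rintro ⟨⟨e', σ⟩, h⟩
      simp only [Sigma.mk.injEq] at h
      obtain ⟨rfl, h⟩ := h
      obtain ⟨rfl, rfl⟩ := Prod.mk.injEq .. ▸ eq_of_heq h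
      refine ⟨?_, ?_⟩
      · simp only [tot, F.g_post, S.tot_comp]
        have := S.pre_symm_pre σ.symm s₀
        have hs : σ.symm.symm = σ := by
          refine Subtype.ext (UGen.ext_g (Gph.ext ?_ ?_))
          · funext y
            exact σ.symm.equiv.symm_apply_eq.2 (σ.equiv.symm_apply_apply y).symm
          · funext p q
            exact propext ⟨fun h => (σ.symm.symm.noEdge _ _ h).elim, fun h => (σ.noEdge _ _ h).elim⟩
        rw [hs] at this
        rw [this]
      · simp only [E, F.g_post]
        exact Gph.comp_E_of_noEdge_right _ σ.noEdge
    · rintro ⟨ht, hE⟩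
      -- The first step is determined by its edges up to an isomorphism of the intermediate corolla;
      -- once this isomorphism is fixed, cancellation determines the second step.
      obtain ⟨φ, hφ⟩ := (F.isGraph f₀).exists_equiv (F.isGraph f) hE.symm
      let σ : Iso e₀ e := Iso.ofEquiv φ (fun y => by
        rw [(F.isGraph f).out_j, hφ, ← (F.isGraph f₀).out_j]) (F.genus f f₀)
      have hg : F.g f = (F.g f₀).comp σ.1.g := by
        refine Gph.ext (funext hφ) ?_
        rw [Gph.comp_E_of_noEdge_right _ σ.noEdge]
        exact hE
      have hf : F.post f₀ σ = f := F.g_inj ((F.g_post _ _).trans hg.symm)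
      have hs : S.pre σ s = s₀ := 
        S.cancel (F.isGraph f₀) (by rw [← S.tot_comp, ← hg]; exact ht)
      exact ⟨⟨e, σ⟩, by simp only [← hs, hf, S.pre_symm_pre]⟩
  · rintro ⟨e, σ⟩
    have : e.n = e₀.n := by simpa using Fintype.card_congr σ.equiv
    simp only [this]

end TwoStep

section Steps

variable {T : Kind}

/-- Loop contractions as first steps. -/
abbrev FirstStep.loop (a : Corolla T) : FirstStep T where
  X := Fin a.n
  oX := a.out
  F := Loop a
  g γ := γ.1.g
  g_inj h := Subtype.ext (UGen.ext_g h)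
  isGraph γ := γ.1.isGraph
  genus γ γ' := by rw [γ.1.genus_of_deg γ.2, γ'.1.genus_of_deg γ'.2]
  post γ σ := ⟨γ.1.post σ, (γ.1.post_deg σ).trans γ.2⟩
  g_post _ _ := rfl

/-- Two-vertex contractions as first steps. -/
abbrev FirstStep.edge (a b : Corolla T) : FirstStep T where
  X := Fin a.n ⊕ Fin b.n
  oX := Sum.elim a.out b.out
  F := Edge a b
  g γ := γ.1.g
  g_inj h := Subtype.ext (BGen.ext_g h)
  isGraph γ := γ.1.isGraph
  genus γ γ' := by rw [γ.1.genus, γ'.1.genus]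
  post γ σ := ⟨γ.1.post σ, (γ.1.post_deg σ).trans γ.2⟩
  g_post _ _ := rfl

/-- Loop contractions as second steps. -/
noncomputable abbrev SecondStep.loop (v : Corolla T) : SecondStep T v where
  ext X := X
  S e := Loop e v
  tot g s := g.comp s.1.g
  pre σ s := ⟨UGen.pre σ s.1, (UGen.pre_deg σ s.1).trans s.2⟩
  pre_symm_pre σ s := Subtype.ext (UGen.ext_g (by
    simp only [UGen.pre]; rw [← Gph.comp_assoc, σ.symm_comp_g, Gph.one_comp]))
  tot_comp g σ s := Gph.comp_assoc _ _ _
  cancel hg _ _ h := Subtype.ext (UGen.ext_g (hg.comp_cancel h))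

/-- Two-vertex contractions as second steps. -/
noncomputable abbrev SecondStep.edge (b v : Corolla T) : SecondStep T v where
  ext X := X ⊕ Fin b.n
  S e := Edge e b v
  tot g s := (g.addRight _).comp s.1.g
  pre σ s := ⟨BGen.pre σ s.1, (BGen.pre_deg σ s.1).trans s.2⟩
  pre_symm_pre σ s := Subtype.ext (BGen.ext_g (by
    simp only [BGen.pre]
    rw [← Gph.comp_assoc, ← Gph.addRight_comp, σ.symm_comp_g, Gph.addRight_one, Gph.one_comp]))
  tot_comp g σ s := by rw [Gph.addRight_comp, Gph.comp_assoc]; rfl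
  cancel hg _ _ h := Subtype.ext (BGen.ext_g ((hg.addRight b.out).comp_cancel h))

end Steps

end FeynmanME

namespace FeynmanME

/-! ### Interchange of two contractions -/

namespace Gph

variable {X Y Z : Type}

theorem pair_eq_of_mem {x x' p q : X} (h : pair x x' p q) : pair p q = pair x x' := by
  rcases h with ⟨rfl, rfl⟩ | ⟨rfl, rfl⟩
  · rfl
  · exact pair_comm _ _

theorem pair_symm {x x' p q : X} (h : pair x x' p q) : pair x x' q p := by
  rcases h with ⟨rfl, rfl⟩ | ⟨rfl, rfl⟩
  · exact .inr ⟨rfl, rfl⟩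
  · exact .inl ⟨rfl, rfl⟩

theorem pair_map_iff {f : Y → X} (hf : Function.Injective f) {x x' p q : Y} :
    pair (f x) (f x') (f p) (f q) ↔ pair x x' p q := by
  simp only [pair, hf.eq_iff]

namespace IsGraph

variable {T : Kind} {oX : X → Bool} {oY : Y → Bool} {oZ : Z → Bool} {g : Gph X Y}

theorem comp_E_of_pair (g : Gph X Y) {g' : Gph Y Z} {w w' : Y} (h' : g'.E = pair w w') (s t : X) :
    (g.comp g').E s t ↔ g.E s t ∨ pair (g.j w) (g.j w') s t := by
  refine or_congr Iff.rfl ⟨?_, ?_⟩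
  · rintro ⟨y, z, h, rfl, rfl⟩
    rw [h'] at h
    rcases h with ⟨rfl, rfl⟩ | ⟨rfl, rfl⟩
    · exact pair_self _ _
    · exact .inr ⟨rfl, rfl⟩
  · rintro (⟨rfl, rfl⟩ | ⟨rfl, rfl⟩)
    · exact ⟨w, w', h' ▸ pair_self _ _, rfl, rfl⟩
    · exact ⟨w', w, h' ▸ .inr ⟨rfl, rfl⟩, rfl, rfl⟩

theorem residual (h : g.IsGraph T oX oY) {g' : Gph Y Z} {z z' : Y}
    (hE : ∀ s t, (g.comp g').E s t ↔ g.E s t ∨ pair (g.j z) (g.j z') s t) :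
    g'.E = pair z z' := by
  funext s t
  refine propext ?_
  rw [← h.comp_E_j, hE, pair_map_iff h.inj]
  exact or_iff_right (h.leg _ _)

theorem mem_range_of_pair_ne (h : g.IsGraph T oX oY) {G : Gph X Z} (hG : G.IsGraph T oX oZ)
    (hE : ∀ p q, g.E p q → G.E p q) {p p' : X} (hp : G.E p p') (hn : ¬ g.E p p') :
    p ∈ Set.range g.j :=
  h.mem_range_iff.2 fun x hx => hn (hG.unique hp (hE _ _ hx) ▸ hx)

end IsGraph

end Gph

open Gph

variable {T : Kind}

theorem Kind.hasLoops.ne_operad (h : T.hasLoops) : T ≠ .operad := by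
  rintro rfl; exact h

theorem Kind.hasLoops.ne_properad (h : T.hasLoops) : T ≠ .properad := by
  rintro rfl; exact h

theorem Kind.loopGenus_eq_zero (h : T ≠ .modular) : T.loopGenus = 0 := by
  cases T <;> first | rfl | exact (h rfl).elim

namespace TwoStep

variable {a b c v : Corolla T} {F : FirstStep T}

theorem tot_loop_E (hF : ∀ {e} (f : F.F e), ∃ p p', (F.g f).E = pair p p')
    (x : TwoStep F (.loop v)) :
    ∃ p p' q q' : F.X, x.E = pair p p' ∧ (∀ s t : F.X, x.tot.E s t ↔ pair p p' s t ∨ pair q q' s t) ∧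
      pair p p' ≠ pair q q' := by
  obtain ⟨e, f, s⟩ := x
  obtain ⟨p, p', hp⟩ := hF f
  obtain ⟨w, w', hw⟩ := s.1.isGraph.oneEdge (s.1.oneEdge_of_deg s.2)
  refine ⟨p, p', (F.g f).j w, (F.g f).j w', hp, fun s t => ?_, fun h => ?_⟩
  · rw [← hp]; exact IsGraph.comp_E_of_pair _ hw _ _
  · have := pair_self ((F.g f).j w) ((F.g f).j w')
    rw [← h, ← hp] at this
    exact (F.isGraph f).leg _ _ this

/-- A composite of two such steps contracts just two edges. A factorization whose first edge differs
from that of `x` must start with the other one, so these factorizations form a single torsor. -/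
theorem E_eq_of_tot_eq (hF : ∀ {e} (f : F.F e), ∃ p p', (F.g f).E = pair p p')
    {x y y' : TwoStep F (.loop v)} (h : x.tot = y.tot) (hn : x.E ≠ y.E) (h' : x.tot = y'.tot)
    (hn' : x.E ≠ y'.E) : y'.E = y.E := by
  obtain ⟨p, p', q, q', hx, hE, -⟩ := x.tot_loop_E hF
  have key : ∀ y : TwoStep F (.loop v), x.tot = y.tot → x.E ≠ y.E → y.E = pair q q' := by
    intro y h hn
    obtain ⟨r, r', _, _, hy, hEy, -⟩ := y.tot_loop_E hF
    rw [hy] at hn ⊢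
    rw [hx] at hn
    have := (hEy r r').2 (.inl (pair_self _ _))
    rw [← h, hE] at this
    rcases this with this | this
    · exact (hn (pair_eq_of_mem this).symm).elim
    · exact pair_eq_of_mem this
  rw [key y h hn, key y' h' hn']

theorem tot_isGraph_loop (x : TwoStep F (.loop v)) : x.tot.IsGraph T F.oX v.out :=
  (F.isGraph x.2.1).comp x.2.2.1.isGraph

theorem tot_isGraph_edge (x : TwoStep F (.edge b v)) :
    x.tot.IsGraph T (Sum.elim F.oX b.out) v.out :=
  ((F.isGraph x.2.1).addRight _).comp x.2.2.1.isGraph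

/-- A two-vertex contraction as second step only joins flags of different vertices, so every edge
inside the first block was contracted in the first step. -/
theorem tot_edge_E_inl (x : TwoStep F (.edge b v)) (s t : F.X) :
    x.tot.E (.inl s) (.inl t) ↔ x.E s t := by
  constructor
  · rintro (h | ⟨y, z, h, h₁, h₂⟩)
    · exact (addRight_E_inl _ _ _).1 h
    · have := x.2.2.1.isLeft_ne x.2.2.2 h
      rcases y with y | y <;> rcases z with z | z <;> simp [addRight] at h₁ h₂ this
  · exact fun h => .inl ((addRight_E_inl _ _ _).2 h)

theorem tot_edge_E_inr (x : TwoStep F (.edge b v)) (s t : Fin b.n) :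
    ¬ x.tot.E (.inr s) (.inr t) := by
  rintro (h | ⟨y, z, h, h₁, h₂⟩)
  · exact addRight_E_inr_left _ _ _ h
  · have := x.2.2.1.isLeft_ne x.2.2.2 h
    rcases y with y | y <;> rcases z with z | z <;> simp [addRight] at h₁ h₂ this

theorem tot_edge_E_inl_inr (x : TwoStep F (.edge b v)) (s : F.X) (t : Fin b.n) :
    x.tot.E (.inl s) (.inr t) ↔ ∃ w, x.2.2.1.g.E (.inl w) (.inr t) ∧ (F.g x.2.1).j w = s := by
  constructor
  · rintro (h | ⟨y, z, h, h₁, h₂⟩)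
    · exact (addRight_E_inr_right _ _ _ h).elim
    · rcases y with y | y <;> rcases z with z | z <;> simp [addRight] at h₁ h₂
      subst h₁ h₂
      exact ⟨y, h, rfl⟩
  · rintro ⟨w, h, rfl⟩
    exact .inr ⟨_, _, h, rfl, rfl⟩

theorem E_eq_of_tot_eq_edge {x y : TwoStep F (.edge b v)} (h : x.tot = y.tot) : x.E = y.E := by
  funext s t
  rw [← tot_edge_E_inl, h, tot_edge_E_inl]

theorem exists_pair_loop {e : Corolla T} (f : (FirstStep.loop a).F e) :
    ∃ p p', ((FirstStep.loop a).g f).E = pair p p' :=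
  f.1.isGraph.oneEdge (f.1.oneEdge_of_deg f.2)

theorem exists_pair_edge (hT : T ≠ .properad) {e : Corolla T} (f : (FirstStep.edge a b).F e) :
    ∃ p p', ((FirstStep.edge a b).g f).E = pair p p' :=
  f.1.isGraph.oneEdge (f.1.oneEdge_of_deg f.2 hT)

/-- The edge {q, q'} is contracted first; {p, p'} survives this step and becomes the loop of the
second one. The next two lemmas produce in the same way the factorizations that begin with a
prescribed edge between two vertices or with a loop at the first vertex. -/
theorem exists_loop_loop (hT : T.hasLoops) {G : Gph (Fin a.n) (Fin v.n)}
    (hG : G.IsGraph T a.out v.out) (hg : v.genus = a.genus + T.loopGenus + T.loopGenus)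
    {p p' q q' : Fin a.n} (hE : ∀ s t, G.E s t ↔ pair p p' s t ∨ pair q q' s t)
    (hne : pair p p' ≠ pair q q') :
    ∃ x : TwoStep (.loop a) (.loop v), x.tot = G ∧ x.E = pair q q' := by
  have hE' : ∀ s t, pair q q' s t → G.E s t := fun s t h => (hE s t).2 (.inr h)
  obtain ⟨n, g, hgr, hgE⟩ := hG.exists_contract (i := id) Function.injective_id hE'
    fun s t => pair_symm
  obtain ⟨g', hgr', rfl⟩ := hgr.exists_comp hG (by rwa [hgE])
  have hpp : (g.comp g').E p p' := (hE _ _).2 (.inl (pair_self _ _))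
  have hn : ¬ g.E p p' := fun h => hne (by rw [hgE] at h; exact pair_eq_of_mem h)
  obtain ⟨z, rfl⟩ := hgr.mem_range_of_pair_ne hG (by rwa [hgE]) hpp hn
  obtain ⟨z', rfl⟩ := hgr.mem_range_of_pair_ne hG (by rwa [hgE]) (hG.symm _ _ hpp)
    (fun h => hn (hgr.symm _ _ h))
  have h1 : g.OneEdge := oneEdge_of_eq_pair hgE
  have h1' : g'.OneEdge := oneEdge_of_eq_pair (hgr.residual fun s t => by rw [hE, hgE, or_comm])
  let e : Corolla T := ⟨n, fun y => a.out (g.j y), a.genus + T.loopGenus,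
    fun h => (hT.ne_operad h).elim, fun h y => a.undirected h _, fun h => by
      rw [a.genus_zero h, Kind.loopGenus_eq_zero h]⟩
  exact ⟨⟨e, ⟨⟨g, hgr, .inr ⟨hT, h1, rfl⟩⟩, (deg_eq_one_iff _).2 h1.not_noEdge⟩,
    ⟨⟨g', hgr', .inr ⟨hT, h1', hg⟩⟩, (deg_eq_one_iff _).2 h1'.not_noEdge⟩⟩, rfl, hgE⟩

theorem exists_edge_loop (hT : T.hasLoops) {G : Gph (Fin a.n ⊕ Fin b.n) (Fin v.n)}
    (hG : G.IsGraph T (Sum.elim a.out b.out) v.out)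
    (hg : v.genus = a.genus + b.genus + T.loopGenus)
    {p p' : Fin a.n ⊕ Fin b.n} {q : Fin a.n} {q' : Fin b.n}
    (hE : ∀ s t, G.E s t ↔ pair p p' s t ∨ pair (.inl q) (.inr q') s t)
    (hne : pair p p' ≠ pair (.inl q) (.inr q')) :
    ∃ x : TwoStep (.edge a b) (.loop v), x.tot = G ∧ x.E = pair (.inl q) (.inr q') := by
  have hE' : ∀ s t, pair (.inl q) (.inr q') s t → G.E s t := fun s t h => (hE s t).2 (.inr h)
  obtain ⟨n, g, hgr, hgE⟩ := hG.exists_contract (i := id) Function.injective_id hE'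
    fun s t => pair_symm
  obtain ⟨g', hgr', rfl⟩ := hgr.exists_comp hG (by rwa [hgE])
  have hpp : (g.comp g').E p p' := (hE _ _).2 (.inl (pair_self _ _))
  have hn : ¬ g.E p p' := fun h => hne (by rw [hgE] at h; exact pair_eq_of_mem h)
  obtain ⟨z, rfl⟩ := hgr.mem_range_of_pair_ne hG (by rwa [hgE]) hpp hn
  obtain ⟨z', rfl⟩ := hgr.mem_range_of_pair_ne hG (by rwa [hgE]) (hG.symm _ _ hpp)
    (fun h => hn (hgr.symm _ _ h))
  have h1 : g.OneEdge := oneEdge_of_eq_pair hgE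
  have h1' : g'.OneEdge := oneEdge_of_eq_pair (hgr.residual fun s t => by rw [hE, hgE, or_comm])
  let e : Corolla T := ⟨n, fun y => Sum.elim a.out b.out (g.j y), a.genus + b.genus,
    fun h => (hT.ne_operad h).elim, fun h y => by
      cases g.j y
      · exact a.undirected h _
      · exact b.undirected h _, fun h => by rw [a.genus_zero h, b.genus_zero h]⟩
  exact ⟨⟨e, ⟨⟨g, hgr, rfl, .inr (.inl ⟨hT.ne_properad, h1, q, q', hgE ▸ pair_self _ _⟩)⟩,
    (deg_eq_one_iff _).2 h1.not_noEdge⟩,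
    ⟨⟨g', hgr', .inr ⟨hT, h1', hg⟩⟩, (deg_eq_one_iff _).2 h1'.not_noEdge⟩⟩, rfl, hgE⟩

theorem exists_loop_edge (hT : T.hasLoops) {G : Gph (Fin a.n ⊕ Fin b.n) (Fin v.n)}
    (hG : G.IsGraph T (Sum.elim a.out b.out) v.out)
    (hg : v.genus = a.genus + b.genus + T.loopGenus) {p q q' : Fin a.n} {p' : Fin b.n}
    (hE : ∀ s t, G.E s t ↔ pair (.inl p) (.inr p') s t ∨ pair (.inl q) (.inl q') s t) :
    ∃ x : TwoStep (.loop a) (.edge b v), x.tot = G := by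
  have hE' : ∀ s t, pair q q' s t → G.E (.inl s) (.inl t) := fun s t h =>
    (hE _ _).2 (.inr ((pair_map_iff Sum.inl_injective).2 h))
  obtain ⟨n, g, hgr, hgE⟩ := hG.exists_contract Sum.inl_injective hE' fun s t => pair_symm
  have hgl := hgr.addRight b.out
  have hE'' : ∀ s t, (g.addRight (Fin b.n)).E s t → G.E s t := by
    rintro _ _ ⟨s, t, h, rfl, rfl⟩
    rw [hgE] at h
    exact hE' _ _ h
  obtain ⟨g', hgr', rfl⟩ := hgl.exists_comp hG hE''
  have hpp : ((g.addRight (Fin b.n)).comp g').E (.inl p) (.inr p') := (hE _ _).2 (.inl (pair_self _ _))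
  obtain ⟨z, hz⟩ := hgl.mem_range_of_pair_ne hG hE'' hpp (addRight_E_inr_right _ _ _)
  obtain ⟨z, rfl⟩ : ∃ y, z = .inl y := by
    rcases z with z | z
    · exact ⟨z, rfl⟩
    · simp [addRight] at hz
  have h1 : g.OneEdge := oneEdge_of_eq_pair hgE
  -- The residual edges are found by comparing the composite with what was contracted first; the
  -- only one left joins the survivor `z` of `p` to `p'`.
  have h2 : g'.E = pair (.inl z) (.inr p') := hgl.residual fun s t => by
    rw [hE, hz, or_comm]
    refine or_congr ?_ Iff.rfl
    rcases s with s | s <;> rcases t with t | t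
    · rw [pair_map_iff Sum.inl_injective, addRight_E_inl, hgE]
    all_goals simp [pair]
  have h1' : g'.OneEdge := oneEdge_of_eq_pair h2
  let e : Corolla T := ⟨n, fun y => a.out (g.j y), a.genus + T.loopGenus,
    fun h => (hT.ne_operad h).elim, fun h y => a.undirected h _, fun h => by
      rw [a.genus_zero h, Kind.loopGenus_eq_zero h]⟩
  exact ⟨⟨e, ⟨⟨g, hgr, .inr ⟨hT, h1, rfl⟩⟩, (deg_eq_one_iff _).2 h1.not_noEdge⟩,
    ⟨⟨g', hgr', by dsimp only [e]; lia,
      .inr (.inl ⟨hT.ne_properad, h1', z, p', h2 ▸ pair_self _ _⟩)⟩,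
      (deg_eq_one_iff _).2 h1'.not_noEdge⟩⟩, rfl⟩

/-- Interchange of the two sources of the first step. -/
def swap (x : TwoStep (.edge a b) (.loop v)) : TwoStep (.edge b a) (.loop v) :=
  ⟨x.1, ⟨x.2.1.1.swap, (x.2.1.1.swap_deg).trans x.2.1.2⟩, x.2.2⟩

theorem swap_tot (x : TwoStep (.edge a b) (.loop v)) :
    x.swap.tot = x.tot.reindex (Equiv.sumComm _ _) :=
  (reindex_comp _ _ _).symm

theorem swap_swap (x : TwoStep (.edge a b) (.loop v)) : x.swap.swap = x := by
  obtain ⟨e, ⟨f, hf⟩, s⟩ := x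
  simp only [swap, BGen.swap_swap]

theorem genus_edge_loop (x : TwoStep (.edge a b) (.loop v)) :
    v.genus = a.genus + b.genus + T.loopGenus := by
  rw [x.2.2.1.genus_of_deg x.2.2.2, x.2.1.1.genus]

theorem loop_loop_exists (x : TwoStep (.loop a) (.loop v)) :
    ∃ y : TwoStep (.loop a) (.loop v), x.tot = y.tot ∧ x.E ≠ y.E := by
  obtain ⟨p, p', q, q', hx, hE, hne⟩ := x.tot_loop_E exists_pair_loop
  obtain ⟨y, h, h'⟩ := exists_loop_loop (x.2.1.1.hasLoops_of_deg x.2.1.2) x.tot_isGraph_loop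
    (by rw [x.2.2.1.genus_of_deg x.2.2.2, x.2.1.1.genus_of_deg x.2.1.2]) hE hne
  exact ⟨y, h.symm, by rw [hx, h']; exact hne⟩

theorem edge_loop_E (x : TwoStep (.edge a b) (.loop v)) :
    ∃ (p : Fin a.n) (p' : Fin b.n) (q q' : Fin a.n ⊕ Fin b.n), x.E = pair (.inl p) (.inr p') ∧
      (∀ s t, x.tot.E s t ↔ pair (.inl p) (.inr p') s t ∨ pair q q' s t) ∧
      pair (.inl p) (.inr p') ≠ pair q q' := by
  have hT := (x.2.2.1.hasLoops_of_deg x.2.2.2).ne_properad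
  obtain ⟨p, p', q, q', hx, hE, hne⟩ := x.tot_loop_E (exists_pair_edge hT)
  obtain ⟨r, r', hr⟩ := x.2.1.1.exists_pair x.2.1.2 hT
  have : pair p p' = pair (.inl r) (.inr r') := hx.symm.trans hr
  rw [this] at hx hE hne
  exact ⟨r, r', q, q', hx, hE, hne⟩

theorem loop_edge_E (z : TwoStep (.loop a) (.edge b v)) :
    ∃ (p : Fin a.n) (p' : Fin b.n) (q q' : Fin a.n), z.E = pair q q' ∧
      (∀ s t, z.tot.E s t ↔ pair (.inl p) (.inr p') s t ∨ pair (.inl q) (.inl q') s t) := by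
  have hT := z.2.1.1.hasLoops_of_deg z.2.1.2
  obtain ⟨w, p', hw⟩ := z.2.2.1.exists_pair z.2.2.2 hT.ne_properad
  obtain ⟨q, q', hq⟩ := exists_pair_loop z.2.1
  refine ⟨z.2.1.1.g.j w, p', q, q', hq, fun s t => ?_⟩
  refine (IsGraph.comp_E_of_pair _ hw s t).trans (or_comm.trans (or_congr Iff.rfl ?_))
  rcases s with s | s <;> rcases t with t | t
  · rw [pair_map_iff Sum.inl_injective, addRight_E_inl, hq]
  all_goals simp [pair]

theorem exists_of_loop_edge (z : TwoStep (.loop a) (.edge b v)) :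
    ∃ x : TwoStep (.edge a b) (.loop v), x.tot = z.tot := by
  have hT := z.2.1.1.hasLoops_of_deg z.2.1.2
  obtain ⟨p, p', q, q', -, hE⟩ := z.loop_edge_E
  obtain ⟨x, hx, -⟩ := exists_edge_loop hT z.tot_isGraph_edge
    (by rw [z.2.2.1.genus, z.2.1.1.genus_of_deg z.2.1.2]; lia) (fun s t => (hE s t).trans or_comm)
    (fun h => by
      have := pair_self (Sum.inl q : Fin a.n ⊕ Fin b.n) (.inl q')
      rw [h] at this
      simp [pair] at this)
  exact ⟨x, hx⟩

/-- Of the two edges of such a composite only one joins the two vertices, so an edge-first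
factorization has no choice in its first edge. -/
theorem edge_loop_E_eq {x x' : TwoStep (.edge a b) (.loop v)} {z : TwoStep (.loop a) (.edge b v)}
    (h : x.tot = z.tot) (h' : x'.tot = z.tot) : x'.E = x.E := by
  obtain ⟨p, p', q, q', -, hE⟩ := z.loop_edge_E
  have key : ∀ x : TwoStep (.edge a b) (.loop v), x.tot = z.tot →
      x.E = pair (.inl p) (.inr p') := by
    intro x h
    obtain ⟨r, r', _, _, hr, hrE, -⟩ := x.edge_loop_E
    have := (hrE _ _).2 (.inl (pair_self _ _))
    rw [h, hE] at this
    rcases this with this | this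
    · rw [hr, pair_eq_of_mem this]
    · simp [pair] at this
  rw [key x h, key x' h']

/-- After the contraction of an edge, the contraction of a loop is of exactly one of three types:
the loop comes from a second edge, from a loop at the first vertex or from one at the second. -/
theorem edge_loop_trichotomy (x : TwoStep (.edge a b) (.loop v)) :
    ((∃ y : TwoStep (.edge a b) (.loop v), x.tot = y.tot ∧ x.E ≠ y.E) ∧
      (¬ ∃ z : TwoStep (.loop a) (.edge b v), x.tot = z.tot) ∧
      ¬ ∃ z : TwoStep (.loop b) (.edge a v), x.swap.tot = z.tot) ∨
    ((¬ ∃ y : TwoStep (.edge a b) (.loop v), x.tot = y.tot ∧ x.E ≠ y.E) ∧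
      (∃ z : TwoStep (.loop a) (.edge b v), x.tot = z.tot) ∧
      ¬ ∃ z : TwoStep (.loop b) (.edge a v), x.swap.tot = z.tot) ∨
    ((¬ ∃ y : TwoStep (.edge a b) (.loop v), x.tot = y.tot ∧ x.E ≠ y.E) ∧
      (¬ ∃ z : TwoStep (.loop a) (.edge b v), x.tot = z.tot) ∧
      ∃ z : TwoStep (.loop b) (.edge a v), x.swap.tot = z.tot) := by
  have hT := x.2.2.1.hasLoops_of_deg x.2.2.2
  obtain ⟨p, p', q, q', hx, hE, hne⟩ := x.edge_loop_E
  have h₁ : (∃ y : TwoStep (.edge a b) (.loop v), x.tot = y.tot ∧ x.E ≠ y.E) →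
      q.isLeft ≠ q'.isLeft := by
    rintro ⟨y, h, hn⟩
    obtain ⟨r, r', _, _, hr, hrE, -⟩ := y.edge_loop_E
    have := (hrE _ _).2 (.inl (pair_self _ _))
    rw [← h, hE] at this
    rcases this with this | this
    · exact (hn (by rw [hx, hr, pair_eq_of_mem this])).elim
    · rcases this with ⟨rfl, rfl⟩ | ⟨rfl, rfl⟩ <;> simp
  have h₂ : (∃ z : TwoStep (.loop a) (.edge b v), x.tot = z.tot) →
      q.isLeft = true ∧ q'.isLeft = true := by
    rintro ⟨z, h⟩
    obtain ⟨_, _, r, r', -, hrE⟩ := z.loop_edge_E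
    have := (hrE _ _).2 (.inr (pair_self _ _))
    rw [← h, hE] at this
    rcases this with this | this
    · simp [pair] at this
    · rcases this with ⟨rfl, rfl⟩ | ⟨rfl, rfl⟩ <;> simp
  have h₃ : (∃ z : TwoStep (.loop b) (.edge a v), x.swap.tot = z.tot) →
      q.isLeft = false ∧ q'.isLeft = false := by
    rintro ⟨z, h⟩
    obtain ⟨_, _, r, r', -, hrE⟩ := z.loop_edge_E
    have := (hrE _ _).2 (.inr (pair_self _ _))
    rw [← h, swap_tot] at this
    have this := (hE (.inr r) (.inr r')).1 this
    rcases this with this | this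
    · simp [pair] at this
    · rcases this with ⟨rfl, rfl⟩ | ⟨rfl, rfl⟩ <;> simp
  -- The second edge {q, q'} decides: it joins the two vertices, or lies at the first, or lies at
  -- the second. By `h₁`, `h₂`, `h₃` each position excludes the other alternatives.
  rcases q with q | q <;> rcases q' with q' | q'
  · refine .inr (.inl ⟨fun h => h₁ h rfl, ?_, fun h => by simpa using (h₃ h).1⟩)
    obtain ⟨z, hz⟩ := exists_loop_edge hT x.tot_isGraph_loop x.genus_edge_loop hE
    exact ⟨z, hz.symm⟩
  · refine .inl ⟨?_, fun h => by simpa using (h₂ h).2, fun h => by simpa using (h₃ h).1⟩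
    obtain ⟨y, hy, hyE⟩ := exists_edge_loop hT x.tot_isGraph_loop x.genus_edge_loop hE hne
    exact ⟨y, hy.symm, by rw [hx, hyE]; exact hne⟩
  · refine .inl ⟨?_, fun h => by simpa using (h₂ h).1, fun h => by simpa using (h₃ h).2⟩
    have hq := pair_comm (Sum.inr q : Fin a.n ⊕ Fin b.n) (.inl q')
    rw [hq] at hne
    simp only [hq] at hE
    obtain ⟨y, hy, hyE⟩ := exists_edge_loop hT x.tot_isGraph_loop x.genus_edge_loop hE hne
    exact ⟨y, hy.symm, by rw [hx, hyE]; exact hne⟩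
  · refine .inr (.inr ⟨fun h => h₁ h rfl, fun h => by simpa using (h₂ h).1, ?_⟩)
    obtain ⟨z, hz⟩ := exists_loop_edge (a := b) (b := a) (p := p') (p' := p) (q := q) (q' := q') hT
      x.swap.tot_isGraph_loop x.swap.genus_edge_loop fun s t => by
        rw [swap_tot, pair_comm]
        refine (hE _ _).trans ?_
        rcases s with s | s <;> rcases t with t | t <;> simp [pair]
    exact ⟨z, hz.symm⟩

end TwoStep

end FeynmanME

namespace FeynmanME

/-! ### Interchange of two two-vertex contractions -/

open Gph

variable {T : Kind}

theorem _root_.Bool.eq_of_ne_of_ne {x y z : Bool} (h : x ≠ z) (h' : y ≠ z) : x = y := by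
  revert x y z; decide

/-- The relation `R` is that of being joined by an edge in a two-vertex contraction. -/
structure Joins {X Y : Type} (T : Kind) (oX : X → Bool) (R : X → Y → Prop) : Prop where
  ex : ∃ x y, R x y
  const : T = .properad → ∀ {x y x' y'}, R x y → R x' y' → oX x = oX x'
  uniq : T ≠ .properad → ∀ {x y x' y'}, R x y → R x' y' → x = x' ∧ y = y'

theorem Joins.congr {X Y X' Y' : Type} {oX : X → Bool} {oX' : X' → Bool} {R : X → Y → Prop}
    {R' : X' → Y' → Prop} (h : Joins T oX R) (f : X' → X) (hf : Function.Injective f) (i : Y' → Y)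
    (hi : Function.Injective i) (ho : ∀ x, oX' x = oX (f x)) (hR : ∀ x y, R' x y ↔ R (f x) (i y))
    (hex : ∃ x y, R' x y) : Joins T oX' R' where
  ex := hex
  const hT _ _ _ _ h₁ h₂ := by rw [ho, ho]; exact h.const hT ((hR _ _).1 h₁) ((hR _ _).1 h₂)
  uniq hT _ _ _ _ h₁ h₂ := by
    have := h.uniq hT ((hR _ _).1 h₁) ((hR _ _).1 h₂)
    exact ⟨hf this.1, hi this.2⟩

theorem Kind.directed_of_eq_properad (h : T = .properad) : T.directed := by subst h; trivial

theorem Kind.directed_of_eq_operad (h : T = .operad) : T.directed := by subst h; trivial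

variable {a b c v e : Corolla T}

theorem BGen.joins (γ : BGen a b v) (h : γ.g.deg = 1) :
    Joins T a.out fun p q => γ.g.E (.inl p) (.inr q) where
  ex := γ.edge_of_deg h
  const _ _ _ _ _ := γ.out_const h
  uniq hT x y x' y' h₁ h₂ := by
    obtain ⟨p, q, hE⟩ := γ.exists_pair h hT
    rw [hE] at h₁ h₂
    simp [pair] at h₁ h₂
    exact ⟨h₁.1.trans h₂.1.symm, h₁.2.trans h₂.2.symm⟩

/-- Recognition of two-vertex contractions. -/
theorem Joins.exists_edge {g : Gph (Fin a.n ⊕ Fin b.n) (Fin v.n)}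
    (hg : g.IsGraph T (Sum.elim a.out b.out) v.out) (hgen : v.genus = a.genus + b.genus)
    (hJ : Joins T a.out fun p q => g.E (.inl p) (.inr q))
    (hcr : ∀ x x', g.E x x' → x.isLeft ≠ x'.isLeft) : ∃ γ : Edge a b v, γ.1.g = g := by
  obtain ⟨p, q, hpq⟩ := hJ.ex
  refine ⟨⟨⟨g, hg, hgen, ?_⟩, (deg_eq_one_iff _).2 fun h => h _ _ hpq⟩, rfl⟩
  by_cases hT : T = .properad
  · exact .inr (.inr ⟨hT, ⟨p, q, hpq⟩, hcr, a.out p, fun p' q' h => hJ.const hT h hpq⟩)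
  · refine .inr (.inl ⟨hT, ⟨.inl p, .inr q, hpq, fun x x' hx => ?_⟩, p, q, hpq⟩)
    have := hcr _ _ hx
    rcases x with x | x <;> rcases x' with x' | x'
    · simp at this
    · obtain ⟨rfl, rfl⟩ := hJ.uniq hT hx hpq
      exact .inl ⟨rfl, rfl⟩
    · obtain ⟨rfl, rfl⟩ := hJ.uniq hT (hg.symm _ _ hx) hpq
      exact .inr ⟨rfl, rfl⟩
    · simp at this

/-- The contraction of an edge joining two operadic corollas gives an operadic corolla. -/
theorem Gph.IsGraph.existsUnique_out {n : ℕ} {g : Gph (Fin a.n ⊕ Fin b.n) (Fin n)}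
    (hT : T = .operad)
    (hg : g.IsGraph T (Sum.elim a.out b.out) fun y => Sum.elim a.out b.out (g.j y))
    (hJ : Joins T a.out fun p q => g.E (.inl p) (.inr q))
    (hcr : ∀ x x', g.E x x' → x.isLeft ≠ x'.isLeft) :
    ∃! y, Sum.elim a.out b.out (g.j y) = true := by
  have hT' : T ≠ .properad := by rw [hT]; simp
  obtain ⟨ra, ha, hua⟩ := a.root hT
  obtain ⟨rb, hb, hub⟩ := b.root hT
  obtain ⟨p, q, hpq⟩ := hJ.ex
  have hop := hg.opposite (Kind.directed_of_eq_operad hT) _ _ hpq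
  simp only [Sum.elim_inl, Sum.elim_inr] at hop
  -- One of the two roots lies on the contracted edge and the other one does not; the latter is the
  -- only surviving output.
  have key : ∀ r r' : Fin a.n ⊕ Fin b.n, (∀ x, Sum.elim a.out b.out x = true → x = r ∨ x = r') →
      Sum.elim a.out b.out r' = true → (∃ x, g.E r x) → (∀ x, ¬ g.E r' x) →
      ∃! y, Sum.elim a.out b.out (g.j y) = true := by
    rintro r r' hu h' ⟨x, hr⟩ hr'
    obtain ⟨y, rfl⟩ := hg.mem_range_iff.2 hr'
    refine ⟨y, h', fun z hz => hg.inj ((hu _ hz).resolve_left (hg.ne_left hr z))⟩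
  have hroots : ∀ x, Sum.elim a.out b.out x = true → x = .inl ra ∨ x = .inr rb := by
    rintro (x | x) hx
    · exact .inl (congrArg _ (hua _ hx))
    · exact .inr (congrArg _ (hub _ hx))
  cases hp : a.out p
  · have hq : b.out q = true := by rw [hp] at hop; simpa using hop.symm
    obtain rfl := hub _ hq
    refine key (.inr q) (.inl ra) (fun x hx => (hroots x hx).symm) ha ⟨_, hg.symm _ _ hpq⟩ ?_
    rintro (x | x) hx
    · exact hcr _ _ hx rfl
    · obtain ⟨rfl, rfl⟩ := hJ.uniq hT' hx hpq
      rw [hp] at ha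
      exact Bool.noConfusion ha
  · obtain rfl := hua _ hp
    refine key (.inl p) (.inr rb) hroots hb ⟨_, hpq⟩ ?_
    rintro (x | x) hx
    · obtain ⟨rfl, rfl⟩ := hJ.uniq hT' (hg.symm _ _ hx) hpq
      exact hop (hp.trans hb.symm)
    · exact hcr _ _ hx rfl

/-- Exchange of the first and the third of three blocks of flags. -/
def exchange (X Y Z : Type) : (X ⊕ Y) ⊕ Z ≃ (Z ⊕ Y) ⊕ X where
  toFun := Sum.elim (Sum.elim .inr fun y => .inl (.inr y)) fun z => .inl (.inl z)
  invFun := Sum.elim (Sum.elim .inr fun y => .inl (.inr y)) fun z => .inl (.inl z)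
  left_inv := by rintro ((x | x) | x) <;> rfl
  right_inv := by rintro ((x | x) | x) <;> rfl

theorem exchange_exchange {X Y Z W : Type} (g : Gph ((X ⊕ Y) ⊕ Z) W) :
    (g.reindex (exchange X Y Z)).reindex (exchange Z Y X) = g := by
  rw [reindex_reindex]
  have : (exchange X Y Z).trans (exchange Z Y X) = Equiv.refl _ :=
    Equiv.ext (by rintro ((x | x) | x) <;> rfl)
  rw [this, reindex_refl]

namespace TwoStep

/-- The graph morphisms that are obtained by contracting first the edges between the first two of
three vertices and then the remaining ones. -/
structure IsEdgeEdge (G : Gph ((Fin a.n ⊕ Fin b.n) ⊕ Fin c.n) (Fin v.n)) : Prop where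
  isGraph : G.IsGraph T (Sum.elim (Sum.elim a.out b.out) c.out) v.out
  genus : v.genus = a.genus + b.genus + c.genus
  cross : ∀ s t, G.E (.inl s) (.inl t) → s.isLeft ≠ t.isLeft
  cross' : ∀ s t, ¬ G.E (.inr s) (.inr t)
  joins : Joins T a.out fun p q => G.E (.inl (.inl p)) (.inl (.inr q))
  joins' : Joins T (Sum.elim a.out b.out) fun p q => G.E (.inl p) (.inr q)

theorem isEdgeEdge (x : TwoStep (.edge a b) (.edge c v)) : IsEdgeEdge x.tot where
  isGraph := x.tot_isGraph_edge
  genus := by rw [x.2.2.1.genus, x.2.1.1.genus]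
  cross s t h := x.2.1.1.isLeft_ne x.2.1.2 ((x.tot_edge_E_inl _ _).1 h)
  cross' := x.tot_edge_E_inr
  joins := (congrArg (Joins T a.out) (funext fun p => funext fun q =>
    propext (x.tot_edge_E_inl (.inl p) (.inr q)))).mpr (x.2.1.1.joins x.2.1.2)
  joins' := by
    have hJ := x.2.2.1.joins x.2.2.2
    have ho : ∀ w, Sum.elim a.out b.out (x.2.1.1.g.j w) = x.1.out w :=
      fun w => (x.2.1.1.isGraph.out_j _).symm
    refine ⟨?_, fun hT s t s' t' h h' => ?_, fun hT s t s' t' h h' => ?_⟩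
    · obtain ⟨w, t, h⟩ := hJ.ex
      exact ⟨_, t, (x.tot_edge_E_inl_inr _ _).2 ⟨w, h, rfl⟩⟩
    · obtain ⟨w, h₁, rfl⟩ := (x.tot_edge_E_inl_inr _ _).1 h
      obtain ⟨w', h₁', rfl⟩ := (x.tot_edge_E_inl_inr _ _).1 h'
      exact (ho _).trans ((hJ.const hT h₁ h₁').trans (ho _).symm)
    · obtain ⟨w, h₁, rfl⟩ := (x.tot_edge_E_inl_inr _ _).1 h
      obtain ⟨w', h₁', rfl⟩ := (x.tot_edge_E_inl_inr _ _).1 h'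
      obtain ⟨rfl, rfl⟩ := hJ.uniq hT h₁ h₁'
      exact ⟨rfl, rfl⟩

/-- The intermediate corolla results from contracting all edges inside the first two blocks. The two
`Joins` conditions say that this step and the residual one are legal two-vertex contractions of the
given kind. -/
theorem IsEdgeEdge.exists_tot_eq {G : Gph ((Fin a.n ⊕ Fin b.n) ⊕ Fin c.n) (Fin v.n)}
    (hG : IsEdgeEdge G) : ∃ x : TwoStep (.edge a b) (.edge c v), x.tot = G := by
  obtain ⟨n, g, hg, hgE⟩ := hG.isGraph.exists_contract Sum.inl_injective
    (E := fun s t => G.E (.inl s) (.inl t)) (fun _ _ h => h) fun s t h => hG.isGraph.symm _ _ h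
  simp only [Sum.elim_inl] at hg
  change g.IsGraph T (Sum.elim a.out b.out) fun y => Sum.elim a.out b.out (g.j y) at hg
  have hgl := hg.addRight c.out
  have hle : ∀ s t, (g.addRight (Fin c.n)).E s t → G.E s t := by
    rintro _ _ ⟨s, t, h, rfl, rfl⟩
    rwa [hgE] at h
  obtain ⟨g', hg', hG'⟩ := hgl.exists_comp hG.isGraph hle
  have hJ : Joins T a.out fun p q => g.E (.inl p) (.inr q) := by
    rw [hgE]; exact hG.joins
  have hcr : ∀ x x', g.E x x' → x.isLeft ≠ x'.isLeft := by
    rw [hgE]; exact hG.cross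
  let e : Corolla T := ⟨n, fun y => Sum.elim a.out b.out (g.j y), a.genus + b.genus,
    fun hT => hg.existsUnique_out hT hJ hcr, fun h y => by
      cases g.j y
      · exact a.undirected h _
      · exact b.undirected h _, fun h => by rw [a.genus_zero h, b.genus_zero h]⟩
  obtain ⟨γ, hγ⟩ := Joins.exists_edge (v := e) hg rfl hJ hcr
  have hE' : ∀ y z, g'.E y z ↔ G.E (Sum.map g.j id y) (Sum.map g.j id z) := fun y z => by
    rw [← hG']; exact hgl.comp_E_j.symm
  obtain ⟨γ', hγ'⟩ := Joins.exists_edge (a := e) (b := c) (v := v) (g := g') hg'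
    (by rw [hG.genus]) (hG.joins'.congr g.j hg.inj id Function.injective_id (fun _ => rfl)
      (fun x y => hE' _ _) (by
        obtain ⟨s, t, hst⟩ := hG.joins'.ex
        obtain ⟨y, hy⟩ := hgl.mem_range_of_pair_ne hG.isGraph hle hst (addRight_E_inr_right _ _ _)
        obtain ⟨y, rfl⟩ : ∃ w, y = .inl w := by
          rcases y with y | y
          · exact ⟨y, rfl⟩
          · simp [addRight] at hy
        refine ⟨y, t, (hE' _ _).2 ?_⟩
        have : g.j y = s := by simpa [addRight] using hy
        simpa [this] using hst)) (by
      rintro (y | y) (z | z) h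
      · have h := (hE' _ _).1 h
        have : g.E (g.j y) (g.j z) := by rw [hgE]; exact h
        exact (hg.leg _ _ this).elim
      · simp
      · simp
      · exact (hG.cross' _ _ ((hE' _ _).1 h)).elim)
  refine ⟨⟨e, γ, γ'⟩, ?_⟩
  change (γ.1.g.addRight _).comp γ'.1.g = G
  rw [hγ, hγ', hG']

/-- Criterion for the edges between the second and the third vertex to be contractible first. -/
theorem exists_exchange_iff (x : TwoStep (.edge a b) (.edge c v)) :
    (∃ y : TwoStep (.edge c b) (.edge a v), x.tot.reindex (exchange _ _ _) = y.tot) ↔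
      (∃ q t, x.tot.E (.inl (.inr q)) (.inr t)) ∧ (T = .properad → ∀ p q p' t,
        x.tot.E (.inl (.inl p)) (.inl (.inr q)) → x.tot.E (.inl (.inl p')) (.inr t) →
        a.out p = a.out p') := by
  have hx := x.isEdgeEdge
  have hsymm := hx.isGraph.symm
  constructor
  · rintro ⟨y, h⟩
    have hy := y.isEdgeEdge
    rw [← h] at hy
    refine ⟨?_, fun hT p q p' t h₁ h₂ => ?_⟩
    · obtain ⟨t, q, h⟩ := hy.joins.ex
      exact ⟨q, t, hsymm _ _ h⟩
    · have hd := hx.isGraph.opposite (Kind.directed_of_eq_properad hT)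
      have h₃ := hd _ _ h₁
      have h₄ := hd _ _ h₂
      have := hy.joins'.const hT (x := .inr q) (y := p) (x' := .inl t) (y' := p') (hsymm _ _ h₁)
        (hsymm _ _ h₂)
      simp only [Sum.elim_inl, Sum.elim_inr] at h₃ h₄ this
      exact Bool.eq_of_ne_of_ne h₃ (this ▸ h₄)
  · rintro ⟨⟨q₀, t₀, h₀⟩, hC⟩
    -- Outside properads a single edge joins the third vertex to the first two. Here it ends at the
    -- second vertex, so none ends at the first.
    have hno : T ≠ .properad → ∀ p t, ¬ x.tot.E (.inl (.inl p)) (.inr t) := fun hT p t h => by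
      simpa using (hx.joins'.uniq hT h h₀).1
    have : IsEdgeEdge (x.tot.reindex (exchange _ _ _)) := by
      refine ⟨hx.isGraph.reindex _ (by rintro ((s | s) | s) <;> rfl), by rw [hx.genus]; lia,
        ?_, ?_, ⟨⟨t₀, q₀, hsymm _ _ h₀⟩, fun hT t q t' q' h h' => ?_, fun hT t q t' q' h h' => ?_⟩,
        ⟨?_, fun hT s p s' p' h h' => ?_, fun hT s p s' p' h h' => ?_⟩⟩
      · rintro (s | s) (t | t) h
        · exact (hx.cross' _ _ h).elim
        · simp
        · simp
        · exact (hx.cross (.inr s) (.inr t) h rfl).elim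
      · exact fun s t h => hx.cross (.inl s) (.inl t) h rfl
      · have h := hsymm _ _ h
        have h' := hsymm _ _ h'
        have hd := hx.isGraph.opposite (Kind.directed_of_eq_properad hT)
        have h₃ := hd _ _ h
        have h₄ := hd _ _ h'
        have := hx.joins'.const hT (x := .inr q) (y := t) (x' := .inr q') (y' := t') h h'
        change b.out q ≠ c.out t at h₃
        change b.out q' ≠ c.out t' at h₄
        change b.out q = b.out q' at this
        exact Bool.eq_of_ne_of_ne h₃.symm (this ▸ h₄.symm)
      · have := hx.joins'.uniq hT (x := .inr q) (y := t) (x' := .inr q') (y' := t')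
          (hsymm _ _ h) (hsymm _ _ h')
        exact ⟨this.2, by simpa using this.1⟩
      · obtain ⟨p, q, h⟩ := hx.joins.ex
        exact ⟨.inr q, p, hsymm _ _ h⟩
      · have hd := hx.isGraph.opposite (Kind.directed_of_eq_properad hT)
        -- After the second and third vertices are merged, all their edges to the first must point
        -- the same way. Edges coming from the same vertex do so already, and `hC` compares the two
        -- groups.
        have key : ∀ s p s' p', (x.tot.reindex (exchange _ _ _)).E (.inl s) (.inr p) →
            (x.tot.reindex (exchange _ _ _)).E (.inl s') (.inr p') → a.out p = a.out p' := by
          rintro (s | s) p (s' | s') p' h h'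
          · exact hx.joins'.const hT (x := .inl p) (y := s) (x' := .inl p') (y' := s')
              (hsymm _ _ h) (hsymm _ _ h')
          · exact (hC hT _ _ _ _ (hsymm _ _ h') (hsymm _ _ h)).symm
          · exact hC hT _ _ _ _ (hsymm _ _ h) (hsymm _ _ h')
          · exact hx.joins.const hT (hsymm _ _ h) (hsymm _ _ h')
        have hk := key _ _ _ _ h h'
        have hop : ∀ s p, (x.tot.reindex (exchange _ _ _)).E (.inl s) (.inr p) →
            Sum.elim c.out b.out s ≠ a.out p := by
          rintro (s | s) p h
          · exact hd _ _ h
          · exact hd _ _ h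
        have h₃ := hop _ _ h
        have h₄ := hop _ _ h'
        exact Bool.eq_of_ne_of_ne h₃ (hk ▸ h₄)
      · rcases s with s | s
        · exact (hno hT _ _ (hsymm _ _ h)).elim
        rcases s' with s' | s'
        · exact (hno hT _ _ (hsymm _ _ h')).elim
        have := hx.joins.uniq hT (hsymm _ _ h) (hsymm _ _ h')
        exact ⟨congrArg _ this.2, this.1⟩
    obtain ⟨y, hy⟩ := this.exists_tot_eq
    exact ⟨y, hy.symm⟩

/-- Interchange of the two sources of the first step. -/
def swapFirst (x : TwoStep (.edge a b) (.edge c v)) : TwoStep (.edge b a) (.edge c v) :=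
  ⟨x.1, ⟨x.2.1.1.swap, (x.2.1.1.swap_deg).trans x.2.1.2⟩, x.2.2⟩

theorem swapFirst_swapFirst (x : TwoStep (.edge a b) (.edge c v)) :
    x.swapFirst.swapFirst = x := by
  obtain ⟨e, ⟨f, hf⟩, s⟩ := x
  simp only [swapFirst, BGen.swap_swap]

end TwoStep

theorem Gph.addRight_reindex {X X' Y : Type} (g : Gph X Y) (e : X ≃ X') (Z : Type) :
    (g.reindex e).addRight Z = (g.addRight Z).reindex (Equiv.sumCongr e (Equiv.refl Z)) := by
  refine Gph.ext ?_ ?_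
  · funext y; rcases y with y | y <;> rfl
  · funext p q
    refine propext ⟨?_, ?_⟩
    · rintro ⟨x, y, h, rfl, rfl⟩
      exact ⟨e.symm x, e.symm y, h, rfl, rfl⟩
    · rintro ⟨x, y, h, h₁, h₂⟩
      refine ⟨e x, e y, by simpa [reindex] using h, ?_, ?_⟩
      · simpa using (Equiv.symm_apply_eq _).1 h₁
      · simpa using (Equiv.symm_apply_eq _).1 h₂

namespace TwoStep

theorem swapFirst_tot (x : TwoStep (.edge a b) (.edge c v)) :
    x.swapFirst.tot = x.tot.reindex (Equiv.sumCongr (Equiv.sumComm _ _) (Equiv.refl _)) := by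
  change ((x.2.1.1.g.reindex _).addRight _).comp x.2.2.1.g = _
  rw [addRight_reindex, ← reindex_comp]
  rfl

theorem rot_of_exchange {x : TwoStep (.edge a b) (.edge c v)} {y : TwoStep (.edge c b) (.edge a v)}
    (h : x.tot.reindex (exchange _ _ _) = y.tot) : x.tot.reindex (rot _ _ _) = y.swapFirst.tot := by
  rw [swapFirst_tot, ← h, reindex_reindex]
  congr 1
  exact Equiv.ext (by rintro ((s | s) | s) <;> rfl)

/-- Either the edges between the second and the third vertex, or those between the first and the
third vertex can be contracted first. -/
theorem exchange_dichotomy (x : TwoStep (.edge a b) (.edge c v)) :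
    (∃ y : TwoStep (.edge c a) (.edge b v), x.swapFirst.tot.reindex (exchange _ _ _) = y.tot) ↔
      ¬ ∃ y : TwoStep (.edge c b) (.edge a v), x.tot.reindex (exchange _ _ _) = y.tot := by
  have hx := x.isEdgeEdge
  have hsymm := hx.isGraph.symm
  rw [exists_exchange_iff, exists_exchange_iff, swapFirst_tot]
  have h₁ : (∃ p t, x.tot.E (.inl (.inl p)) (.inr t)) ∨ ∃ q t, x.tot.E (.inl (.inr q)) (.inr t) := by
    obtain ⟨s | s, t, h⟩ := hx.joins'.ex
    · exact .inl ⟨s, t, h⟩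
    · exact .inr ⟨s, t, h⟩
  -- If only one of the first two vertices is joined to the third, that pair is the one to contract
  -- first. If both are, which occurs only for properads, the directions order the three vertices
  -- linearly with the third one at an end; exactly one neighbour in this order can be merged with
  -- it, since merging the two extremes would create edges in both directions.
  constructor
  · rintro ⟨⟨p, t, h : x.tot.E (.inl (.inl p)) (.inr t)⟩, hC⟩ ⟨⟨q, t', h'⟩, hC'⟩
    by_cases hT : T = .properad
    · obtain ⟨p₀, q₀, h₀⟩ := hx.joins.ex
      have e₁ := hC hT q₀ p₀ q t' (hsymm _ _ h₀) h'
      have e₂ := hC' hT p₀ q₀ p t h₀ h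
      have e₃ := hx.joins'.const hT h h'
      have e₄ := hx.isGraph.opposite (Kind.directed_of_eq_properad hT) _ _ h₀
      simp only [Sum.elim_inl, Sum.elim_inr] at e₃ e₄
      exact e₄ (by rw [e₁, e₂, e₃])
    · simpa using (hx.joins'.uniq hT h h').1
  · intro hn
    by_cases hac : ∃ p t, x.tot.E (.inl (.inl p)) (.inr t)
    · obtain ⟨p, t, h⟩ := hac
      refine ⟨⟨p, t, h⟩, fun hT q₀ p₀ q t' h₀ h' => ?_⟩
      have h₀ : x.tot.E (.inl (.inr q₀)) (.inl (.inl p₀)) := h₀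
      have h' : x.tot.E (.inl (.inr q)) (.inr t') := h'
      by_contra hne
      refine hn ⟨⟨q, t', h'⟩, fun _ p₁ q₁ p₂ t₂ e₁ e₂ => ?_⟩
      have k₁ := hx.joins.const hT e₁ (hsymm _ _ h₀)
      have k₂ := hx.joins'.const hT e₂ h'
      have k₃ := hx.isGraph.opposite (Kind.directed_of_eq_properad hT) _ _ h₀
      simp only [Sum.elim_inl, Sum.elim_inr] at k₂ k₃
      rw [k₁, k₂]
      exact Bool.eq_of_ne_of_ne k₃.symm (Ne.symm hne)
    · refine (hn ⟨h₁.resolve_left hac, fun _ p q p' t _ h => (hac ⟨p', t, h⟩).elim⟩).elim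

end TwoStep

end FeynmanME

namespace FeynmanME

/-! ### Finite sums -/

theorem finsum_mem_setOf_eq_ite {V ι : Type*} [AddCommMonoid V] (f : ι → V) (p : ι → Prop)
    [DecidablePred p] : ∑ᶠ x ∈ {x | p x}, f x = ∑ᶠ x, if p x then f x else 0 :=
  finsum_congr fun x => by
    by_cases h : p x
    · rw [if_pos h]; exact finsum_eq_if.trans (if_pos h)
    · rw [if_neg h]; exact finsum_eq_if.trans (if_neg h)

theorem finsum_split {V ι : Type*} [AddCommMonoid V] (f : ι → V) (hf : f.support.Finite)
    (p q : ι → Prop) (h : ∀ x, q x ↔ ¬ p x) :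
    ∑ᶠ x, f x = ∑ᶠ x ∈ {x | p x}, f x + ∑ᶠ x ∈ {x | q x}, f x := by
  classical
  rw [finsum_mem_setOf_eq_ite, finsum_mem_setOf_eq_ite, ← finsum_add_distrib]
  · refine finsum_congr fun x => ?_
    by_cases hp : p x <;> simp [hp, h]
  all_goals exact hf.subset fun x hx h0 => hx (by simp [h0])

theorem finsum_split_three {V ι : Type*} [AddCommMonoid V] (f : ι → V) (hf : f.support.Finite)
    (p q r : ι → Prop)
    (h : ∀ x, (p x ∧ ¬ q x ∧ ¬ r x) ∨ (¬ p x ∧ q x ∧ ¬ r x) ∨ (¬ p x ∧ ¬ q x ∧ r x)) :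
    ∑ᶠ x, f x = ∑ᶠ x ∈ {x | p x}, f x + ∑ᶠ x ∈ {x | q x}, f x + ∑ᶠ x ∈ {x | r x}, f x := by
  classical
  have hs : ∀ (p : ι → Prop), (Function.support fun x => if p x then f x else 0).Finite :=
    fun p => hf.subset fun x hx h0 => hx (by simp [h0])
  rw [finsum_mem_setOf_eq_ite, finsum_mem_setOf_eq_ite, finsum_mem_setOf_eq_ite,
    ← finsum_add_distrib (hs _) (hs _), ← finsum_add_distrib]
  · refine finsum_congr fun x => ?_
    rcases h x with ⟨h₁, h₂, h₃⟩ | ⟨h₁, h₂, h₃⟩ | ⟨h₁, h₂, h₃⟩ <;> simp [h₁, h₂, h₃]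
  · exact hf.subset fun x hx h0 => hx (by simp [h0])
  · exact hs _

theorem finite_sigma_set {ι : Type*} {κ : ι → Type*} {S : Set ι} {B : ∀ i, Set (κ i)}
    (hS : S.Finite) (hB : ∀ i, (B i).Finite) : (S.sigma B).Finite := by
  refine (hS.biUnion fun i _ => (hB i).image (Sigma.mk i)).subset ?_
  rintro ⟨i, j⟩ ⟨hi, hj⟩
  exact Set.mem_biUnion hi ⟨j, hj, rfl⟩

/-- Only finitely many outer operations are non-zero, although infinitely many intermediate corollas
may occur; this legitimizes exchanging the operations with the inner sums. -/
theorem finsum_nested {k W ι : Type*} {V : ι → Type*} {κ : ι → Type*} [Field k]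
    [∀ i, AddCommGroup (V i)] [∀ i, Module k (V i)] [AddCommGroup W] [Module k W]
    (L : ∀ i, V i →ₗ[k] W) (c : ι → k) (u : ∀ i, κ i → V i) (hL : {i | L i ≠ 0}.Finite)
    (hu : ∀ i, (u i).support.Finite) :
    (Function.support fun x : Σ i, κ i => L x.1 (u x.1 x.2)).Finite ∧
      ∑ᶠ i, c i • L i (∑ᶠ j, u i j) = ∑ᶠ x : Σ i, κ i, c x.1 • L x.1 (u x.1 x.2) := by
  have hs : (Function.support fun x : Σ i, κ i => L x.1 (u x.1 x.2)).Finite := by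
    refine (finite_sigma_set hL fun i => hu i).subset fun x hx => ⟨fun h => hx ?_, fun h => hx ?_⟩
    · simp [h]
    · simp only [h, map_zero]
  refine ⟨hs, ?_⟩
  rw [finsum_sigma_of_finite]
  · refine finsum_congr fun i => ?_
    rw [← LinearMap.smul_apply]
    exact (c i • L i).toAddMonoidHom.map_finsum (hu i)
  · exact hs.subset fun x hx h => hx (by simp only at h ⊢; rw [h, smul_zero])

theorem support_smul_finite {k V ι : Type*} [Field k] [AddCommGroup V] [Module k V] {f : ι → V}
    (hf : f.support.Finite) (c : ι → k) : (Function.support fun i => c i • f i).Finite :=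
  hf.subset fun x hx h => hx (by simp only at h ⊢; rw [h, smul_zero])

theorem finsum_sigma_smul {k V ι : Type*} {β : ι → Type*} [Field k] [AddCommGroup V] [Module k V]
    (c : ι → k) (c' : ∀ i, β i → k) (f : (Σ i, β i) → V) (hf : f.support.Finite) :
    ∑ᶠ x : Σ i, β i, (c x.1 * c' x.1 x.2) • f x = ∑ᶠ i, c i • ∑ᶠ j, c' i j • f ⟨i, j⟩ := by
  rw [finsum_sigma_of_finite _ (support_smul_finite hf _)]
  refine finsum_congr fun i => ?_
  rw [smul_finsum' _ (support_smul_finite ((hf.preimage (sigma_mk_injective (i := i)).injOn).subset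
    fun j hj => hj) _)]
  exact finsum_congr fun j => mul_smul _ _ _

theorem eq_zero_of_eq_neg (k : Type*) {V : Type*} [Field k] [CharZero k] [AddCommGroup V]
    [Module k V] {x : V} (h : x = -x) : x = 0 := by
  have : (2 : k) • x = 0 := by
    rw [two_smul]; nth_rw 2 [h]; exact add_neg_cancel x
  exact (smul_eq_zero.1 this).resolve_left two_ne_zero

/-! ### Sums over two-step factorizations -/

section Sums

variable {k : Type u} [Field k] [CharZero k] {T : Kind} {P : Op k T true} {A : Op k T false}

theorem koszul_zero_left {A A' B B' C C' : Type u} [AddCommGroup A] [AddCommGroup A']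
    [AddCommGroup B] [AddCommGroup B'] [AddCommGroup C] [AddCommGroup C'] [Module k A] [Module k A']
    [Module k B] [Module k B'] [Module k C] [Module k C']
    (f' : A' →ₗ[k] B' →ₗ[k] C') (e' : A' →ₗ[k] A') (e : B →ₗ[k] B) :
    koszul (0 : A →ₗ[k] B →ₗ[k] C) f' e' e = 0 := by
  have h0 : TensorProduct.map₂ (0 : A →ₗ[k] B →ₗ[k] C) f' = 0 := by
    ext; simp
  refine LinearMap.ext fun x => LinearMap.ext fun y => ?_
  simp [koszul, h0]

theorem Conv.bin_support_finite (hloc : T = .properad → P.LocallyFinite) (v : Corolla T) :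
    {γ : Σ a b : Corolla T, Edge a b v | Conv.bin P A γ.2.2.1 ≠ 0}.Finite := by
  refine (P.totBin_support_finite hloc v).subset fun γ hγ h => hγ ?_
  rw [Conv.bin, h]
  exact koszul_zero_left _ _ _

namespace TwoStep

variable {a b c v : Corolla T}

/-- The value of a composite of two loop contractions. -/
noncomputable def loopLoop (z : Conv P A a) (x : TwoStep (.loop a) (.loop v)) : Conv P A v :=
  Conv.un P A x.2.2.1 (Conv.un P A x.2.1.1 z)

/-- The value of a loop contraction after a two-vertex contraction. -/
noncomputable def edgeLoop (z : Conv P A a) (w : Conv P A b) (x : TwoStep (.edge a b) (.loop v)) :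
    Conv P A v :=
  Conv.un P A x.2.2.1 (Conv.bin P A x.2.1.1 z w)

/-- The value of a two-vertex contraction after a loop contraction. -/
noncomputable def loopEdge (z : Conv P A a) (w : Conv P A b) (x : TwoStep (.loop a) (.edge b v)) :
    Conv P A v :=
  Conv.bin P A x.2.2.1 (Conv.un P A x.2.1.1 z) w

/-- The value of a composite of two two-vertex contractions. -/
noncomputable def edgeEdge (z : Conv P A a) (w : Conv P A b) (y : Conv P A c)
    (x : TwoStep (.edge a b) (.edge c v)) : Conv P A v :=
  Conv.bin P A x.2.2.1 (Conv.bin P A x.2.1.1 z w) y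

/-- The weight of a two-step factorization. -/
noncomputable abbrev wt (k : Type u) [Field k] {F : FirstStep T} {S : SecondStep T v}
    (x : TwoStep F S) : k := (x.1.n.factorial : k)⁻¹

instance finite_loop (F : FirstStep T) [∀ e, Finite (F.F e)] :
    Finite (TwoStep F (SecondStep.loop v)) := by
  have : Finite (Σ e : Corolla T, Loop e v) := UGen.finite_sigma (fun _ _ γ => γ.g.deg = 1) v
  exact Finite.of_injective (fun x : TwoStep F (SecondStep.loop v) =>
    (⟨⟨x.1, x.2.2⟩, x.2.1⟩ : Σ x : (Σ e : Corolla T, Loop e v), F.F x.1)) (by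
      rintro ⟨e, f, s⟩ ⟨e', f', s'⟩ h
      simp only [Sigma.mk.injEq] at h
      obtain ⟨⟨rfl, h⟩, h'⟩ := h
      obtain rfl := eq_of_heq h
      obtain rfl := eq_of_heq h'
      rfl)

theorem weight_of_iff {F : FirstStep T} {S : SecondStep T v} (p : TwoStep F S → Prop)
    (h : ∃ y₀ : TwoStep F S, ∀ y : TwoStep F S, p y ↔ y.tot = y₀.tot ∧ y.E = y₀.E) :
    {y | p y}.Finite ∧ ∑ᶠ y ∈ {y | p y}, wt k y = 1 := by
  obtain ⟨y₀, hy⟩ := h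
  have : {y | p y} = {y | y.tot = y₀.tot ∧ y.E = y₀.E} := Set.ext hy
  rw [this]
  exact finsum_weight y₀

/-- Starting with the other of the two loops reverses the sign. Every factorization has such a
partner and the relation is symmetric, so the sum equals its own negative. -/
theorem finsum_loopLoop (z : Conv P A a) :
    ∑ᶠ x : TwoStep (.loop a) (.loop v), wt k x • x.loopLoop z = 0 := by
  have h := finsum_eq_neg_of_rel (k := k)
    (fun x y : TwoStep (.loop a) (.loop v) => x.tot = y.tot ∧ x.E ≠ y.E)
    (wt k) (wt k) (fun x => x.loopLoop z) (fun x => x.loopLoop z)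
    (fun x y h => Conv.un_un_comm _ _ _ _ h.1 h.2 x.2.1.2 x.2.2.2 y.2.1.2 y.2.2.2 z)
    (fun x ⟨y, hy⟩ => weight_of_iff _ ⟨y, fun y' =>
      ⟨fun h => ⟨h.1.symm.trans hy.1, E_eq_of_tot_eq exists_pair_loop hy.1 hy.2 h.1 h.2⟩,
        fun h => ⟨hy.1.trans h.1.symm, by rw [h.2]; exact hy.2⟩⟩⟩)
    (fun y ⟨x, hx⟩ => weight_of_iff _ ⟨x, fun x' =>
      ⟨fun h => ⟨h.1.trans hx.1.symm, E_eq_of_tot_eq exists_pair_loop hx.1.symm hx.2.symm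
        h.1.symm h.2.symm⟩, fun h => ⟨h.1.trans hx.1, by rw [h.2]; exact hx.2⟩⟩⟩)
    (Set.toFinite _) (Set.toFinite _)
  rw [Set.eq_univ_of_forall (s := {x : TwoStep (.loop a) (.loop v) |
      ∃ y : TwoStep (.loop a) (.loop v), x.tot = y.tot ∧ x.E ≠ y.E})
    loop_loop_exists, Set.eq_univ_of_forall
    (s := {y : TwoStep (.loop a) (.loop v) | ∃ x : TwoStep (.loop a) (.loop v),
      x.tot = y.tot ∧ x.E ≠ y.E}) (fun x => by
      obtain ⟨y, h, h'⟩ := loop_loop_exists x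
      exact ⟨y, h.symm, h'.symm⟩), finsum_mem_univ] at h
  exact eq_zero_of_eq_neg k h

/-- Interchange of the two sources, as a bijection. -/
def swapEquiv (a b v : Corolla T) : TwoStep (.edge a b) (.loop v) ≃ TwoStep (.edge b a) (.loop v) :=
  ⟨swap, swap, swap_swap, swap_swap⟩

/-- Interchange of the two sources of the first step, as a bijection. -/
def swapFirstEquiv (a b c v : Corolla T) :
    TwoStep (.edge a b) (.edge c v) ≃ TwoStep (.edge b a) (.edge c v) :=
  ⟨swapFirst, swapFirst, swapFirst_swapFirst, swapFirst_swapFirst⟩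

theorem _root_.FeynmanME.Conv.bin_swap_of_deg {a b v : Corolla T} (γ : BGen a b v) {m : ℤ}
    {x : Conv P A a} {y : Conv P A b}
    (hx : x ∈ Conv.deg P A a 0) (hy : y ∈ Conv.deg P A b m) :
    Conv.bin P A γ.swap y x = Conv.bin P A γ x y :=
  (Conv.bin_swap γ γ.swap rfl (by simp only [Gph.sh, BGen.swap_deg]) hx hy (by simp)).symm

/-- When the loop arises from a second edge between the same two vertices, the two edges can change
roles, and these contributions cancel among themselves. -/
theorem finsum_edgeLoop_same {a b : Corolla T} {z : Conv P A a} {w : Conv P A b} :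
    ∑ᶠ x ∈ {x : TwoStep (.edge a b) (.loop v) | ∃ y : TwoStep (.edge a b) (.loop v),
      x.tot = y.tot ∧ x.E ≠ y.E}, wt k x • x.edgeLoop z w = 0 := by
  have hpair : ∀ x : TwoStep (.edge a b) (.loop v), ∀ {e} (f : (FirstStep.edge a b).F e),
      ∃ p p', ((FirstStep.edge a b).g f).E = Gph.pair p p' := fun x => 
    exists_pair_edge (x.2.2.1.hasLoops_of_deg x.2.2.2).ne_properad
  have h := finsum_eq_neg_of_rel (k := k)
    (fun x y : TwoStep (.edge a b) (.loop v) => x.tot = y.tot ∧ x.E ≠ y.E)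
    (wt k) (wt k) (fun x => x.edgeLoop z w) (fun x => x.edgeLoop z w)
    (fun x y h => Conv.un_bin_comm _ _ _ _ h.1 h.2 x.2.1.2 x.2.2.2 y.2.1.2 y.2.2.2 z w)
    (fun x ⟨y, hy⟩ => weight_of_iff _ ⟨y, fun y' =>
      ⟨fun h => ⟨h.1.symm.trans hy.1, E_eq_of_tot_eq (hpair x) hy.1 hy.2 h.1 h.2⟩,
        fun h => ⟨hy.1.trans h.1.symm, by rw [h.2]; exact hy.2⟩⟩⟩)
    (fun y ⟨x, hx⟩ => weight_of_iff _ ⟨x, fun x' =>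
      ⟨fun h => ⟨h.1.trans hx.1.symm, E_eq_of_tot_eq (hpair x) hx.1.symm hx.2.symm
        h.1.symm h.2.symm⟩, fun h => ⟨h.1.trans hx.1, by rw [h.2]; exact hx.2⟩⟩⟩)
    (Set.toFinite _) (Set.toFinite _)
  refine eq_zero_of_eq_neg k (h.trans (congrArg _ (finsum_mem_congr ?_ fun _ _ => rfl)))
  ext x
  exact exists_congr fun y => and_congr eq_comm ne_comm

theorem finite_loop_edge (a b v : Corolla T) : Finite (TwoStep (.loop a) (.edge b v)) := by
  by_cases hT : T = .properad
  · have : IsEmpty (TwoStep (.loop a) (.edge b v)) :=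
      ⟨fun x => (x.2.1.1.hasLoops_of_deg x.2.1.2).ne_properad hT⟩
    infer_instance
  · have := BGen.finite_sigma hT v
    have : Finite (Σ x : (Σ e b : Corolla T, Edge e b v), Loop a x.1) := inferInstance
    exact Finite.of_injective (fun x : TwoStep (.loop a) (.edge b v) =>
      (⟨⟨x.1, b, x.2.2⟩, x.2.1⟩ : Σ x : (Σ e b : Corolla T, Edge e b v), Loop a x.1)) (by
        rintro ⟨e, f, s⟩ ⟨e', f', s'⟩ h
        simp only [Sigma.mk.injEq] at h
        obtain ⟨⟨rfl, h⟩, h'⟩ := h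
        simp only [heq_eq_eq, Sigma.mk.injEq, true_and] at h
        obtain rfl := h
        obtain rfl := eq_of_heq h'
        rfl)

/-- A loop at the first vertex may be contracted before or after the edge that joins the vertices,
with opposite signs; every loop-first factorization arises in this way. -/
theorem finsum_edgeLoop_left {a b : Corolla T} (z : Conv P A a) (w : Conv P A b) :
    ∑ᶠ x ∈ {x : TwoStep (.edge a b) (.loop v) | ∃ y : TwoStep (.loop a) (.edge b v),
      x.tot = y.tot}, wt k x • x.edgeLoop z w =
      -∑ᶠ y : TwoStep (.loop a) (.edge b v), wt k y • y.loopEdge z w := by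
  have := finite_loop_edge a b v
  have h := finsum_eq_neg_of_rel (k := k)
    (fun (x : TwoStep (.edge a b) (.loop v)) (y : TwoStep (.loop a) (.edge b v)) => x.tot = y.tot)
    (wt k) (wt k) (fun x => x.edgeLoop z w) (fun y => y.loopEdge z w)
    (fun x y h => Conv.un_bin_assoc _ _ _ _ h x.2.1.2 x.2.2.2 y.2.1.2 y.2.2.2 z w)
    (fun x ⟨y, hy⟩ => weight_of_iff _ ⟨y, fun y' =>
      ⟨fun h => ⟨h.symm.trans hy, E_eq_of_tot_eq_edge (h.symm.trans hy)⟩,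
        fun h => hy.trans h.1.symm⟩⟩)
    (fun y ⟨x, hx⟩ => weight_of_iff _ ⟨x, fun x' =>
      ⟨fun h => ⟨h.trans hx.symm, edge_loop_E_eq hx h⟩, fun h => h.1.trans hx⟩⟩)
    (Set.toFinite _) (Set.toFinite _)
  rw [h, Set.eq_univ_of_forall (s := {y : TwoStep (.loop a) (.edge b v) |
    ∃ x : TwoStep (.edge a b) (.loop v), x.tot = y.tot}) exists_of_loop_edge, finsum_mem_univ]

/-- A loop at the second vertex reduces to the previous case by interchanging the sources, which
costs no sign in total degree zero. -/
theorem finsum_edgeLoop_right {a b : Corolla T} {z : Conv P A a} {w : Conv P A b}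
    (hz : z ∈ Conv.deg P A a 0) (hw : w ∈ Conv.deg P A b 0) :
    ∑ᶠ x ∈ {x : TwoStep (.edge a b) (.loop v) | ∃ y : TwoStep (.loop b) (.edge a v),
      x.swap.tot = y.tot}, wt k x • x.edgeLoop z w =
      -∑ᶠ y : TwoStep (.loop b) (.edge a v), wt k y • y.loopEdge w z := by
  rw [← finsum_edgeLoop_left w z]
  refine finsum_mem_eq_of_bijOn (swapEquiv a b v) ⟨fun x hx => hx,
    (swapEquiv a b v).injective.injOn, fun x hx => ⟨x.swap, ?_, swap_swap x⟩⟩ fun x _ => ?_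
  · change ∃ y : TwoStep (.loop b) (.edge a v), x.swap.swap.tot = y.tot
    rw [swap_swap]
    exact hx
  · have : x.swap.edgeLoop w z = x.edgeLoop z w :=
      congrArg (Conv.un P A x.2.2.1) (Conv.bin_swap_of_deg x.2.1.1 hz hw)
    exact congrArg (fun t => wt k x • t) this.symm

theorem finsum_edgeLoop {a b : Corolla T} {z : Conv P A a} {w : Conv P A b}
    (hz : z ∈ Conv.deg P A a 0) (hw : w ∈ Conv.deg P A b 0) :
    ∑ᶠ x : TwoStep (.edge a b) (.loop v), wt k x • x.edgeLoop z w =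
      -∑ᶠ y : TwoStep (.loop a) (.edge b v), wt k y • y.loopEdge z w -
        ∑ᶠ y : TwoStep (.loop b) (.edge a v), wt k y • y.loopEdge w z := by
  rw [finsum_split_three (fun x : TwoStep (.edge a b) (.loop v) => wt k x • x.edgeLoop z w)
    (Set.toFinite _) _ _ _ edge_loop_trichotomy, finsum_edgeLoop_same, finsum_edgeLoop_left,
    finsum_edgeLoop_right hz hw, zero_add, sub_eq_add_neg]

/-- For properads there may be infinitely many second steps, but only finitely many of them act
non-trivially on `P`, and each admits finitely many first steps with the given sources. -/
theorem edgeEdge_support (hloc : T = .properad → P.LocallyFinite)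
    (z : Conv P A a) (w : Conv P A b) (y : Conv P A c) :
    (Function.support fun x : TwoStep (.edge a b) (.edge c v) => x.edgeEdge z w y).Finite := by
  have h := (finite_sigma_set (Conv.bin_support_finite (A := A) hloc v) fun γ =>
    Set.toFinite (Set.univ : Set (Edge a b γ.1)))
  refine Set.Finite.of_finite_image (f := fun x : TwoStep (.edge a b) (.edge c v) =>
    (⟨⟨x.1, c, x.2.2⟩, x.2.1⟩ : Σ γ : (Σ e b : Corolla T, Edge e b v), Edge a b γ.1))
    (h.subset ?_) ?_
  · rintro _ ⟨x, hx, rfl⟩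
    refine ⟨fun h0 => hx ?_, trivial⟩
    simp only [edgeEdge]
    rw [h0]
    rfl
  · rintro ⟨e, f, s⟩ - ⟨e', f', s'⟩ - h
    simp only [Sigma.mk.injEq] at h
    obtain ⟨⟨rfl, h⟩, h'⟩ := h
    simp only [heq_eq_eq, Sigma.mk.injEq, true_and] at h
    obtain rfl := h
    obtain rfl := eq_of_heq h'
    rfl

/-- The sum over those pairs of contractions for which the second and the third vertex can be joined
first. -/
noncomputable def partialSum (v : Corolla T) (z : Conv P A a) (w : Conv P A b) (y : Conv P A c) :
    Conv P A v :=
  ∑ᶠ x ∈ {x : TwoStep (.edge a b) (.edge c v) | ∃ y : TwoStep (.edge c b) (.edge a v),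
    x.tot.reindex (exchange _ _ _) = y.tot}, wt k x • x.edgeEdge z w y

/-- Associativity with an odd sign: contracting the second vertex first with the third instead of
with the first changes the sign, and this correspondence exchanges the outer two arguments. -/
theorem partialSum_exchange (hloc : T = .properad → P.LocallyFinite)
    {z : Conv P A a} {w : Conv P A b} {y : Conv P A c}
    (hz : z ∈ Conv.deg P A a 0) (hw : w ∈ Conv.deg P A b 0) (hy : y ∈ Conv.deg P A c 0) :
    partialSum v z w y = -partialSum v y w z := by
  have h := finsum_eq_neg_of_rel (k := k)
    (fun (x : TwoStep (.edge a b) (.edge c v)) (y : TwoStep (.edge c b) (.edge a v)) =>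
      x.tot.reindex (exchange _ _ _) = y.tot)
    (wt k) (wt k) (fun x => x.edgeEdge z w y) (fun x => x.edgeEdge y w z)
    (fun x x' h => by
      -- The associativity law is stated for the cyclic rotation of the three blocks; the exchange
      -- of the outer blocks differs from it by a swap of the two sources of the first step.
      refine (Conv.bin_bin_assoc _ _ x'.2.1.1.swap x'.2.2.1 (rot_of_exchange h) x.2.1.2 x.2.2.2
        (x'.2.1.1.swap_deg.trans x'.2.1.2) x'.2.2.2 hz hw hy).trans ?_
      rw [Conv.bin_swap_of_deg _ hy hw]
      rfl)
    (fun x ⟨y, hy⟩ => weight_of_iff _ ⟨y, fun y' =>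
      ⟨fun h => ⟨h.symm.trans hy, E_eq_of_tot_eq_edge (h.symm.trans hy)⟩,
        fun h => hy.trans h.1.symm⟩⟩)
    (fun y ⟨x, hx⟩ => weight_of_iff _ ⟨x, fun x' => by
      have key : x'.tot.reindex (exchange _ _ _) = y.tot ↔ x'.tot = x.tot := by
        rw [← hx]
        refine ⟨fun h => ?_, fun h => by rw [h]⟩
        rw [← exchange_exchange x'.tot, h, exchange_exchange]
      rw [key]
      exact ⟨fun h => ⟨h, E_eq_of_tot_eq_edge h⟩, fun h => h.1⟩⟩)
    (edgeEdge_support hloc _ _ _) (edgeEdge_support hloc _ _ _)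
  refine h.trans (congrArg _ (finsum_mem_congr ?_ fun _ _ => rfl))
  ext x
  refine exists_congr fun y => ⟨fun h => ?_, fun h => ?_⟩
  · rw [← h, exchange_exchange]
  · rw [← h, exchange_exchange]

/-- By the dichotomy, the third vertex can be contracted first with exactly one of the other two;
the second alternative becomes the first after the two sources of the first step are swapped. -/
theorem finsum_edgeEdge (hloc : T = .properad → P.LocallyFinite)
    {z : Conv P A a} {w : Conv P A b} {y : Conv P A c}
    (hz : z ∈ Conv.deg P A a 0) (hw : w ∈ Conv.deg P A b 0) :
    ∑ᶠ x : TwoStep (.edge a b) (.edge c v), wt k x • x.edgeEdge z w y =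
      partialSum v z w y + partialSum v w z y := by
  rw [finsum_split _ (support_smul_finite (edgeEdge_support hloc _ _ _) _) _ _ exchange_dichotomy]
  refine congrArg _ (finsum_mem_eq_of_bijOn (swapFirstEquiv a b c v) ⟨fun x hx => hx,
    (swapFirstEquiv a b c v).injective.injOn, fun x hx =>
      ⟨x.swapFirst, ?_, swapFirst_swapFirst x⟩⟩ fun x _ => ?_)
  · change ∃ y : TwoStep (.edge c a) (.edge b v),
      x.swapFirst.swapFirst.tot.reindex (exchange _ _ _) = y.tot
    rw [swapFirst_swapFirst]
    exact hx
  · have : x.swapFirst.edgeEdge w z y = x.edgeEdge z w y :=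
      congrArg (fun t => Conv.bin P A x.2.2.1 t y) (Conv.bin_swap_of_deg x.2.1.1 hz hw)
    exact congrArg (fun t => wt k x • t) this.symm

end TwoStep

end Sums

end FeynmanME

namespace FeynmanME

/-! ### The Bianchi identity -/

/-- Turns a composite of two sums, organized by the intermediate corolla, into a sum over the outer
sources followed by a sum over two-step factorizations. The factorials regroup so that the
intermediate one stays with the inner sum, where the torsor count applies. -/
theorem finsum_nested_reindex {k W ι μ : Type*} {V : ι → Type*} {κ : ι → Type*} {τ : μ → Type*}
    [Field k] [∀ i, AddCommGroup (V i)] [∀ i, Module k (V i)] [AddCommGroup W] [Module k W]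
    (L : ∀ i, V i →ₗ[k] W) (c : ι → k) (b : ∀ i, κ i → k) (z : ∀ i, κ i → V i)
    (hL : {i | L i ≠ 0}.Finite) (hz : ∀ i, (z i).support.Finite) (e : (Σ i, κ i) ≃ Σ m, τ m)
    (w : μ → k) (w' : ∀ m, τ m → k) (G : ∀ m, τ m → W)
    (hc : ∀ x, c x.1 * b x.1 x.2 = w (e x).1 * w' (e x).1 (e x).2)
    (hG : ∀ x, L x.1 (z x.1 x.2) = G (e x).1 (e x).2) :
    (Function.support fun y : Σ m, τ m => G y.1 y.2).Finite ∧
      ∑ᶠ i, c i • L i (∑ᶠ j, b i j • z i j) = ∑ᶠ m, w m • ∑ᶠ t, w' m t • G m t := by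
  obtain ⟨hs, -⟩ := finsum_nested L c z hL hz
  obtain ⟨-, h⟩ := finsum_nested L c (fun i j => b i j • z i j) hL
    fun i => support_smul_finite (hz i) _
  have hs' : (Function.support fun y : Σ m, τ m => G y.1 y.2).Finite := by
    refine (hs.image e).subset fun y hy => ⟨e.symm y, fun h => hy ?_, e.apply_symm_apply y⟩
    simp only at h ⊢
    rw [hG, e.apply_symm_apply] at h
    exact h
  refine ⟨hs', ?_⟩
  rw [h, ← finsum_sigma_smul w w' (fun y : Σ m, τ m => G y.1 y.2) hs']
  refine finsum_eq_of_bijective e e.bijective fun x => ?_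
  rw [← hc, ← hG, map_smul, smul_smul]

theorem support_finite_of_sigma {V W μ : Type*} {τ : μ → Type*} [AddCommGroup V] [AddCommGroup W]
    {G : ∀ m, τ m → W} (h : (Function.support fun y : Σ m, τ m => G y.1 y.2).Finite) {f : μ → V}
    (hf : ∀ m, (∀ t, G m t = 0) → f m = 0) : f.support.Finite := by
  refine (h.image Sigma.fst).subset fun m hm => ?_
  by_contra h'
  exact hm (hf m fun t => by_contra fun h0 => h' ⟨⟨m, t⟩, h0, rfl⟩)

section Bianchi

variable {k : Type u} [Field k] {T : Kind} {P : Op k T true} {A : Op k T false}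

/-- The sum over all loop contractions. -/
noncomputable def loops (α : ∀ v, Conv P A v) (v : Corolla T) : Conv P A v :=
  ∑ᶠ γ : Σ a : Corolla T, Loop a v, (γ.1.n.factorial : k)⁻¹ • Conv.un P A γ.2.1 (α γ.1)

/-- The sum over all two-vertex contractions. -/
noncomputable def bracket (α β : ∀ v, Conv P A v) (v : Corolla T) : Conv P A v :=
  ∑ᶠ γ : Σ a b : Corolla T, Edge a b v, (γ.1.n.factorial * γ.2.1.n.factorial : k)⁻¹ •
    Conv.bin P A γ.2.2.1 (α γ.1) (β γ.2.1)

/-- The left hand side of the master equation. -/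
noncomputable def curvature (α : ∀ v, Conv P A v) (v : Corolla T) : Conv P A v :=
  Conv.d P A v (α v) + loops α v + (2 : k)⁻¹ • bracket α α v

instance finite_loops (v : Corolla T) : Finite (Σ a : Corolla T, Loop a v) :=
  UGen.finite_sigma (fun _ _ γ => γ.g.deg = 1) v

theorem loops_add (α β : ∀ v, Conv P A v) (v : Corolla T) :
    loops (α + β) v = loops α v + loops β v := by
  rw [loops, loops, loops, ← finsum_add_distrib (Set.toFinite _) (Set.toFinite _)]
  simp only [Pi.add_apply, map_add, smul_add]

theorem loops_smul (c : k) (α : ∀ v, Conv P A v) (v : Corolla T) :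
    loops (c • α) v = c • loops α v := by
  rw [loops, loops, smul_finsum' _ (Set.toFinite _)]
  simp only [Pi.smul_apply, map_smul, smul_comm c]

variable [CharZero k]

theorem bracket_support (hloc : T = .properad → P.LocallyFinite) (α β : ∀ v, Conv P A v)
    (v : Corolla T) : (Function.support fun γ : Σ a b : Corolla T, Edge a b v =>
      Conv.bin P A γ.2.2.1 (α γ.1) (β γ.2.1)).Finite :=
  (Conv.bin_support_finite (A := A) hloc v).subset fun γ hγ h => hγ (by simp only; rw [h]; rfl)

theorem bracket_add_left (hloc : T = .properad → P.LocallyFinite) (α α' β : ∀ v, Conv P A v)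
    (v : Corolla T) : bracket (α + α') β v = bracket α β v + bracket α' β v := by
  rw [bracket, bracket, bracket, ← finsum_add_distrib
    (support_smul_finite (bracket_support hloc _ _ _) _)
    (support_smul_finite (bracket_support hloc _ _ _) _)]
  simp only [Pi.add_apply, map_add, smul_add, LinearMap.add_apply]

theorem bracket_add_right (hloc : T = .properad → P.LocallyFinite) (α β β' : ∀ v, Conv P A v)
    (v : Corolla T) : bracket α (β + β') v = bracket α β v + bracket α β' v := by
  rw [bracket, bracket, bracket, ← finsum_add_distrib
    (support_smul_finite (bracket_support hloc _ _ _) _)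
    (support_smul_finite (bracket_support hloc _ _ _) _)]
  simp only [Pi.add_apply, map_add, smul_add]

theorem bracket_smul_left (hloc : T = .properad → P.LocallyFinite) (c : k)
    (α β : ∀ v, Conv P A v) (v : Corolla T) : bracket (c • α) β v = c • bracket α β v := by
  rw [bracket, bracket, smul_finsum' _ (support_smul_finite (bracket_support hloc _ _ _) _)]
  simp only [Pi.smul_apply, map_smul, smul_comm c, LinearMap.smul_apply]

/-- Interchange of the two sources of a two-vertex contraction, as a bijection. -/
def edgeSwapEquiv (v : Corolla T) : (Σ a b : Corolla T, Edge a b v) ≃ Σ a b : Corolla T, Edge a b v where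
  toFun γ := ⟨γ.2.1, γ.1, γ.2.2.1.swap, (BGen.swap_deg _).trans γ.2.2.2⟩
  invFun γ := ⟨γ.2.1, γ.1, γ.2.2.1.swap, (BGen.swap_deg _).trans γ.2.2.2⟩
  left_inv := by rintro ⟨a, b, γ, h⟩; simp only [BGen.swap_swap]
  right_inv := by rintro ⟨a, b, γ, h⟩; simp only [BGen.swap_swap]

theorem bracket_comm {α β : ∀ v, Conv P A v} {m : ℤ} (hα : ∀ v, α v ∈ Conv.deg P A v 0)
    (hβ : ∀ v, β v ∈ Conv.deg P A v m) (v : Corolla T) : bracket β α v = bracket α β v := by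
  refine (finsum_eq_of_bijective _ (edgeSwapEquiv v).bijective fun γ => ?_).symm
  rw [← Conv.bin_swap_of_deg _ (hα _) (hβ _), mul_comm]
  rfl

theorem d_loops (α : ∀ v, Conv P A v) (v : Corolla T) :
    Conv.d P A v (loops α v) = -loops (fun v => Conv.d P A v (α v)) v := by
  rw [loops, loops, ← finsum_neg_distrib]
  refine ((Conv.d P A v).toAddMonoidHom.map_finsum (Set.toFinite _)).trans
    (finsum_congr fun γ => ?_)
  refine ((Conv.d P A v).map_smul _ _).trans ?_
  rw [Conv.d_un_of_deg_one _ γ.2.2, smul_neg]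

theorem d_bracket (hloc : T = .properad → P.LocallyFinite) {α : ∀ v, Conv P A v} (hα : ∀ v, α v ∈ Conv.deg P A v 0)
    (v : Corolla T) : Conv.d P A v (bracket α α v) =
      -((2 : k) • bracket (fun v => Conv.d P A v (α v)) α v) := by
  have h : Conv.d P A v (bracket α α v) = -(bracket (fun v => Conv.d P A v (α v)) α v +
      bracket α (fun v => Conv.d P A v (α v)) v) := by
    refine Eq.trans ?_ (congrArg Neg.neg (finsum_add_distrib
      (support_smul_finite (bracket_support hloc (fun v => Conv.d P A v (α v)) α v) _)
      (support_smul_finite (bracket_support hloc α (fun v => Conv.d P A v (α v)) v) _)))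
    rw [← finsum_neg_distrib]
    refine ((Conv.d P A v).toAddMonoidHom.map_finsum
      (support_smul_finite (bracket_support hloc _ _ _) _)).trans (finsum_congr fun γ => ?_)
    refine ((Conv.d P A v).map_smul _ _).trans ?_
    rw [Conv.d_bin _ γ.2.2.2 (by simp : Even (0 : ℤ)) (hα _), smul_neg, smul_add]
  rw [h, ← bracket_comm hα (fun v => Conv.d_mem_deg (zero_add 1) (hα v)), two_smul]

/-- Any two loops are contracted in both orders, with opposite signs. -/
theorem loops_loops (α : ∀ v, Conv P A v) (v : Corolla T) : loops (loops α) v = 0 := by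
  obtain ⟨-, h⟩ := finsum_nested_reindex (k := k) (ι := Σ e : Corolla T, Loop e v)
    (κ := fun γ => Σ a : Corolla T, Loop a γ.1)
    (fun γ => Conv.un P A γ.2.1) (fun γ => (γ.1.n.factorial : k)⁻¹)
    (fun γ γ' => (γ'.1.n.factorial : k)⁻¹) (fun γ γ' => Conv.un P A γ'.2.1 (α γ'.1)) (Set.toFinite _)
    (fun _ => Set.toFinite _) (τ := fun a => TwoStep (.loop a) (.loop v))
    ⟨fun x => ⟨x.2.1, x.1.1, x.2.2, x.1.2⟩, fun y => ⟨⟨y.2.1, y.2.2.2⟩, y.1, y.2.2.1⟩,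
      fun _ => rfl, fun _ => rfl⟩
    (fun a => (a.n.factorial : k)⁻¹) (fun a => TwoStep.wt k) (fun a => TwoStep.loopLoop (α a))
    (fun _ => mul_comm _ _) (fun _ => rfl)
  refine h.trans ?_
  simp only [TwoStep.finsum_loopLoop, smul_zero, finsum_zero]

theorem loops_bracket_eq_finsum (hloc : T = .properad → P.LocallyFinite) (α : ∀ v, Conv P A v)
    (v : Corolla T) : loops (bracket α α) v = ∑ᶠ s : Corolla T × Corolla T,
      (s.1.n.factorial * s.2.n.factorial : k)⁻¹ •
        ∑ᶠ x : TwoStep (.edge s.1 s.2) (.loop v), TwoStep.wt k x • x.edgeLoop (α s.1) (α s.2) := by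
  obtain ⟨-, h⟩ := finsum_nested_reindex (k := k) (ι := Σ e : Corolla T, Loop e v)
    (κ := fun γ => Σ a b : Corolla T, Edge a b γ.1)
    (fun γ => Conv.un P A γ.2.1) (fun γ => (γ.1.n.factorial : k)⁻¹)
    (fun γ γ' => (γ'.1.n.factorial * γ'.2.1.n.factorial : k)⁻¹)
    (fun γ γ' => Conv.bin P A γ'.2.2.1 (α γ'.1) (α γ'.2.1)) (Set.toFinite _)
    (fun _ => bracket_support hloc _ _ _)
    (τ := fun s : Corolla T × Corolla T => TwoStep (.edge s.1 s.2) (.loop v))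
    ⟨fun x => ⟨⟨x.2.1, x.2.2.1⟩, x.1.1, x.2.2.2, x.1.2⟩,
      fun y => ⟨⟨y.2.1, y.2.2.2⟩, y.1.1, y.1.2, y.2.2.1⟩, fun _ => rfl, fun _ => rfl⟩
    (fun s => (s.1.n.factorial * s.2.n.factorial : k)⁻¹) (fun s => TwoStep.wt k)
    (fun s => TwoStep.edgeLoop (α s.1) (α s.2)) (fun _ => mul_comm _ _) (fun _ => rfl)
  exact h

theorem bracket_loops_eq_finsum (hloc : T = .properad → P.LocallyFinite) (α : ∀ v, Conv P A v)
    (v : Corolla T) : (Function.support fun s : Corolla T × Corolla T =>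
      (s.1.n.factorial * s.2.n.factorial : k)⁻¹ •
        ∑ᶠ x : TwoStep (.loop s.1) (.edge s.2 v), TwoStep.wt k x • x.loopEdge (α s.1) (α s.2)).Finite ∧
      bracket (loops α) α v = ∑ᶠ s : Corolla T × Corolla T,
      (s.1.n.factorial * s.2.n.factorial : k)⁻¹ •
        ∑ᶠ x : TwoStep (.loop s.1) (.edge s.2 v), TwoStep.wt k x • x.loopEdge (α s.1) (α s.2) := by
  obtain ⟨hs, h⟩ := finsum_nested_reindex (k := k) (ι := Σ e b : Corolla T, Edge e b v)
    (κ := fun γ => Σ a : Corolla T, Loop a γ.1)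
    (fun γ => (Conv.bin P A γ.2.2.1).flip (α γ.2.1))
    (fun γ => (γ.1.n.factorial * γ.2.1.n.factorial : k)⁻¹)
    (fun γ γ' => (γ'.1.n.factorial : k)⁻¹) (fun γ γ' => Conv.un P A γ'.2.1 (α γ'.1))
    ((Conv.bin_support_finite (A := A) hloc v).subset fun γ hγ h => hγ (by rw [h]; rfl))
    (fun _ => Set.toFinite _)
    (τ := fun s : Corolla T × Corolla T => TwoStep (.loop s.1) (.edge s.2 v))
    ⟨fun x => ⟨⟨x.2.1, x.1.2.1⟩, x.1.1, x.2.2, x.1.2.2⟩,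
      fun y => ⟨⟨y.2.1, y.1.2, y.2.2.2⟩, y.1.1, y.2.2.1⟩, fun _ => rfl, fun _ => rfl⟩
    (fun s => (s.1.n.factorial * s.2.n.factorial : k)⁻¹) (fun s => TwoStep.wt k)
    (fun s => TwoStep.loopEdge (α s.1) (α s.2))
    (fun x => by
      simp only [mul_inv, Equiv.coe_fn_mk, TwoStep.wt]
      ring) (fun _ => rfl)
  refine ⟨support_finite_of_sigma (G := fun (s : Corolla T × Corolla T)
    (x : TwoStep (.loop s.1) (.edge s.2 v)) => x.loopEdge (α s.1) (α s.2)) hs fun s h0 => ?_, h⟩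
  rw [finsum_eq_zero_of_forall_eq_zero fun y => ?_, smul_zero]
  rw [h0, smul_zero]

/-- The loop sits at the first vertex or at the second, since loops from a second connecting edge
cancel. The two contributions agree after renaming the sources, whence the factor 2. -/
theorem loops_bracket (hloc : T = .properad → P.LocallyFinite) {α : ∀ v, Conv P A v}
    (hα : ∀ v, α v ∈ Conv.deg P A v 0) (v : Corolla T) :
    loops (bracket α α) v = -((2 : k) • bracket (loops α) α v) := by
  obtain ⟨hS, h₃⟩ := bracket_loops_eq_finsum hloc α v
  let S : Corolla T × Corolla T → Conv P A v := fun s =>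
    (s.1.n.factorial * s.2.n.factorial : k)⁻¹ • ∑ᶠ y : TwoStep (.loop s.1) (.edge s.2 v),
      TwoStep.wt k y • y.loopEdge (α s.1) (α s.2)
  have hS : S.support.Finite := hS
  have h₃ : bracket (loops α) α v = ∑ᶠ s, S s := h₃
  have h₄ : ∑ᶠ s : Corolla T × Corolla T, S s.swap = ∑ᶠ s, S s :=
    finsum_comp_equiv (Equiv.prodComm (Corolla T) (Corolla T))
  have hS' : (Function.support fun s : Corolla T × Corolla T => S s.swap).Finite :=
    (hS.image Prod.swap).subset fun s hs => ⟨s.swap, hs, Prod.swap_swap s⟩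
  rw [loops_bracket_eq_finsum hloc, h₃, two_smul]
  nth_rw 2 [← h₄]
  rw [← finsum_add_distrib hS hS', ← finsum_neg_distrib]
  refine finsum_congr fun s => ?_
  rw [TwoStep.finsum_edgeLoop (hα _) (hα _), smul_sub, smul_neg, neg_add, sub_eq_add_neg]
  simp only [S, Prod.fst_swap, Prod.snd_swap, mul_comm]

/-- The Jacobi identity on the diagonal. The sum splits into two families, each a sum over ordered
triples of corollas of a quantity that is antisymmetric in two of them. -/
theorem bracket_bracket (hloc : T = .properad → P.LocallyFinite) {α : ∀ v, Conv P A v}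
    (hα : ∀ v, α v ∈ Conv.deg P A v 0) (v : Corolla T) :
    bracket (bracket α α) α v = 0 := by
  let w : Corolla T × Corolla T × Corolla T → k := fun s =>
    (s.1.n.factorial * s.2.1.n.factorial * s.2.2.n.factorial : k)⁻¹
  obtain ⟨hs, h⟩ := finsum_nested_reindex (k := k) (ι := Σ e c : Corolla T, Edge e c v)
    (κ := fun γ => Σ a b : Corolla T, Edge a b γ.1)
    (fun γ => (Conv.bin P A γ.2.2.1).flip (α γ.2.1))
    (fun γ => (γ.1.n.factorial * γ.2.1.n.factorial : k)⁻¹)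
    (fun γ γ' => (γ'.1.n.factorial * γ'.2.1.n.factorial : k)⁻¹)
    (fun γ γ' => Conv.bin P A γ'.2.2.1 (α γ'.1) (α γ'.2.1))
    ((Conv.bin_support_finite (A := A) hloc v).subset fun γ hγ h => hγ (by rw [h]; rfl))
    (fun _ => bracket_support hloc _ _ _)
    (τ := fun s : Corolla T × Corolla T × Corolla T => TwoStep (.edge s.1 s.2.1) (.edge s.2.2 v))
    ⟨fun x => ⟨⟨x.2.1, x.2.2.1, x.1.2.1⟩, x.1.1, x.2.2.2, x.1.2.2⟩,
      fun y => ⟨⟨y.2.1, y.1.2.2, y.2.2.2⟩, y.1.1, y.1.2.1, y.2.2.1⟩, fun _ => rfl, fun _ => rfl⟩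
    w (fun s => TwoStep.wt k) (fun s => TwoStep.edgeEdge (α s.1) (α s.2.1) (α s.2.2))
    (fun x => by
      simp only [mul_inv, Equiv.coe_fn_mk, TwoStep.wt, w]
      ring) (fun _ => rfl)
  refine h.trans ?_
  let S : Corolla T × Corolla T × Corolla T → Conv P A v := fun s =>
    w s • TwoStep.partialSum v (α s.1) (α s.2.1) (α s.2.2)
  have hS : S.support.Finite := support_finite_of_sigma
    (G := fun (s : Corolla T × Corolla T × Corolla T)
      (x : TwoStep (.edge s.1 s.2.1) (.edge s.2.2 v)) =>
      x.edgeEdge (α s.1) (α s.2.1) (α s.2.2)) hs fun s h0 => by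
    refine (congrArg (w s • ·) (finsum_mem_of_eqOn_zero fun y _ => ?_)).trans (smul_zero _)
    simp only [h0, smul_zero, Pi.zero_apply]
  let σ : Corolla T × Corolla T × Corolla T ≃ Corolla T × Corolla T × Corolla T :=
    ⟨fun s => (s.2.1, s.1, s.2.2), fun s => (s.2.1, s.1, s.2.2), fun _ => rfl, fun _ => rfl⟩
  let τ : Corolla T × Corolla T × Corolla T ≃ Corolla T × Corolla T × Corolla T :=
    ⟨fun s => (s.2.2, s.2.1, s.1), fun s => (s.2.2, s.2.1, s.1), fun _ => rfl, fun _ => rfl⟩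
  -- The bijection `τ` exchanges the first and third corollas, preserves the weight and reverses the
  -- sign of the summand.
  have h₀ : ∑ᶠ s, S s = 0 := by
    refine eq_zero_of_eq_neg k ?_
    rw [← finsum_neg_distrib]
    refine finsum_eq_of_bijective τ τ.bijective fun s => ?_
    have hw : w (τ s) = w s := by
      simp only [w, τ, Equiv.coe_fn_mk]
      congr 1
      ring
    refine (congrArg (w s • ·) (TwoStep.partialSum_exchange hloc (hα _) (hα _) (hα _))).trans
      ((smul_neg _ _).trans (congrArg Neg.neg ?_))
    exact congrArg (· • TwoStep.partialSum v (α s.2.2) (α s.2.1) (α s.1)) hw.symm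
  -- The second family is the first one with the two leading corollas exchanged, so its sum vanishes
  -- as well.
  have hσ : ∀ s, w s • ∑ᶠ y : TwoStep (.edge s.1 s.2.1) (.edge s.2.2 v),
      TwoStep.wt k y • y.edgeEdge (α s.1) (α s.2.1) (α s.2.2) = S s + S (σ s) := fun s => by
    have hw : w (σ s) = w s := by
      simp only [w, σ, Equiv.coe_fn_mk]
      congr 1
      ring
    change _ = _ + w (σ s) • TwoStep.partialSum v (α s.2.1) (α s.1) (α s.2.2)
    rw [TwoStep.finsum_edgeEdge hloc (hα _) (hα _), smul_add, hw]
  rw [finsum_congr hσ, finsum_add_distrib hS, finsum_comp_equiv σ, h₀, add_zero]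
  exact (hS.image σ.symm).subset fun s hs => ⟨σ s, hs, σ.symm_apply_apply s⟩

/-- The Bianchi identity. -/
theorem bianchi (hloc : T = .properad → P.LocallyFinite) {α : ∀ v, Conv P A v}
    (hα : ∀ v, α v ∈ Conv.deg P A v 0) (v : Corolla T) :
    Conv.d P A v (curvature α v) + loops (curvature α) v + bracket (curvature α) α v = 0 := by
  have hc : curvature α = (fun v => Conv.d P A v (α v)) + loops α + (2 : k)⁻¹ • bracket α α := rfl
  -- The factor ½ in the curvature cancels the factors 2 in the derivation rules for d and Δ on [α,
  -- α]. The remaining terms cancel in pairs across `h₁`, `h₂` and `h₃`.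
  have h₁ : Conv.d P A v (curvature α v) = -loops (fun v => Conv.d P A v (α v)) v -
      bracket (fun v => Conv.d P A v (α v)) α v := by
    simp only [curvature, map_add, map_smul, Conv.d_d, d_loops, d_bracket hloc hα, zero_add, smul_neg,
      smul_smul, inv_mul_cancel₀ (two_ne_zero (α := k)), one_smul, sub_eq_add_neg]
  have h₂ : loops (curvature α) v = loops (fun v => Conv.d P A v (α v)) v -
      bracket (loops α) α v := by
    rw [hc, loops_add, loops_add, loops_loops, loops_smul, loops_bracket hloc hα]
    simp only [add_zero, smul_neg, smul_smul, inv_mul_cancel₀ (two_ne_zero (α := k)), one_smul,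
      sub_eq_add_neg]
  have h₃ : bracket (curvature α) α v = bracket (fun v => Conv.d P A v (α v)) α v +
      bracket (loops α) α v := by
    rw [hc, bracket_add_left hloc, bracket_add_left hloc, bracket_smul_left hloc,
      bracket_bracket hloc hα, smul_zero, add_zero]
  rw [h₁, h₂, h₃]
  abel

end Bianchi

end FeynmanME

namespace FeynmanME

/-! ### Invariance under isomorphisms, and degrees -/

section Invariance

variable {k : Type u} [Field k] [CharZero k] {T : Kind} {P : Op k T true} {A : Op k T false}

/-- Compatibility of a family with all isomorphisms of corollas. -/
def IsInvariant (α : ∀ v, Conv P A v) : Prop :=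
  ∀ {a v : Corolla T} (σ : UGen a v), σ.g.deg = 0 → Conv.un P A σ (α a) = α v

theorem Conv.un_iso_un {a v v' : Corolla T} (σ : Iso v v') (γ : UGen a v) (x : Conv P A a) :
    Conv.un P A σ.1 (Conv.un P A γ x) = Conv.un P A (γ.post σ) x :=
  Conv.un_un _ _ _ rfl (by simp [Gph.sh, UGen.post_deg, σ.2]) x

theorem Conv.un_iso_bin {a b v v' : Corolla T} (σ : Iso v v') (γ : BGen a b v) (x : Conv P A a)
    (y : Conv P A b) : Conv.un P A σ.1 (Conv.bin P A γ x y) = Conv.bin P A (γ.post σ) x y :=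
  Conv.un_bin _ _ _ rfl (by simp [Gph.sh, BGen.post_deg, σ.2]) x y

theorem un_loops (α : ∀ v, Conv P A v) {v v' : Corolla T} (σ : Iso v v') :
    Conv.un P A σ.1 (loops α v) = loops α v' := by
  refine ((Conv.un P A σ.1).toAddMonoidHom.map_finsum (Set.toFinite _)).trans
    (finsum_eq_of_bijective _ (UGen.postEquiv 1 σ).bijective fun γ => ?_)
  refine ((Conv.un P A σ.1).map_smul _ _).trans ?_
  rw [Conv.un_iso_un]
  rfl

theorem un_bracket (hloc : T = .properad → P.LocallyFinite) (α β : ∀ v, Conv P A v)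
    {v v' : Corolla T} (σ : Iso v v') : Conv.un P A σ.1 (bracket α β v) = bracket α β v' := by
  refine ((Conv.un P A σ.1).toAddMonoidHom.map_finsum
    (support_smul_finite (bracket_support hloc _ _ _) _)).trans
    (finsum_eq_of_bijective _ (BGen.postEquiv σ).bijective fun γ => ?_)
  refine ((Conv.un P A σ.1).map_smul _ _).trans ?_
  rw [Conv.un_iso_bin]
  rfl

/-- Composition with an isomorphism of the target permutes the contractions onto it and preserves
their sources, hence also their weights. -/
theorem IsInvariant.curvature (hloc : T = .properad → P.LocallyFinite) {α : ∀ v, Conv P A v}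
    (hα : IsInvariant α) : IsInvariant (curvature α) := by
  intro a v σ hσ
  have h₁ := un_loops α ⟨σ, hσ⟩
  have h₂ := un_bracket hloc α α ⟨σ, hσ⟩
  simp only at h₁ h₂
  rw [FeynmanME.curvature, map_add, map_add, map_smul, h₁, h₂, ← Conv.d_un_of_deg_zero σ hσ, hα σ hσ]
  rfl

theorem loops_mem_deg {α : ∀ v, Conv P A v} (hα : ∀ v, α v ∈ Conv.deg P A v 0) (v : Corolla T) :
    loops α v ∈ Conv.deg P A v 1 :=
  finsum_induction (· ∈ Conv.deg P A v 1) (zero_mem _) (fun _ _ => add_mem) fun γ => Submodule.smul_mem _ _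
    (Conv.un_mem_deg _ (by simp [Gph.sh, γ.2.2]) (hα _))

theorem bracket_mem_deg {α β : ∀ v, Conv P A v} {m n : ℤ} (h : m + 1 = n)
    (hα : ∀ v, α v ∈ Conv.deg P A v 0) (hβ : ∀ v, β v ∈ Conv.deg P A v m) (v : Corolla T) :
    bracket α β v ∈ Conv.deg P A v n :=
  finsum_induction (· ∈ Conv.deg P A v n) (zero_mem _) (fun _ _ => add_mem) fun γ => Submodule.smul_mem _ _
    (Conv.bin_mem_deg _ (by simp [Gph.sh, γ.2.2.2, h]) (hα _) (hβ _))

theorem curvature_mem_deg {α : ∀ v, Conv P A v} (hα : ∀ v, α v ∈ Conv.deg P A v 0)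
    (v : Corolla T) : curvature α v ∈ Conv.deg P A v 1 :=
  add_mem (add_mem (Conv.d_mem_deg (zero_add 1) (hα v)) (loops_mem_deg hα v))
    (Submodule.smul_mem _ _ (bracket_mem_deg (zero_add 1) hα hα v))

end Invariance

end FeynmanME

namespace FeynmanME

/-! ### Evaluation of functionals on the first factor -/

section Evaluation

variable {k : Type u} [Field k] {T : Kind} {P : Op k T true} {A : Op k T false}

namespace Conv

/-- Evaluation of a functional of degree `i` on the first factor. -/
noncomputable def ev {v : Corolla T} {i : ℤ} (f : Module.Dual k (P.X v i)) :
    Conv P A v →ₗ[k] A.Tot v :=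
  (TensorProduct.lid k _).toLinearMap ∘ₗ
    TensorProduct.map (f ∘ₗ P.proj v i) LinearMap.id

theorem ev_tmul {v : Corolla T} {i : ℤ} (f : Module.Dual k (P.X v i)) (p : P.Tot v) (o : A.Tot v) :
    ev f (p ⊗ₜ[k] o) = f (P.proj v i p) • o := by simp [ev]

theorem ev_pure {v : Corolla T} {i j : ℤ} (f : Module.Dual k (P.X v i)) (p : P.X v i)
    (o : A.X v j) : ev f (pure P A p o) = f p • A.inc v j o := by
  rw [ev_tmul, P.proj_inc_same]

theorem ev_pure_ne {v : Corolla T} {i i' j : ℤ} (h : i' ≠ i) (f : Module.Dual k (P.X v i))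
    (p : P.X v i') (o : A.X v j) : ev f (pure P A p o) = 0 := by
  rw [ev_tmul, P.proj_inc_ne v h, map_zero, zero_smul]

theorem ev_add {v : Corolla T} {i : ℤ} (f f' : Module.Dual k (P.X v i)) (x : Conv P A v) :
    ev (f + f') x = ev f x + ev f' x := by
  refine LinearMap.congr_fun (g := ev f + ev f') (TensorProduct.ext' fun p o => ?_) x
  simp [ev_tmul, add_smul]

theorem ev_smul {v : Corolla T} {i : ℤ} (c : k) (f : Module.Dual k (P.X v i)) (x : Conv P A v) :
    ev (c • f) x = c • ev f x := by
  refine LinearMap.congr_fun (g := c • ev f) (TensorProduct.ext' fun p o => ?_) x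
  simp [ev_tmul, mul_smul]

end Conv

/-- The index set of the chosen homogeneous basis. -/
abbrev Op.HIndex (P : Op k T true) (v : Corolla T) : Type u :=
  Σ i : ℤ, Module.Basis.ofVectorSpaceIndex k (P.X v i)

/-- The basis of the total space consisting of the chosen bases of the homogeneous components. -/
noncomputable def Op.totBasis (P : Op k T true) (v : Corolla T) :
    Module.Basis (P.HIndex v) k (P.Tot v) :=
  DFinsupp.basis (hBasis P v)

theorem Op.totBasis_repr (P : Op k T true) (v : Corolla T) (s : P.HIndex v) (x : P.Tot v) :
    (P.totBasis v).repr x s = (hBasis P v s.1).coord s.2 (P.proj v s.1 x) := rfl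

theorem Op.totBasis_apply (P : Op k T true) (v : Corolla T) (s : P.HIndex v) :
    P.totBasis v s = P.inc v s.1 (hBasis P v s.1 s.2) := by
  classical
  rw [Module.Basis.apply_eq_iff]
  ext t
  rw [P.totBasis_repr]
  obtain ⟨i, p⟩ := s
  obtain ⟨j, q⟩ := t
  by_cases h : i = j
  · subst h
    rw [P.proj_inc_same, Module.Basis.coord_apply, Module.Basis.repr_self, Finsupp.single_apply,
      Finsupp.single_apply]
    simp
  · rw [P.proj_inc_ne v h, map_zero, Finsupp.single_apply, if_neg]
    exact fun h' => h (congrArg Sigma.fst h')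

theorem Op.finite_hIndex (hfin : P.LevelwiseFinite) (v : Corolla T) : Finite (P.HIndex v) :=
  have := hfin v
  Module.Finite.finite_basis (P.totBasis v)

theorem Op.finite_index (hfin : P.LevelwiseFinite) (v : Corolla T) (i : ℤ) :
    Finite (Module.Basis.ofVectorSpaceIndex k (P.X v i)) :=
  have := P.finite_hIndex hfin v
  Finite.of_injective (Sigma.mk (β := fun i => Module.Basis.ofVectorSpaceIndex k (P.X v i)) i)
    sigma_mk_injective

namespace Conv

theorem repr_eq_ev {v : Corolla T} [DecidableEq (P.HIndex v)] (x : Conv P A v)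
    (s : P.HIndex v) :
    TensorProduct.equivFinsuppOfBasisLeft (P.totBasis v) x s =
      ev ((hBasis P v s.1).coord s.2) x := by
  rw [TensorProduct.equivFinsuppOfBasisLeft_apply]
  rfl

/-- The coordinates with respect to the homogeneous basis of `P(v)` are themselves evaluations of
functionals; no finiteness is needed for this direction. -/
theorem ext_ev {v : Corolla T} {x y : Conv P A v}
    (h : ∀ (i : ℤ) (f : Module.Dual k (P.X v i)), ev f x = ev f y) : x = y := by
  classical
  refine (TensorProduct.equivFinsuppOfBasisLeft (P.totBasis v)).injective (Finsupp.ext fun s => ?_)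
  rw [repr_eq_ev, repr_eq_ev, h]

theorem eq_sum (hfin : P.LevelwiseFinite) {v : Corolla T} (x : Conv P A v) :
    x = ∑ᶠ s : P.HIndex v, P.inc v s.1 (hBasis P v s.1 s.2) ⊗ₜ[k]
      ev ((hBasis P v s.1).coord s.2) x := by
  classical
  have := P.finite_hIndex hfin v
  have := Fintype.ofFinite (P.HIndex v)
  conv_lhs => rw [← (TensorProduct.equivFinsuppOfBasisLeft (P.totBasis v)).symm_apply_apply x,
    TensorProduct.equivFinsuppOfBasisLeft_symm_apply, Finsupp.sum_fintype _ _ (by simp)]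
  rw [finsum_eq_sum_of_fintype]
  exact Finset.sum_congr rfl fun s _ => by rw [repr_eq_ev, P.totBasis_apply]

/-- This is P(v) ⊗ A(v) ≅ Hom(P(v)*, A(v)), where finite dimension of `P(v)` is essential: the
values on the dual basis serve as coordinates. -/
theorem exists_ev (hfin : P.LevelwiseFinite) {v : Corolla T}
    (Φ : ∀ i, Module.Dual k (P.X v i) →ₗ[k] A.Tot v) :
    ∃ x : Conv P A v, ∀ i (f : Module.Dual k (P.X v i)), ev f x = Φ i f := by
  classical
  have := P.finite_hIndex hfin v
  have := P.finite_index hfin v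
  refine ⟨(TensorProduct.equivFinsuppOfBasisLeft (P.totBasis v)).symm
    (Finsupp.equivFunOnFinite.symm fun s => Φ s.1 ((hBasis P v s.1).coord s.2)), fun i f => ?_⟩
  set x := (TensorProduct.equivFinsuppOfBasisLeft (P.totBasis v)).symm
    (Finsupp.equivFunOnFinite.symm fun s => Φ s.1 ((hBasis P v s.1).coord s.2)) with hx
  have key : ∀ s : P.HIndex v, ev ((hBasis P v s.1).coord s.2) x =
      Φ s.1 ((hBasis P v s.1).coord s.2) := fun s => by
    rw [← repr_eq_ev, hx, LinearEquiv.apply_symm_apply]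
    rfl
  let L : Module.Dual k (P.X v i) →ₗ[k] A.Tot v :=
    { toFun f := ev f x
      map_add' f f' := ev_add f f' x
      map_smul' c f := ev_smul c f x }
  have : L = Φ i := (hBasis P v i).dualBasis.ext fun p => by
    rw [Module.Basis.coe_dualBasis]
    exact key ⟨i, p⟩
  exact LinearMap.congr_fun this f

theorem ev_mem_of_deg {v : Corolla T} {m i j : ℤ} (h : i + j = m) (f : Module.Dual k (P.X v i))
    {x : Conv P A v} (hx : x ∈ deg P A v m) :
    ∃ y, ev f x = A.inc v j y := by
  have : ev f x ∈ LinearMap.range (A.inc v j) := by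
    refine map_mem_of_pure_deg (ev f) _ (fun i' j' p o h' => ?_) hx
    by_cases hi : i' = i
    · subst hi
      obtain rfl : j' = j := by lia
      rw [ev_pure]
      exact ⟨f p • o, map_smul _ _ _⟩
    · rw [ev_pure_ne hi]
      exact zero_mem _
  obtain ⟨y, hy⟩ := this
  exact ⟨y, hy.symm⟩

theorem mem_deg_of_ev (hfin : P.LevelwiseFinite) {v : Corolla T} {m : ℤ} {x : Conv P A v}
    (h : ∀ i j, i + j = m → ∀ f : Module.Dual k (P.X v i), ∃ y, ev f x = A.inc v j y) :
    x ∈ deg P A v m := by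
  rw [eq_sum hfin x]
  refine finsum_induction (· ∈ Conv.deg P A v m) (zero_mem _) (fun _ _ => add_mem) fun s => ?_
  obtain ⟨y, hy⟩ := h s.1 (m - s.1) (by lia) ((hBasis P v s.1).coord s.2)
  rw [hy]
  exact pure_mem_deg (by lia) _ _

theorem ev_un {a v : Corolla T} (γ : UGen a v) {i i' : ℤ} (h : i + γ.g.sh true = i')
    (f : Module.Dual k (P.X v i')) (x : Conv P A a) :
    ev f (un P A γ x) = A.totUn γ (ev (f ∘ₗ P.un γ h) x) := by
  refine eq_of_pure (ev f ∘ₗ un P A γ) (A.totUn γ ∘ₗ ev (f ∘ₗ P.un γ h)) (fun j j' p o => ?_) x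
  simp only [LinearMap.comp_apply]
  rw [un_pure γ rfl rfl]
  by_cases hj : j = i
  · subst hj
    subst h
    rw [ev_pure, ev_pure, map_smul, A.totUn_inc γ rfl]
    rfl
  · rw [ev_pure_ne hj, ev_pure_ne, map_zero]
    lia

/-- The functional of degree i' detects the component of degree i' in `P`, and moving the
differential of `A` past that component produces the sign. -/
theorem ev_d {v : Corolla T} {i i' : ℤ} (h : i + 1 = i') (f : Module.Dual k (P.X v i'))
    (x : Conv P A v) :
    ev f (d P A v x) = ev (f ∘ₗ P.d h) x + i'.negOnePow • A.totD v (ev f x) := by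
  refine eq_of_pure (ev f ∘ₗ d P A v)
    (ev (f ∘ₗ P.d h) + i'.negOnePow • (A.totD v ∘ₗ ev f)) (fun j j' p o => ?_) x
  simp only [LinearMap.comp_apply, LinearMap.add_apply, LinearMap.smul_apply]
  rw [d_pure rfl rfl, map_add, negOnePow_smul_eq_ite, negOnePow_smul_eq_ite, apply_ite (ev f),
    map_neg]
  by_cases hj : j = i
  · subst hj
    subst h
    rw [ev_pure, ev_pure, ev_pure_ne (by lia), ev_pure_ne (by lia), map_zero]
    simp only [neg_zero, ite_self]
    rfl
  · rw [ev_pure_ne (i := i') (i' := j + 1) (by lia), ev_pure_ne hj]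
    by_cases hj' : j = i'
    · subst hj'
      rw [ev_pure, ev_pure, map_smul, A.totD_inc rfl]
    · rw [ev_pure_ne hj', ev_pure_ne hj', map_zero]
      simp only [neg_zero, ite_self]

end Conv

end Evaluation

end FeynmanME

namespace FeynmanME

/-! ### Two-vertex operations in terms of dual bases -/

section EvaluationBin

variable {k : Type u} [Field k] [CharZero k] {T : Kind} {P : Op k T true} {A : Op k T false}

theorem Conv.eq_sum_pure (hfin : P.LevelwiseFinite) {v : Corolla T} [Fintype (P.HIndex v)]
    {x : Conv P A v} {xs : ∀ s : P.HIndex v, A.X v (-s.1)}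
    (hx : ∀ s : P.HIndex v, ev ((hBasis P v s.1).coord s.2) x = A.inc v _ (xs s)) :
    x = ∑ s : P.HIndex v, pure P A (hBasis P v s.1 s.2) (xs s) := by
  conv_lhs => rw [eq_sum hfin x]
  rw [finsum_eq_sum_of_fintype]
  simp only [hx]

/-- The right hand side has the shape of the two-vertex part of the differential of the Feynman
transform. Its sign is the Koszul sign of moving an element of `A` of degree -j past an element of
`P` of degree i - 1 - j. -/
theorem Conv.ev_bin (hfin : P.LevelwiseFinite) {a b v : Corolla T} (γ : BGen a b v)
    (hγ : γ.g.deg = 1) {x : Conv P A a} {y : Conv P A b}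
    {xs : ∀ s : P.HIndex a, A.X a (-s.1)} {ys : ∀ s : P.HIndex b, A.X b (-s.1)}
    (hx : ∀ s : P.HIndex a, ev ((hBasis P a s.1).coord s.2) x = A.inc a _ (xs s))
    (hy : ∀ s : P.HIndex b, ev ((hBasis P b s.1).coord s.2) y = A.inc b _ (ys s))
    {i n : ℤ} (hn : ∀ j : ℤ, -j + -(i - 1 - j) + γ.g.sh false = n)
    (hi : ∀ j : ℤ, j + (i - 1 - j) + γ.g.sh true = i)
    (f : Module.Dual k (P.X v i)) :
    ev f (bin P A γ x y) = ∑ᶠ j : ℤ, (j * (i - 1 - j)).negOnePow •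
        ∑ᶠ (p : Module.Basis.ofVectorSpaceIndex k (P.X a j))
          (q : Module.Basis.ofVectorSpaceIndex k (P.X b (i - 1 - j))),
          f (P.bin γ (hi j) (hBasis P a j p) (hBasis P b (i - 1 - j) q)) •
            A.inc v n (A.bin γ (hn j) (xs ⟨j, p⟩) (ys ⟨i - 1 - j, q⟩)) := by
  classical
  have := P.finite_hIndex hfin a
  have := P.finite_hIndex hfin b
  have := Fintype.ofFinite (P.HIndex a)
  have := Fintype.ofFinite (P.HIndex b)
  have hfa := P.finite_index hfin a
  have hfb := P.finite_index hfin b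
  let F : P.HIndex a → P.HIndex b → A.Tot v := fun s t =>
    ev f (bin P A γ (pure P A (hBasis P a s.1 s.2) (xs s)) (pure P A (hBasis P b t.1 t.2) (ys t)))
  have h₁ : ev f (bin P A γ x y) = ∑ᶠ s, ∑ᶠ t, F s t := by
    rw [eq_sum_pure hfin hx, eq_sum_pure hfin hy]
    simp only [map_sum, LinearMap.sum_apply, finsum_eq_sum_of_fintype]
    exact Finset.sum_comm
  -- A contraction raises the degree in `P` by one, so `f` sees only pairs of basis elements whose
  -- degrees add up to i - 1.
  have h₂ : ∀ (s : P.HIndex a) (t : P.HIndex b), t.1 ≠ i - 1 - s.1 → F s t = 0 := by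
    intro s t hst
    simp only [F]
    rw [bin_pure γ rfl rfl, negOnePow_smul_eq_ite, apply_ite (ev f), map_neg, ev_pure_ne, neg_zero,
      ite_self]
    have := hi s.1
    lia
  have h₃ : ∀ s : P.HIndex a, ∑ᶠ t, F s t = ∑ᶠ q, F s ⟨i - 1 - s.1, q⟩ := fun s => by
    rw [finsum_sigma_of_finite _ (Set.toFinite _), finsum_eq_single _ (i - 1 - s.1)]
    intro j hj
    exact finsum_eq_zero_of_forall_eq_zero fun q => h₂ s ⟨j, q⟩ hj
  rw [h₁, finsum_congr h₃, finsum_sigma_of_finite _ (Set.toFinite _)]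
  refine finsum_congr fun j => ?_
  -- The sign acts through the units of ℤ; rewritten as a scalar of `k` it can be moved inside a sum
  -- over a finite index set.
  have hsm : ∀ (m : ℤ) (z : A.Tot v), m.negOnePow • z = ((m.negOnePow : ℤ) : k) • z := fun m z => by
    rw [Units.smul_def, Int.cast_smul_eq_zsmul]
  rw [hsm, smul_finsum' _ (Set.toFinite _)]
  refine finsum_congr fun p => ?_
  rw [smul_finsum' _ (Set.toFinite _)]
  refine finsum_congr fun q => ?_
  simp only [F]
  rw [bin_pure γ (hi j) (hn j), ← hsm, negOnePow_smul_eq_ite, negOnePow_smul_eq_ite,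
    apply_ite (ev f), map_neg, ev_pure]
  simp only [Int.even_mul, even_neg]

end EvaluationBin

end FeynmanME

namespace FeynmanME

/-! ### Morphisms of raw structures -/

section RawHoms

variable {k : Type u} [Field k] {T : Kind} {odd : Bool}

/-- Linear maps which are compatible with the differentials and the operations. -/
structure RawHom (M N : RawOp k T odd) : Type u where
  app : ∀ (v : Corolla T) (n : ℤ), M.X v n →ₗ[k] N.X v n
  app_d : ∀ {v : Corolla T} {i n : ℤ} (h : i + 1 = n) (x : M.X v i),
    app v n (M.d h x) = N.d h (app v i x)
  app_un : ∀ {a v : Corolla T} (γ : UGen a v) {i n : ℤ} (h : i + γ.g.sh odd = n) (x : M.X a i),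
    app v n (M.un γ h x) = N.un γ h (app a i x)
  app_bin : ∀ {a b v : Corolla T} (γ : BGen a b v) {i j n : ℤ} (h : i + j + γ.g.sh odd = n)
    (x : M.X a i) (y : M.X b j),
    app v n (M.bin γ h x y) = N.bin γ h (app a i x) (app b j y)

theorem map_negOnePow_smul {V W : Type*} [AddCommGroup V] [AddCommGroup W] [Module k V] [Module k W]
    (f : V →ₗ[k] W) (m : ℤ) (x : V) : f (m.negOnePow • x) = m.negOnePow • f x := by
  rw [negOnePow_smul_eq_ite, negOnePow_smul_eq_ite, apply_ite f, map_neg]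

/-- Each law is an expression in the operations with signs, hence is preserved by any map compatible
with them. This makes the structural relations vanish under every map into an operad, and shows that
pullbacks are operads. -/
theorem RawHom.law {M N : RawOp k T odd} (f : RawHom M N) {v : Corolla T} {n : ℤ} {x : M.X v n}
    (hx : M.Law x) : N.Law (f.app v n x) := by
  cases hx with
  | d_d h₁ h₂ x => rw [f.app_d, f.app_d]; exact .d_d h₁ h₂ _
  | d_un γ h₁ h₂ h₁' h₂' x =>
    rw [map_sub, map_negOnePow_smul, f.app_d, f.app_un, f.app_un, f.app_d]
    exact .d_un γ h₁ h₂ h₁' h₂' _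
  | d_bin γ h₁ h₂ hi hj h₃ h₄ x y =>
    rw [map_sub, map_negOnePow_smul, map_add, map_negOnePow_smul, f.app_d, f.app_bin, f.app_bin,
      f.app_bin, f.app_d, f.app_d]
    exact .d_bin γ h₁ h₂ hi hj h₃ h₄ _ _
  | un_one γ hγ h x => rw [map_sub, f.app_un]; exact .un_one γ hγ h _
  | un_un γ₁ γ₂ γ hγ h₁ h₂ h x =>
    rw [map_sub, f.app_un, f.app_un, f.app_un]; exact .un_un γ₁ γ₂ γ hγ h₁ h₂ h _
  | un_bin γ₁ γ₂ γ hγ h₁ h₂ h x y =>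
    rw [map_sub, f.app_un, f.app_bin, f.app_bin]; exact .un_bin γ₁ γ₂ γ hγ h₁ h₂ h _ _
  | bin_un γ₁ γ₂ γ hγ h₁ h₂ h x y =>
    rw [map_sub, f.app_bin, f.app_un, f.app_bin]; exact .bin_un γ₁ γ₂ γ hγ h₁ h₂ h _ _
  | bin_swap γ γ' hγ h h' x y =>
    rw [map_sub, map_negOnePow_smul, f.app_bin, f.app_bin]; exact .bin_swap γ γ' hγ h h' _ _
  | un_un_comm γ₁ γ₂ γ₁' γ₂' hγ hne h₁ h₂ h₁' h₂' x =>
    rw [map_sub, map_negOnePow_smul, f.app_un, f.app_un, f.app_un, f.app_un]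
    exact .un_un_comm γ₁ γ₂ γ₁' γ₂' hγ hne h₁ h₂ h₁' h₂' _
  | un_bin_comm γ₁ γ₂ γ₁' γ₂' hγ hne h₁ h₂ h₁' h₂' x y =>
    rw [map_sub, map_negOnePow_smul, f.app_un, f.app_bin, f.app_un, f.app_bin]
    exact .un_bin_comm γ₁ γ₂ γ₁' γ₂' hγ hne h₁ h₂ h₁' h₂' _ _
  | un_bin_assoc γ₁ γ₂ γ₁' γ₂' hγ h₁ h₂ h₁' h₂' x y =>
    rw [map_sub, map_negOnePow_smul, f.app_un, f.app_bin, f.app_bin, f.app_un]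
    exact .un_bin_assoc γ₁ γ₂ γ₁' γ₂' hγ h₁ h₂ h₁' h₂' _ _
  | bin_bin_assoc γ₁ γ₂ γ₁' γ₂' hγ h₁ h₂ h₁' h₂' x y z =>
    rw [map_sub, map_negOnePow_smul, map_negOnePow_smul, f.app_bin, f.app_bin, f.app_bin, f.app_bin]
    exact .bin_bin_assoc γ₁ γ₂ γ₁' γ₂' hγ h₁ h₂ h₁' h₂' _ _ _

end RawHoms

/-! ### Maps out of the Feynman transform -/

section FeynmanTransformMaps

variable {k : Type u} [Field k] {T : Kind} {P : Op k T true} {A : Op k T false}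

/-- The value of a formal monomial, when generators are sent to the components of `α`. -/
noncomputable def Mono.eval (α : ∀ v, Conv P A v) : ∀ {v : Corolla T} {n : ℤ}, Mono P v n → A.X v n
  | v, n, .gen _ f => A.proj v n (Conv.ev f (α v))
  | _, _, .d h x => A.d h (Mono.eval α x)
  | _, _, .un γ h x => A.un γ h (Mono.eval α x)
  | _, _, .bin γ h x y => A.bin γ h (Mono.eval α x) (Mono.eval α y)

/-- The extension of a family to formal linear combinations of monomials. -/
noncomputable def freeEval (α : ∀ v, Conv P A v) : RawHom (freeRaw P) A.toRawOp where
  app v n := Finsupp.linearCombination k fun x : Mono P v n => Mono.eval α x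
  app_d {v i n} h x := by
    refine LinearMap.congr_fun (f := Finsupp.linearCombination k (fun x : Mono P v n => Mono.eval α x) ∘ₗ
      (freeRaw P).d h) (g := A.d h ∘ₗ Finsupp.linearCombination k fun x : Mono P v i => Mono.eval α x)
      (Finsupp.lhom_ext' fun m => LinearMap.ext_ring ?_) x
    simp [Mono.eval]
  app_un {a v} γ i n h x := by
    refine LinearMap.congr_fun (f := Finsupp.linearCombination k (fun x : Mono P v n => Mono.eval α x) ∘ₗ
      (freeRaw P).un γ h) (g := A.un γ h ∘ₗ
        Finsupp.linearCombination k fun x : Mono P a i => Mono.eval α x)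
      (Finsupp.lhom_ext' fun m => LinearMap.ext_ring ?_) x
    simp [Mono.eval]
  app_bin {a b v} γ i j n h x y := by
    induction x using Finsupp.induction_linear with
    | zero => simp
    | add x x' hx hx' => simp only [map_add, LinearMap.add_apply, hx, hx']
    | single m c =>
      induction y using Finsupp.induction_linear with
      | zero => simp
      | add y y' hy hy' => simp only [map_add, hy, hy']
      | single m' c' =>
        rw [← Finsupp.smul_single_one m c, ← Finsupp.smul_single_one m' c']
        simp only [map_smul, LinearMap.smul_apply]
        congr 2
        simp [Mono.eval]

theorem freeEval_gen (α : ∀ v, Conv P A v) {v : Corolla T} {i n : ℤ} (h : i + n = 0)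
    (f : Module.Dual k (P.X v i)) :
    (freeEval α).app v n (genFree P h f) = A.proj v n (Conv.ev f (α v)) := by
  simp [freeEval, genFree, Mono.eval]

/-- The family `α` consists of the values of `Φ` on generators. -/
def RestrictsTo (Φ : RawHom (freeRaw P) A.toRawOp) (α : ∀ v, Conv P A v) : Prop :=
  ∀ {v : Corolla T} {i n : ℤ} (h : i + n = 0) (f : Module.Dual k (P.X v i)),
    Conv.ev f (α v) = A.inc v n (Φ.app v n (genFree P h f))

theorem freeEval_restrictsTo {α : ∀ v, Conv P A v} (hα : ∀ v, α v ∈ Conv.deg P A v 0) :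
    RestrictsTo (freeEval α) α := by
  intro v i n h f
  obtain ⟨y, hy⟩ := Conv.ev_mem_of_deg h f (hα v)
  rw [freeEval_gen, hy, A.proj_inc_same]

theorem RestrictsTo.mem_deg (hfin : P.LevelwiseFinite) {Φ : RawHom (freeRaw P) A.toRawOp}
    {α : ∀ v, Conv P A v} (hΦ : RestrictsTo Φ α) (v : Corolla T) : α v ∈ Conv.deg P A v 0 :=
  Conv.mem_deg_of_ev hfin fun _ _ h f => ⟨_, hΦ h f⟩

theorem RestrictsTo.ev_loops {Φ : RawHom (freeRaw P) A.toRawOp} {α : ∀ v, Conv P A v}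
    (hΦ : RestrictsTo Φ α) {v : Corolla T} {i n : ℤ} (h : i + n = 0)
    (f : Module.Dual k (P.X v i)) :
    Conv.ev f (loops α v) = A.inc v (n + 1) (Φ.app v (n + 1) (loopTerm P h f)) := by
  refine ((Conv.ev f).toAddMonoidHom.map_finsum (Set.toFinite _)).trans (Eq.trans ?_
    ((A.inc v (n + 1) ∘ₗ Φ.app v (n + 1)).toAddMonoidHom.map_finsum (Set.toFinite _)).symm)
  refine finsum_congr fun γ => ?_
  refine ((Conv.ev f).map_smul _ _).trans (Eq.trans (congrArg _ ?_)
    ((A.inc v (n + 1) ∘ₗ Φ.app v (n + 1)).map_smul _ _).symm)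
  rw [Conv.ev_un γ.2.1 (i := i - 1) (by simp [Gph.sh, γ.2.2]), hΦ (n := n + 1) (by lia),
    A.totUn_inc γ.2.1 (n := n + 1) (by simp [Gph.sh]), LinearMap.comp_apply, Φ.app_un]

variable [CharZero k]

/-- The transpose of the two-vertex contractions was written with dual bases; expanding α in the
same bases identifies it, term by term, with the bracket. -/
theorem RestrictsTo.ev_bracket (hfin : P.LevelwiseFinite)
    (hloc : T = .properad → P.LocallyFinite) {Φ : RawHom (freeRaw P) A.toRawOp}
    {α : ∀ v, Conv P A v}
    (hΦ : RestrictsTo Φ α) {v : Corolla T} {i n : ℤ} (h : i + n = 0)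
    (f : Module.Dual k (P.X v i)) :
    (2 : k)⁻¹ • Conv.ev f (bracket α α v) =
      A.inc v (n + 1) (Φ.app v (n + 1) (edgeTerm P h f)) := by
  have hfi := P.finite_index hfin
  have hfh := P.finite_hIndex hfin
  let L := A.inc v (n + 1) ∘ₗ Φ.app v (n + 1)
  change _ = L _
  rw [edgeTerm, map_smul]
  refine congrArg _ ?_
  refine ((Conv.ev f).toAddMonoidHom.map_finsum
    (support_smul_finite (bracket_support hloc _ _ _) _)).trans (Eq.trans ?_
    (L.toAddMonoidHom.map_finsum ?_).symm)
  -- The terms agree for each contraction separately; what remains afterwards is the finiteness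
  -- needed to move the linear map inside the sums.
  · refine finsum_congr fun γ => ?_
    refine ((Conv.ev f).map_smul _ _).trans (Eq.trans (congrArg _ ?_) (L.map_smul _ _).symm)
    rw [Conv.ev_bin hfin γ.2.2.1 γ.2.2.2 (fun s => hΦ (add_neg_cancel s.1) _)
      (fun s => hΦ (add_neg_cancel s.1) _) (n := n + 1) (by intro j; rw [Gph.sh_false]; lia)
      (by intro j; rw [Gph.sh_true_of_deg _ γ.2.2.2]; lia)]
    refine Eq.trans ?_ (L.toAddMonoidHom.map_finsum ?_).symm
    · refine finsum_congr fun j => ?_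
      refine Eq.trans (congrArg _ ?_) (map_negOnePow_smul L _ _).symm
      refine Eq.trans ?_ (L.toAddMonoidHom.map_finsum (Set.toFinite _)).symm
      refine finsum_congr fun p => ?_
      refine Eq.trans ?_ (L.toAddMonoidHom.map_finsum (Set.toFinite _)).symm
      refine finsum_congr fun q => ?_
      refine Eq.trans (congrArg _ ?_) (L.map_smul _ _).symm
      rw [LinearMap.comp_apply, Φ.app_bin]
    · refine (Set.toFinite (Set.range (Sigma.fst : P.HIndex γ.1 → ℤ))).subset fun j hj => ?_
      by_contra hj'
      refine hj ?_
      have : IsEmpty (Module.Basis.ofVectorSpaceIndex k (P.X γ.1 j)) :=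
        ⟨fun p => hj' ⟨⟨j, p⟩, rfl⟩⟩
      exact (congrArg _ (finsum_of_isEmpty _)).trans (smul_zero _)
  · refine (P.totBin_support_finite hloc v).subset fun γ hγ h0 => hγ ?_
    have key : ∀ {i' j n : ℤ} (h : i' + j + γ.2.2.1.g.sh true = n) (x : P.X γ.1 i')
        (y : P.X γ.2.1 j), P.bin γ.2.2.1 h x y = 0 := fun h x y =>
      P.inc_injective _ _ (by rw [← P.totBin_inc, h0]; simp)
    simp only [key, map_zero, zero_smul, finsum_zero, smul_zero]

/-- Up to a sign, the evaluated curvature is the image of the relation that prescribes the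
differential on a generator. Thus the master equation is equivalent to compatibility with the
differential. -/
theorem RestrictsTo.ev_curvature (hfin : P.LevelwiseFinite)
    (hloc : T = .properad → P.LocallyFinite) {Φ : RawHom (freeRaw P) A.toRawOp}
    {α : ∀ v, Conv P A v} (hΦ : RestrictsTo Φ α) {v : Corolla T} {i n : ℤ} (h : i + n = 0)
    (f : Module.Dual k (P.X v i)) :
    Conv.ev f (curvature α v) = -((n + 1).negOnePow • A.inc v (n + 1) (Φ.app v (n + 1)
      ((freeRaw P).d rfl (genFree P h f) - (n + 1).negOnePow •
        (genFree P (i := i - 1) (n := n + 1) (by lia) (f ∘ₗ P.d (by lia)) +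
          loopTerm P h f + edgeTerm P h f)))) := by
  rw [curvature, map_add, map_add, map_smul, hΦ.ev_bracket hfin hloc h, hΦ.ev_loops h,
    Conv.ev_d (i := i - 1) (by lia), hΦ (n := n + 1) (by lia), hΦ h, A.totD_inc rfl, map_sub,
    map_negOnePow_smul, map_add, map_add, Φ.app_d, map_sub, map_negOnePow_smul, map_add, map_add,
    smul_sub, smul_smul]
  have h1 : (n + 1).negOnePow * (n + 1).negOnePow = 1 := by
    rw [← Int.negOnePow_add]; exact Int.negOnePow_even _ ⟨_, rfl⟩
  -- A generator dual to degree i has degree n = -i, so the sign in front of the differential of `A`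
  -- is opposite to the sign in the relation.
  have h2 : i.negOnePow = -(n + 1).negOnePow := by
    rw [show i = -n by lia, Int.negOnePow_neg, Int.negOnePow_succ, neg_neg]
  rw [h1, h2, one_smul, Units.neg_smul]
  abel

/-- Solutions of the master equation in `P ⊗ A`. -/
structure IsMC (α : ∀ v, Conv P A v) : Prop where
  mem_deg : ∀ v, α v ∈ Conv.deg P A v 0
  invariant : IsInvariant α
  curvature_eq_zero : ∀ v, curvature α v = 0

/-- Degree zero holds because a functional of degree i goes to degree -i; invariance and vanishing
curvature are the relations `gen_iso` and `gen_d`, tested against all functionals. -/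
theorem RestrictsTo.isMC (hfin : P.LevelwiseFinite)
    (hloc : T = .properad → P.LocallyFinite) {Φ : RawHom (freeRaw P) A.toRawOp}
    {α : ∀ v, Conv P A v} (hΦ : RestrictsTo Φ α)
    (h : ∀ {v n} (x : (freeRaw P).X v n), FTRel P x → Φ.app v n x = 0) : IsMC α where
  mem_deg := hΦ.mem_deg hfin
  invariant := by
    intro a v σ hσ
    refine Conv.ext_ev fun i f => ?_
    have h0 := h _ (FTRel.gen_iso σ hσ (add_neg_cancel i) (by simp [Gph.sh, hσ])
      (by simp [Gph.sh]) f)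
    rw [map_sub, sub_eq_zero, Φ.app_un] at h0
    rw [Conv.ev_un σ (i := i) (by simp [Gph.sh, hσ]), hΦ (add_neg_cancel i),
      A.totUn_inc σ (n := -i) (by simp [Gph.sh]), h0, hΦ]
  curvature_eq_zero v := by
    refine Conv.ext_ev fun i f => ?_
    rw [hΦ.ev_curvature hfin hloc (add_neg_cancel i), h _ (FTRel.gen_d (add_neg_cancel i) f)]
    simp

theorem IsMC.freeEval_eq_zero (hfin : P.LevelwiseFinite)
    (hloc : T = .properad → P.LocallyFinite) {α : ∀ v, Conv P A v} (hα : IsMC α)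
    {v : Corolla T} {n : ℤ} {x : (freeRaw P).X v n} (hx : FTRel P x) :
    (freeEval α).app v n x = 0 := by
  have hΦ : RestrictsTo (freeEval α) α := freeEval_restrictsTo hα.mem_deg
  induction hx with
  | law hx => exact A.law ((freeEval α).law hx)
  | gen_add h f f' =>
    rw [map_sub, map_add, freeEval_gen, freeEval_gen, freeEval_gen, Conv.ev_add, map_add, sub_self]
  | gen_smul h c f =>
    rw [map_sub, map_smul, freeEval_gen, freeEval_gen, Conv.ev_smul, map_smul, sub_self]
  | @gen_iso a v σ hσ i n h hi hn f =>
    refine A.inc_injective _ _ ?_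
    rw [map_sub, (freeEval α).app_un, map_sub, map_zero, ← A.totUn_inc σ hn, ← hΦ, ← hΦ,
      ← Conv.ev_un, hα.invariant σ hσ, sub_self]
  | gen_d h f =>
    have := hΦ.ev_curvature hfin hloc h f
    rw [hα.curvature_eq_zero, map_zero, eq_comm, neg_eq_zero, smul_eq_zero_iff_eq] at this
    exact A.inc_injective _ _ (this.trans (map_zero _).symm)
  | d h hx ih => rw [(freeEval α).app_d, ih, map_zero]
  | un γ h hx ih => rw [(freeEval α).app_un, ih, map_zero]
  | bin_left γ h y hx ih => rw [(freeEval α).app_bin, ih, map_zero, LinearMap.zero_apply]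
  | bin_right γ h x hy ih => rw [(freeEval α).app_bin, ih, map_zero]

end FeynmanTransformMaps

end FeynmanME

namespace FeynmanME

/-! ### The universal property of the Feynman transform -/

section FeynmanTransformUniversal

variable {k : Type u} [Field k] {T : Kind}

namespace Op

variable {odd : Bool}

/-- The identity. -/
noncomputable def Hom.id (M : Op k T odd) : Hom M M where
  app _ _ := LinearMap.id
  app_d _ _ := rfl
  app_un _ _ _ _ _ := rfl
  app_bin _ _ _ _ _ _ _ := rfl

/-- Composition of morphisms, first `f`, then `g`. -/
noncomputable def Hom.comp {L M N : Op k T odd} (f : Hom L M) (g : Hom M N) : Hom L N where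
  app v n := g.app v n ∘ₗ f.app v n
  app_d h x := by simp only [LinearMap.comp_apply, f.app_d, g.app_d]
  app_un γ _ _ h x := by simp only [LinearMap.comp_apply, f.app_un, g.app_un]
  app_bin γ _ _ _ h x y := by simp only [LinearMap.comp_apply, f.app_bin, g.app_bin]

theorem Hom.comp_app {L M N : Op k T odd} (f : Hom L M) (g : Hom M N) (v : Corolla T) (n : ℤ)
    (x : L.X v n) : (f.comp g).app v n x = g.app v n (f.app v n x) := rfl

/-- The map induced on total spaces. -/
noncomputable def Hom.tot {M N : Op k T odd} (f : Hom M N) (v : Corolla T) :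
    M.Tot v →ₗ[k] N.Tot v :=
  DirectSum.toModule k ℤ _ fun i => N.inc v i ∘ₗ f.app v i

theorem Hom.tot_inc {M N : Op k T odd} (f : Hom M N) (v : Corolla T) (i : ℤ) (x : M.X v i) :
    f.tot v (M.inc v i x) = N.inc v i (f.app v i x) :=
  by simp [tot]

end Op

variable {P : Op k T true} {A B : Op k T false}

theorem Conv.ev_map (g : A.Tot v →ₗ[k] B.Tot v) {i : ℤ} (f : Module.Dual k (P.X v i))
    (x : Conv P A v) : ev f (TensorProduct.map LinearMap.id g x : Conv P B v) = g (ev f x) := by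
  refine LinearMap.congr_fun (f := ev f ∘ₗ TensorProduct.map LinearMap.id g) (g := g ∘ₗ ev f)
    (TensorProduct.ext' fun p o => ?_) x
  simp [ev_tmul]

namespace FT

/-- The map on formal linear combinations of monomials underlying a map out of `FT P`. -/
noncomputable def toRaw (φ : Op.Hom (FT P) A) : RawHom (freeRaw P) A.toRawOp where
  app v n := φ.app v n ∘ₗ (ftSub P v n).mkQ
  app_d h x := φ.app_d h ((ftSub P _ _).mkQ x)
  app_un γ _ _ h x := φ.app_un γ h ((ftSub P _ _).mkQ x)
  app_bin γ _ _ _ h x y := φ.app_bin γ h ((ftSub P _ _).mkQ x) ((ftSub P _ _).mkQ y)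

theorem toRaw_rel (φ : Op.Hom (FT P) A) {v : Corolla T} {n : ℤ} {x : (freeRaw P).X v n}
    (hx : FTRel P x) : (toRaw φ).app v n x = 0 :=
  (congrArg (φ.app v n) ((Submodule.Quotient.mk_eq_zero _).2 (Submodule.subset_span hx))).trans
    (map_zero _)

/-- Maps which respect the relations descend to the Feynman transform. -/
noncomputable def lift (Φ : RawHom (freeRaw P) A.toRawOp)
    (h : ∀ {v n} (x : (freeRaw P).X v n), FTRel P x → Φ.app v n x = 0) : Op.Hom (FT P) A where
  app v n := (ftSub P v n).liftQ (Φ.app v n) (Submodule.span_le.2 fun x hx => h x hx)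
  app_d h x := by
    obtain ⟨x, rfl⟩ := Submodule.Quotient.mk_surjective _ x
    exact Φ.app_d h x
  app_un γ _ _ h x := by
    obtain ⟨x, rfl⟩ := Submodule.Quotient.mk_surjective _ x
    exact Φ.app_un γ h x
  app_bin γ _ _ _ h x y := by
    obtain ⟨x, rfl⟩ := Submodule.Quotient.mk_surjective _ x
    obtain ⟨y, rfl⟩ := Submodule.Quotient.mk_surjective _ y
    exact Φ.app_bin γ h x y

theorem lift_gen (Φ : RawHom (freeRaw P) A.toRawOp)
    (h : ∀ {v n} (x : (freeRaw P).X v n), FTRel P x → Φ.app v n x = 0) {v : Corolla T} {i n : ℤ}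
    (hn : i + n = 0) (f : Module.Dual k (P.X v i)) :
    (lift Φ h).app v n (gen P hn f) = Φ.app v n (genFree P hn f) := rfl

/-- The Feynman transform is generated by the dual of `P` under the operations and the differential,
so induction on formal monomials suffices. -/
theorem hom_ext {φ ψ : Op.Hom (FT P) A}
    (h : ∀ {v : Corolla T} {i n : ℤ} (h : i + n = 0) (f : Module.Dual k (P.X v i)),
      φ.app v n (gen P h f) = ψ.app v n (gen P h f)) : φ = ψ := by
  have key : ∀ {v : Corolla T} {n : ℤ} (m : Mono P v n),
      (toRaw φ).app v n (Finsupp.single m 1) = (toRaw ψ).app v n (Finsupp.single m 1) := by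
    intro v n m
    induction m with
    | gen hn f => exact h hn f
    | @d v i n hn x ih =>
      have h1 : (Finsupp.single (Mono.d hn x) 1 : (freeRaw P).X v n) =
        (freeRaw P).d hn (Finsupp.single x (1 : k)) := by simp
      rw [h1, (toRaw φ).app_d, (toRaw ψ).app_d, ih]
    | @un a v γ i n hn x ih =>
      have h1 : (Finsupp.single (Mono.un γ hn x) 1 : (freeRaw P).X v n) =
        (freeRaw P).un γ hn (Finsupp.single x (1 : k)) := by simp
      rw [h1, (toRaw φ).app_un, (toRaw ψ).app_un, ih]
    | @bin a b v γ i j n hn x y ihx ihy =>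
      have h1 : (Finsupp.single (Mono.bin γ hn x y) 1 : (freeRaw P).X v n) =
        (freeRaw P).bin γ hn (Finsupp.single x (1 : k)) (Finsupp.single y (1 : k)) := by simp
      rw [h1, (toRaw φ).app_bin, (toRaw ψ).app_bin, ihx, ihy]
  refine Op.Hom.ext (funext₂ fun v n => LinearMap.ext fun x => ?_)
  obtain ⟨x, rfl⟩ := Submodule.Quotient.mk_surjective _ x
  exact LinearMap.congr_fun (f := (toRaw φ).app v n) (g := (toRaw ψ).app v n)
    (Finsupp.lhom_ext' fun m => LinearMap.ext_ring (key m)) x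

/-- The relations `gen_add` and `gen_smul` make the values on generators linear in the functional,
which is what is required to represent them by an element of the tensor product. -/
theorem exists_restrictsTo (hfin : P.LevelwiseFinite) (φ : Op.Hom (FT P) A) :
    ∃ α : ∀ v, Conv P A v, RestrictsTo (toRaw φ) α := by
  have h (v : Corolla T) : ∃ x : Conv P A v, ∀ i (f : Module.Dual k (P.X v i)),
      Conv.ev f x = A.inc v (-i) ((toRaw φ).app v (-i) (genFree P (add_neg_cancel i) f)) :=
    Conv.exists_ev hfin fun i =>
      { toFun f := A.inc v (-i) ((toRaw φ).app v (-i) (genFree P (add_neg_cancel i) f))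
        map_add' f f' := by
          rw [← map_add, ← map_add]
          refine congrArg _ (sub_eq_zero.1 ?_)
          rw [← map_sub]
          exact toRaw_rel φ (.gen_add _ f f')
        map_smul' c f := by
          rw [RingHom.id_apply, ← map_smul, ← map_smul]
          refine congrArg _ (sub_eq_zero.1 ?_)
          rw [← map_sub]
          exact toRaw_rel φ (.gen_smul _ c f) }
  choose α hα using h
  refine ⟨α, fun {v i n} h f => ?_⟩
  obtain rfl : n = -i := by lia
  exact hα v i f

theorem _root_.FeynmanME.RestrictsTo.unique {Φ : RawHom (freeRaw P) A.toRawOp}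
    {α α' : ∀ v, Conv P A v} (h : RestrictsTo Φ α) (h' : RestrictsTo Φ α') : α = α' :=
  funext fun _ => Conv.ext_ev fun i f => by rw [h (add_neg_cancel i), h' (add_neg_cancel i)]

variable [CharZero k]

/-- Maps out of the Feynman transform are solutions of the master equation. -/
noncomputable def homEquiv (hfin : P.LevelwiseFinite) (hloc : T = .properad → P.LocallyFinite) :
    Op.Hom (FT P) A ≃ {α : ∀ v, Conv P A v // IsMC α} where
  toFun φ := ⟨(exists_restrictsTo hfin φ).choose,
    RestrictsTo.isMC hfin hloc (exists_restrictsTo hfin φ).choose_spec fun _ => toRaw_rel φ⟩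
  invFun α := lift (freeEval α.1) fun _ hx => α.2.freeEval_eq_zero hfin hloc hx
  left_inv φ := hom_ext fun {v i n} h f => by
    rw [lift_gen, freeEval_gen, (exists_restrictsTo hfin φ).choose_spec h, A.proj_inc_same]
    rfl
  right_inv α := Subtype.ext (RestrictsTo.unique (exists_restrictsTo hfin _).choose_spec
    fun h f => freeEval_restrictsTo α.2.mem_deg h f)

theorem ev_homEquiv (hfin : P.LevelwiseFinite) (hloc : T = .properad → P.LocallyFinite)
    (φ : Op.Hom (FT P) A) {v : Corolla T} {i n : ℤ} (h : i + n = 0)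
    (f : Module.Dual k (P.X v i)) :
    Conv.ev f ((homEquiv hfin hloc φ).1 v) = A.inc v n (φ.app v n (gen P h f)) :=
  (exists_restrictsTo hfin φ).choose_spec h f

theorem homEquiv_comp (hfin : P.LevelwiseFinite) (hloc : T = .properad → P.LocallyFinite)
    (φ : Op.Hom (FT P) A) (g : Op.Hom A B) (v : Corolla T) :
    (homEquiv hfin hloc (φ.comp g)).1 v =
      TensorProduct.map LinearMap.id (g.tot v) ((homEquiv hfin hloc φ).1 v) := by
  refine Conv.ext_ev fun i f => ?_
  rw [Conv.ev_map, ev_homEquiv hfin hloc _ (add_neg_cancel i),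
    ev_homEquiv hfin hloc _ (add_neg_cancel i), g.tot_inc]
  rfl

end FT

end FeynmanTransformUniversal

end FeynmanME

namespace FeynmanME

/-! ### Weak equivalences -/

section WeakEquivalences

variable {k : Type u} [Field k]

/-- The criterion up to refinements quantifies over all test modules; testing on `k` recovers
elements. -/
theorem mono_homologyMap_iff_forall {K L : CochainComplex (ModuleCat.{u} k) ℤ} (φ : K ⟶ L)
    {i j n : ℤ} (hi : i + 1 = j) (hn : j + 1 = n) :
    CategoryTheory.Mono (HomologicalComplex.homologyMap φ j) ↔
      ∀ x : K.X j, K.d j n x = 0 → ∀ y : L.X i, φ.f j x = L.d i j y → ∃ x', x = K.d i j x' := by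
  rw [HomologicalComplex.mono_homologyMap_iff_up_to_refinements φ i j n (by simp; lia) (by simp; lia)]
  constructor
  · intro h x hx y hxy
    obtain ⟨A', π, hπ, x₁, hx₁⟩ := h (A := ModuleCat.of k k)
      (ModuleCat.ofHom (LinearMap.toSpanSingleton k _ x)) (by ext; simp [hx])
      (ModuleCat.ofHom (LinearMap.toSpanSingleton k _ y)) (by ext; simp [hxy])
    obtain ⟨a, ha⟩ := (ModuleCat.epi_iff_surjective π).1 hπ (1 : k)
    refine ⟨x₁ a, ?_⟩
    have := ConcreteCategory.congr_hom hx₁ a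
    simpa [ha] using this
  · intro h A x₂ hx₂ y₁ hy₁
    have h' (a : A) : ∃ x', x₂ a = K.d i j x' :=
      h (x₂ a) (ConcreteCategory.congr_hom hx₂ a) (y₁ a) (ConcreteCategory.congr_hom hy₁ a)
    choose s hs using h'
    -- The chosen preimages need not depend linearly on `a`. The free module on the underlying set
    -- of `A` is an epimorphic cover on which any choice extends linearly.
    refine ⟨ModuleCat.of k (A →₀ k), ModuleCat.ofHom (Finsupp.linearCombination k _root_.id),
      (ModuleCat.epi_iff_surjective _).2 fun a => ⟨Finsupp.single a 1, by simp⟩,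
      ModuleCat.ofHom (Finsupp.linearCombination k s), ?_⟩
    ext a
    simp [hs]

theorem epi_homologyMap_iff_forall {K L : CochainComplex (ModuleCat.{u} k) ℤ} (φ : K ⟶ L)
    {i j n : ℤ} (hi : i + 1 = j) (hn : j + 1 = n) :
    Epi (HomologicalComplex.homologyMap φ j) ↔
      ∀ y : L.X j, L.d j n y = 0 → ∃ x, K.d j n x = 0 ∧ ∃ y', y = φ.f j x + L.d i j y' := by
  rw [HomologicalComplex.epi_homologyMap_iff_up_to_refinements φ i j n (by simp; lia) (by simp; lia)]
  constructor
  · intro h y hy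
    obtain ⟨A', π, hπ, x₁, hx₁, y₁, hy₁⟩ := h (A := ModuleCat.of k k)
      (ModuleCat.ofHom (LinearMap.toSpanSingleton k _ y)) (by ext; simp [hy])
    obtain ⟨a, ha⟩ := (ModuleCat.epi_iff_surjective π).1 hπ (1 : k)
    refine ⟨x₁ a, ConcreteCategory.congr_hom hx₁ a, y₁ a, ?_⟩
    have := ConcreteCategory.congr_hom hy₁ a
    simpa [ha] using this
  · intro h A y₂ hy₂
    choose s hs s' hs' using fun a : A => h (y₂ a) (ConcreteCategory.congr_hom hy₂ a)
    refine ⟨ModuleCat.of k (A →₀ k), ModuleCat.ofHom (Finsupp.linearCombination k _root_.id),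
      (ModuleCat.epi_iff_surjective _).2 fun a => ⟨Finsupp.single a 1, by simp⟩,
      ModuleCat.ofHom (Finsupp.linearCombination k s), ?_,
      ModuleCat.ofHom (Finsupp.linearCombination k s'), ?_⟩
    · ext a
      simp [hs]
    · ext a
      simpa using hs' a

namespace Op

variable {T : Kind} {odd : Bool}

/-- The kernel of `p` is acyclic. -/
def Hom.KerAcyclic {M N : Op k T odd} (p : Hom M N) : Prop :=
  ∀ {v : Corolla T} {i j n : ℤ} (hi : i + 1 = j) (hn : j + 1 = n) (x : M.X v j),
    p.app v j x = 0 → M.d hn x = 0 → ∃ y : M.X v i, p.app v i y = 0 ∧ M.d hi y = x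

theorem complex_d_apply (M : Op k T odd) (v : Corolla T) {i j : ℤ} (h : i + 1 = j)
    (x : M.X v i) : (M.complex v).d i j x = M.d h x := by
  subst h
  simp [complex]
  rfl

theorem isWeakEq_iff {M N : Op k T odd} (p : Hom M N) :
    p.IsWeakEq ↔ ∀ (v : Corolla T) {i j n : ℤ} (hi : i + 1 = j) (hn : j + 1 = n),
      (∀ x : M.X v j, M.d hn x = 0 → ∀ y : N.X v i, p.app v j x = N.d hi y →
        ∃ x', x = M.d hi x') ∧
      ∀ y : N.X v j, N.d hn y = 0 → ∃ x, M.d hn x = 0 ∧ ∃ y', y = p.app v j x + N.d hi y' := by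
  refine forall_congr' fun v => ?_
  have h₁ : ∀ j : ℤ, QuasiIsoAt (p.chain v) j ↔
      CategoryTheory.Mono (HomologicalComplex.homologyMap (p.chain v) j) ∧
      Epi (HomologicalComplex.homologyMap (p.chain v) j) := fun j => by
    rw [quasiIsoAt_iff_isIso_homologyMap, isIso_iff_mono_and_epi]
  have h₂ : ∀ {i j n : ℤ} (hi : i + 1 = j) (hn : j + 1 = n),
      (CategoryTheory.Mono (HomologicalComplex.homologyMap (p.chain v) j) ↔
      ∀ x : M.X v j, M.d hn x = 0 → ∀ y : N.X v i, p.app v j x = N.d hi y →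
        ∃ x', x = M.d hi x') ∧ (Epi (HomologicalComplex.homologyMap (p.chain v) j) ↔
      ∀ y : N.X v j, N.d hn y = 0 → ∃ x, M.d hn x = 0 ∧ ∃ y', y = p.app v j x + N.d hi y') := by
    intro i j n hi hn
    rw [mono_homologyMap_iff_forall _ hi hn, epi_homologyMap_iff_forall _ hi hn]
    simp only [← complex_d_apply]
    exact ⟨Iff.rfl, Iff.rfl⟩
  constructor
  · intro h i j n hi hn
    have := (h₁ j).1 ((quasiIso_iff _).1 h j)
    exact ⟨(h₂ hi hn).1.1 this.1, (h₂ hi hn).2.1 this.2⟩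
  · intro h
    refine (quasiIso_iff _).2 fun j => (h₁ j).2 ?_
    have := h (i := j - 1) (j := j) (by lia) rfl
    exact ⟨(h₂ _ _).1.2 this.1, (h₂ _ _).2.2 this.2⟩

/-- A cocycle x of the kernel is dz for some z, by injectivity on cohomology. Then the image of z is
closed, hence equals the image of a cocycle w up to a coboundary; lifting a primitive of the latter
to u gives the element z - w - du of the kernel, with differential x. -/
theorem Hom.IsWeakEq.kerAcyclic {M N : Op k T odd} {p : Hom M N} (hp : p.IsWeakEq)
    (hf : p.IsFib) : p.KerAcyclic := by
  intro v i j n hi hn x hx hdx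
  have h := fun {i j n : ℤ} (hi : i + 1 = j) (hn : j + 1 = n) => (isWeakEq_iff p).1 hp v hi hn
  obtain ⟨z, hz⟩ := (h hi hn).1 x hdx 0 (by rw [hx, map_zero])
  obtain ⟨w, hw, y', hy'⟩ := (h (i := i - 1) (by lia) hi).2 (p.app v i z)
    (by rw [← p.app_d, ← hz, hx])
  obtain ⟨u, hu⟩ := hf v (i - 1) y'
  refine ⟨z - w - M.d (by lia) u, ?_, ?_⟩
  · rw [map_sub, map_sub, p.app_d, hu, hy']
    abel
  · rw [map_sub, map_sub, hw, M.law (.d_d _ hi u), ← hz, sub_zero, sub_zero]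

/-- Surjectivity provides lifts of elements, and acyclicity of the kernel corrects them to cocycles
or primitives. Acyclic fibrations can thus be handled through their kernels. -/
theorem Hom.KerAcyclic.isWeakEq {M N : Op k T odd} {p : Hom M N} (hp : p.KerAcyclic)
    (hf : p.IsFib) : p.IsWeakEq := by
  refine (isWeakEq_iff p).2 fun v i j n hi hn => ⟨fun x hx y hy => ?_, fun y hy => ?_⟩
  · obtain ⟨z, rfl⟩ := hf v i y
    obtain ⟨w, -, hw⟩ := hp hi hn (x - M.d hi z) (by rw [map_sub, hy, p.app_d, sub_self])
      (by rw [map_sub, hx, M.law (.d_d _ hn z), sub_self])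
    exact ⟨z + w, by rw [map_add, hw]; abel⟩
  · obtain ⟨z, rfl⟩ := hf v j y
    obtain ⟨w, hw, hw'⟩ := hp hn rfl (M.d hn z) (by rw [p.app_d, hy]) (M.law (.d_d hn rfl z))
    exact ⟨z - w, by rw [map_sub, hw', sub_self], 0, by simp [hw]⟩

theorem Hom.IsWeakEq.of_comp_right {L M N : Op k T odd} {f : Hom L M} {g : Hom M N}
    (hf : f.IsWeakEq) (hfg : (f.comp g).IsWeakEq) : g.IsWeakEq := by
  intro v
  have h : (f.comp g).chain v = f.chain v ≫ g.chain v := by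
    ext n x
    rfl
  have := hf v
  have h' := hfg v
  rw [h] at h'
  exact quasiIso_of_comp_left (f.chain v) (g.chain v)

theorem Hom.IsWeakEq.of_comp_left {L M N : Op k T odd} {f : Hom L M} {g : Hom M N}
    (hg : g.IsWeakEq) (hfg : (f.comp g).IsWeakEq) : f.IsWeakEq := by
  intro v
  have h : (f.comp g).chain v = f.chain v ≫ g.chain v := by
    ext n x
    rfl
  have := hg v
  have h' := hfg v
  rw [h] at h'
  exact quasiIso_of_comp_right (f.chain v) (g.chain v)

theorem Hom.isWeakEq_id (M : Op k T odd) : (Hom.id M).IsWeakEq := by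
  intro v
  have h : (Hom.id M).chain v = 𝟙 _ := by
    ext n x
    rfl
  rw [h]
  infer_instance

theorem Hom.IsWeakEq.comp {L M N : Op k T odd} {f : Hom L M} {g : Hom M N}
    (hf : f.IsWeakEq) (hg : g.IsWeakEq) : (f.comp g).IsWeakEq := by
  intro v
  have h : (f.comp g).chain v = f.chain v ≫ g.chain v := by
    ext n x
    rfl
  have := hf v
  have := hg v
  rw [h]
  infer_instance

end Op

end WeakEquivalences

end FeynmanME

namespace FeynmanME

/-! ### Forms on the interval -/

section Interval

open Polynomial

variable {k : Type u} [Field k]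

namespace Omega

/-- The value at a vertex. -/
noncomputable def vertex (k : Type u) [Field k] {n : ℕ} (i : Fin (n + 1)) : Omega k n →ₐ[k] k :=
  lift (fun j => if j = i then 1 else 0) (fun _ => 0) (fun _ _ => mul_comm _ _)
    (fun _ _ => mul_comm _ _) (fun _ _ => by simp) (by simp) (by simp)

theorem vertex_t {n : ℕ} (i j : Fin (n + 1)) : vertex k i (t k j) = if j = i then 1 else 0 :=
  lift_t _ _ _ _ _ _ _ _

theorem vertex_dt {n : ℕ} (i j : Fin (n + 1)) : vertex k i (dt k j) = 0 :=
  lift_dt _ _ _ _ _ _ _ _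

theorem algebraMap_vertex (x : Omega k 0) : algebraMap k (Omega k 0) (vertex k 0 x) = x := by
  have : (Algebra.ofId k (Omega k 0)).comp (vertex k 0) = AlgHom.id k _ := by
    have ht : t k (0 : Fin 1) = 1 := by simpa using sum_t (k := k) 0
    have hdt : dt k (0 : Fin 1) = 0 := by simpa using sum_dt (k := k) 0
    refine hom_ext (fun i => ?_) (fun i => ?_) <;> rw [Fin.fin_one_eq_zero i]
    · simp [vertex_t, ht]
    · simp [hdt]
  exact DFunLike.congr_fun this x

theorem pull_const {n : ℕ} (i : Fin (n + 1)) (θ : Fin 1 → Fin (n + 1)) (hθ : θ 0 = i)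
    (x : Omega k n) : pull θ x = algebraMap k (Omega k 0) (vertex k i x) := by
  have : pull θ = (Algebra.ofId k (Omega k 0)).comp (vertex k i) := by
    have ht : t k (0 : Fin 1) = 1 := by simpa using sum_t (k := k) 0
    have hdt : dt k (0 : Fin 1) = 0 := by simpa using sum_dt (k := k) 0
    refine hom_ext (fun j => ?_) (fun j => ?_)
    · rw [pull_t, AlgHom.comp_apply, vertex_t, Finset.sum_filter, Fin.sum_univ_one, hθ, ht]
      by_cases h : i = j
      · simp [h]
      · simp [h, Ne.symm h]
    · rw [pull_dt, AlgHom.comp_apply, vertex_dt, Finset.sum_filter, Fin.sum_univ_one, hdt]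
      simp
  exact DFunLike.congr_fun this x

theorem t_one : t k (1 : Fin 2) = 1 - t k 0 := by
  have := sum_t (k := k) 1
  rw [Fin.sum_univ_two] at this
  rw [← this, add_sub_cancel_left]

theorem dt_one : dt k (1 : Fin 2) = -dt k 0 := by
  have := sum_dt (k := k) 1
  rw [Fin.sum_univ_two] at this
  exact (neg_eq_of_add_eq_zero_right this).symm

/-- The form `f(t₀) + g(t₀) dt₀` on the interval. -/
noncomputable def form : k[X] × k[X] →ₗ[k] Omega k 1 :=
  LinearMap.coprod (aeval (t k 0)).toLinearMap
    (LinearMap.mulRight k (dt k 0) ∘ₗ (aeval (t k 0)).toLinearMap)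

theorem form_apply (f g : k[X]) :
    form (f, g) = aeval (t k (0 : Fin 2)) f + aeval (t k 0) g * dt k 0 := rfl

theorem aeval_mul_dt (f : k[X]) (j : Fin 2) :
    aeval (t k (0 : Fin 2)) f * dt k j = dt k j * aeval (t k 0) f := by
  induction f using Polynomial.induction_on' with
  | add p q hp hq => simp only [map_add, add_mul, mul_add, hp, hq]
  | monomial n a =>
    rw [aeval_monomial, mul_assoc, ← mul_assoc (dt k j), ← Algebra.commutes a (dt k j), mul_assoc]
    exact congrArg _ (Commute.pow_left (t_dt 0 j) n)

theorem jet_aeval (f : k[X]) :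
    jet 1 (aeval (t k (0 : Fin 2)) f) = !![aeval (t k 0) f, aeval (t k 0) (derivative f) * dt k 0;
      0, aeval (t k 0) f] := by
  have hM : jet 1 (t k (0 : Fin 2)) = !![t k 0, dt k 0; 0, t k 0] := lift_t _ _ _ _ _ _ _ _
  induction f using Polynomial.induction_on with
  | C a =>
    ext p q
    fin_cases p <;> fin_cases q <;>
      simp [Algebra.algebraMap_eq_smul_one]
  | add p q hp hq =>
    rw [map_add, map_add, hp, hq]
    ext p q
    fin_cases p <;> fin_cases q <;> simp [add_mul]
  | monomial n a h =>
    rw [pow_succ, ← mul_assoc, map_mul, map_mul, h, aeval_X, hM, Matrix.mul_fin_two,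
      derivative_mul (g := X), derivative_X, mul_one, map_add, map_mul _ _ X, aeval_X, add_mul,
      mul_assoc _ _ (dt k 0), t_dt, ← mul_assoc]
    simp [add_comm]

variable [CharZero k]

theorem dt_mul_dt (i j : Fin 2) : dt k i * dt k j = 0 := by
  have h0 : dt k (0 : Fin 2) * dt k (0 : Fin 2) = 0 := by
    have h := dt_dt (k := k) (0 : Fin 2) 0
    have h2 : (2 : k) • (dt k (0 : Fin 2) * dt k 0) = 0 := by
      rw [two_smul]
      nth_rw 1 [h]
      exact neg_add_cancel _
    exact (smul_eq_zero.1 h2).resolve_left two_ne_zero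
  fin_cases i <;> fin_cases j <;> simp [h0, dt_one]

theorem form_mul_form (f g f' g' : k[X]) :
    form (f, g) * form (f', g') = form (f * f', f * g' + g * f') := by
  simp only [form_apply, add_mul, mul_add, map_add, map_mul]
  rw [mul_assoc _ (dt k 0) (aeval _ f'), ← aeval_mul_dt f', ← mul_assoc, ← mul_assoc,
    mul_assoc _ (dt k 0), ← mul_assoc (dt k 0), ← aeval_mul_dt g', mul_assoc _ (dt k 0) (dt k 0),
    dt_mul_dt, mul_zero, mul_zero, add_zero]
  abel

@[simp] theorem form_zero : form (0, 0) = (0 : Omega k 1) := map_zero form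

/-- The elements f + g dt form a subalgebra containing the generators. By the universal property,
`Ω_1` maps to this subalgebra, and the composite with the inclusion is the identity. -/
theorem form_surjective : Function.Surjective (form (k := k)) := by
  let S : Subalgebra k (Omega k 1) :=
    { carrier := Set.range form
      mul_mem' := by
        rintro _ _ ⟨⟨f, g⟩, rfl⟩ ⟨⟨f', g'⟩, rfl⟩
        exact ⟨_, (form_mul_form f g f' g').symm⟩
      add_mem' := by
        rintro _ _ ⟨x, rfl⟩ ⟨y, rfl⟩
        exact ⟨x + y, map_add _ _ _⟩
      algebraMap_mem' := fun r => ⟨(C r, 0), by simp [form_apply]⟩ }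
  have ht : ∀ i, t k i ∈ S := by
    have h0 : t k (0 : Fin 2) ∈ S := ⟨(X, 0), by simp [form_apply]⟩
    intro i
    fin_cases i
    · exact h0
    · change t k (1 : Fin 2) ∈ S
      rw [t_one]
      exact sub_mem (one_mem _) h0
  have hdt : ∀ i, dt k i ∈ S := by
    have h0 : dt k (0 : Fin 2) ∈ S := ⟨(0, 1), by simp [form_apply]⟩
    intro i
    fin_cases i
    · exact h0
    · change dt k (1 : Fin 2) ∈ S
      rw [dt_one]
      exact neg_mem h0
  let F : Omega k 1 →ₐ[k] S := lift (fun i => ⟨t k i, ht i⟩) (fun i => ⟨dt k i, hdt i⟩)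
    (fun i j => Subtype.ext (t_t i j)) (fun i j => Subtype.ext (t_dt i j))
    (fun i j => Subtype.ext (dt_dt i j)) (Subtype.ext (by simpa using sum_t (k := k) 1))
    (Subtype.ext (by simpa using sum_dt (k := k) 1))
  have hF : S.val.comp F = AlgHom.id k _ :=
    hom_ext (fun i => by simp [F, lift_t]) (fun i => by simp [F, lift_dt])
  intro x
  have : (F x : Omega k 1) = x := DFunLike.congr_fun hF x
  rw [← this]
  exact (F x).2

/-- The coefficients of a form on the interval. -/
noncomputable def coeffs : Omega k 1 →ₐ[k] TrivSqZeroExt k[X] k[X] :=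
  lift ![.inl X, .inl (1 - X)] ![.inr 1, .inr (-1)] (fun _ _ => mul_comm _ _)
    (fun _ _ => mul_comm _ _) (fun i j => by fin_cases i <;> fin_cases j <;> simp)
    (by simp [Fin.sum_univ_two, ← TrivSqZeroExt.inl_add])
    (by simp [Fin.sum_univ_two, ← TrivSqZeroExt.inr_add])

theorem coeffs_form (f g : k[X]) : coeffs (form (f, g)) = TrivSqZeroExt.inl f + .inr g := by
  have h : ∀ f : k[X], coeffs (aeval (t k (0 : Fin 2)) f) = TrivSqZeroExt.inl f := by
    intro f
    have : coeffs.comp (aeval (t k (0 : Fin 2))) = TrivSqZeroExt.inlAlgHom k k[X] k[X] := by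
      ext : 1
      simp [coeffs, lift_t]
    exact DFunLike.congr_fun this f
  rw [form_apply, map_add, map_mul, h, h, coeffs, lift_dt]
  refine congrArg _ ?_
  change TrivSqZeroExt.inl g * TrivSqZeroExt.inr (1 : k[X]) = _
  rw [TrivSqZeroExt.inl_mul_inr, smul_eq_mul, mul_one]

/-- Antiderivatives of polynomials. -/
noncomputable def primitive : k[X] →ₗ[k] k[X] :=
  (Polynomial.basisMonomials k).constr k fun n => monomial (n + 1) ((n + 1 : k)⁻¹)

theorem primitive_monomial (n : ℕ) (a : k) :
    primitive (monomial n a) = monomial (n + 1) (a * (n + 1 : k)⁻¹) := by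
  have : monomial n a = a • (Polynomial.basisMonomials k) n := by simp [smul_monomial]
  rw [this, map_smul, primitive, Module.Basis.constr_basis, smul_monomial, smul_eq_mul]

theorem derivative_primitive (f : k[X]) : derivative (primitive f) = f := by
  induction f using Polynomial.induction_on' with
  | add p q hp hq => rw [map_add, map_add, hp, hq]
  | monomial n a =>
    rw [primitive_monomial, derivative_monomial]
    have : (n + 1 : k) ≠ 0 := Nat.cast_add_one_ne_zero n
    simp [this]

theorem primitive_derivative (f : k[X]) : primitive (derivative f) = f - C (f.eval 0) := by
  induction f using Polynomial.induction_on' with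
  | add p q hp hq => rw [map_add, map_add, hp, hq, eval_add, C_add]; abel
  | monomial n a =>
    rw [derivative_monomial, primitive_monomial]
    cases n with
    | zero => simp
    | succ n =>
      have : (n + 1 : k) ≠ 0 := Nat.cast_add_one_ne_zero n
      simp [this]

theorem eval_primitive (f : k[X]) : (primitive f).eval 0 = 0 := by
  induction f using Polynomial.induction_on' with
  | add p q hp hq => rw [map_add, eval_add, hp, hq, add_zero]
  | monomial n a => rw [primitive_monomial]; simp

/-- Integration along the interval, starting at the vertex `1`. -/
noncomputable def integral : Omega k 1 →ₗ[k] Omega k 1 :=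
  form ∘ₗ LinearMap.inl k k[X] k[X] ∘ₗ primitive ∘ₗ
    (TrivSqZeroExt.sndHom k[X] k[X]).restrictScalars k ∘ₗ coeffs.toLinearMap

theorem integral_form (f g : k[X]) : integral (form (f, g)) = form (primitive g, 0) := by
  simp [integral, coeffs_form]

theorem eps_form (f g : k[X]) : eps 1 (form (f, g)) = form (f, -g) := by
  have hdt : jet 1 (dt k (0 : Fin 2)) = !![-dt k 0, 0; 0, dt k 0] := lift_dt _ _ _ _ _ _ _ _
  change jet 1 _ 0 0 = _
  rw [form_apply, map_add, map_mul, jet_aeval, jet_aeval, hdt, Matrix.mul_fin_two, form_apply]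
  simp

theorem d_form (f g : k[X]) : d 1 (form (f, g)) = form (0, derivative f) := by
  have hdt : jet 1 (dt k (0 : Fin 2)) = !![-dt k 0, 0; 0, dt k 0] := lift_dt _ _ _ _ _ _ _ _
  change jet 1 _ 0 1 = _
  rw [form_apply, map_add, map_mul, jet_aeval, jet_aeval, hdt, Matrix.mul_fin_two, form_apply]
  simp [mul_assoc, dt_mul_dt]

theorem vertex_form (i : Fin 2) (f g : k[X]) :
    vertex k i (form (f, g)) = f.eval (if i = 0 then 1 else 0) := by
  rw [form_apply, map_add, map_mul, vertex_dt, mul_zero, add_zero, ← AlgHom.comp_apply,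
    ← Polynomial.aeval_algHom, vertex_t, Polynomial.coe_aeval_eq_eval]
  simp only [eq_comm]

theorem mul_comm_interval (x y : Omega k 1) : x * y = y * x := by
  obtain ⟨⟨f, g⟩, rfl⟩ := form_surjective x
  obtain ⟨⟨f', g'⟩, rfl⟩ := form_surjective y
  rw [form_mul_form, form_mul_form, mul_comm f', add_comm, mul_comm g, mul_comm f g']

theorem mem_gr_zero {w : Omega k 1} : w ∈ gr k 1 0 ↔ ∃ f, w = form (f, 0) := by
  have h : Algebra.adjoin k (Set.range (t k (n := 1))) = (aeval (t k (0 : Fin 2))).range := by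
    refine le_antisymm (Algebra.adjoin_le ?_) ?_
    · rintro _ ⟨i, rfl⟩
      fin_cases i
      · exact ⟨X, by simp⟩
      · exact ⟨1 - X, by simp [t_one]⟩
    · rw [← Algebra.adjoin_singleton_eq_range_aeval]
      exact Algebra.adjoin_mono (Set.singleton_subset_iff.2 ⟨0, rfl⟩)
  rw [gr, pow_zero, mul_one, h]
  refine exists_congr fun f => ?_
  rw [form_apply, map_zero, zero_mul, add_zero, eq_comm]
  rfl

theorem span_dt : Submodule.span k (Set.range (dt k (n := 1))) = Submodule.span k {dt k 0} := by
  refine le_antisymm (Submodule.span_le.2 ?_) (Submodule.span_mono (by simp))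
  rintro _ ⟨i, rfl⟩
  fin_cases i
  · exact Submodule.subset_span rfl
  · change dt k (1 : Fin 2) ∈ _
    rw [dt_one]
    exact neg_mem (Submodule.subset_span rfl)

theorem mem_gr_one {w : Omega k 1} : w ∈ gr k 1 1 ↔ ∃ g, w = form (0, g) := by
  have h : gr k 1 1 = gr k 1 0 * Submodule.span k {dt k 0} := by
    rw [gr, gr, pow_zero, mul_one, pow_one, span_dt]
  rw [h, Submodule.mem_mul_span_singleton]
  constructor
  · rintro ⟨z, hz, rfl⟩
    obtain ⟨f, rfl⟩ := mem_gr_zero.1 hz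
    exact ⟨f, by simp [form_apply]⟩
  · rintro ⟨g, rfl⟩
    exact ⟨_, mem_gr_zero.2 ⟨g, rfl⟩, by simp [form_apply]⟩

theorem gr_eq_bot {r : ℕ} (hr : 2 ≤ r) : gr k 1 r = ⊥ := by
  obtain ⟨r, rfl⟩ := Nat.exists_eq_add_of_le hr
  have : Submodule.span k (Set.range (dt k (n := 1))) ^ 2 = ⊥ := by
    rw [span_dt, Submodule.span_pow, Set.singleton_pow, pow_two, dt_mul_dt,
      Submodule.span_zero_singleton]
  rw [gr, pow_add, this, Submodule.bot_mul, Submodule.mul_bot]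

/-- All later sign computations on the interval need only these cases; the vanishing alternative
covers degrees two and higher. -/
theorem gr_cases {r : ℕ} {w : Omega k 1} (hw : w ∈ gr k 1 r) :
    (r = 0 ∧ ∃ f, w = form (f, 0)) ∨ (r = 1 ∧ ∃ g, w = form (0, g)) ∨ w = 0 := by
  match r, hw with
  | 0, hw => exact .inl ⟨rfl, mem_gr_zero.1 hw⟩
  | 1, hw => exact .inr (.inl ⟨rfl, mem_gr_one.1 hw⟩)
  | r + 2, hw => exact .inr (.inr (by simpa [gr_eq_bot (Nat.le_add_left 2 r)] using hw))

theorem eps_of_mem {r : ℕ} {w : Omega k 1} (hw : w ∈ gr k 1 r) :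
    eps 1 w = (r : ℤ).negOnePow • w := by
  obtain ⟨rfl, f, rfl⟩ | ⟨rfl, g, rfl⟩ | rfl := gr_cases hw
  · simp [eps_form]
  · rw [eps_form, Nat.cast_one, Int.negOnePow_one, Units.neg_smul, one_smul, ← map_neg]
    simp
  · simp

theorem d_mem_gr {r : ℕ} {w : Omega k 1} (hw : w ∈ gr k 1 r) : d 1 w ∈ gr k 1 (r + 1) := by
  obtain ⟨rfl, f, rfl⟩ | ⟨rfl, g, rfl⟩ | rfl := gr_cases hw
  · rw [d_form]
    exact mem_gr_one.2 ⟨_, rfl⟩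
  · rw [d_form]
    simp
  · simp

theorem d_d (w : Omega k 1) : d 1 (d 1 w) = 0 := by
  obtain ⟨⟨f, g⟩, rfl⟩ := form_surjective w
  rw [d_form, d_form]
  simp

theorem mul_mem_gr {r s : ℕ} {w w' : Omega k 1} (hw : w ∈ gr k 1 r) (hw' : w' ∈ gr k 1 s) :
    w * w' ∈ gr k 1 (r + s) := by
  obtain ⟨rfl, f, rfl⟩ | ⟨rfl, g, rfl⟩ | rfl := gr_cases hw
  · obtain ⟨rfl, f', rfl⟩ | ⟨rfl, g', rfl⟩ | rfl := gr_cases hw'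
    · rw [form_mul_form]
      exact mem_gr_zero.2 ⟨f * f', by simp⟩
    · rw [form_mul_form]
      exact mem_gr_one.2 ⟨f * g', by simp⟩
    · simp
  · obtain ⟨rfl, f', rfl⟩ | ⟨rfl, g', rfl⟩ | rfl := gr_cases hw'
    · rw [form_mul_form]
      exact mem_gr_one.2 ⟨g * f', by simp⟩
    · rw [form_mul_form]
      simp
    · simp
  · simp

theorem mul_comm_gr {r s : ℕ} {w w' : Omega k 1} (hw : w ∈ gr k 1 r) (hw' : w' ∈ gr k 1 s) :
    w * w' = ((r : ℤ) * s).negOnePow • (w' * w) := by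
  obtain ⟨rfl, f, rfl⟩ | ⟨rfl, g, rfl⟩ | rfl := gr_cases hw
  · simp [mul_comm_interval]
  · obtain ⟨rfl, f', rfl⟩ | ⟨rfl, g', rfl⟩ | rfl := gr_cases hw'
    · simp [mul_comm_interval]
    · simp [form_mul_form]
    · simp
  · simp

theorem d_mul_gr {r : ℕ} {w : Omega k 1} (hw : w ∈ gr k 1 r) (w' : Omega k 1) :
    d 1 (w * w') = d 1 w * w' + (r : ℤ).negOnePow • (w * d 1 w') := by
  obtain ⟨⟨f', g'⟩, rfl⟩ := form_surjective w'
  obtain ⟨rfl, f, rfl⟩ | ⟨rfl, g, rfl⟩ | rfl := gr_cases hw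
  · simp [form_mul_form, d_form, ← map_add, add_comm, mul_comm]
  · simp [form_mul_form, d_form]
  · simp

theorem integral_mem {r : ℕ} {w : Omega k 1} (hw : w ∈ gr k 1 r) :
    (integral w = 0) ∨ (r = 1 ∧ integral w ∈ gr k 1 0) := by
  obtain ⟨rfl, f, rfl⟩ | ⟨rfl, g, rfl⟩ | rfl := gr_cases hw
  · left; simp [integral_form]
  · right; rw [integral_form]; exact ⟨rfl, mem_gr_zero.2 ⟨_, rfl⟩⟩
  · left; simp

theorem vertex_integral (w : Omega k 1) : vertex k 1 (integral w) = 0 := by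
  obtain ⟨⟨f, g⟩, rfl⟩ := form_surjective w
  rw [integral_form, vertex_form]
  simp [eval_primitive]

/-- The fundamental theorem of calculus. The primitive vanishes where t₀ = 0, which is the vertex 1,
so integration is a homotopy from the identity to evaluation there. -/
theorem d_integral_add (w : Omega k 1) :
    d 1 (integral w) + integral (d 1 w) = w - algebraMap k _ (vertex k 1 w) := by
  obtain ⟨⟨f, g⟩, rfl⟩ := form_surjective w
  rw [integral_form, vertex_form, d_form, d_form, integral_form, derivative_primitive,
    primitive_derivative, ← map_add]
  simp [form_apply]
  abel

theorem vertex_of_mem {r : ℕ} (hr : r ≠ 0) {w : Omega k 1} (hw : w ∈ gr k 1 r) (i : Fin 2) :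
    vertex k i w = 0 := by
  obtain ⟨h, -⟩ | ⟨rfl, g, rfl⟩ | rfl := gr_cases hw
  · exact absurd h hr
  · simp [vertex_form]
  · simp

theorem vertex_d (i : Fin 2) (w : Omega k 1) : vertex k i (d 1 w) = 0 := by
  obtain ⟨⟨f, g⟩, rfl⟩ := form_surjective w
  rw [d_form, vertex_form]
  simp

theorem eq_add_of_interval (w : Omega k 1) :
    ∃ w₀ ∈ gr k 1 0, ∃ w₁ ∈ gr k 1 1, w = w₀ + w₁ := by
  obtain ⟨⟨f, g⟩, rfl⟩ := form_surjective w
  exact ⟨_, mem_gr_zero.2 ⟨f, rfl⟩, _, mem_gr_one.2 ⟨g, rfl⟩, by rw [← map_add]; simp⟩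

end Omega

end Interval

end FeynmanME

namespace FeynmanME

/-! ### Forms on the interval with values in an operad -/

theorem map_negOnePow_smul₂ {k : Type*} [Field k] {U V W : Type*} [AddCommGroup U] [AddCommGroup V]
    [AddCommGroup W] [Module k U] [Module k V] [Module k W] (f : U →ₗ[k] V →ₗ[k] W) (m : ℤ) (x : U)
    (y : V) : f (m.negOnePow • x) y = m.negOnePow • f x y :=
  map_negOnePow_smul (f.flip y) m x

section FormsOnInterval

variable {k : Type u} [Field k] {T : Kind} (A : Op k T false)

/-- The space `A(v) ⊗ Ω_1`. -/
abbrev Forms (v : Corolla T) : Type u := A.Tot v ⊗[k] Omega k 1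

namespace Forms

/-- The differential. -/
noncomputable def d (v : Corolla T) : Forms A v →ₗ[k] Forms A v :=
  TensorProduct.map (A.totD v) LinearMap.id + TensorProduct.map (A.totEps v) (Omega.d 1)

/-- One-vertex operations. -/
noncomputable def un {a v : Corolla T} (γ : UGen a v) : Forms A a →ₗ[k] Forms A v :=
  TensorProduct.map (A.totUn γ) LinearMap.id

/-- Two-vertex operations. -/
noncomputable def bin {a b v : Corolla T} (γ : BGen a b v) :
    Forms A a →ₗ[k] Forms A b →ₗ[k] Forms A v :=
  koszul (A.totBin γ) (LinearMap.mul k (Omega k 1)) (Omega.eps 1) (A.totEps b)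

/-- Elements of total degree `m`. -/
noncomputable def deg (v : Corolla T) (m : ℤ) : Submodule k (Forms A v) :=
  Submodule.span k {x | ∃ (i : ℤ) (r : ℕ) (o : A.X v i) (w : Omega k 1),
    w ∈ Omega.gr k 1 r ∧ i + r = m ∧ x = A.inc v i o ⊗ₜ w}

variable {A}

theorem tmul_mem_deg {v : Corolla T} {i m : ℤ} {r : ℕ} (h : i + r = m) (o : A.X v i)
    {w : Omega k 1} (hw : w ∈ Omega.gr k 1 r) : A.inc v i o ⊗ₜ w ∈ deg A v m :=
  Submodule.subset_span ⟨i, r, o, w, hw, h, rfl⟩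

theorem eq_of_deg {v : Corolla T} {V : Type*} [AddCommGroup V] [Module k V] {m : ℤ}
    (f g : Forms A v →ₗ[k] V)
    (h : ∀ (i : ℤ) (r : ℕ) (o : A.X v i) (w : Omega k 1), w ∈ Omega.gr k 1 r → i + r = m →
      f (A.inc v i o ⊗ₜ w) = g (A.inc v i o ⊗ₜ w))
    {x} (hx : x ∈ deg A v m) : f x = g x := by
  refine LinearMap.eqOn_span (f := f) (g := g) ?_ hx
  rintro _ ⟨i, r, o, w, hw, hm, rfl⟩
  exact h i r o w hw hm

theorem map_mem_of_deg {v : Corolla T} {V : Type*} [AddCommGroup V] [Module k V] {m : ℤ}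
    (f : Forms A v →ₗ[k] V) (S : Submodule k V)
    (h : ∀ (i : ℤ) (r : ℕ) (o : A.X v i) (w : Omega k 1), w ∈ Omega.gr k 1 r → i + r = m →
      f (A.inc v i o ⊗ₜ w) ∈ S)
    {x} (hx : x ∈ deg A v m) : f x ∈ S := by
  have : deg A v m ≤ S.comap f := by
    refine Submodule.span_le.2 ?_
    rintro _ ⟨i, r, o, w, hw, hm, rfl⟩
    exact h i r o w hw hm
  exact this hx

theorem un_tmul {a v : Corolla T} (γ : UGen a v) {i n : ℤ} (h : i + γ.g.sh false = n)
    (o : A.X a i) (w : Omega k 1) :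
    un A γ (A.inc a i o ⊗ₜ w) = A.inc v n (A.un γ h o) ⊗ₜ w := by
  simp [un, Op.totUn_inc _ γ h]

theorem d_tmul {v : Corolla T} {i i' : ℤ} (h : i + 1 = i') (o : A.X v i) (w : Omega k 1) :
    d A v (A.inc v i o ⊗ₜ w) =
      A.inc v i' (A.d h o) ⊗ₜ w + i.negOnePow • (A.inc v i o ⊗ₜ Omega.d 1 w) := by
  simp [d, Op.totD_inc _ h, Op.totEps_inc]
  rfl

variable [CharZero k]

theorem eq_of_tmul {v : Corolla T} {V : Type*} [AddCommGroup V] [Module k V]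
    (f g : Forms A v →ₗ[k] V)
    (h : ∀ (i : ℤ) (r : ℕ) (o : A.X v i) (w : Omega k 1), w ∈ Omega.gr k 1 r →
      f (A.inc v i o ⊗ₜ w) = g (A.inc v i o ⊗ₜ w)) : f = g := by
  refine TensorProduct.ext (A.tot_hom_ext fun i o => LinearMap.ext fun w => ?_)
  obtain ⟨w₀, h₀, w₁, h₁, rfl⟩ := Omega.eq_add_of_interval w
  change f (A.inc v i o ⊗ₜ (w₀ + w₁)) = g (A.inc v i o ⊗ₜ (w₀ + w₁))
  rw [TensorProduct.tmul_add, map_add, map_add, h i 0 o w₀ h₀, h i 1 o w₁ h₁]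

theorem bin_tmul {a b v : Corolla T} (γ : BGen a b v) {i j n : ℤ} (h : i + j + γ.g.sh false = n)
    (o : A.X a i) (o' : A.X b j) {r : ℕ} {w : Omega k 1} (hw : w ∈ Omega.gr k 1 r)
    (w' : Omega k 1) :
    bin A γ (A.inc a i o ⊗ₜ w) (A.inc b j o' ⊗ₜ w') =
      (r * j).negOnePow • (A.inc v n (A.bin γ h o o') ⊗ₜ (w * w')) := by
  rw [bin, koszul_tmul _ _ _ _ _ _ _ _ (Omega.eps_of_mem hw) (A.totEps_inc o'), A.totBin_inc γ h]
  rfl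

theorem d_mem_deg {v : Corolla T} {m n : ℤ} (h : m + 1 = n) {x} (hx : x ∈ deg A v m) :
    d A v x ∈ deg A v n := by
  refine map_mem_of_deg _ _ (fun i r o w hw hm => ?_) hx
  rw [d_tmul rfl, negOnePow_smul_eq_ite]
  have h₂ := tmul_mem_deg (m := n) (by push_cast; lia) o (Omega.d_mem_gr hw)
  refine add_mem (tmul_mem_deg (by lia) _ hw) ?_
  split_ifs
  · exact h₂
  · exact neg_mem h₂

theorem un_mem_deg {a v : Corolla T} (γ : UGen a v) {m n : ℤ} (h : m + γ.g.sh false = n) {x}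
    (hx : x ∈ deg A a m) : un A γ x ∈ deg A v n := by
  refine map_mem_of_deg _ _ (fun i r o w hw hm => ?_) hx
  rw [un_tmul γ rfl]
  exact tmul_mem_deg (by lia) _ hw

theorem bin_mem_deg {a b v : Corolla T} (γ : BGen a b v) {l m n : ℤ}
    (h : l + m + γ.g.sh false = n) {x y} (hx : x ∈ deg A a l) (hy : y ∈ deg A b m) :
    bin A γ x y ∈ deg A v n := by
  refine map_mem_of_deg ((bin A γ).flip y) _ (fun i r o w hw hm => ?_) hx
  refine map_mem_of_deg (bin A γ _) _ (fun j s o' w' hw' hm' => ?_) hy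
  rw [bin_tmul γ rfl o o' hw, negOnePow_smul_eq_ite]
  have := tmul_mem_deg (m := n) (by push_cast; lia) (A.bin γ rfl o o') (Omega.mul_mem_gr hw hw')
  split_ifs
  · exact this
  · exact neg_mem this

theorem d_d (v : Corolla T) (x : Forms A v) : d A v (d A v x) = 0 := by
  refine LinearMap.congr_fun (f := d A v ∘ₗ d A v) (g := 0)
    (eq_of_tmul _ _ fun i r o w hw => ?_) x
  rw [LinearMap.comp_apply, d_tmul rfl, map_add, d_tmul rfl, A.law (.d_d rfl rfl o),
    negOnePow_smul_eq_ite, negOnePow_smul_eq_ite, apply_ite (d A v), map_neg, d_tmul rfl,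
    Omega.d_d, negOnePow_smul_eq_ite]
  by_cases hi : Even i <;>
    simp only [hi, Int.even_add_one, not_true, not_false_iff, if_true, if_false] <;> simp

theorem d_un {a v : Corolla T} (γ : UGen a v) (x : Forms A a) :
    d A v (un A γ x) = un A γ (d A a x) := by
  refine LinearMap.congr_fun (f := d A v ∘ₗ un A γ) (g := un A γ ∘ₗ d A a)
    (eq_of_tmul _ _ fun i r o w hw => ?_) x
  have h0 : γ.g.sh false = 0 := γ.g.sh_false
  have h₁ := sub_eq_zero.1 <| A.law (.d_un γ (n := i + 1 + γ.g.sh false) rfl (by lia) rfl rfl o)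
  simp only [LinearMap.comp_apply]
  rw [un_tmul γ rfl, d_tmul (i' := i + 1 + γ.g.sh false) (by lia), d_tmul rfl, map_add,
    un_tmul γ rfl, h₁]
  simp only [negOnePow_smul_eq_ite, h0, add_zero, Even.zero, if_true]
  split_ifs <;> simp [un_tmul γ rfl]

theorem un_un {a b v : Corolla T} (γ₁ : UGen a b) (γ₂ : UGen b v) (γ : UGen a v)
    (hγ : γ.g = γ₁.g.comp γ₂.g) (x : Forms A a) : un A γ₂ (un A γ₁ x) = un A γ x := by
  refine LinearMap.congr_fun (f := un A γ₂ ∘ₗ un A γ₁) (g := un A γ)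
    (eq_of_tmul _ _ fun i r o w hw => ?_) x
  simp only [LinearMap.comp_apply]
  rw [un_tmul γ₁ rfl, un_tmul γ₂ rfl, un_tmul γ (n := i + γ₁.g.sh false + γ₂.g.sh false)
    (by simp [Gph.sh_false]), sub_eq_zero.1 (A.law (.un_un γ₁ γ₂ γ hγ rfl rfl _ o))]

theorem un_one {v : Corolla T} (γ : UGen v v) (hγ : γ.g = Gph.one _) (x : Forms A v) :
    un A γ x = x := by
  refine LinearMap.congr_fun (f := un A γ) (g := LinearMap.id)
    (eq_of_tmul _ _ fun i r o w hw => ?_) x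
  simp only [LinearMap.id_apply]
  rw [un_tmul γ (n := i) (by simp [Gph.sh_false]), sub_eq_zero.1 (A.law (.un_one γ hγ _ o))]

theorem un_un_comm {a b b' v : Corolla T} (γ₁ : UGen a b) (γ₂ : UGen b v) (γ₁' : UGen a b')
    (γ₂' : UGen b' v) (hγ : γ₁.g.comp γ₂.g = γ₁'.g.comp γ₂'.g) (hne : γ₁.g.E ≠ γ₁'.g.E)
    (x : Forms A a) : un A γ₂ (un A γ₁ x) = un A γ₂' (un A γ₁' x) := by
  refine LinearMap.congr_fun (f := un A γ₂ ∘ₗ un A γ₁) (g := un A γ₂' ∘ₗ un A γ₁')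
    (eq_of_tmul _ _ fun i r o w hw => ?_) x
  have e := sub_eq_zero.1 <| A.law (.un_un_comm γ₁ γ₂ γ₁' γ₂' hγ hne (i := i) rfl rfl rfl
    (by simp [Gph.sh_false]) o)
  simp only [LinearMap.comp_apply]
  rw [un_tmul γ₁ rfl, un_tmul γ₂ rfl, un_tmul γ₁' rfl,
    un_tmul γ₂' (n := i + γ₁.g.sh false + γ₂.g.sh false) (by simp [Gph.sh_false]), e]
  simp [Gph.sh_false]

/-- To prove an identity between bilinear maps it suffices to consider pure tensors. -/
theorem eq_of_tmul₂ {a b : Corolla T} {V : Type*} [AddCommGroup V] [Module k V]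
    (f g : Forms A a →ₗ[k] Forms A b →ₗ[k] V)
    (h : ∀ (i j : ℤ) (r s : ℕ) (o : A.X a i) (o' : A.X b j) (w w' : Omega k 1),
      w ∈ Omega.gr k 1 r → w' ∈ Omega.gr k 1 s →
      f (A.inc a i o ⊗ₜ w) (A.inc b j o' ⊗ₜ w') = g (A.inc a i o ⊗ₜ w) (A.inc b j o' ⊗ₜ w'))
    (x : Forms A a) (y : Forms A b) : f x y = g x y := by
  rw [eq_of_tmul f g fun i r o w hw => eq_of_tmul _ _ fun j s o' w' hw' =>
    h i j r s o o' w w' hw hw']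

theorem un_bin {a b c v : Corolla T} (γ₁ : BGen a b c) (γ₂ : UGen c v) (γ : BGen a b v)
    (hγ : γ.g = γ₁.g.comp γ₂.g) (x : Forms A a) (y : Forms A b) :
    un A γ₂ (bin A γ₁ x y) = bin A γ x y := by
  refine eq_of_tmul₂ ((bin A γ₁).compr₂ (un A γ₂)) (bin A γ)
    (fun i j r s o o' w w' hw hw' => ?_) x y
  rw [LinearMap.compr₂_apply, bin_tmul γ₁ rfl o o' hw, map_negOnePow_smul, un_tmul γ₂ rfl,
    bin_tmul γ (n := i + j + γ₁.g.sh false + γ₂.g.sh false) (by simp [Gph.sh_false]) o o' hw,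
    ← sub_eq_zero.1 (A.law (.un_bin γ₁ γ₂ γ hγ rfl rfl _ o o'))]

theorem bin_un {a a' b v : Corolla T} (γ₁ : UGen a a') (γ₂ : BGen a' b v) (γ : BGen a b v)
    (hγ : γ.g = (γ₁.g.addRight _).comp γ₂.g) (x : Forms A a) (y : Forms A b) :
    bin A γ₂ (un A γ₁ x) y = bin A γ x y := by
  refine eq_of_tmul₂ (bin A γ₂ ∘ₗ un A γ₁) (bin A γ)
    (fun i j r s o o' w w' hw hw' => ?_) x y
  rw [LinearMap.comp_apply, un_tmul γ₁ rfl, bin_tmul γ₂ rfl _ o' hw,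
    bin_tmul γ (n := i + γ₁.g.sh false + j + γ₂.g.sh false) (by simp [Gph.sh_false]) o o' hw,
    ← sub_eq_zero.1 (A.law (.bin_un γ₁ γ₂ γ hγ rfl rfl _ o o'))]

theorem un_bin_comm {a b c c' v : Corolla T} (γ₁ : BGen a b c) (γ₂ : UGen c v) (γ₁' : BGen a b c')
    (γ₂' : UGen c' v) (hγ : γ₁.g.comp γ₂.g = γ₁'.g.comp γ₂'.g) (hne : γ₁.g.E ≠ γ₁'.g.E)
    (x : Forms A a) (y : Forms A b) :
    un A γ₂ (bin A γ₁ x y) = un A γ₂' (bin A γ₁' x y) := by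
  refine eq_of_tmul₂ ((bin A γ₁).compr₂ (un A γ₂)) ((bin A γ₁').compr₂ (un A γ₂'))
    (fun i j r s o o' w w' hw hw' => ?_) x y
  have e := sub_eq_zero.1 <| A.law (.un_bin_comm γ₁ γ₂ γ₁' γ₂' hγ hne (i := i) (j := j) rfl rfl
    rfl (by simp [Gph.sh_false]) o o')
  rw [LinearMap.compr₂_apply, LinearMap.compr₂_apply, bin_tmul γ₁ rfl o o' hw,
    bin_tmul γ₁' rfl o o' hw, map_negOnePow_smul, map_negOnePow_smul, un_tmul γ₂ rfl,
    un_tmul γ₂' (n := i + j + γ₁.g.sh false + γ₂.g.sh false) (by simp [Gph.sh_false]), e]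
  simp [Gph.sh_false]

theorem un_bin_assoc {a a' b c v : Corolla T} (γ₁ : BGen a b c) (γ₂ : UGen c v) (γ₁' : UGen a a')
    (γ₂' : BGen a' b v) (hγ : γ₁.g.comp γ₂.g = (γ₁'.g.addRight _).comp γ₂'.g)
    (x : Forms A a) (y : Forms A b) :
    un A γ₂ (bin A γ₁ x y) = bin A γ₂' (un A γ₁' x) y := by
  refine eq_of_tmul₂ ((bin A γ₁).compr₂ (un A γ₂)) (bin A γ₂' ∘ₗ un A γ₁')
    (fun i j r s o o' w w' hw hw' => ?_) x y
  have e := sub_eq_zero.1 <| A.law (.un_bin_assoc γ₁ γ₂ γ₁' γ₂' hγ (i := i) (j := j) rfl rfl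
    rfl (by simp [Gph.sh_false]) o o')
  rw [LinearMap.compr₂_apply, LinearMap.comp_apply, bin_tmul γ₁ rfl o o' hw, un_tmul γ₁' rfl,
    map_negOnePow_smul, un_tmul γ₂ rfl,
    bin_tmul γ₂' (n := i + j + γ₁.g.sh false + γ₂.g.sh false) (by simp [Gph.sh_false]) _ o' hw, e]
  simp [Gph.sh_false]

/-- Here the full sign is needed for all total degrees, since `A ⊗ Ω_1` must itself be shown to be a
dg operad. -/
theorem bin_swap {a b v : Corolla T} (γ : BGen a b v) (γ' : BGen b a v)
    (hγ : γ'.g = γ.g.reindex (Equiv.sumComm _ _)) {m n : ℤ}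
    {x : Forms A a} {y : Forms A b} (hx : x ∈ deg A a m) (hy : y ∈ deg A b n) :
    bin A γ x y = (m * n).negOnePow • bin A γ' y x := by
  refine eq_of_deg ((bin A γ).flip y) ((m * n).negOnePow • bin A γ' y)
    (fun i r o w hw hm => ?_) hx
  refine eq_of_deg (bin A γ _) ((m * n).negOnePow • (bin A γ').flip _)
    (fun j s o' w' hw' hn => ?_) hy
  simp only [LinearMap.smul_apply, LinearMap.flip_apply]
  rw [bin_tmul γ rfl o o' hw, bin_tmul γ' (n := i + j + γ.g.sh false)
      (by simp [Gph.sh_false]; lia) o' o hw', Omega.mul_comm_gr hw hw',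
    sub_eq_zero.1 (A.law (.bin_swap γ γ' hγ rfl (by simp [Gph.sh_false]; lia) o o'))]
  subst hm hn
  simp only [negOnePow_smul_eq_ite, Int.even_mul, Int.even_add]
  by_cases hi : Even i <;> by_cases hj : Even j <;> by_cases hr : Even (r : ℤ) <;>
    by_cases hs : Even (s : ℤ) <;> simp [hi, hj, hr, hs, TensorProduct.tmul_neg, TensorProduct.neg_tmul]

theorem d_bin {a b v : Corolla T} (γ : BGen a b v) {m : ℤ} {x : Forms A a}
    (hx : x ∈ deg A a m) (y : Forms A b) :
    d A v (bin A γ x y) = bin A γ (d A a x) y + m.negOnePow • bin A γ x (d A b y) := by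
  refine eq_of_deg (d A v ∘ₗ (bin A γ).flip y)
    ((bin A γ).flip y ∘ₗ d A a + m.negOnePow • (bin A γ).flip (d A b y))
    (fun i r o w hw hm => ?_) hx
  refine LinearMap.congr_fun (f := d A v ∘ₗ bin A γ _)
    (g := bin A γ (d A a _) + m.negOnePow • (bin A γ _ ∘ₗ d A b))
    (eq_of_tmul _ _ fun j s o' w' hw' => ?_) y
  have h₁ := sub_eq_zero.1 <| A.law (.d_bin γ (n := i + j + γ.g.sh false + 1) rfl rfl rfl rfl
    (by lia) (by lia) o o')
  have e₁ := bin_tmul γ (n := i + j + γ.g.sh false + 1) (by lia) (A.d rfl o) o' hw w'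
  have e₂ := bin_tmul γ (n := i + j + γ.g.sh false) rfl o o' (Omega.d_mem_gr hw) w'
  have e₃ := bin_tmul γ (n := i + j + γ.g.sh false + 1) (by lia) o (A.d rfl o') hw w'
  have e₄ := bin_tmul γ (n := i + j + γ.g.sh false) rfl o o' hw (Omega.d 1 w')
  simp only [LinearMap.smul_apply, LinearMap.add_apply, LinearMap.comp_apply]
  rw [bin_tmul γ rfl o o' hw, map_negOnePow_smul, d_tmul rfl, d_tmul rfl, d_tmul rfl, map_add,
    map_add, LinearMap.add_apply, map_negOnePow_smul, h₁, Omega.d_mul_gr hw, e₁, e₃, e₄]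
  rw [map_negOnePow_smul₂, e₂]
  subst hm
  simp only [negOnePow_smul_eq_ite, Int.even_mul, Int.even_add, Gph.sh_false, Nat.cast_add,
    Nat.cast_one, Int.not_even_one, Even.zero, if_true, iff_true, iff_false]
  by_cases hi : Even i <;> by_cases hj : Even j <;> by_cases hr : Even (r : ℤ) <;>
    simp [hi, hj, hr, TensorProduct.tmul_neg, TensorProduct.neg_tmul, TensorProduct.tmul_add,
      TensorProduct.add_tmul] <;> abel

theorem bin_bin_assoc {a b c e e' v : Corolla T} (γ₁ : BGen a b e) (γ₂ : BGen e c v)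
    (γ₁' : BGen b c e') (γ₂' : BGen e' a v)
    (hγ : ((γ₁.g.addRight _).comp γ₂.g).reindex (rot _ _ _) = (γ₁'.g.addRight _).comp γ₂'.g)
    {l m n : ℤ} {x : Forms A a} {y : Forms A b} {z : Forms A c}
    (hx : x ∈ deg A a l) (hy : y ∈ deg A b m) (hz : z ∈ deg A c n) :
    bin A γ₂ (bin A γ₁ x y) z = (l * (m + n)).negOnePow • bin A γ₂' (bin A γ₁' y z) x := by
  refine eq_of_deg ((bin A γ₂).flip z ∘ₗ (bin A γ₁).flip y)
    ((l * (m + n)).negOnePow • (bin A γ₂' (bin A γ₁' y z))) (fun i r o w hw hl => ?_) hx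
  refine eq_of_deg ((bin A γ₂).flip z ∘ₗ bin A γ₁ _)
    ((l * (m + n)).negOnePow • ((bin A γ₂').flip _ ∘ₗ (bin A γ₁').flip z))
    (fun i' r' o' w' hw' hm => ?_) hy
  refine eq_of_deg (bin A γ₂ _)
    ((l * (m + n)).negOnePow • ((bin A γ₂').flip _ ∘ₗ bin A γ₁' _))
    (fun i'' r'' o'' w'' hw'' hn => ?_) hz
  simp only [LinearMap.smul_apply, LinearMap.flip_apply, LinearMap.comp_apply]
  have h₁ := sub_eq_zero.1 <| A.law (.bin_bin_assoc γ₁ γ₂ γ₁' γ₂' hγ (i := i) (j := i') (l := i'')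
    rfl rfl rfl (by simp [Gph.sh_false]; lia) o o' o'')
  rw [bin_tmul γ₁ rfl o o' hw, bin_tmul γ₁' rfl o' o'' hw', map_negOnePow_smul₂,
    map_negOnePow_smul₂,
    bin_tmul γ₂ rfl _ _ (Omega.mul_mem_gr hw hw'),
    bin_tmul γ₂' (n := i + i' + γ₁.g.sh false + i'' + γ₂.g.sh false) (by simp [Gph.sh_false]; lia)
      _ _ (Omega.mul_mem_gr hw' hw''), h₁, mul_assoc,
    Omega.mul_comm_gr hw (Omega.mul_mem_gr hw' hw'')]
  subst hl hm hn
  simp only [negOnePow_smul_eq_ite, Int.even_mul, Int.even_add, Gph.sh_false, Nat.cast_add,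
    Even.zero, or_true, if_true, iff_true, iff_false]
  by_cases hi : Even i <;> by_cases hi' : Even i' <;> by_cases hi'' : Even i'' <;>
  by_cases hr : Even (r : ℤ) <;> by_cases hr' : Even (r' : ℤ) <;> by_cases hr'' : Even (r'' : ℤ) <;>
    simp [hi, hi', hi'', hr, hr', hr'', TensorProduct.tmul_neg, TensorProduct.neg_tmul]

end Forms

end FormsOnInterval

end FeynmanME

namespace FeynmanME

/-! ### The path operad -/

section PathOperad

variable {k : Type u} [Field k] [CharZero k] {T : Kind}

/-- The raw structure of `A ⊗ Ω_1`. -/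
noncomputable abbrev pathRaw (A : Op k T false) : RawOp k T false where
  X v n := ModuleCat.of k (Forms.deg A v n)
  d {v _ _} h := (Forms.d A v).restrict fun _ hx => Forms.d_mem_deg h hx
  un γ _ _ h := (Forms.un A γ).restrict fun _ hx => Forms.un_mem_deg γ h hx
  bin γ _ _ _ h := LinearMap.mk₂ k
    (fun x y => ⟨Forms.bin A γ x.1 y.1, Forms.bin_mem_deg γ h x.2 y.2⟩)
    (fun _ _ _ => Subtype.ext (by simp)) (fun _ _ _ => Subtype.ext (by simp))
    (fun _ _ _ => Subtype.ext (by simp)) (fun _ _ _ => Subtype.ext (by simp))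

theorem pathRaw_law (A : Op k T false) {v : Corolla T} {n : ℤ} {x : (pathRaw A).X v n}
    (hx : (pathRaw A).Law x) : x = 0 := by
  have hs : ∀ {X Y : Type} (g : Gph X Y), (g.sh false).negOnePow = 1 := fun g => by
    simp [Gph.sh_false]
  have hss : ∀ {X Y X' Y' : Type} (g : Gph X Y) (g' : Gph X' Y'),
      (g.sh false * g'.sh false).negOnePow = 1 := fun g g' => by simp [Gph.sh_false]
  have hc : ∀ {v : Corolla T} {n : ℤ} (m : ℤ) (y : Forms.deg A v n),
      ((m.negOnePow • y : Forms.deg A v n) : Forms A v) = m.negOnePow • y.1 :=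
    fun m y => map_negOnePow_smul (Forms.deg A _ _).subtype m y
  cases hx with
  | d_d h₁ h₂ x => exact Subtype.ext (Forms.d_d _ x.1)
  | d_un γ h₁ h₂ h₁' h₂' x =>
    rw [hs, one_smul]
    exact sub_eq_zero.2 (Subtype.ext (Forms.d_un γ x.1))
  | @d_bin a b _ γ i j m i' j' _ h₁ h₂ hi hj h₃ h₄ x y =>
    rw [hs, one_smul]
    refine sub_eq_zero.2 (Subtype.ext ((Forms.d_bin γ x.2 y.1).trans ?_))
    exact congrArg _ (hc i ⟨Forms.bin A γ x.1 (Forms.d A b y.1), Forms.bin_mem_deg γ h₄ x.2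
      (Forms.d_mem_deg hj y.2)⟩).symm
  | un_one γ hγ h x => exact sub_eq_zero.2 (Subtype.ext (Forms.un_one γ hγ x.1))
  | un_un γ₁ γ₂ γ hγ h₁ h₂ h x => exact sub_eq_zero.2 (Subtype.ext (Forms.un_un γ₁ γ₂ γ hγ x.1))
  | un_bin γ₁ γ₂ γ hγ h₁ h₂ h x y =>
    exact sub_eq_zero.2 (Subtype.ext (Forms.un_bin γ₁ γ₂ γ hγ x.1 y.1))
  | bin_un γ₁ γ₂ γ hγ h₁ h₂ h x y =>
    exact sub_eq_zero.2 (Subtype.ext (Forms.bin_un γ₁ γ₂ γ hγ x.1 y.1))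
  | bin_swap γ γ' hγ h h' x y =>
    refine sub_eq_zero.2 (Subtype.ext ((Forms.bin_swap γ γ' hγ x.2 y.2).trans ?_))
    exact (hc _ ⟨Forms.bin A γ' y.1 x.1, Forms.bin_mem_deg γ' h' y.2 x.2⟩).symm
  | un_un_comm γ₁ γ₂ γ₁' γ₂' hγ hne h₁ h₂ h₁' h₂' x =>
    rw [hss, one_smul]
    exact sub_eq_zero.2 (Subtype.ext (Forms.un_un_comm γ₁ γ₂ γ₁' γ₂' hγ hne x.1))
  | un_bin_comm γ₁ γ₂ γ₁' γ₂' hγ hne h₁ h₂ h₁' h₂' x y =>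
    rw [hss, one_smul]
    exact sub_eq_zero.2 (Subtype.ext (Forms.un_bin_comm γ₁ γ₂ γ₁' γ₂' hγ hne x.1 y.1))
  | un_bin_assoc γ₁ γ₂ γ₁' γ₂' hγ h₁ h₂ h₁' h₂' x y =>
    rw [hss, one_smul]
    exact sub_eq_zero.2 (Subtype.ext (Forms.un_bin_assoc γ₁ γ₂ γ₁' γ₂' hγ x.1 y.1))
  | bin_bin_assoc γ₁ γ₂ γ₁' γ₂' hγ h₁ h₂ h₁' h₂' x y z =>
    rw [hss, one_smul]
    refine sub_eq_zero.2 (Subtype.ext ((Forms.bin_bin_assoc γ₁ γ₂ γ₁' γ₂' hγ x.2 y.2 z.2).trans ?_))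
    exact (hc _ ⟨Forms.bin A γ₂' (Forms.bin A γ₁' y.1 z.1) x.1,
      Forms.bin_mem_deg γ₂' h₂' (Forms.bin_mem_deg γ₁' h₁' y.2 z.2) x.2⟩).symm

/-- The dg `𝔉`-operad `A ⊗ Ω_1`. -/
noncomputable def PathOp (A : Op k T false) : Op k T false where
  toRawOp := pathRaw A
  law := pathRaw_law A

variable {A B C : Op k T false}

/-- The value at a vertex of the interval. -/
noncomputable def Forms.vertex (A : Op k T false) (i : Fin 2) (v : Corolla T) :
    Forms A v →ₗ[k] A.Tot v :=
  (TensorProduct.rid k _).toLinearMap ∘ₗ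
    TensorProduct.map LinearMap.id (Omega.vertex k i).toLinearMap

theorem Forms.vertex_tmul (i : Fin 2) {v : Corolla T} (o : A.Tot v) (w : Omega k 1) :
    Forms.vertex A i v (o ⊗ₜ w) = Omega.vertex k i w • o := by
  simp [Forms.vertex]

theorem Forms.vertex_d (i : Fin 2) {v : Corolla T} (x : Forms A v) :
    Forms.vertex A i v (Forms.d A v x) = A.totD v (Forms.vertex A i v x) := by
  refine LinearMap.congr_fun (f := Forms.vertex A i v ∘ₗ Forms.d A v)
    (g := A.totD v ∘ₗ Forms.vertex A i v) (Forms.eq_of_tmul _ _ fun i r o w hw => ?_) x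
  simp only [LinearMap.comp_apply]
  rw [Forms.d_tmul rfl, map_add, map_negOnePow_smul, Forms.vertex_tmul, Forms.vertex_tmul,
    Forms.vertex_tmul, Omega.vertex_d, zero_smul, smul_zero, add_zero, map_smul, A.totD_inc rfl]

theorem Forms.vertex_un (i : Fin 2) {a v : Corolla T} (γ : UGen a v) (x : Forms A a) :
    Forms.vertex A i v (Forms.un A γ x) = A.totUn γ (Forms.vertex A i a x) := by
  refine LinearMap.congr_fun (f := Forms.vertex A i v ∘ₗ Forms.un A γ)
    (g := A.totUn γ ∘ₗ Forms.vertex A i a) (Forms.eq_of_tmul _ _ fun i r o w hw => ?_) x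
  simp only [LinearMap.comp_apply]
  rw [Forms.un_tmul γ rfl, Forms.vertex_tmul, Forms.vertex_tmul, map_smul, A.totUn_inc γ rfl]

/-- The Koszul sign plays no role: it is trivial for functions, and forms of positive degree vanish
at a vertex. -/
theorem Forms.vertex_bin (i : Fin 2) {a b v : Corolla T} (γ : BGen a b v) (x : Forms A a)
    (y : Forms A b) : Forms.vertex A i v (Forms.bin A γ x y) =
      A.totBin γ (Forms.vertex A i a x) (Forms.vertex A i b y) := by
  refine Forms.eq_of_tmul₂ ((Forms.bin A γ).compr₂ (Forms.vertex A i v))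
    ((A.totBin γ).compl₁₂ (Forms.vertex A i a) (Forms.vertex A i b))
    (fun j j' r s o o' w w' hw hw' => ?_) x y
  rw [LinearMap.compr₂_apply, LinearMap.compl₁₂_apply, Forms.bin_tmul γ rfl o o' hw,
    map_negOnePow_smul, Forms.vertex_tmul, Forms.vertex_tmul, Forms.vertex_tmul, map_smul,
    LinearMap.map_smul₂, A.totBin_inc γ rfl, map_mul, mul_comm (Omega.vertex k i w), mul_smul]
  by_cases hr : r = 0
  · subst hr
    simp
  · rw [Omega.vertex_of_mem hr hw, zero_smul, smul_zero, smul_zero]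

theorem Forms.vertex_of_deg (i : Fin 2) {v : Corolla T} {n : ℤ} {x : Forms A v}
    (hx : x ∈ Forms.deg A v n) :
    A.inc v n (A.proj v n (Forms.vertex A i v x)) = Forms.vertex A i v x := by
  refine Forms.eq_of_deg (A.inc v n ∘ₗ A.proj v n ∘ₗ Forms.vertex A i v) (Forms.vertex A i v)
    (fun j r o w hw h => ?_) hx
  rw [LinearMap.comp_apply, LinearMap.comp_apply, Forms.vertex_tmul]
  by_cases hr : r = 0
  · subst hr
    obtain rfl : j = n := by simpa using h
    rw [map_smul, map_smul, A.proj_inc_same]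
  · rw [Omega.vertex_of_mem hr hw, zero_smul, map_zero, map_zero]

namespace PathOp

/-- The evaluations at the two ends of the interval. -/
noncomputable def ev (A : Op k T false) (i : Fin 2) : Op.Hom (PathOp A) A where
  app v n := A.proj v n ∘ₗ Forms.vertex A i v ∘ₗ (Forms.deg A v n).subtype
  app_d {v j n} h x := by
    refine A.inc_injective v n ((Forms.vertex_of_deg i (Forms.d_mem_deg h x.2)).trans ?_)
    rw [Forms.vertex_d, ← Forms.vertex_of_deg i x.2, A.totD_inc h]
    rfl
  app_un {a v} γ j n h x := by
    refine A.inc_injective v n ((Forms.vertex_of_deg i (Forms.un_mem_deg γ h x.2)).trans ?_)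
    rw [Forms.vertex_un, ← Forms.vertex_of_deg i x.2, A.totUn_inc γ h]
    rfl
  app_bin {a b v} γ j j' n h x y := by
    refine A.inc_injective v n ((Forms.vertex_of_deg i (Forms.bin_mem_deg γ h x.2 y.2)).trans ?_)
    rw [Forms.vertex_bin, ← Forms.vertex_of_deg i x.2, ← Forms.vertex_of_deg i y.2,
      A.totBin_inc γ h]
    rfl

theorem inc_ev (i : Fin 2) (v : Corolla T) (n : ℤ) (x : (PathOp A).X v n) :
    A.inc v n ((ev A i).app v n x) = Forms.vertex A i v x.1 := Forms.vertex_of_deg i x.2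

theorem _root_.FeynmanME.Omega.one_mem_gr : (1 : Omega k 1) ∈ Omega.gr k 1 0 :=
  Omega.mem_gr_zero.2 ⟨1, by simp [Omega.form_apply]⟩

theorem _root_.FeynmanME.Omega.t_mem_gr : Omega.t k (0 : Fin 2) ∈ Omega.gr k 1 0 :=
  Omega.mem_gr_zero.2 ⟨Polynomial.X, by simp [Omega.form_apply]⟩

/-- Multiplication by a function. -/
noncomputable def mulFun (A : Op k T false) {w : Omega k 1} (hw : w ∈ Omega.gr k 1 0)
    (v : Corolla T) (n : ℤ) : A.X v n →ₗ[k] (PathOp A).X v n :=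
  ((TensorProduct.mk k (A.Tot v) (Omega k 1)).flip w ∘ₗ A.inc v n).codRestrict (Forms.deg A v n)
    fun o => Forms.tmul_mem_deg (by simp) o hw

theorem ev_mulFun {w : Omega k 1} (hw : w ∈ Omega.gr k 1 0) (i : Fin 2) (v : Corolla T) (n : ℤ)
    (o : A.X v n) : (ev A i).app v n (mulFun A hw v n o) = Omega.vertex k i w • o := by
  refine A.inc_injective v n ?_
  rw [inc_ev]
  exact (Forms.vertex_tmul i _ w).trans (map_smul _ _ _).symm

/-- Constant paths. -/
noncomputable def const (A : Op k T false) : Op.Hom A (PathOp A) where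
  app v n := mulFun A Omega.one_mem_gr v n
  app_d {v i n} h x := by
    refine Subtype.ext ((Forms.d_tmul h x 1).trans ?_).symm
    have : Omega.d 1 (1 : Omega k 1) = 0 := by
      have := Omega.d_form (1 : Polynomial k) 0
      simpa [Omega.form_apply] using this
    rw [this, TensorProduct.tmul_zero, smul_zero, add_zero]
    rfl
  app_un γ _ _ h x := Subtype.ext (Forms.un_tmul γ h x 1).symm
  app_bin γ i j n h x y := by
    refine Subtype.ext ((Forms.bin_tmul γ h x y Omega.one_mem_gr 1).trans ?_).symm
    simp
    rfl

theorem ev_const (i : Fin 2) (v : Corolla T) (n : ℤ) (o : A.X v n) :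
    (ev A i).app v n ((const A).app v n o) = o :=
  (ev_mulFun Omega.one_mem_gr i v n o).trans (by rw [map_one, one_smul])

/-- The function `t₀`, which takes the value `1` at the vertex `0` and `0` at the vertex `1`. -/
noncomputable abbrev ramp (A : Op k T false) (v : Corolla T) (n : ℤ) :
    A.X v n →ₗ[k] (PathOp A).X v n := mulFun A Omega.t_mem_gr v n

theorem ev_zero_ramp (v : Corolla T) (n : ℤ) (o : A.X v n) :
    (ev A 0).app v n (ramp A v n o) = o := by
  rw [ev_mulFun, Omega.vertex_t, if_pos rfl, one_smul]

theorem ev_one_ramp (v : Corolla T) (n : ℤ) (o : A.X v n) :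
    (ev A 1).app v n (ramp A v n o) = 0 := by
  rw [ev_mulFun, Omega.vertex_t, if_neg (by decide), zero_smul]

/-- Affine interpolation along t₀, which is 0 at the vertex 1 and 1 at the vertex 0. -/
theorem exists_ev (v : Corolla T) (n : ℤ) (x₀ x₁ : A.X v n) :
    ∃ y, (ev A 1).app v n y = x₀ ∧ (ev A 0).app v n y = x₁ := by
  refine ⟨(const A).app v n x₀ + ramp A v n (x₁ - x₀), ?_, ?_⟩
  · rw [map_add, ev_const, ev_one_ramp, add_zero]
  · rw [map_add, ev_const, ev_zero_ramp, add_sub_cancel]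

theorem ev_isFib (i : Fin 2) : (ev A i).IsFib := fun v n x => ⟨(const A).app v n x, ev_const i v n x⟩

/-- The homotopy ε ⊗ ∫ contracts all forms onto the constant extension of their value at the vertex
1, and that value is zero on the kernel. -/
theorem ev_kerAcyclic : (ev A 1).KerAcyclic := by
  intro v i j n hi hn x hx hdx
  -- The sign operator makes `h` anticommute with the differential of `A`, so only the differential
  -- of forms contributes to dh + hd.
  let h : Forms A v →ₗ[k] Forms A v := TensorProduct.map (A.totEps v) Omega.integral
  have h_tmul : ∀ {i : ℤ} (o : A.X v i) (w : Omega k 1),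
      h (A.inc v i o ⊗ₜ w) = i.negOnePow • (A.inc v i o ⊗ₜ Omega.integral w) := fun o w => by
    simp only [h, TensorProduct.map_tmul, A.totEps_inc]
    rfl
  have hh : ∀ y : Forms A v, Forms.d A v (h y) + h (Forms.d A v y) =
      y - Forms.vertex A 1 v y ⊗ₜ[k] (1 : Omega k 1) := by
    intro y
    refine LinearMap.congr_fun (f := Forms.d A v ∘ₗ h + h ∘ₗ Forms.d A v)
      (g := LinearMap.id - (TensorProduct.mk k (A.Tot v) (Omega k 1)).flip 1 ∘ₗ
        Forms.vertex A 1 v) (Forms.eq_of_tmul _ _ fun l r o w hw => ?_) y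
    simp only [LinearMap.comp_apply, LinearMap.add_apply, LinearMap.sub_apply, LinearMap.id_apply,
      LinearMap.flip_apply, TensorProduct.mk_apply]
    rw [h_tmul, map_negOnePow_smul, Forms.d_tmul rfl, Forms.d_tmul rfl, map_add, h_tmul,
      map_negOnePow_smul, h_tmul, Forms.vertex_tmul, smul_add, smul_smul, smul_smul,
      ← Int.negOnePow_add, Int.negOnePow_even (l + l) ⟨l, rfl⟩, one_smul, one_smul,
      Int.negOnePow_succ, Units.neg_smul]
    have := congrArg (fun w => A.inc v l o ⊗ₜ[k] w) (Omega.d_integral_add w)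
    simp only [TensorProduct.tmul_add, TensorProduct.tmul_sub, Algebra.algebraMap_eq_smul_one,
      TensorProduct.tmul_smul] at this
    rw [← TensorProduct.smul_tmul']
    rw [← this]
    abel
  have hmem : h x.1 ∈ Forms.deg A v i := by
    refine Forms.map_mem_of_deg h _ (fun l r o w hw hl => ?_) x.2
    rw [h_tmul, negOnePow_smul_eq_ite]
    obtain h0 | ⟨rfl, h0⟩ := Omega.integral_mem hw
    · simp [h0]
    · have := Forms.tmul_mem_deg (m := i) (by push_cast at hl ⊢; lia) o h0
      split_ifs
      · exact this
      · exact neg_mem this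
  have hx' : Forms.vertex A 1 v x.1 = 0 := by rw [← inc_ev, hx, map_zero]
  refine ⟨⟨h x.1, hmem⟩, ?_, ?_⟩
  · refine A.inc_injective v i ((inc_ev _ _ _ _).trans ?_)
    rw [map_zero]
    refine LinearMap.congr_fun (f := Forms.vertex A 1 v ∘ₗ h) (g := 0)
      (Forms.eq_of_tmul _ _ fun l r o w hw => ?_) x.1
    rw [LinearMap.comp_apply, h_tmul, map_negOnePow_smul, Forms.vertex_tmul, Omega.vertex_integral]
    simp
  · refine Subtype.ext ?_
    have h1 : Forms.d A v x.1 = 0 := congrArg Subtype.val hdx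
    have := hh x.1
    rw [h1, map_zero, add_zero, hx', TensorProduct.zero_tmul, sub_zero] at this
    exact this

theorem ev_isWeakEq : (ev A 1).IsWeakEq := ev_kerAcyclic.isWeakEq (ev_isFib 1)

theorem const_comp_ev (i : Fin 2) : (const A).comp (ev A i) = Op.Hom.id A :=
  Op.Hom.ext (funext₂ fun v n => LinearMap.ext fun x => ev_const i v n x)

theorem const_isWeakEq : (const A).IsWeakEq :=
  ev_isWeakEq.of_comp_left (by rw [const_comp_ev]; exact Op.Hom.isWeakEq_id A)

/-- The path object `A ⊗ Ω_1`. -/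
noncomputable def pathObject (A : Op k T false) : Op.PathObject A where
  P := PathOp A
  s := const A
  -- The face δ₀ omits the vertex 0, so it is evaluation at the vertex 1; the order of the two ends
  -- follows the faces of `ME_•`.
  q₀ := ev A 1
  q₁ := ev A 0
  weakEq := const_isWeakEq
  q₀_s := ev_const 1
  q₁_s := ev_const 0
  fib := exists_ev

end PathOp

end PathOperad

end FeynmanME

namespace FeynmanME

/-! ### Pullbacks -/

section Pullbacks

variable {k : Type u} [Field k] {T : Kind} {odd : Bool} {A B C : Op k T odd}

/-- The pairs with the same image. -/
noncomputable abbrev pullbackSub (f : Op.Hom A C) (g : Op.Hom B C) (v : Corolla T) (n : ℤ) :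
    Submodule k (A.X v n × B.X v n) :=
  LinearMap.eqLocus (f.app v n ∘ₗ LinearMap.fst k _ _) (g.app v n ∘ₗ LinearMap.snd k _ _)

/-- The raw structure of the pullback. -/
noncomputable abbrev pullbackRaw (f : Op.Hom A C) (g : Op.Hom B C) : RawOp k T odd where
  X v n := ModuleCat.of k (pullbackSub f g v n)
  d h := ((A.d h).prodMap (B.d h)).restrict fun x (hx : f.app _ _ x.1 = g.app _ _ x.2) => by
    change f.app _ _ (A.d h x.1) = g.app _ _ (B.d h x.2)
    rw [f.app_d, g.app_d, hx]
  un γ _ _ h := ((A.un γ h).prodMap (B.un γ h)).restrict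
    fun x (hx : f.app _ _ x.1 = g.app _ _ x.2) => by
      change f.app _ _ (A.un γ h x.1) = g.app _ _ (B.un γ h x.2)
      rw [f.app_un, g.app_un, hx]
  bin γ _ _ _ h := LinearMap.mk₂ k
    (fun x y => ⟨(A.bin γ h x.1.1 y.1.1, B.bin γ h x.1.2 y.1.2), by
      have hx : f.app _ _ x.1.1 = g.app _ _ x.1.2 := x.2
      have hy : f.app _ _ y.1.1 = g.app _ _ y.1.2 := y.2
      change f.app _ _ (A.bin γ h x.1.1 y.1.1) = g.app _ _ (B.bin γ h x.1.2 y.1.2)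
      rw [f.app_bin, g.app_bin, hx, hy]⟩)
    (fun _ _ _ => Subtype.ext (by simp)) (fun _ _ _ => Subtype.ext (by simp))
    (fun _ _ _ => Subtype.ext (by simp)) (fun _ _ _ => Subtype.ext (by simp))

/-- The pullback of dg `𝔉`-operads. -/
noncomputable def Pullback (f : Op.Hom A C) (g : Op.Hom B C) : Op k T odd where
  toRawOp := pullbackRaw f g
  law {v n x} hx := by
    let p₁ : RawHom (pullbackRaw f g) A.toRawOp :=
      { app v n := LinearMap.fst k _ _ ∘ₗ (pullbackSub f g v n).subtype
        app_d _ _ := rfl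
        app_un _ _ _ _ _ := rfl
        app_bin _ _ _ _ _ _ _ := rfl }
    let p₂ : RawHom (pullbackRaw f g) B.toRawOp :=
      { app v n := LinearMap.snd k _ _ ∘ₗ (pullbackSub f g v n).subtype
        app_d _ _ := rfl
        app_un _ _ _ _ _ := rfl
        app_bin _ _ _ _ _ _ _ := rfl }
    exact Subtype.ext (Prod.ext (A.law (p₁.law hx)) (B.law (p₂.law hx)))

namespace Pullback

variable {f : Op.Hom A C} {g : Op.Hom B C}

/-- An element of the pullback. -/
noncomputable def mk {v : Corolla T} {n : ℤ} (a : A.X v n) (b : B.X v n)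
    (h : f.app v n a = g.app v n b) : (Pullback f g).X v n := ⟨(a, b), h⟩

/-- The first projection. -/
noncomputable def fst (f : Op.Hom A C) (g : Op.Hom B C) : Op.Hom (Pullback f g) A where
  app v n := LinearMap.fst k _ _ ∘ₗ (pullbackSub f g v n).subtype
  app_d _ _ := rfl
  app_un _ _ _ _ _ := rfl
  app_bin _ _ _ _ _ _ _ := rfl

/-- The second projection. -/
noncomputable def snd (f : Op.Hom A C) (g : Op.Hom B C) : Op.Hom (Pullback f g) B where
  app v n := LinearMap.snd k _ _ ∘ₗ (pullbackSub f g v n).subtype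
  app_d _ _ := rfl
  app_un _ _ _ _ _ := rfl
  app_bin _ _ _ _ _ _ _ := rfl

theorem fst_mk {v : Corolla T} {n : ℤ} (a : A.X v n) (b : B.X v n)
    (h : f.app v n a = g.app v n b) : (fst f g).app v n (mk a b h) = a := rfl

theorem snd_mk {v : Corolla T} {n : ℤ} (a : A.X v n) (b : B.X v n)
    (h : f.app v n a = g.app v n b) : (snd f g).app v n (mk a b h) = b := rfl

theorem condition {v : Corolla T} {n : ℤ} (x : (Pullback f g).X v n) :
    f.app v n ((fst f g).app v n x) = g.app v n ((snd f g).app v n x) := x.2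

theorem ext {v : Corolla T} {n : ℤ} {x y : (Pullback f g).X v n}
    (h₁ : (fst f g).app v n x = (fst f g).app v n y)
    (h₂ : (snd f g).app v n x = (snd f g).app v n y) : x = y :=
  Subtype.ext (Prod.ext h₁ h₂)

/-- Maps into the pullback. -/
noncomputable def lift {M : Op k T odd} (φ : Op.Hom M A) (ψ : Op.Hom M B)
    (h : ∀ v n x, f.app v n (φ.app v n x) = g.app v n (ψ.app v n x)) :
    Op.Hom M (Pullback f g) where
  app v n := ((φ.app v n).prod (ψ.app v n)).codRestrict (pullbackSub f g v n) (h v n)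
  app_d h x := Subtype.ext (Prod.ext (φ.app_d h x) (ψ.app_d h x))
  app_un γ _ _ h x := Subtype.ext (Prod.ext (φ.app_un γ h x) (ψ.app_un γ h x))
  app_bin γ _ _ _ h x y := Subtype.ext (Prod.ext (φ.app_bin γ h x y) (ψ.app_bin γ h x y))

end Pullback

end Pullbacks

/-! ### Functoriality of the path operad -/

section PathFunctoriality

variable {k : Type u} [Field k] [CharZero k] {T : Kind} {A B C : Op k T false}

/-- The map on total spaces induced by a family of linear maps. -/
noncomputable def Op.totMap {v : Corolla T} (f : ∀ n, A.X v n →ₗ[k] B.X v n) :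
    A.Tot v →ₗ[k] B.Tot v :=
  DirectSum.toModule k ℤ _ fun n => B.inc v n ∘ₗ f n

theorem Op.totMap_inc {v : Corolla T} (f : ∀ n, A.X v n →ₗ[k] B.X v n) (n : ℤ) (x : A.X v n) :
    Op.totMap f (A.inc v n x) = B.inc v n (f n x) := by simp [Op.totMap]

namespace PathOp

/-- The map on forms induced by a family of linear maps. -/
noncomputable def lmap {v : Corolla T} (f : ∀ n, A.X v n →ₗ[k] B.X v n) (n : ℤ) :
    (PathOp A).X v n →ₗ[k] (PathOp B).X v n :=
  (TensorProduct.map (Op.totMap f) (LinearMap.id (R := k) (M := Omega k 1))).restrict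
    (p := Forms.deg A v n) (q := Forms.deg B v n) fun x hx => by
      refine Forms.map_mem_of_deg _ _ (fun i r o w hw h => ?_) hx
      rw [TensorProduct.map_tmul, Op.totMap_inc]
      exact Forms.tmul_mem_deg h _ hw

theorem lmap_val {v : Corolla T} (f : ∀ n, A.X v n →ₗ[k] B.X v n) (n : ℤ)
    (x : (PathOp A).X v n) :
    (lmap f n x).1 = TensorProduct.map (Op.totMap f) (LinearMap.id (R := k)) x.1 := rfl

theorem lmap_comp {v : Corolla T} (f : ∀ n, A.X v n →ₗ[k] B.X v n)
    (g : ∀ n, B.X v n →ₗ[k] C.X v n) (n : ℤ) (x : (PathOp A).X v n) :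
    lmap g n (lmap f n x) = lmap (fun n => g n ∘ₗ f n) n x := by
  refine Subtype.ext ?_
  refine Forms.eq_of_deg (m := n) (TensorProduct.map (Op.totMap g) (LinearMap.id (R := k)) ∘ₗ
    TensorProduct.map (Op.totMap f) LinearMap.id)
    (TensorProduct.map (Op.totMap fun n => g n ∘ₗ f n) LinearMap.id) (fun i r o w hw h => ?_) x.2
  simp [Op.totMap_inc]

theorem lmap_id {v : Corolla T} {f : ∀ n, A.X v n →ₗ[k] A.X v n} (hf : ∀ n x, f n x = x) (n : ℤ)
    (x : (PathOp A).X v n) : lmap f n x = x := by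
  refine Subtype.ext ?_
  refine Forms.eq_of_deg (m := n) (TensorProduct.map (Op.totMap f) (LinearMap.id (R := k)))
    LinearMap.id (fun i r o w hw h => ?_) x.2
  simp [Op.totMap_inc, hf]

theorem lmap_zero {v : Corolla T} {f : ∀ n, A.X v n →ₗ[k] B.X v n} (hf : ∀ n x, f n x = 0) (n : ℤ)
    (x : (PathOp A).X v n) : lmap f n x = 0 := by
  refine Subtype.ext ?_
  refine Forms.eq_of_deg (m := n) (TensorProduct.map (Op.totMap f) (LinearMap.id (R := k)))
    0 (fun i r o w hw h => ?_) x.2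
  simp [Op.totMap_inc, hf]

theorem ev_lmap {v : Corolla T} (f : ∀ n, A.X v n →ₗ[k] B.X v n) (i : Fin 2) (n : ℤ)
    (x : (PathOp A).X v n) :
    (ev B i).app v n (lmap f n x) = f n ((ev A i).app v n x) := by
  refine B.inc_injective v n ?_
  rw [inc_ev, ← Op.totMap_inc f, inc_ev, lmap_val]
  refine Forms.eq_of_deg (m := n) (Forms.vertex B i v ∘ₗ
    TensorProduct.map (Op.totMap f) (LinearMap.id (R := k)))
    (Op.totMap f ∘ₗ Forms.vertex A i v) (fun j r o w hw h => ?_) x.2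
  simp [Forms.vertex_tmul]

theorem lmap_mulFun {v : Corolla T} (f : ∀ n, A.X v n →ₗ[k] B.X v n) {w : Omega k 1}
    (hw : w ∈ Omega.gr k 1 0) (n : ℤ) (x : A.X v n) :
    lmap f n (mulFun A hw v n x) = mulFun B hw v n (f n x) := by
  refine Subtype.ext ?_
  change TensorProduct.map _ _ (A.inc v n x ⊗ₜ w) = B.inc v n (f n x) ⊗ₜ w
  rw [TensorProduct.map_tmul, Op.totMap_inc]
  rfl

/-- Functoriality of the path operad. -/
noncomputable def map (f : Op.Hom A B) : Op.Hom (PathOp A) (PathOp B) where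
  app v n := lmap (f.app v) n
  app_d {v i n} h x := by
    refine Subtype.ext ?_
    refine LinearMap.congr_fun
      (f := TensorProduct.map (Op.totMap (f.app v)) (LinearMap.id (R := k)) ∘ₗ Forms.d A v)
      (g := Forms.d B v ∘ₗ TensorProduct.map (Op.totMap (f.app v)) (LinearMap.id (R := k)))
      (Forms.eq_of_tmul _ _ fun i r o w hw => ?_) x.1
    simp only [LinearMap.comp_apply]
    rw [Forms.d_tmul rfl, map_add, map_negOnePow_smul, TensorProduct.map_tmul,
      TensorProduct.map_tmul, TensorProduct.map_tmul, Op.totMap_inc, Op.totMap_inc, LinearMap.id_apply,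
      Forms.d_tmul rfl, f.app_d]
    rfl
  app_un {a v} γ i n h x := by
    refine Subtype.ext ?_
    refine LinearMap.congr_fun
      (f := TensorProduct.map (Op.totMap (f.app v)) (LinearMap.id (R := k)) ∘ₗ Forms.un A γ)
      (g := Forms.un B γ ∘ₗ TensorProduct.map (Op.totMap (f.app a)) (LinearMap.id (R := k)))
      (Forms.eq_of_tmul _ _ fun i r o w hw => ?_) x.1
    simp only [LinearMap.comp_apply]
    rw [Forms.un_tmul γ rfl, TensorProduct.map_tmul, TensorProduct.map_tmul, Op.totMap_inc,
      Op.totMap_inc, LinearMap.id_apply, Forms.un_tmul γ rfl, f.app_un]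
  app_bin {a b v} γ i j n h x y := by
    refine Subtype.ext ?_
    refine Forms.eq_of_tmul₂
      ((Forms.bin A γ).compr₂ (TensorProduct.map (Op.totMap (f.app v)) (LinearMap.id (R := k))))
      ((Forms.bin B γ).compl₁₂ (TensorProduct.map (Op.totMap (f.app a)) (LinearMap.id (R := k)))
        (TensorProduct.map (Op.totMap (f.app b)) (LinearMap.id (R := k))))
      (fun i j r s o o' w w' hw hw' => ?_) x.1 y.1
    rw [LinearMap.compr₂_apply, LinearMap.compl₁₂_apply, Forms.bin_tmul γ rfl o o' hw,
      map_negOnePow_smul, TensorProduct.map_tmul, TensorProduct.map_tmul, TensorProduct.map_tmul,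
      Op.totMap_inc, Op.totMap_inc, Op.totMap_inc, LinearMap.id_apply, LinearMap.id_apply,
      LinearMap.id_apply, Forms.bin_tmul γ rfl _ _ hw, f.app_bin]

theorem ev_map (f : Op.Hom A B) (i : Fin 2) (v : Corolla T) (n : ℤ) (x : (PathOp A).X v n) :
    (ev B i).app v n ((map f).app v n x) = f.app v n ((ev A i).app v n x) := ev_lmap _ i n x

end PathOp

end PathFunctoriality

end FeynmanME

namespace FeynmanME

/-! ### Homotopies -/

section Homotopies

variable {k : Type u} [Field k] [CharZero k] {T : Kind} {M A : Op k T false}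

/-- Homotopies with respect to the path object `A ⊗ Ω_1`. -/
def PathHomotopic (γ₀ γ₁ : Op.Hom M A) : Prop :=
  ∃ h : Op.Hom M (PathOp A), (∀ v n x, (PathOp.ev A 1).app v n (h.app v n x) = γ₀.app v n x) ∧
    ∀ v n x, (PathOp.ev A 0).app v n (h.app v n x) = γ₁.app v n x

theorem PathHomotopic.homotopic {γ₀ γ₁ : Op.Hom M A} (h : PathHomotopic γ₀ γ₁) :
    Op.Homotopic γ₀ γ₁ := ⟨PathOp.pathObject A, h⟩

theorem PathHomotopic.refl (γ : Op.Hom M A) : PathHomotopic γ γ :=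
  ⟨γ.comp (PathOp.const A), fun v n x => PathOp.ev_const 1 v n _,
    fun v n x => PathOp.ev_const 0 v n _⟩

/-- Two homotopic maps are related to a common third one by homotopies with respect to `A ⊗ Ω_1`. -/
theorem Op.IsCofibrant.exists_pathHomotopic (hM : M.IsCofibrant) {γ₀ γ₁ : Op.Hom M A}
    (h : Op.Homotopic γ₀ γ₁) :
    ∃ γ : Op.Hom M A, PathHomotopic γ γ₀ ∧ PathHomotopic γ γ₁ := by
  obtain ⟨Q, h, h₀, h₁⟩ := h
  -- The pullback is the mapping path object of `s`: elements of `A` together with a path in `Q.P`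
  -- that starts at their image. Its projection `fst` to `A` is an acyclic fibration with section
  -- `i`, and by two out of three the evaluation `p` at the end of the path is an acyclic fibration
  -- onto `Q.P`.
  let fst := Pullback.fst Q.s (PathOp.ev Q.P 1)
  let p := (Pullback.snd Q.s (PathOp.ev Q.P 1)).comp (PathOp.ev Q.P 0)
  let i : Op.Hom A (Pullback Q.s (PathOp.ev Q.P 1)) :=
    Pullback.lift (Op.Hom.id A) (Q.s.comp (PathOp.const Q.P)) fun v n x =>
      (PathOp.ev_const 1 v n _).symm
  have hfst : fst.IsWeakEq := by
    refine Op.Hom.KerAcyclic.isWeakEq ?_ fun v n x => ⟨i.app v n x, rfl⟩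
    intro v i j n hi hn x hx hdx
    have hc := Pullback.condition x
    change Q.s.app v j (fst.app v j x) = _ at hc
    rw [hx, map_zero] at hc
    obtain ⟨y, hy, hy'⟩ := PathOp.ev_kerAcyclic hi hn _ hc.symm
      (((Pullback.snd _ _).app_d hn x).symm.trans ((congrArg _ hdx).trans (map_zero _)))
    refine ⟨Pullback.mk 0 y (by rw [hy, map_zero]), rfl, Pullback.ext ?_ ?_⟩
    · rw [(Pullback.fst _ _).app_d, Pullback.fst_mk, map_zero]
      exact hx.symm
    · rw [(Pullback.snd _ _).app_d, Pullback.snd_mk, hy']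
  have hi : i.IsWeakEq := hfst.of_comp_left (Op.Hom.isWeakEq_id A)
  have hp : p.IsWeakEq := by
    refine hi.of_comp_right ?_
    have : i.comp p = Q.s := Op.Hom.ext (funext₂ fun v n => LinearMap.ext fun x =>
      PathOp.ev_const 0 v n _)
    rw [this]
    exact Q.weakEq
  obtain ⟨H, hH⟩ := hM _ _ p hp (fun v n y => ⟨Pullback.mk 0 (PathOp.ramp Q.P v n y)
    (by rw [map_zero, PathOp.ev_one_ramp]), PathOp.ev_zero_ramp v n y⟩) h
  -- Lifting the homotopy along `p` yields a map γ to `A` and a path in `Q.P` from s ∘ γ to the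
  -- given homotopy. The two projections of `Q` turn that path into paths in `A` from γ to γ₀ and
  -- from γ to γ₁.
  let w := H.comp (Pullback.snd Q.s (PathOp.ev Q.P 1))
  have hw₁ : ∀ v n x, (PathOp.ev Q.P 1).app v n (w.app v n x) =
      Q.s.app v n ((H.comp fst).app v n x) := fun v n x => (Pullback.condition (H.app v n x)).symm
  refine ⟨H.comp fst, ⟨w.comp (PathOp.map Q.q₀), fun v n x => ?_, fun v n x => ?_⟩,
    ⟨w.comp (PathOp.map Q.q₁), fun v n x => ?_, fun v n x => ?_⟩⟩
  · rw [Op.Hom.comp_app, PathOp.ev_map, hw₁, Q.q₀_s]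
  · rw [Op.Hom.comp_app, PathOp.ev_map, ← h₀, ← hH]
    rfl
  · rw [Op.Hom.comp_app, PathOp.ev_map, hw₁, Q.q₁_s]
  · rw [Op.Hom.comp_app, PathOp.ev_map, ← h₁, ← hH]
    rfl

/-- The paths with a common starting point. -/
noncomputable abbrev Horn (A : Op k T false) : Op k T false :=
  Pullback (PathOp.ev A 1) (PathOp.ev A 1)

/-- Three sides of a square: `((a, b), c)` where `a`, `b` have the same starting point and `c` starts
where `b` ends. -/
noncomputable abbrev OpenBox (A : Op k T false) : Op k T false :=
  Pullback ((Pullback.snd (PathOp.ev A 1) (PathOp.ev A 1)).comp (PathOp.ev A 0)) (PathOp.ev A 1)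

/-- The restriction of a square to three of its sides. -/
noncomputable def boxRestriction (A : Op k T false) :
    Op.Hom (PathOp (PathOp A)) (OpenBox A) :=
  Pullback.lift (Pullback.lift (PathOp.map (PathOp.ev A 1)) (PathOp.ev (PathOp A) 1)
    fun v n x => PathOp.ev_map (PathOp.ev A 1) 1 v n x)
    (PathOp.map (PathOp.ev A 0)) fun v n x => (PathOp.ev_map (PathOp.ev A 0) 1 v n x).symm

/-- Fibrations are only required to be degreewise surjective, so an explicit linear filler is
enough; it need not respect any operation or the differential. -/
theorem boxRestriction_isFib : (boxRestriction A).IsFib := by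
  intro v n y
  set x := (Pullback.fst _ _).app v n y with hx
  set a := (Pullback.fst _ _).app v n x with ha
  set b := (Pullback.snd _ _).app v n x with hb
  set c := (Pullback.snd _ _).app v n y with hc
  have hab : (PathOp.ev A 1).app v n a = (PathOp.ev A 1).app v n b := Pullback.condition x
  have hbc : (PathOp.ev A 0).app v n b = (PathOp.ev A 1).app v n c := Pullback.condition y
  let ramp' : ∀ n, A.X v n →ₗ[k] (PathOp A).X v n := fun n =>
    (PathOp.const A).app v n - PathOp.ramp A v n
  have h1 : ∀ n x, ((PathOp.ev A 1).app v n ∘ₗ ramp' n) x = x := fun n x => by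
    simp only [ramp', LinearMap.comp_apply, LinearMap.sub_apply, map_sub, PathOp.ev_const,
      PathOp.ev_one_ramp, sub_zero]
  have h0 : ∀ n x, ((PathOp.ev A 0).app v n ∘ₗ ramp' n) x = 0 := fun n x => by
    simp only [ramp', LinearMap.comp_apply, LinearMap.sub_apply, map_sub, PathOp.ev_const,
      PathOp.ev_zero_ramp, sub_self]
  have h1' : ∀ n x, ((PathOp.ev A 1).app v n ∘ₗ PathOp.ramp A v n) x = 0 :=
    fun n x => PathOp.ev_one_ramp v n x
  have h0' : ∀ n x, ((PathOp.ev A 0).app v n ∘ₗ PathOp.ramp A v n) x = x :=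
    fun n x => PathOp.ev_zero_ramp v n x
  -- The side `b` is extended constantly, and the two sides adjacent to it are corrected by affine
  -- ramps in the inner coordinate. The corrections vanish on `b` because the initial value of each
  -- side has been subtracted.
  refine ⟨(PathOp.const (PathOp A)).app v n b +
    PathOp.lmap ramp' n (a - (PathOp.const A).app v n ((PathOp.ev A 1).app v n a)) +
    PathOp.lmap (PathOp.ramp A v) n (c - (PathOp.const A).app v n ((PathOp.ev A 1).app v n c)),
    Pullback.ext (Pullback.ext ?_ ?_) ?_⟩
  · change PathOp.lmap ((PathOp.ev A 1).app v) n _ = a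
    rw [map_add, map_add, PathOp.lmap_comp, PathOp.lmap_comp, PathOp.lmap_id h1,
      PathOp.lmap_zero h1', add_zero, hab]
    have : PathOp.lmap ((PathOp.ev A 1).app v) n ((PathOp.const (PathOp A)).app v n b) =
      (PathOp.const A).app v n ((PathOp.ev A 1).app v n b) := PathOp.lmap_mulFun _ Omega.one_mem_gr n b
    rw [this, add_sub_cancel]
  · change (PathOp.ev (PathOp A) 1).app v n _ = b
    rw [map_add, map_add, PathOp.ev_const, PathOp.ev_lmap, PathOp.ev_lmap,
      map_sub ((PathOp.ev A 1).app v n), map_sub ((PathOp.ev A 1).app v n),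
      PathOp.ev_const, PathOp.ev_const, sub_self, sub_self, map_zero, map_zero, add_zero, add_zero]
  · change PathOp.lmap ((PathOp.ev A 0).app v) n _ = c
    rw [map_add, map_add, PathOp.lmap_comp, PathOp.lmap_comp, PathOp.lmap_zero h0,
      PathOp.lmap_id h0', add_zero]
    have : PathOp.lmap ((PathOp.ev A 0).app v) n ((PathOp.const (PathOp A)).app v n b) =
      (PathOp.const A).app v n ((PathOp.ev A 0).app v n b) := PathOp.lmap_mulFun _ Omega.one_mem_gr n b
    rw [this, hbc, add_sub_cancel]

/-- The square and the open box both contract to the value at one corner, and the two evaluations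
there are compatible; two out of three then applies. -/
theorem boxRestriction_isWeakEq : (boxRestriction A).IsWeakEq := by
  let r : Op.Hom (OpenBox A) A :=
    ((Pullback.fst _ _).comp (Pullback.fst (PathOp.ev A 1) (PathOp.ev A 1))).comp (PathOp.ev A 1)
  have hr : r.IsWeakEq := by
    refine Op.Hom.KerAcyclic.isWeakEq ?_ fun v n x =>
      ⟨Pullback.mk (Pullback.mk ((PathOp.const A).app v n x) ((PathOp.const A).app v n x) rfl)
        ((PathOp.const A).app v n x) ?_, PathOp.ev_const 1 v n x⟩
    · intro v i j n hi hn y hy hdy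
      set x := (Pullback.fst _ _).app v j y with hx
      set a := (Pullback.fst _ _).app v j x with ha
      set b := (Pullback.snd _ _).app v j x with hb
      set c := (Pullback.snd _ _).app v j y with hc
      have hab : (PathOp.ev A 1).app v j a = (PathOp.ev A 1).app v j b := Pullback.condition x
      have hbc : (PathOp.ev A 0).app v j b = (PathOp.ev A 1).app v j c := Pullback.condition y
      have ha0 : (PathOp.ev A 1).app v j a = 0 := hy
      have hdx : (Horn A).d hn x = 0 := by rw [hx, ← Op.Hom.app_d, hdy, map_zero]
      have hda : (PathOp A).d hn a = 0 := by rw [ha, ← Op.Hom.app_d, hdx, map_zero]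
      have hdb : (PathOp A).d hn b = 0 := by rw [hb, ← Op.Hom.app_d, hdx, map_zero]
      have hdc : (PathOp A).d hn c = 0 := by rw [hc, ← Op.Hom.app_d, hdy, map_zero]
      obtain ⟨a', ha', hda'⟩ := PathOp.ev_kerAcyclic hi hn a ha0 hda
      obtain ⟨b', hb', hdb'⟩ := PathOp.ev_kerAcyclic hi hn b (hab.symm.trans ha0) hdb
      -- The third side does not start at zero but where `b` ends; the constant path at that point
      -- is subtracted first and put back with the primitive of `b`.
      obtain ⟨c', hc', hdc'⟩ := PathOp.ev_kerAcyclic hi hn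
        (c - (PathOp.const A).app v j ((PathOp.ev A 0).app v j b))
        (by rw [map_sub, PathOp.ev_const, hbc, sub_self])
        (by rw [map_sub, hdc, ← Op.Hom.app_d, ← Op.Hom.app_d, hdb, map_zero, map_zero, sub_zero])
      refine ⟨Pullback.mk (Pullback.mk a' b' (ha'.trans hb'.symm))
        (c' + (PathOp.const A).app v i ((PathOp.ev A 0).app v i b')) ?_, ha',
        Pullback.ext (Pullback.ext hda' hdb') ?_⟩
      · rw [map_add, hc', zero_add, PathOp.ev_const]
        rfl
      · rw [Op.Hom.app_d, Pullback.snd_mk, map_add, hdc', ← Op.Hom.app_d, ← Op.Hom.app_d, hdb',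
          sub_add_cancel]
    · exact (PathOp.ev_const 0 v n x).trans (PathOp.ev_const 1 v n x).symm
  refine hr.of_comp_left ?_
  have : (boxRestriction A).comp r = (PathOp.ev (PathOp A) 1).comp (PathOp.ev A 1) :=
    Op.Hom.ext (funext₂ fun v n => LinearMap.ext fun x => PathOp.ev_map (PathOp.ev A 1) 1 v n x)
  rw [this]
  exact PathOp.ev_isWeakEq.comp PathOp.ev_isWeakEq

/-- The two homotopies and the constant homotopy at γ form an open box. Cofibrancy lifts it to a
square, whose remaining side joins γ₀ to γ₁. Together with reflexivity this yields symmetry and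
transitivity. -/
theorem PathHomotopic.euclidean (hM : M.IsCofibrant) {γ γ₀ γ₁ : Op.Hom M A}
    (h₀ : PathHomotopic γ γ₀) (h₁ : PathHomotopic γ γ₁) : PathHomotopic γ₀ γ₁ := by
  obtain ⟨a, ha, ha'⟩ := h₀
  obtain ⟨c, hc, hc'⟩ := h₁
  let f : Op.Hom M (OpenBox A) := Pullback.lift (Pullback.lift a (γ.comp (PathOp.const A))
    fun v n x => (ha v n x).trans (PathOp.ev_const 1 v n _).symm) c
    fun v n x => (PathOp.ev_const 0 v n _).trans (hc v n x).symm
  obtain ⟨W, hW⟩ := hM _ _ (boxRestriction A) boxRestriction_isWeakEq boxRestriction_isFib f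
  have hWa : ∀ v n x, (PathOp.map (PathOp.ev A 1)).app v n (W.app v n x) = a.app v n x :=
    fun v n x => congrArg (fun y => (Pullback.fst _ _).app v n ((Pullback.fst _ _).app v n y))
      (hW v n x)
  have hWc : ∀ v n x, (PathOp.map (PathOp.ev A 0)).app v n (W.app v n x) = c.app v n x :=
    fun v n x => congrArg (fun y => (Pullback.snd _ _).app v n y) (hW v n x)
  refine ⟨W.comp (PathOp.ev (PathOp A) 0), fun v n x => ?_, fun v n x => ?_⟩
  · rw [Op.Hom.comp_app, ← PathOp.ev_map, hWa, ha']
  · rw [Op.Hom.comp_app, ← PathOp.ev_map, hWc, hc']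

theorem Op.IsCofibrant.homotopic_iff (hM : M.IsCofibrant) {γ₀ γ₁ : Op.Hom M A} :
    Op.Homotopic γ₀ γ₁ ↔ PathHomotopic γ₀ γ₁ := by
  refine ⟨fun h => ?_, PathHomotopic.homotopic⟩
  obtain ⟨γ, h₀, h₁⟩ := hM.exists_pathHomotopic h
  exact h₀.euclidean hM h₁

theorem PathHomotopic.equivalence (hM : M.IsCofibrant) :
    Equivalence (PathHomotopic (M := M) (A := A)) where
  refl := PathHomotopic.refl
  symm h := h.euclidean hM (PathHomotopic.refl _)
  trans h h' := (h.euclidean hM (PathHomotopic.refl _)).euclidean hM h'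

end Homotopies

end FeynmanME

namespace FeynmanME

/-! ### Operads which model the tensor product with forms -/

section Models

variable {k : Type u} [Field k] {T : Kind}

/-- An identification of the total spaces of `B` with `O ⊗ Ω_n` which is compatible with degrees,
differentials and operations. -/
structure FormsModel (O B : Op k T false) (n : ℕ) where
  equiv : ∀ v, B.Tot v ≃ₗ[k] O.Tot v ⊗[k] Omega k n
  equiv_d : ∀ v x, equiv v (B.totD v x) = TensorProduct.map (O.totD v) LinearMap.id (equiv v x) +
    TensorProduct.map (O.totEps v) (Omega.d n) (equiv v x)
  equiv_eps : ∀ v x, equiv v (B.totEps v x) =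
    TensorProduct.map (O.totEps v) (Omega.eps n) (equiv v x)
  equiv_un : ∀ {a v : Corolla T} (γ : UGen a v) (x : B.Tot a), equiv v (B.totUn γ x) =
    TensorProduct.map (O.totUn γ) LinearMap.id (equiv a x)
  equiv_bin : ∀ {a b v : Corolla T} (γ : BGen a b v) (x : B.Tot a) (y : B.Tot b),
    equiv v (B.totBin γ x y) =
      koszul (O.totBin γ) (LinearMap.mul k (Omega k n)) (Omega.eps n) (O.totEps b)
        (equiv a x) (equiv b y)
  equiv_inc : ∀ (v : Corolla T) (m : ℤ) (x : B.X v m), equiv v (B.inc v m x) ∈ Submodule.span k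
    {y | ∃ (i : ℤ) (r : ℕ) (o : O.X v i) (w : Omega k n),
      w ∈ Omega.gr k n r ∧ i + r = m ∧ y = O.inc v i o ⊗ₜ w}
  exists_inc : ∀ (v : Corolla T) (m i : ℤ) (r : ℕ) (o : O.X v i) (w : Omega k n),
    w ∈ Omega.gr k n r → i + r = m → ∃ x : B.X v m, equiv v (B.inc v m x) = O.inc v i o ⊗ₜ w

namespace FormsModel

variable {P : Op k T true} {O B : Op k T false} {n : ℕ} (K : FormsModel O B n)

/-- The induced identification after tensoring with `P`. -/
noncomputable def coeff (P : Op k T true) (v : Corolla T) : Conv P B v ≃ₗ[k] Coeff P O v n :=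
  TensorProduct.congr (LinearEquiv.refl k _) (K.equiv v)

theorem coeff_tmul (v : Corolla T) (p : P.Tot v) (o : B.Tot v) :
    K.coeff P v (p ⊗ₜ o) = p ⊗ₜ K.equiv v o := rfl

theorem coeff_d (v : Corolla T) (x : Conv P B v) :
    K.coeff P v (Conv.d P B v x) = Coeff.d P O v n (K.coeff P v x) := by
  refine LinearMap.congr_fun (f := (K.coeff P v).toLinearMap ∘ₗ Conv.d P B v)
    (g := Coeff.d P O v n ∘ₗ (K.coeff P v).toLinearMap) (TensorProduct.ext' fun p o => ?_) x
  simp only [LinearMap.comp_apply, LinearEquiv.coe_coe, Conv.d, Coeff.d, LinearMap.add_apply,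
    TensorProduct.map_tmul, map_add, K.coeff_tmul, K.equiv_d, LinearMap.id_apply,
    TensorProduct.tmul_add]

theorem coeff_un {a v : Corolla T} (γ : UGen a v) (x : Conv P B a) :
    K.coeff P v (Conv.un P B γ x) = Coeff.un P O γ n (K.coeff P a x) := by
  refine LinearMap.congr_fun (f := (K.coeff P v).toLinearMap ∘ₗ Conv.un P B γ)
    (g := Coeff.un P O γ n ∘ₗ (K.coeff P a).toLinearMap) (TensorProduct.ext' fun p o => ?_) x
  simp only [LinearMap.comp_apply, LinearEquiv.coe_coe, Conv.un, Coeff.un,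
    TensorProduct.map_tmul, K.coeff_tmul, K.equiv_un]

theorem coeff_bin {a b v : Corolla T} (γ : BGen a b v) (x : Conv P B a) (y : Conv P B b) :
    K.coeff P v (Conv.bin P B γ x y) = Coeff.bin P O γ n (K.coeff P a x) (K.coeff P b y) :=
  (koszul_natural _ _ _ _ _ _ (K.equiv a).toLinearMap (K.equiv b).toLinearMap
    (K.equiv v).toLinearMap (fun x y => (K.equiv_bin γ x y).symm) (fun x => (K.equiv_eps a x).symm)
    x y).symm

/-- Both submodules are spanned by homogeneous pure tensors; the two degree axioms of a model match
the spanning elements in each direction. -/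
theorem coeff_mem_deg0 {v : Corolla T} {x : Conv P B v} :
    K.coeff P v x ∈ Coeff.deg0 P O v n ↔ x ∈ Conv.deg P B v 0 := by
  have h₁ : ∀ x ∈ Conv.deg P B v 0, K.coeff P v x ∈ Coeff.deg0 P O v n := fun x hx => by
    refine Conv.map_mem_of_pure_deg (K.coeff P v).toLinearMap _ (fun i j p o hij => ?_) hx
    rw [LinearEquiv.coe_coe, K.coeff_tmul]
    have : Submodule.span k {y | ∃ (i : ℤ) (r : ℕ) (o : O.X v i) (w : Omega k n),
        w ∈ Omega.gr k n r ∧ i + r = j ∧ y = O.inc v i o ⊗ₜ w} ≤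
        (Coeff.deg0 P O v n).comap (TensorProduct.mk k _ _ (P.inc v i p)) := by
      refine Submodule.span_le.2 ?_
      rintro _ ⟨l, r, o, w, hw, h, rfl⟩
      exact Submodule.subset_span ⟨i, l, r, p, o, w, hw, by lia, rfl⟩
    exact this (K.equiv_inc v j o)
  refine ⟨fun hx => ?_, h₁ x⟩
  have : Coeff.deg0 P O v n ≤ (Conv.deg P B v 0).comap (K.coeff P v).symm.toLinearMap := by
    refine Submodule.span_le.2 ?_
    rintro _ ⟨i, j, r, p, o, w, hw, h, rfl⟩
    obtain ⟨y, hy⟩ := K.exists_inc v (j + r) j r o w hw rfl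
    have : (K.coeff P v).symm (P.inc v i p ⊗ₜ[k] (O.inc v j o ⊗ₜ[k] w)) = Conv.pure P B p y := by
      rw [LinearEquiv.symm_apply_eq, K.coeff_tmul, hy]
    change (K.coeff P v).symm _ ∈ Conv.deg P B v 0
    rw [this]
    exact Conv.pure_mem_deg (by lia) _ _
  simpa using this hx

variable [CharZero k]

theorem coeff_curvature (α : ∀ v, Conv P B v) (v : Corolla T) :
    K.coeff P v (curvature α v) = Coeff.d P O v n (K.coeff P v (α v)) +
      (∑ᶠ γ : Σ a : Corolla T, {γ : UGen a v // γ.g.deg = 1},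
        ((γ.1.n.factorial : k)⁻¹) • Coeff.un P O γ.2.1 n (K.coeff P γ.1 (α γ.1))) +
      (2 : k)⁻¹ • (∑ᶠ γ : Σ a b : Corolla T, {γ : BGen a b v // γ.g.deg = 1},
        ((γ.1.n.factorial * γ.2.1.n.factorial : k)⁻¹) •
          Coeff.bin P O γ.2.2.1 n (K.coeff P γ.1 (α γ.1)) (K.coeff P γ.2.1 (α γ.2.1))) := by
  rw [curvature, map_add, map_add, map_smul, K.coeff_d]
  congr 2
  · refine ((K.coeff P v).toAddEquiv.map_finsum _).trans (finsum_congr fun γ => ?_)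
    exact ((K.coeff P v).map_smul _ _).trans (congrArg _ (K.coeff_un _ _))
  · refine ((K.coeff P v).toAddEquiv.map_finsum _).trans (finsum_congr fun γ => ?_)
    exact ((K.coeff P v).map_smul _ _).trans (congrArg _ (K.coeff_bin _ _ _))

/-- Every condition is transported along the identification. The finiteness conditions in the
definition of solutions are automatic under the finiteness assumption on `P`. -/
theorem isME_iff (hloc : T = .properad → P.LocallyFinite) {α : ∀ v, Conv P B v} :
    IsME P O n (fun v => K.coeff P v (α v)) ↔ IsMC α := by
  constructor
  · intro h
    exact ⟨fun v => K.coeff_mem_deg0.1 (h.deg0 v),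
      fun {a v} σ hσ => (K.coeff P v).injective ((K.coeff_un σ _).trans (h.invariant σ hσ)),
      fun v => (K.coeff P v).injective (by rw [K.coeff_curvature, map_zero]; exact h.master v)⟩
  · intro h
    exact ⟨fun v => K.coeff_mem_deg0.2 (h.mem_deg v),
      fun σ hσ => (K.coeff_un σ _).symm.trans (congrArg _ (h.invariant σ hσ)),
      fun v => Set.toFinite _,
      fun v => (bracket_support hloc α α v).subset fun γ hγ h0 => hγ
        ((K.coeff_bin _ _ _).symm.trans ((congrArg _ h0).trans (map_zero _))),
      fun v => by
        have := congrArg (K.coeff P v) (h.curvature_eq_zero v)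
        rwa [K.coeff_curvature, map_zero] at this⟩

/-- Solutions of the master equation with values in `O ⊗ Ω_n` are solutions with values in a model. -/
noncomputable def solutions (hloc : T = .properad → P.LocallyFinite) :
    {α : ∀ v, Conv P B v // IsMC α} ≃ {α : ∀ v, Coeff P O v n // IsME P O n α} :=
  (Equiv.piCongrRight fun v => (K.coeff P v).toEquiv).subtypeEquiv fun _ => (K.isME_iff hloc).symm

end FormsModel

end Models

end FeynmanME

namespace FeynmanME

/-! ### The case `n = 0`: `O` as a model of `O ⊗ Ω_0` -/

section ConstantModel

variable {k : Type u} [Field k]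

theorem Omega.eps_one : Omega.eps 0 (1 : Omega k 0) = 1 := by
  change Omega.jet 0 1 0 0 = 1
  simp

theorem Omega.d_one : Omega.d 0 (1 : Omega k 0) = 0 := by
  change Omega.jet 0 1 0 1 = 0
  simp

/-- `Ω_0 = k`. -/
noncomputable def Omega.zeroEquiv (k : Type u) [Field k] : k ≃ₗ[k] Omega k 0 where
  toLinearMap := Algebra.linearMap k (Omega k 0)
  invFun := Omega.vertex k 0
  left_inv c := by simp
  right_inv x := Omega.algebraMap_vertex x

theorem Omega.one_mem_gr_zero : (1 : Omega k 0) ∈ Omega.gr k 0 0 := by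
  rw [Omega.gr, pow_zero, mul_one]
  exact one_mem (Algebra.adjoin k (Set.range (Omega.t k (n := 0))))

theorem Omega.gr_zero_eq_bot {r : ℕ} (hr : r ≠ 0) : Omega.gr k 0 r = ⊥ := by
  have hdt : Omega.dt k (0 : Fin 1) = 0 := by simpa using Omega.sum_dt (k := k) 0
  have : Submodule.span k (Set.range (Omega.dt k (n := 0))) = ⊥ := by
    rw [Submodule.span_eq_bot]
    rintro _ ⟨i, rfl⟩
    rw [Fin.fin_one_eq_zero i, hdt]
  rw [Omega.gr, this, ← Submodule.zero_eq_bot, zero_pow hr, mul_zero]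

variable [CharZero k] {T : Kind}

/-- `O` is a model of `O ⊗ Ω_0`. -/
noncomputable def FormsModel.const (O : Op k T false) : FormsModel O O 0 where
  equiv v := (TensorProduct.rid k _).symm ≪≫ₗ
    TensorProduct.congr (LinearEquiv.refl k _) (Omega.zeroEquiv k)
  equiv_d v x := by
    change O.totD v x ⊗ₜ algebraMap k (Omega k 0) 1 = O.totD v x ⊗ₜ algebraMap k (Omega k 0) 1 +
      O.totEps v x ⊗ₜ Omega.d 0 (algebraMap k (Omega k 0) 1)
    rw [map_one, Omega.d_one, TensorProduct.tmul_zero, add_zero]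
  equiv_eps v x := by
    change O.totEps v x ⊗ₜ algebraMap k (Omega k 0) 1 =
      O.totEps v x ⊗ₜ Omega.eps 0 (algebraMap k (Omega k 0) 1)
    rw [map_one, Omega.eps_one]
  equiv_un γ x := rfl
  equiv_bin {a b v} γ x y := by
    change O.totBin γ x y ⊗ₜ algebraMap k (Omega k 0) 1 = koszul _ _ _ _
      (x ⊗ₜ algebraMap k (Omega k 0) 1) (y ⊗ₜ algebraMap k (Omega k 0) 1)
    rw [map_one]
    induction y using Op.tot_induction with
    | h0 => simp
    | hadd y y' hy hy' => rw [map_add, TensorProduct.add_tmul, TensorProduct.add_tmul, map_add, hy, hy']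
    | h j y =>
      rw [koszul_tmul (p := 0) _ _ _ _ _ _ _ _ (by simp [Omega.eps_one]) (O.totEps_inc y)]
      simp
  equiv_inc v m x := Submodule.subset_span ⟨m, 0, x, 1, Omega.one_mem_gr_zero, by simp,
    congrArg (O.inc v m x ⊗ₜ[k] ·) (map_one (algebraMap k (Omega k 0)))⟩
  exists_inc v m i r o w hw h := by
    by_cases hr : r = 0
    · subst hr
      obtain rfl : i = m := by simpa using h
      refine ⟨Omega.vertex k 0 w • o, ?_⟩
      change O.inc v i (Omega.vertex k 0 w • o) ⊗ₜ algebraMap k (Omega k 0) 1 = _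
      rw [map_smul, TensorProduct.smul_tmul, ← Algebra.linearMap_apply, ← map_smul, smul_eq_mul,
        mul_one, Algebra.linearMap_apply, Omega.algebraMap_vertex]
    · rw [Omega.gr_zero_eq_bot hr] at hw
      obtain rfl : w = 0 := hw
      exact ⟨0, by simp⟩

end ConstantModel

/-! ### The case `n = 1`: the path operad as a model of `O ⊗ Ω_1` -/

section PathModel

variable {k : Type u} [Field k] [CharZero k] {T : Kind} {O : Op k T false}

namespace PathOp

/-- The inclusion of the total space of the path operad into all forms. -/
noncomputable def toForms (O : Op k T false) (v : Corolla T) : (PathOp O).Tot v →ₗ[k] Forms O v :=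
  DirectSum.toModule k ℤ _ fun m => (Forms.deg O v m).subtype

theorem toForms_inc (v : Corolla T) (m : ℤ) (x : (PathOp O).X v m) :
    toForms O v ((PathOp O).inc v m x) = x.1 :=
  (DirectSum.toModule_lof (M := fun m => (PathOp O).X v m) k m x).trans rfl

/-- The projection onto the forms of degree `m`. -/
noncomputable def formsProj (O : Op k T false) (v : Corolla T) (m : ℤ) :
    Forms O v →ₗ[k] Forms O v :=
  (2 : k)⁻¹ • (TensorProduct.map (O.inc v m ∘ₗ O.proj v m) (LinearMap.id + Omega.eps 1) +
    TensorProduct.map (O.inc v (m - 1) ∘ₗ O.proj v (m - 1)) (LinearMap.id - Omega.eps 1))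

/-- A form of total degree l has its coefficients in degree l when it is a function and in degree l
- 1 when it is a one-form. The operators (1 ± ε)/2 separate functions from one-forms. -/
theorem formsProj_of_deg {v : Corolla T} {m : ℤ} {x : Forms O v} (hx : x ∈ Forms.deg O v m)
    (l : ℤ) : formsProj O v l x = if m = l then x else 0 := by
  have h2 : (2 : k) ≠ 0 := two_ne_zero
  have key : ∀ x : Forms O v, (2 : k)⁻¹ • (x + x) = x := fun x => by
    rw [← two_smul k x, smul_smul, inv_mul_cancel₀ h2, one_smul]
  refine Eq.trans (Forms.eq_of_deg (formsProj O v l) (if m = l then LinearMap.id else 0)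
    (fun i r o w hw h => ?_) hx) (by split_ifs <;> rfl)
  have heps := Omega.eps_of_mem hw
  obtain ⟨rfl, -⟩ | ⟨rfl, -⟩ | rfl := Omega.gr_cases hw
  · obtain rfl : i = m := by simpa using h
    simp only [Nat.cast_zero, Int.negOnePow_zero, one_smul] at heps
    simp only [formsProj, LinearMap.smul_apply, LinearMap.add_apply, TensorProduct.map_tmul,
      LinearMap.comp_apply, LinearMap.sub_apply, LinearMap.id_apply, heps, sub_self,
      TensorProduct.tmul_zero, add_zero]
    split_ifs with hl
    · subst hl
      rw [O.proj_inc_same, TensorProduct.tmul_add, key]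
      rfl
    · rw [O.proj_inc_ne v hl, map_zero, TensorProduct.zero_tmul, smul_zero]
      rfl
  · simp only [Nat.cast_one, Int.negOnePow_one, Units.neg_smul, one_smul] at heps
    simp only [formsProj, LinearMap.smul_apply, LinearMap.add_apply, TensorProduct.map_tmul,
      LinearMap.comp_apply, LinearMap.sub_apply, LinearMap.id_apply, heps, add_neg_cancel,
      TensorProduct.tmul_zero, zero_add, sub_neg_eq_add]
    split_ifs with hl
    · obtain rfl : i = l - 1 := by push_cast at h; lia
      rw [O.proj_inc_same, TensorProduct.tmul_add, key]
      rfl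
    · rw [O.proj_inc_ne v (by push_cast at h; lia), map_zero, TensorProduct.zero_tmul, smul_zero]
      rfl
  · simp

theorem formsProj_toForms (v : Corolla T) (m : ℤ) (x : (PathOp O).Tot v) :
    formsProj O v m (toForms O v x) = ((PathOp O).proj v m x).1 := by
  refine LinearMap.congr_fun (f := formsProj O v m ∘ₗ toForms O v)
    (g := (Forms.deg O v m).subtype ∘ₗ (PathOp O).proj v m) ((PathOp O).tot_hom_ext fun l x => ?_) x
  change formsProj O v m (toForms O v ((PathOp O).inc v l x)) =
    ((PathOp O).proj v m ((PathOp O).inc v l x)).1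
  refine (congrArg _ (toForms_inc v l x)).trans ((formsProj_of_deg x.2 m).trans ?_)
  split_ifs with h
  · subst h
    exact (congrArg Subtype.val ((PathOp O).proj_inc_same v l x)).symm
  · exact (congrArg Subtype.val ((PathOp O).proj_inc_ne v h x)).symm

/-- The path operad was defined degree by degree as subspaces of all forms, so one has to see that
these are independent and span. The projections recover each component, and every pure tensor splits
into a function part and a one-form part. -/
theorem toForms_bijective (v : Corolla T) : Function.Bijective (toForms O v) := by
  constructor
  · refine (injective_iff_map_eq_zero _).2 fun x hx => DFinsupp.ext fun m => Subtype.ext ?_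
    have := formsProj_toForms v m x
    rw [hx, map_zero] at this
    exact this.symm
  · refine LinearMap.range_eq_top.1 (eq_top_iff.2 ?_)
    rw [← TensorProduct.span_tmul_eq_top, Submodule.span_le]
    rintro _ ⟨o, w, rfl⟩
    induction o using Op.tot_induction with
    | h0 => simp
    | hadd o o' h h' =>
      rw [TensorProduct.add_tmul]
      exact add_mem h h'
    | h i o =>
      obtain ⟨w₀, h₀, w₁, h₁, rfl⟩ := Omega.eq_add_of_interval w
      rw [TensorProduct.tmul_add]
      exact add_mem ⟨(PathOp O).inc v i ⟨_, Forms.tmul_mem_deg (by simp) o h₀⟩, toForms_inc _ _ _⟩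
        ⟨(PathOp O).inc v (i + 1) ⟨_, Forms.tmul_mem_deg (by simp) o h₁⟩, toForms_inc _ _ _⟩

end PathOp

/-- The path operad is a model of `O ⊗ Ω_1`. -/
noncomputable def FormsModel.path (O : Op k T false) : FormsModel O (PathOp O) 1 where
  equiv v := LinearEquiv.ofBijective (PathOp.toForms O v) (PathOp.toForms_bijective v)
  equiv_d v x := by
    refine LinearMap.congr_fun (f := PathOp.toForms O v ∘ₗ (PathOp O).totD v)
      (g := Forms.d O v ∘ₗ PathOp.toForms O v) ((PathOp O).tot_hom_ext fun l x => ?_) x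
    rw [LinearMap.comp_apply, LinearMap.comp_apply, (PathOp O).totD_inc rfl, PathOp.toForms_inc,
      PathOp.toForms_inc]
    rfl
  equiv_eps v x := by
    refine LinearMap.congr_fun (f := PathOp.toForms O v ∘ₗ (PathOp O).totEps v)
      (g := TensorProduct.map (O.totEps v) (Omega.eps 1) ∘ₗ PathOp.toForms O v)
      ((PathOp O).tot_hom_ext fun l x => ?_) x
    rw [LinearMap.comp_apply, LinearMap.comp_apply, (PathOp O).totEps_inc, map_negOnePow_smul,
      PathOp.toForms_inc]
    have := Forms.eq_of_deg (((l.negOnePow : ℤ) : k) • LinearMap.id)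
      (TensorProduct.map (O.totEps v) (Omega.eps 1)) (fun i r o w hw h => ?_) x.2
    · rw [← this, LinearMap.smul_apply, Int.cast_smul_eq_zsmul]
      rfl
    · subst h
      rw [LinearMap.smul_apply, Int.cast_smul_eq_zsmul, ← Units.smul_def, TensorProduct.map_tmul,
        O.totEps_inc, Omega.eps_of_mem hw]
      simp only [negOnePow_smul_eq_ite, Int.even_add, LinearMap.id_apply]
      by_cases hi : Even i <;> by_cases hr : Even (r : ℤ) <;>
        simp [hi, hr, TensorProduct.tmul_neg, TensorProduct.neg_tmul]
  equiv_un {a v} γ x := by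
    refine LinearMap.congr_fun (f := PathOp.toForms O v ∘ₗ (PathOp O).totUn γ)
      (g := Forms.un O γ ∘ₗ PathOp.toForms O a) ((PathOp O).tot_hom_ext fun l x => ?_) x
    rw [LinearMap.comp_apply, LinearMap.comp_apply, (PathOp O).totUn_inc γ rfl, PathOp.toForms_inc,
      PathOp.toForms_inc]
    rfl
  equiv_bin {a b v} γ x y := by
    have : ((PathOp O).totBin γ).compr₂ (PathOp.toForms O v) =
        (Forms.bin O γ).compl₁₂ (PathOp.toForms O a) (PathOp.toForms O b) :=
      (PathOp O).tot_hom_ext fun l x => (PathOp O).tot_hom_ext fun m y => by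
        rw [LinearMap.compr₂_apply, LinearMap.compl₁₂_apply, (PathOp O).totBin_inc γ rfl,
          PathOp.toForms_inc, PathOp.toForms_inc, PathOp.toForms_inc]
        rfl
    exact LinearMap.congr_fun₂ this x y
  equiv_inc v m x := by
    rw [LinearEquiv.ofBijective_apply, PathOp.toForms_inc]
    exact x.2
  exists_inc v m i r o w hw h :=
    ⟨⟨_, Forms.tmul_mem_deg h o hw⟩, PathOp.toForms_inc v m _⟩

theorem FormsModel.pull_path (i : Fin 2) {θ : Fin 1 → Fin 2} (hθ : θ 0 = i) (v : Corolla T)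
    (x : (PathOp O).Tot v) :
    TensorProduct.map LinearMap.id (Omega.pull (k := k) θ).toLinearMap
      ((FormsModel.path O).equiv v x) =
      (FormsModel.const O).equiv v ((PathOp.ev O i).tot v x) := by
  have h₁ : ∀ y : Forms O v, TensorProduct.map LinearMap.id (Omega.pull (k := k) θ).toLinearMap y =
      (FormsModel.const O).equiv v (Forms.vertex O i v y) := fun y => by
    refine LinearMap.congr_fun
      (f := TensorProduct.map LinearMap.id (Omega.pull (k := k) θ).toLinearMap)
      (g := ((FormsModel.const O).equiv v).toLinearMap ∘ₗ Forms.vertex O i v)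
      (TensorProduct.ext' fun o w => ?_) y
    rw [TensorProduct.map_tmul, LinearMap.comp_apply, Forms.vertex_tmul]
    change o ⊗ₜ Omega.pull θ w = (Omega.vertex k i w • o) ⊗ₜ algebraMap k (Omega k 0) 1
    rw [Omega.pull_const i θ hθ, TensorProduct.smul_tmul, Algebra.algebraMap_eq_smul_one, map_one]
  rw [h₁]
  refine congrArg _ ?_
  refine LinearMap.congr_fun (f := Forms.vertex O i v ∘ₗ PathOp.toForms O v)
    (g := (PathOp.ev O i).tot v) ((PathOp O).tot_hom_ext fun l x => ?_) x
  rw [LinearMap.comp_apply, PathOp.toForms_inc, Op.Hom.tot_inc, PathOp.inc_ev]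

end PathModel

end FeynmanME

namespace FeynmanME

/-! ### Vertices, edges and connected components of `ME_•` -/

section Simplices

variable {k : Type u} [Field k] [CharZero k] {T : Kind} {P : Op k T true} {O : Op k T false}

/-- Maps `FT P → O` are vertices of `ME_•`. -/
noncomputable def vertexEquiv (hfin : P.LevelwiseFinite) (hloc : T = .properad → P.LocallyFinite) :
    Op.Hom (FT P) O ≃ MESimplex P O 0 :=
  (FT.homEquiv hfin hloc).trans ((FormsModel.const O).solutions hloc)

/-- Maps to the path operad are edges of `ME_•`. -/
noncomputable def edgeEquiv (hfin : P.LevelwiseFinite) (hloc : T = .properad → P.LocallyFinite) :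
    Op.Hom (FT P) (PathOp O) ≃ MESimplex P O 1 :=
  (FT.homEquiv hfin hloc).trans ((FormsModel.path O).solutions hloc)

theorem eval_vertexEquiv (hfin : P.LevelwiseFinite) (hloc : T = .properad → P.LocallyFinite)
    (γ : Op.Hom (FT P) O) (v : Corolla T) {i n : ℤ} (h : i + n = 0)
    (f : Module.Dual k (P.X v i)) :
    Coeff.eval O f 0 (MESimplex.family P O (vertexEquiv hfin hloc γ) v) =
      O.inc v n (γ.app v n (FT.gen P h f)) ⊗ₜ[k] (1 : Omega k 0) := by
  have key : ∀ x : Conv P O v, Coeff.eval O f 0 ((FormsModel.const O).coeff P v x) =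
      (FormsModel.const O).equiv v (Conv.ev f x) := fun x => by
    refine LinearMap.congr_fun
      (f := Coeff.eval O f 0 ∘ₗ ((FormsModel.const O).coeff P v).toLinearMap)
      (g := ((FormsModel.const O).equiv v).toLinearMap ∘ₗ Conv.ev f)
      (TensorProduct.ext' fun p o => ?_) x
    simp only [LinearMap.comp_apply, LinearEquiv.coe_coe, FormsModel.coeff_tmul, Coeff.eval,
      TensorProduct.map_tmul, TensorProduct.lid_tmul, Conv.ev, map_smul, LinearMap.id_apply]
  refine (key _).trans ?_
  rw [FT.ev_homEquiv hfin hloc γ h]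
  exact congrArg (_ ⊗ₜ[k] ·) (map_one (algebraMap k (Omega k 0)))

/-- The i-th face is the pull-back along the inclusion of the vertex other than `i`, and pulling a
form back to a point is evaluating it there. -/
theorem δ_edgeEquiv (hfin : P.LevelwiseFinite) (hloc : T = .properad → P.LocallyFinite)
    (h : Op.Hom (FT P) (PathOp O)) (i j : Fin 2) (hij : i.succAbove 0 = j) :
    (MESet P O).δ i (edgeEquiv hfin hloc h) = vertexEquiv hfin hloc (h.comp (PathOp.ev O j)) := by
  refine Subtype.ext (funext fun v => ?_)
  change Coeff.pull P O (i.succAbove) v ((FormsModel.path O).coeff P v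
    ((FT.homEquiv hfin hloc h).1 v)) = (FormsModel.const O).coeff P v
      ((FT.homEquiv hfin hloc (h.comp (PathOp.ev O j))).1 v)
  rw [FT.homEquiv_comp]
  refine LinearMap.congr_fun
    (f := Coeff.pull P O (i.succAbove) v ∘ₗ ((FormsModel.path O).coeff P v).toLinearMap)
    (g := ((FormsModel.const O).coeff P v).toLinearMap ∘ₗ
      TensorProduct.map LinearMap.id ((PathOp.ev O j).tot v))
    (TensorProduct.ext' fun p o => ?_) _
  exact congrArg (p ⊗ₜ[k] ·) (FormsModel.pull_path j hij v o)

theorem pathHomotopic_iff_meRel (hfin : P.LevelwiseFinite)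
    (hloc : T = .properad → P.LocallyFinite) (γ₀ γ₁ : Op.Hom (FT P) O) :
    PathHomotopic γ₀ γ₁ ↔ MERel P O (vertexEquiv hfin hloc γ₀) (vertexEquiv hfin hloc γ₁) := by
  have key : ∀ (h : Op.Hom (FT P) (PathOp O)) (j : Fin 2) (γ : Op.Hom (FT P) O),
      (∀ v n x, (PathOp.ev O j).app v n (h.app v n x) = γ.app v n x) ↔ h.comp (PathOp.ev O j) = γ :=
    fun h j γ => ⟨fun H => Op.Hom.ext (funext₂ fun v n => LinearMap.ext fun x => H v n x),
      fun H v n x => by rw [← H]; rfl⟩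
  rw [PathHomotopic, MERel, ← (edgeEquiv hfin hloc).exists_congr_right]
  refine exists_congr fun h => ?_
  rw [key, key, δ_edgeEquiv hfin hloc h 0 1 rfl, δ_edgeEquiv hfin hloc h 1 0 rfl,
    (vertexEquiv hfin hloc).apply_eq_iff_eq, (vertexEquiv hfin hloc).apply_eq_iff_eq]

/-- In general π₀ is the quotient by the equivalence relation that the edges generate. Here the
relation given by single edges is already an equivalence, so nothing is added. -/
theorem π₀_mk_eq_iff {s₀ s₁ : MESimplex P O 0} (h : Equivalence (MERel P O)) :
    (SSet.π₀.mk s₀ : (MESet P O).π₀) = SSet.π₀.mk s₁ ↔ MERel P O s₀ s₁ := by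
  rw [SSet.π₀.mk_eq_mk_iff]
  constructor
  · intro H
    induction H with
    | rel x y e =>
      obtain ⟨e⟩ := e
      -- A simplicial edge runs from its face δ₁ to its face δ₀, opposite to the order of the
      -- arguments of `MERel`.
      exact h.symm ⟨e.edge, e.tgt_eq, e.src_eq⟩
    | refl x => exact h.refl x
    | symm x y _ ih => exact h.symm ih
    | trans x y z _ _ ih ih' => exact h.trans ih ih'
  · rintro ⟨s, h₀, h₁⟩
    exact .symm _ _ (.rel _ _ ⟨SSet.Edge.mk s h₁ h₀⟩)

end Simplices

/-- Homotopy through any path object, homotopy through `O ⊗ Ω_1` and ∼ are the same relation under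
the bijection on vertices; the equivalence properties pass from one to the others. -/
theorem me_of_isCofibrant {k : Type u} [Field k] [CharZero k] {T : Kind}
    {P : Op k T true} {O : Op k T false}
    (hfin : P.LevelwiseFinite) (hloc : T = Kind.properad → P.LocallyFinite)
    (hcof : (FT P).IsCofibrant) :
    Equivalence (Op.Homotopic (M := FT P) (O := O)) ∧
    Equivalence (MERel P O) ∧
    ∃ e : Op.Hom (FT P) O ≃ MESimplex P O 0,
      (∀ (γ : Op.Hom (FT P) O) (v : Corolla T) (i n : ℤ)
        (h : i + n = 0) (f : Module.Dual k (P.X v i)),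
        Coeff.eval O f 0 (MESimplex.family P O (e γ) v) =
          O.inc v n (γ.app v n (FT.gen P h f)) ⊗ₜ[k] (1 : Omega k 0)) ∧
      (∀ γ₀ γ₁ : Op.Hom (FT P) O, Op.Homotopic γ₀ γ₁ ↔ MERel P O (e γ₀) (e γ₁)) ∧
      ∃ E : Quot (Op.Homotopic (M := FT P) (O := O)) ≃ (MESet P O).π₀,
        ∀ γ : Op.Hom (FT P) O, E (Quot.mk _ γ) = SSet.π₀.mk (e γ) := by
  set e := vertexEquiv (O := O) hfin hloc with he
  have hiff : ∀ γ₀ γ₁ : Op.Hom (FT P) O, Op.Homotopic γ₀ γ₁ ↔ MERel P O (e γ₀) (e γ₁) :=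
    fun γ₀ γ₁ => hcof.homotopic_iff.trans (pathHomotopic_iff_meRel hfin hloc γ₀ γ₁)
  have hH : Equivalence (Op.Homotopic (M := FT P) (O := O)) := by
    have := PathHomotopic.equivalence (A := O) hcof
    exact ⟨fun x => hcof.homotopic_iff.2 (this.refl x),
      fun h => hcof.homotopic_iff.2 (this.symm (hcof.homotopic_iff.1 h)),
      fun h h' => hcof.homotopic_iff.2 (this.trans (hcof.homotopic_iff.1 h)
        (hcof.homotopic_iff.1 h'))⟩
  have hiff' : ∀ s₀ s₁, MERel P O s₀ s₁ ↔ Op.Homotopic (e.symm s₀) (e.symm s₁) :=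
    fun s₀ s₁ => by rw [hiff, e.apply_symm_apply, e.apply_symm_apply]
  have hR : Equivalence (MERel P O) :=
    ⟨fun s => (hiff' _ _).2 (hH.refl _), fun h => (hiff' _ _).2 (hH.symm ((hiff' _ _).1 h)),
      fun h h' => (hiff' _ _).2 (hH.trans ((hiff' _ _).1 h) ((hiff' _ _).1 h'))⟩
  refine ⟨hH, hR, e, fun γ v i n h f => eval_vertexEquiv hfin hloc γ v h f, hiff,
    Equiv.ofBijective (Quot.lift (fun γ => SSet.π₀.mk (e γ))
      fun γ₀ γ₁ h => (π₀_mk_eq_iff hR).2 ((hiff _ _).1 h)) ⟨?_, ?_⟩, fun γ => rfl⟩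
  · rintro ⟨γ₀⟩ ⟨γ₁⟩ h
    exact Quot.sound ((hiff _ _).2 ((π₀_mk_eq_iff hR).1 h))
  · intro x
    obtain ⟨s, rfl⟩ := SSet.π₀.mk_surjective x
    exact ⟨Quot.mk _ (e.symm s), congrArg SSet.π₀.mk (e.apply_symm_apply s)⟩

end FeynmanME

namespace FeynmanME

/-! ### Averages over isomorphisms -/

section Averages

variable {k : Type u} [Field k] [CharZero k] {T : Kind} {P : Op k T true} {A B : Op k T false}

instance finite_sigma_iso (v : Corolla T) : Finite (Σ a : Corolla T, Iso a v) :=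
  UGen.finite_sigma (fun _ _ γ => γ.g.deg = 0) v

theorem finsum_const_eq (ι : Type*) {V : Type*} [Finite ι] [AddCommMonoid V] (x : V) :
    ∑ᶠ _ : ι, x = Nat.card ι • x := by
  have := Fintype.ofFinite ι
  rw [finsum_eq_sum_of_fintype, Finset.sum_const, Finset.card_univ, Nat.card_eq_fintype_card]

/-- The average of a family over all isomorphisms of corollas. -/
noncomputable def average (ξ : ∀ v, Conv P A v) (v : Corolla T) : Conv P A v :=
  (Nat.card (Σ a : Corolla T, Iso a v) : k)⁻¹ •
    ∑ᶠ γ : Σ a : Corolla T, Iso a v, Conv.un P A γ.2.1 (ξ γ.1)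

theorem average_isInvariant (ξ : ∀ v, Conv P A v) : IsInvariant (average ξ) := by
  intro a v σ hσ
  rw [average, average, map_smul, Nat.card_congr (UGen.postEquiv 0 ⟨σ, hσ⟩)]
  refine congrArg _ (((Conv.un P A σ).toAddMonoidHom.map_finsum (Set.toFinite _)).trans
    (finsum_eq_of_bijective _ (UGen.postEquiv 0 ⟨σ, hσ⟩).bijective fun γ => ?_))
  exact Conv.un_iso_un ⟨σ, hσ⟩ _ _

theorem average_natural {ξ : ∀ v, Conv P A v} {ζ : ∀ v, Conv P B v}
    (F : ∀ v, Conv P A v →ₗ[k] Conv P B v)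
    (hF : ∀ {a v : Corolla T} (σ : Iso a v) (x : Conv P A a),
      F v (Conv.un P A σ.1 x) = Conv.un P B σ.1 (F a x))
    (h : ∀ v, F v (ξ v) = ζ v) (v : Corolla T) : F v (average ξ v) = average ζ v := by
  rw [average, average, map_smul]
  refine congrArg _ (((F v).toAddMonoidHom.map_finsum (Set.toFinite _)).trans
    (finsum_congr fun γ => ?_))
  exact (hF γ.2 _).trans (congrArg _ (h _))

/-- An invariant family contributes the same value for each isomorphism, and the number of these is
invertible in `k`. Averaging thus corrects a choice without disturbing what is already invariant. -/
theorem IsInvariant.average_eq {ξ : ∀ v, Conv P A v} (hξ : IsInvariant ξ) (v : Corolla T) :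
    average ξ v = ξ v := by
  have : Nonempty (Σ a : Corolla T, Iso a v) := ⟨⟨v, Iso.refl v⟩⟩
  have h : (fun γ : Σ a : Corolla T, Iso a v => Conv.un P A γ.2.1 (ξ γ.1)) = fun _ => ξ v :=
    funext fun γ => hξ γ.2.1 γ.2.2
  have hc := finsum_const_eq (Σ a : Corolla T, Iso a v) (ξ v)
  rw [average, h, hc, ← Nat.cast_smul_eq_nsmul k, smul_smul,
    inv_mul_cancel₀ (Nat.cast_ne_zero.2 Nat.card_pos.ne'), one_smul]

theorem average_mem {ξ : ∀ v, Conv P A v} (S : ∀ v, Submodule k (Conv P A v))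
    (hS : ∀ {a v : Corolla T} (σ : Iso a v) {x : Conv P A a}, x ∈ S a → Conv.un P A σ.1 x ∈ S v)
    (h : ∀ v, ξ v ∈ S v) (v : Corolla T) : average ξ v ∈ S v :=
  Submodule.smul_mem _ _ (finsum_induction (· ∈ S v) (zero_mem _) (fun _ _ => add_mem)
    fun γ => hS γ.2 (h _))

end Averages

/-! ### The filtration by the degree in `P` -/

section Filtration

variable {k : Type u} [Field k] {T : Kind} {P : Op k T true} {A B : Op k T false}

namespace Conv

variable (P A) in
/-- The elements whose components in `P` are of degree at least `m`. -/
noncomputable def fil (v : Corolla T) (m : ℤ) : Submodule k (Conv P A v) :=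
  Submodule.span k {x | ∃ (i j : ℤ) (p : P.X v i) (o : A.X v j), m ≤ i ∧ x = pure P A p o}

theorem pure_mem_fil {v : Corolla T} {i j m : ℤ} (h : m ≤ i) (p : P.X v i) (o : A.X v j) :
    pure P A p o ∈ fil P A v m := Submodule.subset_span ⟨i, j, p, o, h, rfl⟩

theorem fil_antitone (v : Corolla T) {m n : ℤ} (h : m ≤ n) : fil P A v n ≤ fil P A v m :=
  Submodule.span_mono fun _ ⟨i, j, p, o, hi, hx⟩ => ⟨i, j, p, o, h.trans hi, hx⟩

theorem map_mem_of_fil {v : Corolla T} {V : Type*} [AddCommGroup V] [Module k V] {m : ℤ}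
    (f : Conv P A v →ₗ[k] V) (S : Submodule k V)
    (h : ∀ (i j : ℤ) (p : P.X v i) (o : A.X v j), m ≤ i → f (pure P A p o) ∈ S)
    {x} (hx : x ∈ fil P A v m) : f x ∈ S := by
  have : fil P A v m ≤ S.comap f := by
    refine Submodule.span_le.2 ?_
    rintro _ ⟨i, j, p, o, hm, rfl⟩
    exact h i j p o hm
  exact this hx

theorem ev_eq_zero_of_fil {v : Corolla T} {m i : ℤ} (hi : i < m) (f : Module.Dual k (P.X v i))
    {x : Conv P A v} (hx : x ∈ fil P A v m) : ev f x = 0 := by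
  have := map_mem_of_fil (ev f) ⊥ (fun i' j p o h => by
    rw [ev_pure_ne (by lia)]; exact zero_mem _) hx
  simpa using this

theorem mem_fil_of_ev (hfin : P.LevelwiseFinite) {v : Corolla T} {m : ℤ} {x : Conv P A v}
    (h : ∀ s : P.HIndex v, s.1 < m → ev ((hBasis P v s.1).coord s.2) x = 0) :
    x ∈ fil P A v m := by
  rw [eq_sum hfin x]
  refine finsum_induction (· ∈ fil P A v m) (zero_mem _) (fun _ _ => add_mem) fun s => ?_
  by_cases hs : s.1 < m
  · rw [h s hs, TensorProduct.tmul_zero]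
    exact zero_mem _
  · generalize ev ((hBasis P v s.1).coord s.2) x = o
    induction o using Op.tot_induction with
    | h0 =>
      rw [TensorProduct.tmul_zero]
      exact zero_mem _
    | hadd o o' h h' =>
      rw [TensorProduct.tmul_add]
      exact add_mem h h'
    | h j o => exact pure_mem_fil (not_lt.1 hs) _ _

theorem d_mem_fil {v : Corolla T} {m : ℤ} {x : Conv P A v} (hx : x ∈ fil P A v m) :
    d P A v x ∈ fil P A v m := by
  refine map_mem_of_fil (d P A v) _ (fun i j p o h => ?_) hx
  rw [d_pure rfl rfl, negOnePow_smul_eq_ite]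
  refine add_mem (pure_mem_fil (by lia) _ _) ?_
  split_ifs
  · exact pure_mem_fil h _ _
  · exact neg_mem (pure_mem_fil h _ _)

theorem un_mem_fil {a v : Corolla T} (γ : UGen a v) {m n : ℤ} (h : m + γ.g.sh true = n)
    {x : Conv P A a} (hx : x ∈ fil P A a m) : un P A γ x ∈ fil P A v n := by
  refine map_mem_of_fil (un P A γ) _ (fun i j p o hi => ?_) hx
  rw [un_pure γ rfl rfl]
  exact pure_mem_fil (by lia) _ _

theorem bin_mem_fil [CharZero k] {a b v : Corolla T} (γ : BGen a b v) {l m n : ℤ}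
    (h : l + m + γ.g.sh true = n) {x : Conv P A a} {y : Conv P A b} (hx : x ∈ fil P A a l)
    (hy : y ∈ fil P A b m) : bin P A γ x y ∈ fil P A v n := by
  refine map_mem_of_fil ((bin P A γ).flip y) _ (fun i j p o hi => ?_) hx
  refine map_mem_of_fil (bin P A γ (pure P A p o)) _ (fun i' j' p' o' hi' => ?_) hy
  rw [bin_pure γ rfl rfl, negOnePow_smul_eq_ite]
  split_ifs
  · exact pure_mem_fil (by lia) _ _
  · exact neg_mem (pure_mem_fil (by lia) _ _)

theorem mem_fil_zero (hP : P.NonNeg) {v : Corolla T} (x : Conv P A v) : x ∈ fil P A v 0 := by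
  have h : ⊤ ≤ fil P A v 0 := by
    have h := hom_ext (P := P) (A := A) (v := v) (f := (fil P A v 0).mkQ) (g := 0)
      fun i j p o => by
        rw [LinearMap.zero_apply, Submodule.mkQ_apply, Submodule.Quotient.mk_eq_zero]
        by_cases hi : i < 0
        · have := hP v i hi
          rw [Subsingleton.elim p 0, zero_pure]
          exact zero_mem _
        · exact pure_mem_fil (not_lt.1 hi) _ _
    rw [← (fil P A v 0).ker_mkQ, h, LinearMap.ker_zero]
  exact h trivial

/-- A finite-dimensional `P(v)` lives in finitely many degrees; the bound depends on `v`, so lifts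
will stabilize at each corolla separately. -/
theorem exists_fil_eq_bot (hfin : P.LevelwiseFinite) (v : Corolla T) :
    ∃ N : ℕ, fil P A v N = ⊥ := by
  have := P.finite_hIndex hfin v
  obtain ⟨N, hN⟩ := (Set.finite_range fun s : P.HIndex v => s.1).bddAbove
  refine ⟨(N + 1).toNat, Submodule.span_eq_bot.2 ?_⟩
  rintro _ ⟨i, j, p, o, hi, rfl⟩
  have : IsEmpty (Module.Basis.ofVectorSpaceIndex k (P.X v i)) :=
    ⟨fun q => by have : i ≤ N := hN ⟨⟨i, q⟩, rfl⟩; lia⟩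
  have : Subsingleton (P.X v i) := (hBasis P v i).repr.injective.subsingleton
  rw [Subsingleton.elim p 0, zero_pure]

end Conv

end Filtration

end FeynmanME

namespace FeynmanME

/-! ### Naturality of the curvature -/

section Naturality

variable {k : Type u} [Field k] {T : Kind} {P : Op k T true} {A B : Op k T false}

namespace Conv

/-- The map induced by a morphism of the second factor. -/
noncomputable def map (P : Op k T true) (g : Op.Hom A B) (v : Corolla T) :
    Conv P A v →ₗ[k] Conv P B v := TensorProduct.map LinearMap.id (g.tot v)

theorem map_pure (g : Op.Hom A B) {v : Corolla T} {i j : ℤ} (p : P.X v i) (o : A.X v j) :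
    map P g v (pure P A p o) = pure P B p (g.app v j o) :=
  congrArg (P.inc v i p ⊗ₜ[k] ·) (g.tot_inc v j o)

theorem map_d (g : Op.Hom A B) {v : Corolla T} (x : Conv P A v) :
    map P g v (d P A v x) = d P B v (map P g v x) := by
  refine eq_of_pure (map P g v ∘ₗ d P A v) (d P B v ∘ₗ map P g v) (fun i j p o => ?_) x
  rw [LinearMap.comp_apply, LinearMap.comp_apply, d_pure rfl rfl, map_pure, d_pure rfl rfl, map_add,
    map_negOnePow_smul, map_pure, map_pure, g.app_d]

theorem map_un (g : Op.Hom A B) {a v : Corolla T} (γ : UGen a v) (x : Conv P A a) :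
    map P g v (un P A γ x) = un P B γ (map P g a x) := by
  refine eq_of_pure (map P g v ∘ₗ un P A γ) (un P B γ ∘ₗ map P g a) (fun i j p o => ?_) x
  rw [LinearMap.comp_apply, LinearMap.comp_apply, un_pure γ rfl rfl, map_pure, map_pure,
    un_pure γ rfl rfl, g.app_un]

theorem exists_map_eq {g : Op.Hom A B} (hg : g.IsFib) {v : Corolla T} {m : ℤ} {y : Conv P B v}
    (hy : y ∈ deg P B v m) : ∃ x ∈ deg P A v m, map P g v x = y := by
  have : y ∈ (deg P A v m).map (map P g v) := by
    refine map_mem_of_pure_deg LinearMap.id _ (fun i j p o h => ?_) hy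
    obtain ⟨o, rfl⟩ := hg v j o
    exact ⟨_, pure_mem_deg h p o, map_pure g p o⟩
  exact this

variable [CharZero k]

theorem map_bin (g : Op.Hom A B) {a b v : Corolla T} (γ : BGen a b v) (x : Conv P A a)
    (y : Conv P A b) :
    map P g v (bin P A γ x y) = bin P B γ (map P g a x) (map P g b y) := by
  refine LinearMap.congr_fun₂ (f := (bin P A γ).compr₂ (map P g v))
    (g := (bin P B γ).compl₁₂ (map P g a) (map P g b))
    (hom_ext fun i j p o => hom_ext fun i' j' p' o' => ?_) x y
  rw [LinearMap.compr₂_apply, LinearMap.compl₁₂_apply, bin_pure γ rfl rfl, map_pure, map_pure,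
    bin_pure γ rfl rfl, map_negOnePow_smul, map_pure, g.app_bin]

end Conv

variable [CharZero k]

theorem map_curvature (hloc : T = .properad → P.LocallyFinite) (g : Op.Hom A B)
    (α : ∀ v, Conv P A v) (v : Corolla T) :
    Conv.map P g v (curvature α v) = curvature (fun v => Conv.map P g v (α v)) v := by
  have h₁ : Conv.map P g v (loops α v) = loops (fun v => Conv.map P g v (α v)) v :=
    ((Conv.map P g v).toAddMonoidHom.map_finsum (Set.toFinite _)).trans
      (finsum_congr fun γ => ((Conv.map P g v).map_smul _ _).trans
        (congrArg _ (Conv.map_un g _ _)))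
  have h₂ : Conv.map P g v (bracket α α v) =
      bracket (fun v => Conv.map P g v (α v)) (fun v => Conv.map P g v (α v)) v :=
    ((Conv.map P g v).toAddMonoidHom.map_finsum
      (support_smul_finite (bracket_support hloc _ _ _) _)).trans
      (finsum_congr fun γ => ((Conv.map P g v).map_smul _ _).trans
        (congrArg _ (Conv.map_bin g _ _ _)))
  rw [curvature, curvature, map_add, map_add, map_smul, h₁, h₂, Conv.map_d]

end Naturality

/-! ### Leading terms of the curvature and their primitives -/

section FilteredCurvature

variable {k : Type u} [Field k] [CharZero k] {T : Kind} {P : Op k T true} {A B : Op k T false}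

theorem loops_mem_fil {m n : ℤ} (h : m + 1 = n) {α : ∀ v, Conv P A v}
    (hα : ∀ v, α v ∈ Conv.fil P A v m) (v : Corolla T) : loops α v ∈ Conv.fil P A v n :=
  finsum_induction (· ∈ Conv.fil P A v n) (zero_mem _) (fun _ _ => add_mem) fun γ =>
    Submodule.smul_mem _ _ (Conv.un_mem_fil _ (by simp [Gph.sh, γ.2.2, h]) (hα _))

theorem bracket_mem_fil {l m n : ℤ} (h : l + m + 1 = n) {α β : ∀ v, Conv P A v}
    (hα : ∀ v, α v ∈ Conv.fil P A v l) (hβ : ∀ v, β v ∈ Conv.fil P A v m) (v : Corolla T) :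
    bracket α β v ∈ Conv.fil P A v n :=
  finsum_induction (· ∈ Conv.fil P A v n) (zero_mem _) (fun _ _ => add_mem) fun γ =>
    Submodule.smul_mem _ _ (Conv.bin_mem_fil _ (by simp [Gph.sh, γ.2.2.2, h]) (hα _) (hβ _))

/-- To first order, the curvature changes by the differential. -/
theorem curvature_add_sub_mem_fil (hP : P.NonNeg) (hloc : T = .properad → P.LocallyFinite)
    (α : ∀ v, Conv P A v) {ξ : ∀ v, Conv P A v} {m n : ℤ} (h : m + 1 = n)
    (hξ : ∀ v, ξ v ∈ Conv.fil P A v m) (v : Corolla T) :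
    curvature (α + ξ) v - (curvature α v + Conv.d P A v (ξ v)) ∈ Conv.fil P A v n := by
  have : curvature (α + ξ) v - (curvature α v + Conv.d P A v (ξ v)) = loops ξ v +
      (2 : k)⁻¹ • (bracket α ξ v + (bracket ξ α v + bracket ξ ξ v)) := by
    rw [curvature, curvature, loops_add, bracket_add_left hloc, bracket_add_right hloc,
      bracket_add_right hloc, Pi.add_apply, map_add]
    module
  rw [this]
  have h₀ : ∀ (β : ∀ v, Conv P A v) v, β v ∈ Conv.fil P A v 0 :=
    fun β v => Conv.mem_fil_zero hP (β v)
  exact add_mem (loops_mem_fil h hξ v) (Submodule.smul_mem _ _ (add_mem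
    (bracket_mem_fil (by lia) (h₀ _) hξ v) (add_mem (bracket_mem_fil (by lia) hξ (h₀ _) v)
      (bracket_mem_fil (by lia) hξ (h₀ _) v))))

/-- By the Bianchi identity dF is minus the sum of ΔF and [F, α], and contractions raise the
filtration by one. So the leading term of the curvature is closed. -/
theorem d_curvature_mem_fil (hP : P.NonNeg) (hloc : T = .properad → P.LocallyFinite)
    {α : ∀ v, Conv P A v} (hα : ∀ v, α v ∈ Conv.deg P A v 0) {m n : ℤ} (h : m + 1 = n)
    (hc : ∀ v, curvature α v ∈ Conv.fil P A v m) (v : Corolla T) :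
    Conv.d P A v (curvature α v) ∈ Conv.fil P A v n := by
  have hb := bianchi hloc hα v
  rw [add_assoc, add_eq_zero_iff_eq_neg] at hb
  rw [hb]
  exact neg_mem (add_mem (loops_mem_fil h hc v)
    (bracket_mem_fil (by lia) hc (fun w => Conv.mem_fil_zero hP (α w)) v))

/-- Expand the leading part of x in a basis of the degree m component of `P`. Its coefficients lie
in the kernel of `p` and are closed for the differential of `A`, because the differential of `P`
only contributes in higher degree. Primitives of the coefficients in the kernel give ξ. -/
theorem Conv.exists_primitive (hfin : P.LevelwiseFinite) {p : Op.Hom A B} (hp : p.KerAcyclic)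
    {v : Corolla T} {m n : ℤ} (h : m + 1 = n) {x : Conv P A v} (hx : x ∈ deg P A v 1)
    (hxm : x ∈ fil P A v m) (hpx : map P p v x = 0) (hdx : d P A v x ∈ fil P A v n) :
    ∃ ξ ∈ deg P A v 0, ξ ∈ fil P A v m ∧ map P p v ξ = 0 ∧ x + d P A v ξ ∈ fil P A v n := by
  have := P.finite_index hfin v m
  have := Fintype.ofFinite (Module.Basis.ofVectorSpaceIndex k (P.X v m))
  have key : ∀ q : Module.Basis.ofVectorSpaceIndex k (P.X v m), ∃ y : A.X v (-m),
      p.app v (-m) y = 0 ∧ A.inc v (-m + 1) (A.d rfl y) = ev ((hBasis P v m).coord q) x := by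
    intro q
    obtain ⟨z, hz⟩ := ev_mem_of_deg (j := -m + 1) (by lia) ((hBasis P v m).coord q) hx
    have hpz : p.app v _ z = 0 := by
      have := Conv.ev_map (p.tot v) ((hBasis P v m).coord q) x
      rw [hz, p.tot_inc] at this
      refine B.inc_injective v _ (this.symm.trans ?_)
      rw [map_zero]
      exact (congrArg _ hpx).trans (map_zero _)
    have hdz : A.d rfl z = 0 := by
      have := ev_eq_zero_of_fil (by lia) ((hBasis P v m).coord q) hdx
      rw [ev_d (i := m - 1) (by lia), ev_eq_zero_of_fil (by lia) _ hxm, zero_add, hz,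
        A.totD_inc rfl, smul_eq_zero_iff_eq] at this
      exact A.inc_injective v _ (this.trans (map_zero _).symm)
    obtain ⟨y, hy, rfl⟩ := hp rfl rfl z hpz hdz
    exact ⟨y, hy, hz.symm⟩
  choose y hy hdy using key
  -- The correction carries the sign -(-1)^m, since the differential of `A` acts on the component of
  -- degree m with sign (-1)^m and the result has to cancel x.
  have hs : ∀ S : Submodule k (Conv P A v), (∀ q, pure P A (hBasis P v m q) (y q) ∈ S) →
      -(m.negOnePow • ∑ q, pure P A (hBasis P v m q) (y q)) ∈ S := fun S hS => by
    rw [negOnePow_smul_eq_ite]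
    split_ifs
    · exact neg_mem (sum_mem fun q _ => hS q)
    · exact neg_mem (neg_mem (sum_mem fun q _ => hS q))
  have hm := hs _ fun q => pure_mem_fil le_rfl _ _
  refine ⟨_, hs _ fun q => pure_mem_deg (add_neg_cancel m) _ _, hm, ?_, ?_⟩
  · refine hs (LinearMap.ker (map P p v)) fun q => ?_
    rw [LinearMap.mem_ker, map_pure, hy, pure_zero]
  · refine mem_fil_of_ev hfin fun s hsn => ?_
    by_cases hsm : s.1 < m
    · exact ev_eq_zero_of_fil hsm _ (add_mem hxm (d_mem_fil hm))
    · obtain ⟨i, q⟩ := s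
      obtain rfl : i = m := by simp only at hsn hsm; lia
      have he : ev ((hBasis P v i).coord q) (∑ q, pure P A (hBasis P v i q) (y q)) =
          A.inc v _ (y q) := by
        rw [map_sum, Finset.sum_eq_single q]
        · rw [ev_pure, Module.Basis.coord_apply, Module.Basis.repr_self, Finsupp.single_eq_same,
            one_smul]
        · intro q' _ hq'
          rw [ev_pure, Module.Basis.coord_apply, Module.Basis.repr_self,
            Finsupp.single_eq_of_ne hq'.symm, zero_smul]
        · exact fun hq => (hq (Finset.mem_univ q)).elim
      rw [map_add, ev_d (i := i - 1) (by lia), ev_eq_zero_of_fil (by lia) _ hm, zero_add, map_neg,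
        map_negOnePow_smul, he, map_neg, map_negOnePow_smul, A.totD_inc rfl, ← hdy, smul_neg,
        smul_smul, Int.units_mul_self, one_smul, add_neg_cancel]

end FilteredCurvature

end FeynmanME

namespace FeynmanME

/-! ### Lifting solutions along acyclic fibrations -/

section Lifting

variable {k : Type u} [Field k] [CharZero k] {T : Kind} {P : Op k T true} {A B : Op k T false}

/-- A lift of a family along `p` whose curvature vanishes in degrees of `P` below `m`. -/
structure IsPartialLift (p : Op.Hom A B) (β : ∀ v, Conv P B v) (m : ℕ) (α : ∀ v, Conv P A v) :
    Prop where
  mem_deg : ∀ v, α v ∈ Conv.deg P A v 0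
  invariant : IsInvariant α
  map_eq : ∀ v, Conv.map P p v (α v) = β v
  curvature_mem : ∀ v, curvature α v ∈ Conv.fil P A v m

/-- Surjectivity gives lifts of degree zero at each corolla, and averaging makes them compatible.
They still lift β because β is invariant. -/
theorem IsMC.exists_isPartialLift (hP : P.NonNeg) {p : Op.Hom A B} (hf : p.IsFib)
    {β : ∀ v, Conv P B v} (hβ : IsMC β) : ∃ α, IsPartialLift p β 0 α := by
  choose ξ hξ hpξ using fun v => Conv.exists_map_eq hf (hβ.mem_deg v)
  refine ⟨average ξ, average_mem (fun v => Conv.deg P A v 0)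
    (fun σ _ => Conv.un_mem_deg _ (by simp [Gph.sh, σ.2])) hξ, average_isInvariant ξ, fun v => ?_,
    fun v => Conv.mem_fil_zero hP _⟩
  have hinv : IsInvariant β := hβ.invariant
  rw [average_natural (Conv.map P p) (fun σ x => Conv.map_un p σ.1 x) hpξ, hinv.average_eq]

/-- One step of obstruction theory: the leading term of the curvature lies in the kernel of `p`
because β is a solution, and the averaged primitive removes it. -/
theorem IsPartialLift.exists_succ (hP : P.NonNeg) (hfin : P.LevelwiseFinite)
    (hloc : T = .properad → P.LocallyFinite) {p : Op.Hom A B} (hp : p.KerAcyclic)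
    {β : ∀ v, Conv P B v} (hβ : IsMC β) {m : ℕ} {α : ∀ v, Conv P A v}
    (hα : IsPartialLift p β m α) :
    ∃ α', IsPartialLift p β (m + 1) α' ∧ ∀ v, α' v - α v ∈ Conv.fil P A v m := by
  have hsh : ∀ {a v : Corolla T} (σ : Iso a v) (n : ℤ), n + σ.1.g.sh true = n :=
    fun σ n => by simp [Gph.sh, σ.2]
  have hpc : ∀ v, Conv.map P p v (curvature α v) = 0 := fun v => by
    rw [map_curvature hloc, funext hα.map_eq, hβ.curvature_eq_zero]
  choose ξ hξ hξm hpξ hdξ using fun v => Conv.exists_primitive hfin hp (n := m + 1) rfl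
    (curvature_mem_deg hα.mem_deg v) (hα.curvature_mem v) (hpc v)
    (d_curvature_mem_fil hP hloc hα.mem_deg rfl hα.curvature_mem v)
  have hm : ∀ v, average ξ v ∈ Conv.fil P A v m := average_mem (fun v => Conv.fil P A v m)
    (fun σ _ => Conv.un_mem_fil _ (hsh σ _)) hξm
  -- Averaging the primitive keeps its effect: the average commutes with the differential and fixes
  -- the curvature, which is already invariant.
  have hd : ∀ v, curvature α v + Conv.d P A v (average ξ v) ∈ Conv.fil P A v (m + 1) := fun v => by
    have hc : IsInvariant (curvature α) := IsInvariant.curvature hloc hα.invariant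
    rw [← hc.average_eq v, average_natural (Conv.d P A)
      (fun σ x => (Conv.d_un_of_deg_zero σ.1 σ.2 x)) (fun v => rfl) v]
    have : average (curvature α) v + average (fun v => Conv.d P A v (ξ v)) v =
        average (fun v => curvature α v + Conv.d P A v (ξ v)) v := by
      simp only [average, map_add]
      rw [finsum_add_distrib (Set.toFinite _) (Set.toFinite _), smul_add]
    rw [this]
    exact average_mem (fun v => Conv.fil P A v (m + 1))
      (fun σ _ => Conv.un_mem_fil _ (hsh σ _)) hdξ v
  refine ⟨α + average ξ, ⟨fun v => add_mem (hα.mem_deg v) (average_mem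
    (fun v => Conv.deg P A v 0) (fun σ _ => Conv.un_mem_deg _ (hsh σ _)) hξ v), fun {a v} σ hσ => ?_,
    fun v => ?_, fun v => ?_⟩, fun v => ?_⟩
  · rw [Pi.add_apply, Pi.add_apply, map_add, hα.invariant σ hσ, average_isInvariant ξ σ hσ]
  · have h0 : average (fun v => (0 : Conv P B v)) v = 0 := by simp [average]
    rw [Pi.add_apply, map_add, hα.map_eq, average_natural (Conv.map P p)
      (fun σ x => Conv.map_un p σ.1 x) hpξ, h0, add_zero]
  · push_cast
    have := add_mem (curvature_add_sub_mem_fil hP hloc α rfl hm v) (hd v)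
    rwa [sub_add_cancel] at this
  · rw [Pi.add_apply, add_sub_cancel_left]
    exact hm v

/-- Solutions of the master equation lift along acyclic fibrations. -/
theorem IsMC.exists_lift (hP : P.NonNeg) (hfin : P.LevelwiseFinite)
    (hloc : T = .properad → P.LocallyFinite) {p : Op.Hom A B} (hf : p.IsFib) (hp : p.KerAcyclic)
    {β : ∀ v, Conv P B v} (hβ : IsMC β) :
    ∃ α : ∀ v, Conv P A v, IsMC α ∧ ∀ v, Conv.map P p v (α v) = β v := by
  obtain ⟨α₀, h₀⟩ := hβ.exists_isPartialLift hP hf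
  choose next hnext hdiff using fun (m : ℕ) (α : {α // IsPartialLift p β m α}) =>
    α.2.exists_succ hP hfin hloc hp hβ
  let α : ∀ m : ℕ, {α // IsPartialLift p β m α} := fun m =>
    Nat.rec ⟨α₀, h₀⟩ (fun m α => ⟨next m α, hnext m α⟩) m
  have hα : ∀ (m l : ℕ) v, (α (m + l)).1 v - (α m).1 v ∈ Conv.fil P A v m := by
    intro m l v
    induction l with
    | zero =>
      rw [add_zero, sub_self]
      exact zero_mem _
    | succ l ih =>
      have := add_mem (Conv.fil_antitone v (by push_cast; lia) (hdiff (m + l) (α (m + l)) v)) ih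
      rwa [sub_add_sub_cancel] at this
  -- At `v` nothing changes after stage `N v`, since later corrections lie in a filtration step that
  -- is zero; the limit is taken corolla by corolla.
  choose N hN using Conv.exists_fil_eq_bot (A := A) hfin
  have hst : ∀ m v, N v ≤ m → (α m).1 v = (α (N v)).1 v := fun m v h => by
    obtain ⟨l, rfl⟩ := Nat.exists_eq_add_of_le h
    have := hα (N v) l v
    rwa [hN, Submodule.mem_bot, sub_eq_zero] at this
  let α' : ∀ v, Conv P A v := fun v => (α (N v)).1 v
  have hα' : ∀ (m : ℕ) v, α' v - (α m).1 v ∈ Conv.fil P A v m := fun m v => by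
    by_cases h : N v ≤ m
    · rw [hst m v h, sub_self]
      exact zero_mem _
    · obtain ⟨l, hl⟩ := Nat.exists_eq_add_of_le (not_le.1 h).le
      have := hα m l v
      rwa [← hl] at this
  refine ⟨α', ⟨fun v => (α (N v)).2.mem_deg v, fun {a v} σ hσ => ?_, fun v => ?_⟩,
    fun v => (α (N v)).2.map_eq v⟩
  · have h := (α (max (N a) (N v))).2.invariant σ hσ
    rwa [hst _ a (le_max_left _ _), hst _ v (le_max_right _ _)] at h
  · have h₁ := curvature_add_sub_mem_fil hP hloc (α (N v)).1 rfl (hα' (N v)) v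
    have h₂ : (α (N v)).1 + (fun w => α' w - (α (N v)).1 w) = α' :=
      funext fun w => add_sub_cancel _ _
    rw [h₂] at h₁
    have h₃ := add_mem (Conv.fil_antitone v (by lia) h₁)
      (add_mem ((α (N v)).2.curvature_mem v) (Conv.d_mem_fil (hα' (N v) v)))
    rwa [sub_add_cancel, hN, Submodule.mem_bot] at h₃

/-- Through the universal property, a lifting problem against an acyclic fibration becomes the
lifting of a solution, and naturality of the bijection turns the lifted solution back into a lifted
map. -/
theorem Op.NonNeg.isCofibrant (hP : P.NonNeg) (hfin : P.LevelwiseFinite)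
    (hloc : T = .properad → P.LocallyFinite) : (FT P).IsCofibrant := by
  intro A B p hw hf f
  obtain ⟨α, hα, hmap⟩ := (FT.homEquiv hfin hloc f).2.exists_lift hP hfin hloc hf (hw.kerAcyclic hf)
  have : ((FT.homEquiv hfin hloc).symm ⟨α, hα⟩).comp p = f := by
    refine (FT.homEquiv hfin hloc).injective (Subtype.ext (funext fun v => ?_))
    rw [FT.homEquiv_comp, Equiv.apply_symm_apply]
    exact hmap v
  exact ⟨(FT.homEquiv hfin hloc).symm ⟨α, hα⟩, fun v n x => by rw [← Op.Hom.comp_app, this]⟩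

end Lifting

end FeynmanME

theorem mainTheorem9 {k : Type u} [Field k] [CharZero k] (T : FeynmanME.Kind)
    (P : FeynmanME.Op k T true) (O : FeynmanME.Op k T false)
    (hfin : P.LevelwiseFinite)
    (hloc : T = FeynmanME.Kind.properad → P.LocallyFinite)
    (hcof : P.NonNeg ∨ (FeynmanME.FT P).IsCofibrant) :
    Equivalence (FeynmanME.Op.Homotopic (M := FeynmanME.FT P) (O := O)) ∧
    Equivalence (FeynmanME.MERel P O) ∧
    ∃ e : FeynmanME.Op.Hom (FeynmanME.FT P) O ≃ FeynmanME.MESimplex P O 0,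
      (∀ (γ : FeynmanME.Op.Hom (FeynmanME.FT P) O) (v : FeynmanME.Corolla T) (i n : ℤ)
        (h : i + n = 0) (f : Module.Dual k (P.X v i)),
        FeynmanME.Coeff.eval O f 0 (FeynmanME.MESimplex.family P O (e γ) v) =
          O.inc v n (γ.app v n (FeynmanME.FT.gen P h f)) ⊗ₜ[k] (1 : FeynmanME.Omega k 0)) ∧
      (∀ γ₀ γ₁ : FeynmanME.Op.Hom (FeynmanME.FT P) O,
        FeynmanME.Op.Homotopic γ₀ γ₁ ↔ FeynmanME.MERel P O (e γ₀) (e γ₁)) ∧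
      ∃ E : Quot (FeynmanME.Op.Homotopic (M := FeynmanME.FT P) (O := O)) ≃
          (FeynmanME.MESet P O).π₀,
        ∀ γ : FeynmanME.Op.Hom (FeynmanME.FT P) O,
          E (Quot.mk _ γ) = SSet.π₀.mk (e γ) := by
  exact FeynmanME.me_of_isCofibrant hfin hloc
    (hcof.elim (fun hP => hP.isCofibrant hfin hloc) fun h => h)
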